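/- Fix an integer $n\geq 1$. Manifolds are smooth, Hausdorff, second countable, of dimension $n$ and without boundary; functions are complex-valued. Let $M_n(\mathbb R)_+$ be the set of symmetric positive definite real $n\times n$ matrices. In local coordinates $(\partial^\alpha g(x))^\beta$ denotes a monomial in the partial derivatives $\partial^{\alpha}g_{ij}(x)$ of the coefficients of the metric $g$. **Local Riemannian invariants.** A (scalar) local Riemannian invariant of weight $w\in\mathbb R$ is the datum, for every Riemannian manifold $(M^n,g)$, of a function $\mathcal I_g\in C^\infty(M)$ such that: there are finitely many functions $a_{\alpha\beta}\in C^\infty(M_n(\mathbb R)_+)$ with $\mathcal I_g(x)=\sum a_{\alpha\beta}(g(x))(\partial^\alpha g(x))^\beta$ in any local coordinates; and $\mathcal I_{tg}=t^{-w}\mathcal I_g$ for all $t>0$. **Riemannian invariant $\Psi$DOs.** Let $m\in\mathbb Z$, $w\in\mathbb R$, and let $\Psi^m(M)$ be the space of classical pseudodifferential operators $C^\infty_c(M)\to C^\infty(M)$ of order $m$. A Riemannian invariant $\Psi$DO of order $m$ and weight $w$ is the datum, for every Riemannian manifold $(M^n,g)$, of an operator $P_g\in\Psi^m(M)$ such that: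 (i) for each $j\geq 0$ there are finitely many functions $a_{j\alpha\beta}(g,\xi)\in C^\infty(M_n(\mathbb R)_+\times(\mathbb R^n\setminus 0))$, positively homogeneous of degree $m-j$ in $\xi$, such that in any local coordinates $P_g$ has symbol $p_g\sim\sum_{j\ge0} p_{g,m-j}$ with $p_{g,m-j}(x,\xi)=\sum_{\alpha,\beta}(\partial^\alpha g(x))^\beta a_{j\alpha\beta}(g(x),\xi)$; (ii) $P_{tg}=t^{-w}P_g$ modulo smoothing operators for all $t>0$. It is admissible if in (i) one can take $a_{0\alpha\beta}=0$ for $(\alpha,\beta)\neq 0$, and elliptic if, for every $(M^n,g)$, the principal symbol of $P_g$ does not vanish for $\xi\neq0$. **Logarithmic singularities.** The logarithmic singularity of $P\in\Psi^m(M)$ is the $1$-density $c_P$ on $M$ such that in any local coordinates the Schwartz kernel of $P$ has near the diagonal a behaviour of the form $$k_P(x,y)=\sum_{-(m+n)\le j\le -1}a_j(x,x-y)-c_P(x)\log|x-y|+\mathrm O(1),$$ with $a_j(x,y)$ smooth for $y\neq0$ and positively homogeneous of degree $j$ in $y$. If $P\in\Psi^m(M)$ is elliptic, its Green kernel logarithmic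 singularity is $\gamma_P:=c_Q$, where $Q\in\Psi^{-m}(M)$ is any parametrix of $P$. Let $|v_g|$ denote the Riemannian density of $(M,g)$, i.e. $|v_g|=\sqrt{\det g(x)}\,dx$ in local coordinates. **Proposition.** Let $P_g$ be a Riemannian invariant $\Psi$DO of order $m\in\mathbb Z$ and weight $w$. 1) The logarithmic singularity of $P_g$ is of the form $c_{P_g}=\mathcal I_{P_g}|v_g|$, where $\mathcal I_{P_g}$ is a local Riemannian invariant of weight $\frac n2+w$. 2) If $P_g$ is elliptic and admissible, then its Green kernel logarithmic singularity is of the form $\gamma_{P_g}=\mathcal J_{P_g}|v_g|$, where $\mathcal J_{P_g}$ is a local Riemannian invariant of weight $\frac n2-w$. -/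

import Mathlib

open scoped Manifold ContDiff Bundle
open MeasureTheory

universe u

noncomputable section

namespace RiemPsiDO

/-! ### Manifolds, metrics, coordinates -/

/-- `ℝⁿ` with its Euclidean norm and Lebesgue measure. -/
abbrev E (n : ℕ) : Type := EuclideanSpace ℝ (Fin n)

/-- The `i`-th vector of the canonical basis of `ℝⁿ`. -/
def e {n : ℕ} (i : Fin n) : E n := EuclideanSpace.single i (1 : ℝ)

/-- Smooth `n`-dimensional manifolds (without boundary, Hausdorff, second countable). -/
structure Mfd (n : ℕ) : Type (u + 1) where
  carrier : Type u
  [top : TopologicalSpace carrier]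
  [charted : ChartedSpace (E n) carrier]
  [manifold : IsManifold (𝓡 n) ∞ carrier]
  [t2 : T2Space carrier]
  [secondCountable : SecondCountableTopology carrier]

instance (n : ℕ) : CoeSort (Mfd.{u} n) (Type u) := ⟨Mfd.carrier⟩

attribute [instance] Mfd.top Mfd.charted Mfd.manifold Mfd.t2 Mfd.secondCountable

variable {n : ℕ}

/-- Smooth Riemannian metrics on `M`. -/
abbrev RMetric (M : Mfd.{u} n) : Type u :=
  Bundle.ContMDiffRiemannianMetric (𝓡 n) ∞ (E n) (fun x : M => TangentSpace (𝓡 n) x)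

/-- The rescaled metric `t g`, for `t > 0`. -/
def RMetric.scale {M : Mfd.{u} n} (g : RMetric M) (t : ℝ) (ht : 0 < t) : RMetric M where
  inner x := t • g.inner x
  symm x v w := by
    have := g.symm x v w
    simp [this]
  pos x v hv := by
    have := g.pos x v hv
    simpa using mul_pos ht this
  isVonNBounded x := by
    have h := (g.isVonNBounded x).image
      ((Real.sqrt t)⁻¹ • ContinuousLinearMap.id ℝ (TangentSpace (𝓡 n) x))
    refine h.subset ?_
    intro v hv
    have hs : 0 < Real.sqrt t := Real.sqrt_pos.2 ht
    refine ⟨Real.sqrt t • v, ?_, ?_⟩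
    · have hv' : t * g.inner x v v < 1 := hv
      have hst : Real.sqrt t * Real.sqrt t = t := Real.mul_self_sqrt ht.le
      have : g.inner x (Real.sqrt t • v) (Real.sqrt t • v) = t * g.inner x v v := by
        rw [map_smul, map_smul]
        simp only [_root_.smul_apply, smul_eq_mul]
        rw [← mul_assoc, hst]
      change g.inner x (Real.sqrt t • v) (Real.sqrt t • v) < 1
      rw [this]
      exact hv'
    · change (Real.sqrt t)⁻¹ • (Real.sqrt t • v) = v
      rw [smul_smul, inv_mul_cancel₀ hs.ne', one_smul]
  contMDiff := ContMDiff.const_smul_section (𝕜 := ℝ) (I := 𝓡 n) (F := E n →L[ℝ] E n →L[ℝ] ℝ)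
    (V := fun x : M => TangentSpace (𝓡 n) x →L[ℝ] TangentSpace (𝓡 n) x →L[ℝ] ℝ) (a := t)
    (s := g.inner) g.contMDiff

/-- Local coordinates on `M`: a chart of the maximal smooth atlas. -/
abbrev Coord (M : Mfd.{u} n) : Type u := OpenPartialHomeomorph M (E n)

def IsCoord {M : Mfd.{u} n} (φ : Coord M) : Prop :=
  φ ∈ IsManifold.maximalAtlas (𝓡 n) ∞ M

/-- The coordinate frame `∂₁, …, ∂ₙ` of the coordinates `φ`, at the point with coordinates `y`. -/
def frame {M : Mfd.{u} n} (φ : Coord M) (y : E n) (i : Fin n) :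
    TangentSpace (𝓡 n) (φ.symm y) :=
  mfderiv (𝓡 n) (𝓡 n) φ.symm y (e i)

/-- The Gram matrix of a family of `n` tangent vectors. -/
def gram {M : Mfd.{u} n} (g : RMetric M) (x : M) (v : Fin n → TangentSpace (𝓡 n) x) :
    Matrix (Fin n) (Fin n) ℝ :=
  Matrix.of fun i j => g.inner x (v i) (v j)

/-- The coefficients `g_{ij}(y)` of the metric in the coordinates `φ`. -/
def coeff {M : Mfd.{u} n} (g : RMetric M) (φ : Coord M) (y : E n) : Fin n → Fin n → ℝ :=
  fun i j => g.inner (φ.symm y) (frame φ y i) (frame φ y j)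

/-- The set of (symmetric) positive definite `n × n` matrices. -/
def Pos (n : ℕ) : Set (Fin n → Fin n → ℝ) := {A | (Matrix.of A).PosDef}

/-! ### Densities -/

/-- Complex-valued `1`-densities on `M` (as set-theoretic sections): functions of `n` tangent
vectors at a point which get multiplied by `|det A|` when the vectors are transformed by `A`. -/
structure Density (M : Mfd.{u} n) where
  toFun : ∀ x : M, (Fin n → TangentSpace (𝓡 n) x) → ℂ
  map_transform : ∀ (x : M) (v : Fin n → TangentSpace (𝓡 n) x) (A : Matrix (Fin n) (Fin n) ℝ),
    toFun x (fun i => ∑ j, A i j • v j) = (|A.det| : ℝ) * toFun x v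

/-- The function `c(y)` such that the density is `c(y) dy` in the coordinates `φ`. -/
def Density.coord {M : Mfd.{u} n} (c : Density M) (φ : Coord M) (y : E n) : ℂ :=
  c.toFun (φ.symm y) (frame φ y)

/-- The product `f |v_g|` of a function and of the Riemannian density
`|v_g|(v₁, …, vₙ) = √det (g(vᵢ, vⱼ))`. -/
def mulVol {M : Mfd.{u} n} (f : M → ℂ) (g : RMetric M) : Density M where
  toFun x v := f x * (Real.sqrt (gram g x v).det : ℝ)
  map_transform x v A := by
    have h : gram g x (fun i => ∑ j, A i j • v j) = A * gram g x v * A.transpose := by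
      ext i j
      simp only [gram, Matrix.of_apply, Matrix.mul_apply, Matrix.transpose_apply, map_sum,
        map_smul, _root_.sum_apply, _root_.smul_apply, smul_eq_mul,
        Finset.sum_mul, Finset.mul_sum]
      refine Finset.sum_congr rfl fun k _ => Finset.sum_congr rfl fun l _ => ?_
      ring
    have h2 : (A * gram g x v * A.transpose).det = A.det ^ 2 * (gram g x v).det := by
      rw [Matrix.det_mul, Matrix.det_mul, Matrix.det_transpose]
      ring
    rw [h, h2, Real.sqrt_mul (sq_nonneg _), Real.sqrt_sq_eq_abs]
    push_cast
    ring

/-! ### Operators -/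

/-- `C^∞(M)`, complex-valued. -/
def Smooth (M : Mfd.{u} n) : Submodule ℂ (M → ℂ) where
  carrier := {f | ContMDiff (𝓡 n) 𝓘(ℝ, ℂ) ∞ f}
  add_mem' ha hb := ContMDiff.add ha hb
  zero_mem' := contMDiff_const
  smul_mem' c f hf := by
    have h : ContMDiff 𝓘(ℝ, ℂ) 𝓘(ℝ, ℂ) ∞ (fun z : ℂ => c * z) :=
      (contDiff_const.mul contDiff_id).contMDiff
    exact h.comp hf

/-- `C^∞_c(M)`, complex-valued. -/
def Test (M : Mfd.{u} n) : Submodule ℂ (M → ℂ) where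
  carrier := {f | f ∈ Smooth M ∧ HasCompactSupport f}
  add_mem' ha hb := ⟨add_mem ha.1 hb.1, ha.2.add hb.2⟩
  zero_mem' := ⟨zero_mem _, HasCompactSupport.zero⟩
  smul_mem' c _ hf := ⟨(Smooth M).smul_mem c hf.1, hf.2.smul_left (f := fun _ => c)⟩

/-- Linear operators from `C^∞_c(M)` to `C^∞(M)`. -/
abbrev Op (M : Mfd.{u} n) : Type u := Test M →ₗ[ℂ] Smooth M

/-- The inclusion of `C^∞_c(M)` in `C^∞(M)`, i.e. the identity operator. -/
def incl (M : Mfd.{u} n) : Op M := Submodule.inclusion fun _ h => h.1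

/-- A function supported in the domain of `φ`, read in the coordinates `φ`, extended by `0`. -/
def inCoord {M : Mfd.{u} n} (φ : Coord M) (v : M → ℂ) : E n → ℂ :=
  φ.target.indicator (v ∘ φ.symm)

/-- Continuity of `P` from `C^∞_c(M)` to `C^∞(M)`, in terms of seminorms in local coordinates. -/
def IsContinuousOp {M : Mfd.{u} n} (P : Op M) : Prop :=
  ∀ φ ψ : Coord M, IsCoord φ → IsCoord ψ →
    ∀ K L : Set M, IsCompact K → K ⊆ φ.source → IsCompact L → L ⊆ ψ.source →
      ∀ k : ℕ, ∃ (N : ℕ) (C : ℝ), ∀ (v : Test M) (B : ℝ), tsupport (v : M → ℂ) ⊆ K →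
        (∀ i ≤ N, ∀ y, ‖iteratedFDeriv ℝ i (inCoord φ (v : M → ℂ)) y‖ ≤ B) →
          ∀ x ∈ L, ‖iteratedFDeriv ℝ k ((P v : M → ℂ) ∘ ψ.symm) (ψ x)‖ ≤ C * B

/-- Over `φ.source × ψ.source` the Schwartz kernel of `P` is smooth. -/
def HasSmoothKernel {M : Mfd.{u} n} (P : Op M) (φ ψ : Coord M) : Prop :=
  ∃ k : E n → E n → ℂ,
    ContDiffOn ℝ ∞ (fun z : E n × E n => k z.1 z.2) (φ.target ×ˢ ψ.target) ∧
    ∀ v : Test M, tsupport (v : M → ℂ) ⊆ ψ.source → ∀ x ∈ φ.source,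
      (P v : M → ℂ) x = ∫ y in ψ.target, k (φ x) y * inCoord ψ (v : M → ℂ) y

/-- Smoothing operators, i.e. operators whose Schwartz kernel is smooth: the class `Ψ^{-∞}(M)`. -/
def IsSmoothing {M : Mfd.{u} n} (P : Op M) : Prop :=
  ∀ φ ψ : Coord M, IsCoord φ → IsCoord ψ → HasSmoothKernel P φ ψ

/-- The Schwartz kernel of `P` is smooth off the diagonal of `M × M`: as `M` is Hausdorff, the
products of two disjoint coordinate domains cover the complement of the diagonal. -/
def IsSmoothOffDiagonal {M : Mfd.{u} n} (P : Op M) : Prop :=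
  ∀ φ ψ : Coord M, IsCoord φ → IsCoord ψ → Disjoint φ.source ψ.source → HasSmoothKernel P φ ψ

/-! ### Symbols and pseudodifferential operators -/

/-- Homogeneous symbols `S_d(U × ℝⁿ)`, with `U` a subset of a normed space of parameters. -/
def IsHomogSymbol {F : Type*} [NormedAddCommGroup F] [NormedSpace ℝ F] (U : Set F) (d : ℤ)
    (p : F → E n → ℂ) : Prop :=
  ContDiffOn ℝ ∞ (fun z : F × E n => p z.1 z.2) (U ×ˢ {0}ᶜ) ∧
  ∀ x ∈ U, ∀ ξ : E n, ξ ≠ 0 → ∀ t : ℝ, 0 < t → p x (t • ξ) = (t : ℂ) ^ d * p x ξ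

/-- `p` is a symbol in `S^m(U × ℝⁿ)` with asymptotic expansion `p ∼ ∑ q_j`, `q_j ∈ S_{m-j}`. -/
def IsSymbol (U : Set (E n)) (m : ℤ) (p : E n → E n → ℂ) (q : ℕ → E n → E n → ℂ) : Prop :=
  ContDiffOn ℝ ∞ (fun z : E n × E n => p z.1 z.2) (U ×ˢ Set.univ) ∧
  (∀ j : ℕ, IsHomogSymbol U (m - j) (q j)) ∧
  ∀ (N : ℕ) (K : Set (E n)), IsCompact K → K ⊆ U → ∀ a b : ℕ, ∃ C : ℝ, ∀ x ∈ K, ∀ ξ : E n,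
    1 ≤ ‖ξ‖ →
      ‖iteratedFDeriv ℝ a (fun x' => iteratedFDeriv ℝ b
          (fun ξ' => p x' ξ' - ∑ j ∈ Finset.range N, q j x' ξ') ξ) x‖
        ≤ C * ‖ξ‖ ^ (m - b - N : ℤ)

/-- The Fourier transform `û(ξ) = ∫ e^{-i y·ξ} u(y) dy`. -/
def fourier (u : E n → ℂ) (ξ : E n) : ℂ :=
  ∫ y, Complex.exp (-Complex.I * (inner ℝ y ξ : ℝ)) * u y

/-- `p(x,D)u(x) = (2π)^{-n} ∫ e^{i x·ξ} p(x,ξ) û(ξ) dξ`. -/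
def quantize (p : E n → E n → ℂ) (u : E n → ℂ) (x : E n) : ℂ :=
  ((2 * Real.pi : ℝ) : ℂ)⁻¹ ^ n *
    ∫ ξ, Complex.exp (Complex.I * (inner ℝ x ξ : ℝ)) * p x ξ * fourier u ξ

/-- In the coordinates `φ` we have `P = p(x,D) + R` with `p ∈ S^m`, `p ∼ ∑ q_j` and `R` smoothing:
`P` has symbol `∑ q_j`, where `q_j` is homogeneous of degree `m - j`. -/
def HasSymbol {M : Mfd.{u} n} (m : ℤ) (P : Op M) (φ : Coord M) (q : ℕ → E n → E n → ℂ) : Prop :=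
  ∃ p r : E n → E n → ℂ, IsSymbol φ.target m p q ∧
    ContDiffOn ℝ ∞ (fun z : E n × E n => r z.1 z.2) (φ.target ×ˢ φ.target) ∧
    ∀ v : Test M, tsupport (v : M → ℂ) ⊆ φ.source → ∀ x ∈ φ.source,
      (P v : M → ℂ) x = quantize p (inCoord φ (v : M → ℂ)) (φ x) +
        ∫ y in φ.target, r (φ x) y * inCoord φ (v : M → ℂ) y

/-- `P ∈ Ψ^m(M)`. -/
structure IsPsiDO {M : Mfd.{u} n} (m : ℤ) (P : Op M) : Prop where
  continuous : IsContinuousOp P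
  offDiagonal : IsSmoothOffDiagonal P
  symbol : ∀ φ : Coord M, IsCoord φ → ∃ q, HasSymbol m P φ q

/-- Ellipticity: in local coordinates the principal symbol does not vanish for `ξ ≠ 0`. -/
def IsElliptic {M : Mfd.{u} n} (m : ℤ) (P : Op M) : Prop :=
  ∀ φ : Coord M, IsCoord φ → ∃ q, HasSymbol m P φ q ∧ ∀ x ∈ φ.target, ∀ ξ ≠ 0, q 0 x ξ ≠ 0

/-- A linear operator on `C^∞(M)` is properly supported: over a compact set its values depend only
on the values of the argument on some compact set, and it maps functions supported in a given
compact set to functions supported in some other given compact set. -/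
def IsProperlySupported {M : Mfd.{u} n} (T : Smooth M →ₗ[ℂ] Smooth M) : Prop :=
  (∀ K : Set M, IsCompact K → ∃ L : Set M, IsCompact L ∧
    ∀ f : Smooth M, (∀ x ∈ L, (f : M → ℂ) x = 0) → ∀ x ∈ K, (T f : M → ℂ) x = 0) ∧
  (∀ K : Set M, IsCompact K → ∃ L : Set M, IsCompact L ∧
    ∀ f : Smooth M, (∀ x ∉ K, (f : M → ℂ) x = 0) → ∀ x ∉ L, (T f : M → ℂ) x = 0)

/-- `Q ∈ Ψ^{-m}(M)` is a parametrix of `P ∈ Ψ^m(M)`: modulo smoothing operators, `P Q = 1` and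
`Q P = 1`. To make sense of the compositions `Q` is replaced by a properly supported operator `T`
which agrees with `Q` modulo smoothing operators (`T₀` is the restriction of `T` to
`C^∞_c(M)`). -/
def IsParametrix {M : Mfd.{u} n} (m : ℤ) (P Q : Op M) : Prop :=
  IsPsiDO (-m) Q ∧ ∃ (T : Smooth M →ₗ[ℂ] Smooth M) (T₀ : Test M →ₗ[ℂ] Test M),
    IsProperlySupported T ∧ incl M ∘ₗ T₀ = T ∘ₗ incl M ∧
    IsSmoothing (Q - T ∘ₗ incl M) ∧
    IsSmoothing (P ∘ₗ T₀ - incl M) ∧ IsSmoothing (T ∘ₗ P - incl M)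

/-! ### Logarithmic singularities -/

/-- `k` is the Schwartz kernel of `P` off the diagonal, in the coordinates `φ`. -/
def IsOffDiagonalKernel {M : Mfd.{u} n} (P : Op M) (φ : Coord M) (k : E n → E n → ℂ) : Prop :=
  ContDiffOn ℝ ∞ (fun z : E n × E n => k z.1 z.2)
    {z | z.1 ∈ φ.target ∧ z.2 ∈ φ.target ∧ z.1 ≠ z.2} ∧
  ∀ v : Test M, tsupport (v : M → ℂ) ⊆ φ.source →
    ∀ x ∈ φ.source, x ∉ tsupport (v : M → ℂ) →
      (P v : M → ℂ) x = ∫ y in φ.target, k (φ x) y * inCoord φ (v : M → ℂ) y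

/-- The density `c` is the logarithmic singularity `c_P` of the Schwartz kernel of `P ∈ Ψ^m(M)`:
in any local coordinates, near the diagonal,
`k_P(x,y) = ∑_{-(m+n) ≤ j ≤ -1} a_j(x,x-y) - c(x) log|x-y| + O(1)`, where `a_j(x,y)` is smooth for
`y ≠ 0` and homogeneous of degree `j` in `y`. -/
def IsLogSing {M : Mfd.{u} n} (m : ℤ) (P : Op M) (c : Density M) : Prop :=
  ∀ φ : Coord M, IsCoord φ → ∃ (k : E n → E n → ℂ) (a : ℤ → E n → E n → ℂ),
    IsOffDiagonalKernel P φ k ∧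
    (∀ j ∈ Finset.Icc (-(m + n)) (-1), IsHomogSymbol φ.target j (a j)) ∧
    ∀ K : Set (E n), IsCompact K → K ⊆ φ.target → ∃ C : ℝ, ∀ x ∈ K, ∀ y ∈ K, x ≠ y →
      ‖k x y - ((∑ j ∈ Finset.Icc (-(m + n)) (-1), a j x (x - y))
        - c.coord φ x * (Real.log ‖x - y‖ : ℝ))‖ ≤ C

/-- The density `γ` is the Green kernel logarithmic singularity `γ_P` of an elliptic operator
`P ∈ Ψ^m(M)`: it is the logarithmic singularity of any parametrix of `P`. -/
def IsGreenLogSing {M : Mfd.{u} n} (m : ℤ) (P : Op M) (γ : Density M) : Prop :=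
  ∀ Q : Op M, IsParametrix m P Q → IsLogSing (-m) Q γ

/-! ### Riemannian invariants -/

/-- Exponents `β` of the monomials in the derivatives `∂^α g_{ij}`: a multiset of triples
`(i, j, α)`, where the multi-index `α` is written as a list of directions of differentiation. -/
abbrev Mon (n : ℕ) : Type := Multiset (Fin n × Fin n × List (Fin n))

/-- `∂^α f (y)`. -/
def partialDeriv (α : List (Fin n)) (f : E n → ℝ) (y : E n) : ℝ :=
  iteratedFDeriv ℝ α.length f y (fun i => e (α.get i))

/-- The monomial `(∂^α g(y))^β`, i.e. the product of the `∂^α g_{ij}(y)` over `(i, j, α) ∈ β`. -/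
def jet {M : Mfd.{u} n} (g : RMetric M) (φ : Coord M) (β : Mon n) (y : E n) : ℝ :=
  (β.map fun s => partialDeriv s.2.2 (fun z => coeff g φ z s.1 s.2.1) y).prod

/-- `I` is a (scalar) local Riemannian invariant of weight `w` in dimension `n`. -/
structure IsLocalInvariant (w : ℝ) (I : ∀ M : Mfd.{u} n, RMetric M → M → ℂ) : Prop where
  smooth : ∀ (M : Mfd.{u} n) (g : RMetric M), I M g ∈ Smooth M
  universal : ∃ (S : Finset (Mon n)) (a : Mon n → (Fin n → Fin n → ℝ) → ℂ),
    (∀ β, ContDiffOn ℝ ∞ (a β) (Pos n)) ∧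
    ∀ (M : Mfd.{u} n) (g : RMetric M) (φ : Coord M), IsCoord φ → ∀ x ∈ φ.source,
      I M g x = ∑ β ∈ S, a β (coeff g φ (φ x)) * (jet g φ β (φ x) : ℝ)
  scaling : ∀ (M : Mfd.{u} n) (g : RMetric M) (t : ℝ) (ht : 0 < t) (x : M),
    I M (g.scale t ht) x = ((t ^ (-w) : ℝ) : ℂ) * I M g x

/-- The symbols `a_{jβ} ∈ S_{m-j}(M_n(ℝ)_+ × ℝⁿ)`, `β ∈ S j`, give the symbol of `P_g` in any local
coordinates, through `p_{g,m-j}(y,ξ) = ∑_β (∂^α g(y))^β a_{jβ}(g(y),ξ)`. -/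
def HasUniversalSymbol (m : ℤ) (P : ∀ M : Mfd.{u} n, RMetric M → Op M) (S : ℕ → Finset (Mon n))
    (a : ℕ → Mon n → (Fin n → Fin n → ℝ) → E n → ℂ) : Prop :=
  (∀ (j : ℕ) (β : Mon n), IsHomogSymbol (Pos n) (m - j) (a j β)) ∧
  ∀ (M : Mfd.{u} n) (g : RMetric M) (φ : Coord M), IsCoord φ →
    HasSymbol m (P M g) φ
      (fun j y ξ => ∑ β ∈ S j, (jet g φ β y : ℝ) * a j β (coeff g φ y) ξ)

/-- `P` is a Riemannian invariant pseudodifferential operator of order `m` and weight `w`. -/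
structure IsInvariantPsiDO (m : ℤ) (w : ℝ) (P : ∀ M : Mfd.{u} n, RMetric M → Op M) : Prop where
  psiDO : ∀ (M : Mfd.{u} n) (g : RMetric M), IsPsiDO m (P M g)
  universal : ∃ S a, HasUniversalSymbol m P S a
  scaling : ∀ (M : Mfd.{u} n) (g : RMetric M) (t : ℝ) (ht : 0 < t),
    IsSmoothing (P M (g.scale t ht) - ((t ^ (-w) : ℝ) : ℂ) • P M g)

/-- Admissibility: the coefficients `a_{0β}` can be taken to be zero for `β ≠ 0`. -/
def IsAdmissible (m : ℤ) (P : ∀ M : Mfd.{u} n, RMetric M → Op M) : Prop :=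
  ∃ S a, HasUniversalSymbol m P S a ∧ ∀ β, β ≠ 0 → a 0 β = 0

end RiemPsiDO

end

open RiemPsiDO

noncomputable section
namespace RiemPsiDO
open Set Filter Topology

section ParametricIntegrals

variable {Y T F : Type*} [NormedAddCommGroup Y] [NormedSpace ℝ Y] [NormedAddCommGroup F]
  [NormedSpace ℝ F]

set_option synthInstance.maxHeartbeats 200000 in
/-- Differentiation under the integral sign, to all orders. -/
theorem contDiffOn_integral_of_bound [MeasurableSpace T] {μ : Measure T} {U : Set Y}
    (hU : IsOpen U) {G : Y → T → F}
    (hG : ∀ᵐ t ∂μ, ContDiffOn ℝ ∞ (fun x => G x t) U)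
    (hm : ∀ k : ℕ, ∀ x ∈ U,
      AEStronglyMeasurable (fun t => iteratedFDeriv ℝ k (fun x => G x t) x) μ)
    {β : ℕ → T → ℝ} (hβ : ∀ k, Integrable (β k) μ)
    (hb : ∀ k, ∀ᵐ t ∂μ, ∀ x ∈ U, ‖iteratedFDeriv ℝ k (fun x => G x t) x‖ ≤ β k t) :
    ContDiffOn ℝ ∞ (fun x => ∫ t, G x t ∂μ) U ∧
      ∀ k : ℕ, ∀ x ∈ U, iteratedFDeriv ℝ k (fun x => ∫ t, G x t ∂μ) x =
        ∫ t, iteratedFDeriv ℝ k (fun x => G x t) x ∂μ := by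
  have h_int : ∀ k : ℕ, ∀ x ∈ U,
      Integrable (fun t => iteratedFDeriv ℝ k (fun x => G x t) x) μ := fun k x hx =>
    (hβ k).mono' (hm k x hx) ((hb k).mono fun t ht => ht x hx)
  have hderiv : ∀ k : ℕ, ∀ x ∈ U,
      HasFDerivAt (fun x => ∫ t, iteratedFDeriv ℝ k (fun x => G x t) x ∂μ)
        (∫ t, iteratedFDeriv ℝ (k + 1) (fun x => G x t) x ∂μ).curryLeft x := by
    intro k x hx
    have hcur : (∫ t, iteratedFDeriv ℝ (k + 1) (fun x => G x t) x ∂μ).curryLeft =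
        ∫ t, fderiv ℝ (iteratedFDeriv ℝ k (fun x => G x t)) x ∂μ := by
      let Lq : (Y [×(k + 1)]→L[ℝ] F) ≃L[ℝ] (Y →L[ℝ] (Y [×k]→L[ℝ] F)) :=
        (continuousMultilinearCurryLeftEquiv ℝ (fun _ : Fin (k + 1) => Y)
          F).toContinuousLinearEquiv
      have := ContinuousLinearEquiv.integral_comp_comm (𝕜 := ℝ) (F := Y →L[ℝ] (Y [×k]→L[ℝ] F)) (μ := μ) Lq
        (fun t => iteratedFDeriv ℝ (k + 1) (fun x => G x t) x)
      refine this.symm.trans (integral_congr_ae (Eventually.of_forall fun t => ?_))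
      simp only [iteratedFDeriv_succ_eq_comp_left, Function.comp_apply]
      exact (continuousMultilinearCurryLeftEquiv ℝ (fun _ : Fin (k + 1) => Y)
        F).apply_symm_apply _
    rw [hcur]
    have hnorm : ∀ t (x : Y), ‖fderiv ℝ (iteratedFDeriv ℝ k (fun x => G x t)) x‖ =
        ‖iteratedFDeriv ℝ (k + 1) (fun x => G x t) x‖ := fun t x => norm_fderiv_iteratedFDeriv
    refine hasFDerivAt_integral_of_dominated_of_fderiv_le
      (F := fun x t => iteratedFDeriv ℝ k (fun x => G x t) x)
      (F' := fun x t => fderiv ℝ (iteratedFDeriv ℝ k (fun x => G x t)) x) (hU.mem_nhds hx)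
      (Filter.mem_of_superset (hU.mem_nhds hx) fun y hy => hm k y hy) (h_int k x hx) ?_ ?_
      (hβ (k + 1)) ?_
    · have := (continuousMultilinearCurryLeftEquiv ℝ (fun _ : Fin (k + 1) => Y)
        F).continuous.comp_aestronglyMeasurable (hm (k + 1) x hx)
      refine this.congr (Eventually.of_forall fun t => ?_)
      simp only [iteratedFDeriv_succ_eq_comp_left, Function.comp_apply]
      exact (continuousMultilinearCurryLeftEquiv ℝ (fun _ : Fin (k + 1) => Y)
        F).apply_symm_apply _
    · filter_upwards [hb (k + 1)] with t ht y hy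
      rw [hnorm]; exact ht y hy
    · filter_upwards [hG] with t ht y hy
      have h1 : ContDiffAt ℝ ∞ (fun x => G x t) y := ht.contDiffAt (hU.mem_nhds hy)
      exact (h1.differentiableAt_iteratedFDeriv (by exact_mod_cast WithTop.coe_lt_top k)).hasFDerivAt
  have hT : HasFTaylorSeriesUpToOn ∞ (fun x => ∫ t, G x t ∂μ)
      (fun x k => ∫ t, iteratedFDeriv ℝ k (fun x => G x t) x ∂μ) U := by
    refine ⟨fun x hx => ?_, fun k _ x hx => (hderiv k x hx).hasFDerivWithinAt,
      fun k _ x hx => (hderiv k x hx).continuousAt.continuousWithinAt⟩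
    have := (continuousMultilinearCurryFin0 ℝ Y F).toContinuousLinearEquiv.integral_comp_comm
      (μ := μ) (fun t => iteratedFDeriv ℝ 0 (fun x => G x t) x)
    refine this.symm.trans (integral_congr_ae (Eventually.of_forall fun t => ?_))
    simp
  refine ⟨hT.contDiffOn, fun k x hx => ?_⟩
  rw [← iteratedFDerivWithin_of_isOpen k hU hx]
  exact (hT.eq_iteratedFDerivWithin_of_uniqueDiffOn (by exact_mod_cast le_top) hU.uniqueDiffOn
    hx).symm

variable [NormedAddCommGroup T] [NormedSpace ℝ T]

/-- The iterated derivatives in the first variable of a smooth function of two variables. -/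
theorem iteratedFDeriv_slice {G : Y × T → F} {x : Y} {t : T} (k : ℕ)
    {Ω : Set (Y × T)} (hΩ : IsOpen Ω) (hG : ContDiffOn ℝ ∞ G Ω) (h : (x, t) ∈ Ω) :
    iteratedFDeriv ℝ k (fun x => G (x, t)) x =
      (iteratedFDeriv ℝ k G (x, t)).compContinuousLinearMap
        fun _ => ContinuousLinearMap.inl ℝ Y T := by
  set G' : Y × T → F := fun z => G (z + (0, t)) with hG'
  have hΩ' : IsOpen ((fun z : Y × T => z + (0, t)) ⁻¹' Ω) :=
    hΩ.preimage (by fun_prop)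
  have hc : ContDiffOn ℝ ∞ G' ((fun z : Y × T => z + (0, t)) ⁻¹' Ω) :=
    hG.comp (by fun_prop) fun z hz => hz
  have hx : (ContinuousLinearMap.inl ℝ Y T) x ∈ (fun z : Y × T => z + (0, t)) ⁻¹' Ω := by
    simpa using h
  have ho := hΩ'.preimage (ContinuousLinearMap.inl ℝ Y T).continuous
  have := ContinuousLinearMap.iteratedFDerivWithin_comp_right (ContinuousLinearMap.inl ℝ Y T) hc
    hΩ'.uniqueDiffOn ho.uniqueDiffOn hx (i := k) (by exact_mod_cast le_top)
  rw [iteratedFDerivWithin_of_isOpen k hΩ' hx, iteratedFDerivWithin_of_isOpen k ho hx] at this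
  have e1 : (G' ∘ ContinuousLinearMap.inl ℝ Y T) = fun x => G (x, t) := by
    ext x; simp [hG']
  rw [e1] at this
  rw [this, hG', iteratedFDeriv_comp_add_right]
  simp

theorem continuousOn_iteratedFDeriv_slice {G : Y × T → F} (k : ℕ)
    {Ω : Set (Y × T)} (hΩ : IsOpen Ω) (hG : ContDiffOn ℝ ∞ G Ω) :
    ContinuousOn (fun z : Y × T => iteratedFDeriv ℝ k (fun x => G (x, z.2)) z.1) Ω := by
  have h1 : ContinuousOn (fun z => (iteratedFDeriv ℝ k G z).compContinuousLinearMap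
        fun _ => ContinuousLinearMap.inl ℝ Y T) Ω := by
    have h2 : ContinuousOn (iteratedFDeriv ℝ k G) Ω := by
      have := hG.continuousOn_iteratedFDerivWithin (m := k) (by exact_mod_cast le_top)
        hΩ.uniqueDiffOn
      exact this.congr fun z hz => (iteratedFDerivWithin_of_isOpen k hΩ hz).symm
    exact (ContinuousMultilinearMap.compContinuousLinearMapL
      (fun _ : Fin k => ContinuousLinearMap.inl ℝ Y T)).continuous.comp_continuousOn h2
  exact h1.congr fun z hz => iteratedFDeriv_slice k hΩ hG hz

variable [MeasurableSpace T] [BorelSpace T]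

/-- Differentiation under the integral sign for a smooth integrand times a measurable weight. -/
theorem contDiffOn_integral_mul_of_contDiffOn_prod [SecondCountableTopology T] {μ : Measure T}
    {U : Set Y} (hU : IsOpen U) {T₀ : Set T} (hT₀ : IsOpen T₀) (hμ : ∀ᵐ t ∂μ, t ∈ T₀)
    {G : Y × T → ℂ} (hG : ContDiffOn ℝ ∞ G (U ×ˢ T₀)) {w : T → ℂ}
    (hw : AEStronglyMeasurable w μ)
    {β : ℕ → T → ℝ} (hβ : ∀ k, Integrable (β k) μ)
    (hb : ∀ k, ∀ t ∈ T₀, ∀ x ∈ U,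
      ‖w t‖ * ‖iteratedFDeriv ℝ k (fun x => G (x, t)) x‖ ≤ β k t) :
    ContDiffOn ℝ ∞ (fun x => ∫ t, w t * G (x, t) ∂μ) U ∧
      ∀ k : ℕ, ∀ x ∈ U, ‖iteratedFDeriv ℝ k (fun x => ∫ t, w t * G (x, t) ∂μ) x‖ ≤
        ∫ t, β k t ∂μ := by
  have hsl : ∀ t ∈ T₀, ContDiffOn ℝ ∞ (fun x => G (x, t)) U := fun t ht =>
    hG.comp (by fun_prop) fun x hx => ⟨hx, ht⟩
  have hD : ∀ k : ℕ, ∀ t ∈ T₀, ∀ x ∈ U, iteratedFDeriv ℝ k (fun x => w t * G (x, t)) x =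
      w t • iteratedFDeriv ℝ k (fun x => G (x, t)) x := fun k t ht x hx =>
    iteratedFDeriv_const_smul_apply' (𝕜 := ℝ) (a := w t)
      (((hsl t ht).contDiffAt (hU.mem_nhds hx)).of_le (by exact_mod_cast le_top))
  have hbd : ∀ k : ℕ, ∀ t ∈ T₀, ∀ x ∈ U,
      ‖iteratedFDeriv ℝ k (fun x => w t * G (x, t)) x‖ ≤ β k t := by
    intro k t ht x hx
    rw [hD k t ht x hx, norm_smul]
    exact hb k t ht x hx
  have hmain := contDiffOn_integral_of_bound (G := fun x t => w t * G (x, t)) (μ := μ) hU ?_ ?_ hβ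
    fun k => hμ.mono fun t ht => hbd k t ht
  · refine ⟨hmain.1, fun k x hx => ?_⟩
    rw [hmain.2 k x hx]
    exact norm_integral_le_of_norm_le (hβ k) (hμ.mono fun t ht => hbd k t ht x hx)
  · filter_upwards [hμ] with t ht
    exact contDiffOn_const.mul (hsl t ht)
  · intro k x hx
    have h1 : AEStronglyMeasurable
        (fun t => w t • iteratedFDeriv ℝ k (fun x => G (x, t)) x) μ := by
      refine hw.smul ?_
      rw [← Measure.restrict_eq_self_of_ae_mem hμ]
      refine ContinuousOn.aestronglyMeasurable ?_ hT₀.measurableSet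
      exact (continuousOn_iteratedFDeriv_slice k (hU.prod hT₀) hG).comp (f := fun t => (x, t))
        (by fun_prop) fun t ht => ⟨hx, ht⟩
    exact h1.congr (hμ.mono fun t ht => (hD k t ht x hx).symm)

/-- Smoothness of integrals over a compact set. -/
theorem contDiffOn_integral_of_isCompact [SecondCountableTopology T] [LocallyCompactSpace Y]
    {μ : Measure T} [IsFiniteMeasureOnCompacts μ]
    {U : Set Y} (hU : IsOpen U) {T₁ : Set T} (hT₁ : IsCompact T₁) {Ω : Set (Y × T)}
    (hΩ : IsOpen Ω) (hΩT : ∀ x ∈ U, ∀ t ∈ T₁, (x, t) ∈ Ω)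
    {G : Y × T → F} (hG : ContDiffOn ℝ ∞ G Ω) :
    ContDiffOn ℝ ∞ (fun x => ∫ t in T₁, G (x, t) ∂μ) U ∧
      ∀ x ∈ U, ∀ v, fderiv ℝ (fun x => ∫ t in T₁, G (x, t) ∂μ) x v =
        ∫ t in T₁, fderiv ℝ (fun x => G (x, t)) x v ∂μ := by
  suffices H : ∀ x₀ ∈ U, ContDiffAt ℝ ∞ (fun x => ∫ t in T₁, G (x, t) ∂μ) x₀ ∧
      ∀ v, fderiv ℝ (fun x => ∫ t in T₁, G (x, t) ∂μ) x₀ v =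
        ∫ t in T₁, fderiv ℝ (fun x => G (x, t)) x₀ v ∂μ from
    ⟨fun x hx => (H x hx).1.contDiffWithinAt, fun x hx => (H x hx).2⟩
  intro x₀ hx₀
  obtain ⟨u, v, hu, hv, hxu, hTv, huv⟩ := generalized_tube_lemma (isCompact_singleton (x := x₀))
    hT₁ hΩ (by rintro ⟨x, t⟩ ⟨hx, ht⟩; obtain rfl : x = x₀ := hx; exact hΩT x hx₀ t ht)
  obtain ⟨K, hK, hxK, hKu⟩ := exists_compact_subset (hu.inter hU) (x := x₀)
    ⟨hxu rfl, hx₀⟩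
  have hbd : ∀ k : ℕ, ∃ C : ℝ, ∀ x ∈ K, ∀ t ∈ T₁,
      ‖iteratedFDeriv ℝ k (fun x => G (x, t)) x‖ ≤ C := by
    intro k
    obtain ⟨C, hC⟩ := (hK.prod hT₁).exists_bound_of_continuousOn
      ((continuousOn_iteratedFDeriv_slice k hΩ hG).mono
        fun z hz => huv ⟨(hKu hz.1).1, hTv hz.2⟩)
    exact ⟨C, fun x hx t ht => hC (x, t) ⟨hx, ht⟩⟩
  choose C hC using hbd
  have hfin : IsFiniteMeasure (μ.restrict T₁) := ⟨by simpa using hT₁.measure_lt_top⟩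
  have hμ : ∀ᵐ t ∂(μ.restrict T₁), t ∈ T₁ := ae_restrict_mem hT₁.measurableSet
  have hmeas : ∀ k : ℕ, ∀ x ∈ interior K, AEStronglyMeasurable
      (fun t => iteratedFDeriv ℝ k (fun x => G (x, t)) x) (μ.restrict T₁) := by
    intro k x hx
    refine ContinuousOn.aestronglyMeasurable ?_ hT₁.measurableSet
    exact (continuousOn_iteratedFDeriv_slice k hΩ hG).comp (f := fun t => (x, t)) (by fun_prop)
      fun t ht => huv ⟨(hKu (interior_subset hx)).1, hTv ht⟩
  have hbdae : ∀ k : ℕ, ∀ᵐ t ∂(μ.restrict T₁), ∀ x ∈ interior K,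
      ‖iteratedFDeriv ℝ k (fun x => G (x, t)) x‖ ≤ C k := by
    intro k
    filter_upwards [hμ] with t ht x hx
    exact hC k x (interior_subset hx) t ht
  have := contDiffOn_integral_of_bound (G := fun x t => G (x, t)) (μ := μ.restrict T₁)
    (U := interior K) isOpen_interior (by
      filter_upwards [hμ] with t ht
      exact hG.comp (by fun_prop) fun x hx => huv ⟨(hKu (interior_subset hx)).1, hTv ht⟩)
    hmeas (β := fun k _ => C k) (fun k => integrable_const _) hbdae
  refine ⟨this.1.contDiffAt (isOpen_interior.mem_nhds hxK), fun v => ?_⟩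
  have h1 := this.2 1 x₀ hxK
  have h2 := congrArg (fun L => L (fun _ => v)) h1
  simp only [iteratedFDeriv_one_apply] at h2
  have h_int : Integrable (fun t => iteratedFDeriv ℝ 1 (fun x => G (x, t)) x₀) (μ.restrict T₁) :=
    (integrable_const (C 1)).mono' (hmeas 1 x₀ hxK) ((hbdae 1).mono fun t ht => ht x₀ hxK)
  rw [h2, ContinuousMultilinearMap.integral_apply h_int]
  simp only [iteratedFDeriv_one_apply]

end ParametricIntegrals

section Bounds

variable {Y : Type*} [NormedAddCommGroup Y] [NormedSpace ℝ Y]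

theorem norm_iteratedFDeriv_mul_le_of_isOpen {U : Set Y} (hU : IsOpen U) {f g : Y → ℂ}
    (hf : ContDiffOn ℝ ∞ f U) (hg : ContDiffOn ℝ ∞ g U) {x : Y} (hx : x ∈ U) (k : ℕ) :
    ‖iteratedFDeriv ℝ k (fun y => f y * g y) x‖ ≤ ∑ i ∈ Finset.range (k + 1),
      (k.choose i : ℝ) * ‖iteratedFDeriv ℝ i f x‖ * ‖iteratedFDeriv ℝ (k - i) g x‖ := by
  have := norm_iteratedFDerivWithin_mul_le hf hg hU.uniqueDiffOn hx (n := k)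
    (by exact_mod_cast le_top)
  simpa only [iteratedFDerivWithin_of_isOpen _ hU hx] using this

end Bounds
end RiemPsiDO

end

noncomputable section
namespace RiemPsiDO
open Set Filter Topology

variable {n : ℕ}

/-! ### Directional derivatives and integration by parts -/

section DirectionalDerivative

theorem minSmoothness_two_le : minSmoothness ℝ 2 ≤ (∞ : WithTop ℕ∞) := by
  rw [minSmoothness_of_isRCLikeNormedField]
  exact WithTop.coe_le_coe.2 (show ((2 : ℕ) : ℕ∞) ≤ ⊤ from le_top)

variable {W : Type*} [NormedAddCommGroup W] [NormedSpace ℝ W]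

/-- The directional derivative of `F` along the constant vector field `v`. -/
def dd (v : W) (F : W → ℂ) : W → ℂ := fun z => fderiv ℝ F z v

theorem contDiffOn_dd {Ω : Set W} (hΩ : IsOpen Ω) {F : W → ℂ} (hF : ContDiffOn ℝ ∞ F Ω) (v : W) :
    ContDiffOn ℝ ∞ (dd v F) Ω :=
  (hF.fderiv_of_isOpen hΩ (m := ∞) (by simp)).clm_apply contDiffOn_const

theorem contDiff_dd {F : W → ℂ} (hF : ContDiff ℝ ∞ F) (v : W) : ContDiff ℝ ∞ (dd v F) :=
  (hF.fderiv_right (m := ∞) (by simp)).clm_apply contDiff_const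

theorem differentiableAt_of_contDiffOn {Ω : Set W} (hΩ : IsOpen Ω) {F : W → ℂ}
    (hF : ContDiffOn ℝ ∞ F Ω) {z : W} (hz : z ∈ Ω) : DifferentiableAt ℝ F z :=
  (hF.contDiffAt (hΩ.mem_nhds hz)).differentiableAt (by simp)

theorem dd_congr {Ω : Set W} (hΩ : IsOpen Ω) {F G : W → ℂ} (h : ∀ z ∈ Ω, F z = G z) (v : W) :
    ∀ z ∈ Ω, dd v F z = dd v G z := fun z hz => by
  have : F =ᶠ[𝓝 z] G := Filter.mem_of_superset (hΩ.mem_nhds hz) h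
  simp only [dd, this.fderiv_eq]

theorem dd_eq_zero {Ω : Set W} (hΩ : IsOpen Ω) {F : W → ℂ} (h : ∀ z ∈ Ω, F z = 0) (v : W) :
    ∀ z ∈ Ω, dd v F z = 0 := fun z hz => by
  rw [dd_congr hΩ (G := fun _ => 0) h v z hz]
  simp [dd]

theorem dd_add {F G : W → ℂ} {z : W} (hF : DifferentiableAt ℝ F z) (hG : DifferentiableAt ℝ G z)
    (v : W) : dd v (fun z => F z + G z) z = dd v F z + dd v G z := by
  simp [dd, fderiv_fun_add hF hG]

theorem dd_mul {F G : W → ℂ} {z : W} (hF : DifferentiableAt ℝ F z) (hG : DifferentiableAt ℝ G z)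
    (v : W) : dd v (fun z => F z * G z) z = F z * dd v G z + dd v F z * G z := by
  simp [dd, fderiv_fun_mul hF hG, mul_comm]

theorem dd_const_mul {F : W → ℂ} {z : W} (hF : DifferentiableAt ℝ F z) (c : ℂ) (v : W) :
    dd v (fun z => c * F z) z = c * dd v F z := by
  simp [dd, fderiv_const_mul hF]

theorem dd_sum {ι : Type*} (s : Finset ι) {F : ι → W → ℂ} {z : W}
    (hF : ∀ i ∈ s, DifferentiableAt ℝ (F i) z) (v : W) :
    dd v (fun z => ∑ i ∈ s, F i z) z = ∑ i ∈ s, dd v (F i) z := by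
  simp [dd, fderiv_fun_sum hF]

theorem dd_comm {Ω : Set W} (hΩ : IsOpen Ω) {F : W → ℂ} (hF : ContDiffOn ℝ ∞ F Ω) {z : W}
    (hz : z ∈ Ω) (u v : W) : dd u (dd v F) z = dd v (dd u F) z := by
  have h1 : ContDiffAt ℝ ∞ F z := hF.contDiffAt (hΩ.mem_nhds hz)
  have h2 : DifferentiableAt ℝ (fderiv ℝ F) z :=
    (h1.fderiv_right (m := ∞) (by simp)).differentiableAt (by simp)
  have h3 : ∀ a b : W, dd a (dd b F) z = fderiv ℝ (fderiv ℝ F) z a b := by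
    intro a b
    have : dd b F = fun z => fderiv ℝ F z b := rfl
    rw [this]
    unfold dd
    rw [fderiv_clm_apply h2 (differentiableAt_const b)]
    simp
  rw [h3, h3]
  exact (h1.isSymmSndFDerivAt minSmoothness_two_le).eq u v

theorem contDiff_mul_of_tsupport_subset {Ω : Set W} (hΩ : IsOpen Ω) {f g : W → ℂ}
    (hf : ContDiffOn ℝ ∞ f Ω) (hg : ContDiff ℝ ∞ g) (hs : tsupport g ⊆ Ω) :
    ContDiff ℝ ∞ (fun x => f x * g x) := by
  rw [contDiff_iff_contDiffAt]
  intro x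
  by_cases hx : x ∈ tsupport g
  · exact (hf.contDiffAt (hΩ.mem_nhds (hs hx))).mul hg.contDiffAt
  · have : (fun x => f x * g x) =ᶠ[𝓝 x] fun _ => 0 := by
      filter_upwards [notMem_tsupport_iff_eventuallyEq.1 hx] with y hy
      simp [hy]
    exact contDiffAt_const.congr_of_eventuallyEq this

theorem tsupport_dd_subset (v : W) (g : W → ℂ) : tsupport (dd v g) ⊆ tsupport g := by
  refine closure_minimal (fun x hx => ?_) (isClosed_tsupport _)
  by_contra h
  refine hx ?_
  have := notMem_tsupport_iff_eventuallyEq.1 h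
  simp [dd, this.fderiv_eq]

theorem hasCompactSupport_dd {g : W → ℂ} (hg : HasCompactSupport g) (v : W) :
    HasCompactSupport (dd v g) :=
  hg.of_isClosed_subset (isClosed_tsupport _) (tsupport_dd_subset v g)

end DirectionalDerivative

theorem integrable_mul_of_tsupport_subset {Ω : Set (E n)} (hΩ : IsOpen Ω) {f g : E n → ℂ}
    (hf : ContDiffOn ℝ ∞ f Ω) (hg : ContDiff ℝ ∞ g) (hc : HasCompactSupport g)
    (hs : tsupport g ⊆ Ω) : Integrable (fun x => f x * g x) :=
  (contDiff_mul_of_tsupport_subset hΩ hf hg hs).continuous.integrable_of_hasCompactSupport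
    (hc.mul_left)

/-- Integration by parts against a test function. -/
theorem integral_mul_dd {Ω : Set (E n)} (hΩ : IsOpen Ω) {f g : E n → ℂ}
    (hf : ContDiffOn ℝ ∞ f Ω) (hg : ContDiff ℝ ∞ g) (hc : HasCompactSupport g)
    (hs : tsupport g ⊆ Ω) (v : E n) :
    ∫ x, f x * dd v g x = - ∫ x, dd v f x * g x := by
  refine integral_mul_fderiv_eq_neg_fderiv_mul_of_integrable
    (integrable_mul_of_tsupport_subset hΩ (contDiffOn_dd hΩ hf v) hg hc hs)
    (integrable_mul_of_tsupport_subset hΩ hf (contDiff_dd hg v) (hasCompactSupport_dd hc v)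
      ((tsupport_dd_subset v g).trans hs))
    (integrable_mul_of_tsupport_subset hΩ hf hg hc hs)
    (fun x hx => differentiableAt_of_contDiffOn hΩ hf (hs hx))
    (fun x _ => hg.differentiable (by simp) x)

/-! ### Test symbols -/

/-- Smooth functions with compact support in `ℝⁿ ∖ 0`. -/
def TestSym (n : ℕ) : Submodule ℂ (E n → ℂ) where
  carrier := {f | ContDiff ℝ ∞ f ∧ HasCompactSupport f ∧ f =ᶠ[𝓝 0] 0}
  add_mem' ha hb := ⟨ha.1.add hb.1, ha.2.1.add hb.2.1, by
    simpa using ha.2.2.add hb.2.2⟩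
  zero_mem' := ⟨contDiff_const, HasCompactSupport.zero, EventuallyEq.rfl⟩
  smul_mem' c f hf := ⟨contDiff_const.smul hf.1, hf.2.1.smul_left (f := fun _ => c), by
    filter_upwards [hf.2.2] with x hx; simp [hx]⟩

theorem TestSym.tsupport_subset {f : E n → ℂ} (hf : f ∈ TestSym n) : tsupport f ⊆ {0}ᶜ := by
  intro x hx h0
  rw [mem_singleton_iff.1 h0] at hx
  exact notMem_tsupport_iff_eventuallyEq.2 hf.2.2 hx

theorem TestSym.mem_of_tsupport_subset {f : E n → ℂ} (hf : ContDiff ℝ ∞ f)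
    (hc : HasCompactSupport f) (h : tsupport f ⊆ {0}ᶜ) : f ∈ TestSym n :=
  ⟨hf, hc, notMem_tsupport_iff_eventuallyEq.1 fun h0 => h h0 rfl⟩

theorem TestSym.mul_mem {f p : E n → ℂ} (hp : ContDiffOn ℝ ∞ p {0}ᶜ) (hf : f ∈ TestSym n) :
    (fun ξ => p ξ * f ξ) ∈ TestSym n :=
  ⟨contDiff_mul_of_tsupport_subset isOpen_compl_singleton hp hf.1 (tsupport_subset hf),
    hf.2.1.mul_left, by filter_upwards [hf.2.2] with x hx; simp [hx]⟩

theorem TestSym.comp_mem {f : E n → ℂ} (hf : f ∈ TestSym n) (N : E n ≃L[ℝ] E n) :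
    (fun ξ => f (N ξ)) ∈ TestSym n := by
  refine ⟨hf.1.comp N.contDiff, hf.2.1.comp_homeomorph N.toHomeomorph, ?_⟩
  have : Tendsto N (𝓝 0) (𝓝 0) := by simpa using N.continuous.tendsto 0
  exact this.eventually hf.2.2

theorem TestSym.dd_mem {f : E n → ℂ} (hf : f ∈ TestSym n) (v : E n) : dd v f ∈ TestSym n :=
  mem_of_tsupport_subset (contDiff_dd hf.1 v) (hasCompactSupport_dd hf.2.1 v)
    ((tsupport_dd_subset v f).trans (tsupport_subset hf))

theorem TestSym.integrable_mul {f p : E n → ℂ} (hp : ContDiffOn ℝ ∞ p {0}ᶜ)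
    (hf : f ∈ TestSym n) : Integrable (fun ξ => p ξ * f ξ) :=
  integrable_mul_of_tsupport_subset isOpen_compl_singleton hp hf.1 hf.2.1 (tsupport_subset hf)

theorem TestSym.integrable {f : E n → ℂ} (hf : f ∈ TestSym n) : Integrable f :=
  hf.1.continuous.integrable_of_hasCompactSupport hf.2.1

theorem TestSym.integral_mul_dd {f p : E n → ℂ} (hp : ContDiffOn ℝ ∞ p {0}ᶜ)
    (hf : f ∈ TestSym n) (v : E n) : ∫ x, p x * dd v f x = - ∫ x, dd v p x * f x :=
  RiemPsiDO.integral_mul_dd isOpen_compl_singleton hp hf.1 hf.2.1 (tsupport_subset hf) v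

/-- A high frequency cut-off: `0` near the origin and `1` outside of the unit ball. -/
def hi (ξ : E n) : ℂ := (Real.smoothTransition (2 * ‖ξ‖ ^ 2 - 1) : ℝ)

/-- The Euler derivative of `hi`. -/
def bump (ξ : E n) : ℂ := fderiv ℝ hi ξ ξ

theorem contDiff_hi : ContDiff ℝ ∞ (hi : E n → ℂ) := by
  have h : ContDiff ℝ ∞ (fun ξ : E n => Real.smoothTransition (2 * ‖ξ‖ ^ 2 - 1)) :=
    Real.smoothTransition.contDiff.comp
      ((contDiff_const.mul (contDiff_norm_sq ℝ)).sub contDiff_const)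
  exact Complex.ofRealCLM.contDiff.comp h

theorem hi_eq_zero {ξ : E n} (h : ‖ξ‖ ≤ 1 / 2) : hi ξ = 0 := by
  have : 2 * ‖ξ‖ ^ 2 - 1 ≤ 0 := by nlinarith [norm_nonneg ξ]
  simp [hi, Real.smoothTransition.zero_of_nonpos this]

theorem hi_eq_one {ξ : E n} (h : 1 ≤ ‖ξ‖) : hi ξ = 1 := by
  have : 1 ≤ 2 * ‖ξ‖ ^ 2 - 1 := by nlinarith [norm_nonneg ξ]
  simp [hi, Real.smoothTransition.one_of_one_le this]

theorem norm_hi_le (ξ : E n) : ‖hi ξ‖ ≤ 1 := by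
  rw [hi, Complex.norm_real, Real.norm_of_nonneg (Real.smoothTransition.nonneg _)]
  exact Real.smoothTransition.le_one _

theorem hi_eventuallyEq_zero : (hi : E n → ℂ) =ᶠ[𝓝 0] 0 := by
  filter_upwards [Metric.ball_mem_nhds (0 : E n) (ε := 1 / 2) (by norm_num)] with ξ hξ
  exact hi_eq_zero (by simpa using (mem_ball_zero_iff.1 hξ).le)

theorem hasCompactSupport_hi_sub_one : HasCompactSupport (fun ξ : E n => hi ξ - 1) := by
  refine HasCompactSupport.intro (isCompact_closedBall (0 : E n) 1) fun ξ hξ => ?_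
  rw [hi_eq_one, sub_self]
  simpa using (not_le.1 fun h => hξ (mem_closedBall_zero_iff.2 h)).le

theorem dd_hi_comp_mem (N : E n ≃L[ℝ] E n) (w : E n) :
    dd w (fun ξ => hi (N ξ)) ∈ TestSym n := by
  have hs : ContDiff ℝ ∞ (fun ξ : E n => hi (N ξ)) := contDiff_hi.comp N.contDiff
  have h1 : dd w (fun ξ => hi (N ξ)) = dd w (fun ξ => hi (N ξ) - 1) := by
    ext ξ; simp [dd, fderiv_sub_const]
  refine ⟨contDiff_dd hs w, ?_, ?_⟩
  · rw [h1]
    exact hasCompactSupport_dd (hasCompactSupport_hi_sub_one.comp_homeomorph N.toHomeomorph) w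
  · have ht : Tendsto N (𝓝 0) (𝓝 0) := by simpa using N.continuous.tendsto 0
    have := (ht.eventually (hi_eventuallyEq_zero (n := n))).eventually_nhds
    filter_upwards [this] with ξ hξ
    have : (fun ξ => hi (N ξ)) =ᶠ[𝓝 ξ] fun _ => 0 := hξ
    simp [dd, this.fderiv_eq]

theorem euler_eq_sum (D : E n → ℂ) (ξ : E n) : fderiv ℝ D ξ ξ = ∑ i, (ξ i : ℂ) * dd (e i) D ξ := by
  have : ξ = ∑ i, ξ i • (e i : E n) := by
    have := (EuclideanSpace.basisFun (Fin n) ℝ).sum_repr ξ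
    simpa [e, EuclideanSpace.basisFun_apply] using this.symm
  conv_lhs => rw [this]
  simp only [map_sum, map_smul, dd]
  rw [← this]
  simp

theorem bump_comp_eq (N : E n ≃L[ℝ] E n) (ξ : E n) :
    bump (N ξ) = fderiv ℝ (fun ξ => hi (N ξ)) ξ ξ := by
  have := N.comp_right_fderiv (f := (hi : E n → ℂ)) (x := ξ)
  have h2 : fderiv ℝ (fun ξ => hi (N ξ)) ξ = (fderiv ℝ hi (N ξ)).comp (N : E n →L[ℝ] E n) := this
  rw [h2]; rfl

theorem contDiff_coord (i : Fin n) : ContDiff ℝ ∞ (fun ξ : E n => (ξ i : ℂ)) :=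
  Complex.ofRealCLM.contDiff.comp (EuclideanSpace.proj i : E n →L[ℝ] ℝ).contDiff

theorem bump_mem : (bump : E n → ℂ) ∈ TestSym n := by
  have h : (bump : E n → ℂ) = ∑ i, fun ξ => (ξ i : ℂ) * dd (e i) hi ξ := by
    ext ξ; simp [bump, euler_eq_sum]
  rw [h]
  refine Submodule.sum_mem _ fun i _ => TestSym.mul_mem (contDiff_coord i).contDiffOn ?_
  exact dd_hi_comp_mem (ContinuousLinearEquiv.refl ℝ (E n)) (e i)

/-! ### Homogeneous functions and residues -/

/-- Smooth functions on `ℝⁿ ∖ 0` which are homogeneous of degree `d`. -/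
def Homog (d : ℤ) (f : E n → ℂ) : Prop :=
  ContDiffOn ℝ ∞ f {0}ᶜ ∧ ∀ ξ : E n, ξ ≠ 0 → ∀ t : ℝ, 0 < t → f (t • ξ) = (t : ℂ) ^ d * f ξ

theorem IsHomogSymbol.homog {F : Type*} [NormedAddCommGroup F] [NormedSpace ℝ F] {U : Set F}
    {d : ℤ} {p : F → E n → ℂ} (hp : IsHomogSymbol U d p) {x : F} (hx : x ∈ U) : Homog d (p x) :=
  ⟨hp.1.comp (f := fun ξ => (x, ξ)) (by fun_prop) fun _ hξ => ⟨hx, hξ⟩, hp.2 x hx⟩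

theorem Homog.mul {d d' : ℤ} {f g : E n → ℂ} (hf : Homog d f) (hg : Homog d' g) :
    Homog (d + d') (fun ξ => f ξ * g ξ) := by
  refine ⟨hf.1.mul hg.1, fun ξ hξ t ht => ?_⟩
  beta_reduce
  rw [hf.2 ξ hξ t ht, hg.2 ξ hξ t ht, zpow_add₀ (by exact_mod_cast ht.ne')]
  ring

theorem Homog.sum {ι : Type*} {d : ℤ} {s : Finset ι} {f : ι → E n → ℂ}
    (hf : ∀ i ∈ s, Homog d (f i)) : Homog d (fun ξ => ∑ i ∈ s, f i ξ) := by
  refine ⟨ContDiffOn.sum fun i hi => (hf i hi).1, fun ξ hξ t ht => ?_⟩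
  rw [Finset.mul_sum]
  exact Finset.sum_congr rfl fun i hi => (hf i hi).2 ξ hξ t ht

theorem Homog.const_mul {d : ℤ} {f : E n → ℂ} (hf : Homog d f) (c : ℂ) :
    Homog d (fun ξ => c * f ξ) :=
  ⟨contDiffOn_const.mul hf.1, fun ξ hξ t ht => by beta_reduce; rw [hf.2 ξ hξ t ht]; ring⟩

theorem Homog.inv {d : ℤ} {f : E n → ℂ} (hf : Homog d f) (h0 : ∀ ξ ≠ 0, f ξ ≠ 0) :
    Homog (-d) (fun ξ => (f ξ)⁻¹) := by
  refine ⟨hf.1.inv fun ξ hξ => h0 ξ hξ, fun ξ hξ t ht => ?_⟩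
  beta_reduce
  rw [hf.2 ξ hξ t ht, mul_inv, zpow_neg]

theorem Homog.dd {d : ℤ} {f : E n → ℂ} (hf : Homog d f) (v : E n) :
    Homog (d - 1) (dd v f) := by
  refine ⟨contDiffOn_dd isOpen_compl_singleton hf.1 v, fun ξ hξ t ht => ?_⟩
  have h1 : ∀ ζ ∈ ({0}ᶜ : Set (E n)), (fun ξ => f (t • ξ)) ζ = (fun ξ => (t : ℂ) ^ d * f ξ) ζ :=
    fun ζ hζ => hf.2 ζ hζ t ht
  have h2 := dd_congr isOpen_compl_singleton h1 v ξ hξ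
  rw [dd_const_mul (differentiableAt_of_contDiffOn isOpen_compl_singleton hf.1 hξ)] at h2
  have h3 : RiemPsiDO.dd v (fun ξ => f (t • ξ)) ξ = (t : ℂ) * RiemPsiDO.dd v f (t • ξ) := by
    simp only [RiemPsiDO.dd]
    rw [fderiv_comp_smul]
    simp
  have ht' : (t : ℂ) ≠ 0 := by exact_mod_cast ht.ne'
  rw [h3] at h2
  rw [zpow_sub_one₀ ht']
  field_simp
  rw [mul_comm, h2]

theorem Homog.euler {d : ℤ} {f : E n → ℂ} (hf : Homog d f) {ξ : E n} (hξ : ξ ≠ 0) :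
    fderiv ℝ f ξ ξ = d * f ξ := by
  have hd : DifferentiableAt ℝ f ξ := differentiableAt_of_contDiffOn isOpen_compl_singleton hf.1 hξ
  have h1 : HasDerivAt (fun t : ℝ => f (t • ξ)) (fderiv ℝ f ξ ξ) 1 := by
    have hl : HasDerivAt (fun t : ℝ => t • ξ) ξ 1 := by
      simpa using (hasDerivAt_id (1 : ℝ)).smul_const ξ
    have hd' : HasFDerivAt f (fderiv ℝ f ξ) ((1 : ℝ) • ξ) := by simpa using hd.hasFDerivAt
    exact hd'.comp_hasDerivAt (1 : ℝ) hl
  have h2 : HasDerivAt (fun t : ℝ => (t : ℂ) ^ d * f ξ) (d * f ξ) 1 := by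
    have : HasDerivAt (fun z : ℂ => z ^ d) ((d : ℂ) * 1 ^ (d - 1)) ((1 : ℝ) : ℂ) := by
      simpa using hasDerivAt_zpow d (1 : ℂ) (Or.inl one_ne_zero)
    have := (this.comp_ofReal).mul_const (f ξ)
    simpa using this
  refine h1.unique (h2.congr_of_eventuallyEq ?_)
  filter_upwards [lt_mem_nhds (zero_lt_one (α := ℝ))] with t ht
  exact hf.2 ξ hξ t ht

theorem integral_euler_mul {d : ℤ} {D G : E n → ℂ} (hD : D ∈ TestSym n) (hG : Homog d G) :
    ∫ ξ, G ξ * fderiv ℝ D ξ ξ = -(n + d : ℂ) * ∫ ξ, G ξ * D ξ := by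
  have h1 : ∀ i : Fin n, ContDiffOn ℝ ∞ (fun ξ : E n => (ξ i : ℂ) * G ξ) {0}ᶜ := fun i =>
    (contDiff_coord i).contDiffOn.mul hG.1
  have h2 : ∀ ξ, G ξ * fderiv ℝ D ξ ξ = ∑ i, ((ξ i : ℂ) * G ξ) * dd (e i) D ξ := by
    intro ξ
    rw [euler_eq_sum, Finset.mul_sum]
    exact Finset.sum_congr rfl fun i _ => by ring
  simp_rw [h2]
  rw [integral_finsetSum _ fun i _ => TestSym.integrable_mul (h1 i) (TestSym.dd_mem hD _)]
  simp_rw [TestSym.integral_mul_dd (h1 _) hD]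
  rw [Finset.sum_neg_distrib, ← integral_finsetSum _ fun i _ => TestSym.integrable_mul
    (contDiffOn_dd isOpen_compl_singleton (h1 i) _) hD, neg_mul, ← integral_const_mul]
  congr 1
  refine integral_congr_ae (Eventually.of_forall fun ξ => ?_)
  simp only
  by_cases hξ : ξ = 0
  · have : D ξ = 0 := by rw [hξ]; exact hD.2.2.eq_of_nhds
    simp [this]
  have hdG := differentiableAt_of_contDiffOn isOpen_compl_singleton hG.1 hξ
  have h3 : ∀ i : Fin n, dd (e i) (fun ξ : E n => (ξ i : ℂ) * G ξ) ξ =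
      (ξ i : ℂ) * dd (e i) G ξ + G ξ := by
    intro i
    rw [dd_mul ((contDiff_coord i).differentiable (by simp) ξ) hdG]
    have : dd (e i) (fun ξ : E n => (ξ i : ℂ)) ξ = 1 := by
      have h4 : HasFDerivAt (fun ξ : E n => (ξ i : ℂ))
          (Complex.ofRealCLM.comp (EuclideanSpace.proj i : E n →L[ℝ] ℝ)) ξ :=
        (Complex.ofRealCLM.comp (EuclideanSpace.proj i : E n →L[ℝ] ℝ)).hasFDerivAt
      simp [dd, h4.fderiv, e]
    rw [this, one_mul]
  simp_rw [h3]
  rw [← Finset.sum_mul, Finset.sum_add_distrib, ← euler_eq_sum, hG.euler hξ]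
  simp
  ring

/-- A directional derivative of a homogeneous function has no residue. -/
theorem integral_dd_mul_bump_comp {G : E n → ℂ} (hG : Homog (1 - n) G) (w : E n)
    (N : E n ≃L[ℝ] E n) : ∫ ξ, dd w G ξ * bump (N ξ) = 0 := by
  have hχ : ContDiff ℝ ∞ (fun ξ : E n => hi (N ξ)) := contDiff_hi.comp N.contDiff
  have h1 := TestSym.integral_mul_dd hG.1 (TestSym.comp_mem (bump_mem (n := n)) N) w
  have h2 : ∀ ξ, dd w (fun ξ => bump (N ξ)) ξ =
      fderiv ℝ (dd w (fun ξ => hi (N ξ))) ξ ξ + dd w (fun ξ => hi (N ξ)) ξ := by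
    intro ξ
    have h3 : DifferentiableAt ℝ (fderiv ℝ (fun ξ => hi (N ξ))) ξ :=
      (hχ.fderiv_right (m := ∞) (by simp)).differentiable (by simp) ξ
    have h4 : fderiv ℝ (dd w (fun ξ => hi (N ξ))) ξ ξ =
        fderiv ℝ (fderiv ℝ (fun ξ => hi (N ξ))) ξ ξ w := by
      have : dd w (fun ξ => hi (N ξ)) = fun ξ => fderiv ℝ (fun ξ => hi (N ξ)) ξ w := rfl
      rw [this, fderiv_clm_apply h3 (differentiableAt_const w)]
      simp
    rw [h4, (hχ.contDiffAt.isSymmSndFDerivAt (x := ξ) minSmoothness_two_le).eq ξ w]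
    simp_rw [bump_comp_eq]
    unfold dd
    rw [fderiv_clm_apply h3 differentiableAt_fun_id]
    simp [add_comm]
  simp_rw [h2, mul_add] at h1
  have hD := dd_hi_comp_mem N w
  rw [integral_add ?_ (TestSym.integrable_mul hG.1 hD), integral_euler_mul hD hG] at h1
  · push_cast at h1
    have h5 : -((n : ℂ) + (1 - n)) = -1 := by ring
    rw [h5, neg_one_mul, neg_add_cancel] at h1
    exact neg_eq_zero.1 h1.symm
  · have : (fun ξ => fderiv ℝ (dd w (fun ξ => hi (N ξ))) ξ ξ) =
        ∑ i, fun ξ : E n => (ξ i : ℂ) * dd (e i) (dd w (fun ξ => hi (N ξ))) ξ := by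
      ext ξ; simp [euler_eq_sum]
    refine TestSym.integrable_mul hG.1 (f := fun ξ => fderiv ℝ (dd w (fun ξ => hi (N ξ))) ξ ξ) ?_
    rw [this]
    exact Submodule.sum_mem _ fun i _ => TestSym.mul_mem (contDiff_coord i).contDiffOn
      (TestSym.dd_mem hD _)

/-- Invariance of the residue under linear changes of variables. -/
theorem integral_mul_bump_comp {F : E n → ℂ} (hF : Homog (-n) F) (N : E n ≃L[ℝ] E n) :
    ∫ ξ, F ξ * bump (N ξ) = ∫ ξ, F ξ * bump ξ := by
  set D : E n → ℂ := fun ξ => hi (N ξ) - hi ξ with hDdef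
  have hN : ContDiff ℝ ∞ (fun ξ : E n => hi (N ξ)) := contDiff_hi.comp N.contDiff
  have hD : D ∈ TestSym n := by
    refine ⟨hN.sub contDiff_hi, ?_, ?_⟩
    · have h1 : HasCompactSupport (fun ξ : E n => hi (N ξ) - 1) :=
        hasCompactSupport_hi_sub_one.comp_homeomorph N.toHomeomorph
      have h2 : D = (fun ξ : E n => hi (N ξ) - 1) - fun ξ : E n => hi ξ - 1 := by
        ext ξ; simp [hDdef]
      rw [h2]
      exact h1.sub hasCompactSupport_hi_sub_one
    · have ht : Tendsto N (𝓝 0) (𝓝 0) := by simpa using N.continuous.tendsto 0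
      filter_upwards [ht.eventually (hi_eventuallyEq_zero (n := n)), hi_eventuallyEq_zero]
        with ξ h1 h2
      simp [hDdef, h1, h2]
  have h := integral_euler_mul hD hF
  have h1 : ∀ ξ, F ξ * fderiv ℝ D ξ ξ = F ξ * bump (N ξ) - F ξ * bump ξ := by
    intro ξ
    rw [bump_comp_eq, bump, hDdef, fderiv_fun_sub (hN.differentiable (by simp) ξ)
      (contDiff_hi.differentiable (by simp) ξ)]
    simp [mul_sub]
  simp_rw [h1] at h
  rw [integral_sub (TestSym.integrable_mul hF.1 (TestSym.comp_mem bump_mem N))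
    (TestSym.integrable_mul hF.1 bump_mem)] at h
  push_cast at h
  rw [add_neg_cancel, neg_zero, zero_mul] at h
  exact sub_eq_zero.1 h

end RiemPsiDO

end

noncomputable section
namespace RiemPsiDO
open Set Filter Topology

variable {n : ℕ}

/-! ### Oscillating exponentials -/

/-- The exponential `e^{i z·ζ}`. -/
def ee (z ζ : E n) : ℂ := Complex.exp (Complex.I * (inner ℝ z ζ : ℝ))

/-- The constant `(2π)^{-n}`. -/
def cn (n : ℕ) : ℂ := ((2 * Real.pi : ℝ) : ℂ)⁻¹ ^ n

theorem norm_ee (z ζ : E n) : ‖ee z ζ‖ = 1 := by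
  rw [ee, mul_comm, Complex.norm_exp_ofReal_mul_I]

theorem cn_ne_zero (n : ℕ) : cn n ≠ 0 :=
  pow_ne_zero _ (inv_ne_zero (by exact_mod_cast Real.two_pi_pos.ne'))

theorem contDiff_ee : ContDiff ℝ ∞ (fun z : E n × E n => ee z.1 z.2) := by
  have h : ContDiff ℝ ∞ (fun z : E n × E n => (inner ℝ z.1 z.2 : ℝ)) := contDiff_inner
  exact Complex.contDiff_exp.comp (contDiff_const.mul (Complex.ofRealCLM.contDiff.comp h))

theorem continuous_ee : Continuous (fun z : E n × E n => ee z.1 z.2) := contDiff_ee.continuous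

theorem contDiff_ee_right (z : E n) : ContDiff ℝ ∞ (ee z) :=
  contDiff_ee.comp (contDiff_prodMk_right z)

theorem ee_add_left (z z' ζ : E n) : ee (z + z') ζ = ee z ζ * ee z' ζ := by
  simp only [ee, inner_add_left]
  rw [← Complex.exp_add]; push_cast; ring_nf

theorem ee_add_right (z ζ ζ' : E n) : ee z (ζ + ζ') = ee z ζ * ee z ζ' := by
  simp only [ee, inner_add_right]
  rw [← Complex.exp_add]; push_cast; ring_nf

theorem ee_zero_left (ζ : E n) : ee 0 ζ = 1 := by simp [ee]

theorem ee_smul_left (s : ℝ) (z ζ : E n) : ee (s • z) ζ = ee z (s • ζ) := by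
  simp [ee, inner_smul_left, inner_smul_right]

theorem inner_e_right (z : E n) (i : Fin n) : (inner ℝ z (e i) : ℝ) = z i := by
  simp [e, EuclideanSpace.inner_single_right]

theorem dd_ee (z : E n) (i : Fin n) (ζ : E n) :
    dd (e i) (ee z) ζ = Complex.I * (z i : ℂ) * ee z ζ := by
  have h : HasFDerivAt (ee z) (ee z ζ • (Complex.I • Complex.ofRealCLM.comp (innerSL ℝ z))) ζ := by
    have h1 : HasFDerivAt (fun ζ : E n => Complex.I * ((inner ℝ z ζ : ℝ) : ℂ))
        (Complex.I • Complex.ofRealCLM.comp (innerSL ℝ z)) ζ :=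
      (Complex.ofRealCLM.comp (innerSL ℝ z)).hasFDerivAt.const_mul Complex.I
    exact h1.cexp
  rw [dd, h.fderiv]
  simp [inner_e_right, mul_comm]

theorem iteratedDeriv_exp_I (k : ℕ) :
    iteratedDeriv k (fun t : ℝ => Complex.exp (Complex.I * t)) =
      fun t : ℝ => Complex.I ^ k * Complex.exp (Complex.I * t) := by
  induction k with
  | zero => simp
  | succ k ih =>
    rw [iteratedDeriv_succ, ih]
    ext t
    have h1 : HasDerivAt (fun t : ℝ => Complex.exp (Complex.I * t))
        (Complex.exp (Complex.I * t) * (Complex.I * 1)) t :=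
      ((Complex.ofRealCLM.hasDerivAt (x := t)).const_mul Complex.I).cexp
    rw [(h1.const_mul (Complex.I ^ k)).deriv]
    ring

theorem norm_iteratedFDeriv_exp_le {W : Type*} [NormedAddCommGroup W] [NormedSpace ℝ W]
    (L : W →L[ℝ] ℝ) (k : ℕ) (x : W) :
    ‖iteratedFDeriv ℝ k (fun x => Complex.exp (Complex.I * (L x : ℝ))) x‖ ≤ ‖L‖ ^ k := by
  have hs : ContDiff ℝ ∞ (fun t : ℝ => Complex.exp (Complex.I * t)) :=
    Complex.contDiff_exp.comp (contDiff_const.mul Complex.ofRealCLM.contDiff)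
  have h := ContinuousLinearMap.iteratedFDeriv_comp_right L hs x (i := k)
    (by exact_mod_cast le_top)
  have h' : iteratedFDeriv ℝ k (fun x => Complex.exp (Complex.I * (L x : ℝ))) x =
      (iteratedFDeriv ℝ k (fun t : ℝ => Complex.exp (Complex.I * t)) (L x)).compContinuousLinearMap
        fun _ => L := h
  rw [h']
  refine (ContinuousMultilinearMap.norm_compContinuousLinearMap_le _ _).trans ?_
  rw [norm_iteratedFDeriv_eq_norm_iteratedDeriv, iteratedDeriv_exp_I]
  have : ‖Complex.exp (Complex.I * (L x : ℝ))‖ = 1 := by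
    rw [mul_comm, Complex.norm_exp_ofReal_mul_I]
  simp [this]

theorem norm_iteratedFDeriv_ee_le (s : ℝ) (y₀ ζ : E n) (k : ℕ) (x : E n) :
    ‖iteratedFDeriv ℝ k (fun x => ee (s • (x - y₀)) ζ) x‖ ≤ (|s| * ‖ζ‖) ^ k := by
  have h : (fun x => ee (s • (x - y₀)) ζ) = fun x => (fun x =>
      Complex.exp (Complex.I * ((s • innerSL ℝ ζ : E n →L[ℝ] ℝ) x : ℝ))) (x - y₀) := by
    ext x
    simp [ee, inner_smul_left, real_inner_comm]
  have h2 := iteratedFDeriv_comp_sub (𝕜 := ℝ) (f := fun x : E n =>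
    Complex.exp (Complex.I * ((s • innerSL ℝ ζ : E n →L[ℝ] ℝ) x : ℝ))) k y₀ x
  rw [h, h2]
  refine (norm_iteratedFDeriv_exp_le _ k _).trans ?_
  gcongr
  rw [norm_smul, innerSL_apply_norm, Real.norm_eq_abs]

theorem norm_iteratedFDeriv_ee_mul_le {U : Set (E n)} (hU : IsOpen U) {g : E n → ℂ}
    (hg : ContDiffOn ℝ ∞ g U) (s : ℝ) (y₀ ζ : E n) {x : E n} (hx : x ∈ U) {k : ℕ} {C : ℝ}
    (hC : ∀ i ≤ k, ‖iteratedFDeriv ℝ i g x‖ ≤ C) :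
    ‖iteratedFDeriv ℝ k (fun x => ee (s • (x - y₀)) ζ * g x) x‖ ≤
      (2 * (1 + |s| * ‖ζ‖)) ^ k * C := by
  have hs : ContDiffOn ℝ ∞ (fun x => ee (s • (x - y₀)) ζ) U :=
    (contDiff_ee.comp ((by fun_prop : ContDiff ℝ ∞ fun x : E n => (s • (x - y₀), ζ)))).contDiffOn
  refine (norm_iteratedFDeriv_mul_le_of_isOpen hU hs hg hx k).trans ?_
  have hC0 : 0 ≤ C := (norm_nonneg _).trans (hC 0 (Nat.zero_le _))
  calc _ ≤ ∑ i ∈ Finset.range (k + 1), (k.choose i : ℝ) * ((1 + |s| * ‖ζ‖) ^ k * C) := by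
        refine Finset.sum_le_sum fun i hi => ?_
        have hik : i ≤ k := Nat.lt_succ_iff.1 (Finset.mem_range.1 hi)
        rw [mul_assoc]
        refine mul_le_mul_of_nonneg_left ?_ (Nat.cast_nonneg _)
        refine mul_le_mul ?_ (hC _ (Nat.sub_le _ _)) (norm_nonneg _) (by positivity)
        refine (norm_iteratedFDeriv_ee_le s y₀ ζ i x).trans ?_
        calc (|s| * ‖ζ‖) ^ i ≤ (1 + |s| * ‖ζ‖) ^ i := by gcongr; linarith
          _ ≤ (1 + |s| * ‖ζ‖) ^ k :=
            pow_le_pow_right₀ (le_add_of_nonneg_right (by positivity)) hik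
    _ = _ := by
        rw [← Finset.sum_mul, ← Nat.cast_sum, Nat.sum_range_choose, mul_pow]
        push_cast; ring

/-! ### Integrals of compactly supported functions depending on parameters -/

section CompactIntegral

variable {Y : Type*} [NormedAddCommGroup Y] [NormedSpace ℝ Y] [FiniteDimensional ℝ Y]

theorem contDiffOn_integral_of_support {U : Set Y} (hU : IsOpen U) {B : Set (E n)}
    (hB : IsCompact B) {c : Y × E n → ℂ} {Ω : Set (Y × E n)} (hΩ : IsOpen Ω)
    (hΩB : ∀ x ∈ U, ∀ ζ ∈ B, (x, ζ) ∈ Ω) (hc : ContDiffOn ℝ ∞ c Ω)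
    (hs : ∀ x ∈ U, ∀ ζ ∉ B, c (x, ζ) = 0) :
    ContDiffOn ℝ ∞ (fun x => ∫ ζ, c (x, ζ)) U ∧
      ∀ x ∈ U, ∀ v, fderiv ℝ (fun x => ∫ ζ, c (x, ζ)) x v =
        ∫ ζ, fderiv ℝ (fun x => c (x, ζ)) x v := by
  have : ProperSpace Y := FiniteDimensional.proper ℝ Y
  have : LocallyCompactSpace Y := inferInstance
  have h := contDiffOn_integral_of_isCompact (μ := (volume : Measure (E n))) hU hB hΩ hΩB hc
  have e1 : ∀ x ∈ U, ∫ ζ in B, c (x, ζ) = ∫ ζ, c (x, ζ) := fun x hx =>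
    setIntegral_eq_integral_of_forall_compl_eq_zero (hs x hx)
  refine ⟨h.1.congr fun x hx => (e1 x hx).symm, fun x hx v => ?_⟩
  have e2 : (fun x => ∫ ζ in B, c (x, ζ)) =ᶠ[𝓝 x] fun x => ∫ ζ, c (x, ζ) :=
    Filter.mem_of_superset (hU.mem_nhds hx) e1
  rw [← e2.fderiv_eq, h.2 x hx v]
  refine setIntegral_eq_integral_of_forall_compl_eq_zero fun ζ hζ => ?_
  have : (fun x => c (x, ζ)) =ᶠ[𝓝 x] fun _ => 0 :=
    Filter.mem_of_superset (hU.mem_nhds hx) fun x hx => hs x hx ζ hζ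
  simp [this.fderiv_eq]

end CompactIntegral

theorem dd_slice_left {Y : Type*} [NormedAddCommGroup Y] [NormedSpace ℝ Y] {b : Y × E n → ℂ}
    {z : Y × E n} (h : DifferentiableAt ℝ b z) (v : Y) :
    fderiv ℝ (fun x => b (x, z.2)) z.1 v = dd (v, 0) b z := by
  have h1 : HasFDerivAt (fun x : Y => (x, z.2)) (ContinuousLinearMap.inl ℝ Y (E n)) z.1 :=
    hasFDerivAt_prodMk_left z.1 z.2
  have h2 : HasFDerivAt (fun x => b (x, z.2)) ((fderiv ℝ b z).comp
      (ContinuousLinearMap.inl ℝ Y (E n))) z.1 :=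
    HasFDerivAt.comp (g := b) z.1 h.hasFDerivAt h1
  rw [h2.fderiv]; rfl

theorem dd_slice_right {Y : Type*} [NormedAddCommGroup Y] [NormedSpace ℝ Y] {b : Y × E n → ℂ}
    {z : Y × E n} (h : DifferentiableAt ℝ b z) (v : E n) :
    dd v (fun ζ => b (z.1, ζ)) z.2 = dd (0, v) b z := by
  have h1 : HasFDerivAt (fun ζ : E n => (z.1, ζ)) (ContinuousLinearMap.inr ℝ Y (E n)) z.2 :=
    hasFDerivAt_prodMk_right z.1 z.2
  have h2 : HasFDerivAt (fun ζ => b (z.1, ζ)) ((fderiv ℝ b z).comp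
      (ContinuousLinearMap.inr ℝ Y (E n))) z.2 :=
    HasFDerivAt.comp (g := b) z.2 h.hasFDerivAt h1
  rw [dd, h2.fderiv]; rfl

/-! ### Amplitudes -/

/-- Smooth amplitudes `b(x,ζ)`, `x ∈ U`, which vanish for `ζ` outside of a compact subset of
`ℝⁿ ∖ 0`. -/
structure IsAmp (U : Set (E n)) (b : E n × E n → ℂ) : Prop where
  smooth : ContDiffOn ℝ ∞ b (U ×ˢ univ)
  supp : ∃ B : Set (E n), IsCompact B ∧ 0 ∉ B ∧ ∀ x ∈ U, ∀ ζ ∉ B, b (x, ζ) = 0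

theorem IsAmp.mono {U U' : Set (E n)} (h : U' ⊆ U) {b : E n × E n → ℂ} (hb : IsAmp U b) :
    IsAmp U' b :=
  ⟨hb.smooth.mono (prod_mono_left h), by
    obtain ⟨B, hB, h0, hs⟩ := hb.supp
    exact ⟨B, hB, h0, fun x hx => hs x (h hx)⟩⟩

theorem IsAmp.slice_mem {U : Set (E n)} {b : E n × E n → ℂ} (hb : IsAmp U b) {x : E n}
    (hx : x ∈ U) : (fun ζ => b (x, ζ)) ∈ TestSym n := by
  obtain ⟨B, hB, h0, hs⟩ := hb.supp
  refine ⟨?_, HasCompactSupport.intro hB (hs x hx), ?_⟩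
  · rw [← contDiffOn_univ]
    exact hb.smooth.comp (by fun_prop) fun ζ _ => ⟨hx, mem_univ _⟩
  · filter_upwards [hB.isClosed.isOpen_compl.mem_nhds h0] with ζ hζ using hs x hx ζ hζ

theorem IsAmp.dd {U : Set (E n)} (hU : IsOpen U) {b : E n × E n → ℂ} (hb : IsAmp U b)
    (v : E n × E n) : IsAmp U (dd v b) := by
  obtain ⟨B, hB, h0, hs⟩ := hb.supp
  refine ⟨contDiffOn_dd (hU.prod isOpen_univ) hb.smooth v, B, hB, h0, fun x hx ζ hζ => ?_⟩
  exact dd_eq_zero (hU.prod hB.isClosed.isOpen_compl) (fun z hz => hs z.1 hz.1 z.2 hz.2) v (x, ζ)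
    ⟨hx, hζ⟩

theorem IsAmp.add {U : Set (E n)} {b c : E n × E n → ℂ} (hb : IsAmp U b) (hc : IsAmp U c) :
    IsAmp U (fun z => b z + c z) := by
  obtain ⟨B, hB, h0, hs⟩ := hb.supp
  obtain ⟨B', hB', h0', hs'⟩ := hc.supp
  refine ⟨hb.smooth.add hc.smooth, B ∪ B', hB.union hB', fun h => h.elim h0 h0',
    fun x hx ζ hζ => ?_⟩
  simp only [mem_union, not_or] at hζ
  simp [hs x hx ζ hζ.1, hs' x hx ζ hζ.2]

theorem IsAmp.const_mul {U : Set (E n)} {b : E n × E n → ℂ} (hb : IsAmp U b) (c : ℂ) :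
    IsAmp U (fun z => c * b z) := by
  obtain ⟨B, hB, h0, hs⟩ := hb.supp
  exact ⟨contDiffOn_const.mul hb.smooth, B, hB, h0, fun x hx ζ hζ => by simp [hs x hx ζ hζ]⟩

theorem IsAmp.zero (U : Set (E n)) : IsAmp U (fun _ => 0) :=
  ⟨contDiffOn_const, ∅, isCompact_empty, by simp, fun _ _ _ _ => rfl⟩

theorem IsAmp.sum {ι : Type*} {U : Set (E n)} (s : Finset ι) {b : ι → E n × E n → ℂ}
    (hb : ∀ i ∈ s, IsAmp U (b i)) : IsAmp U (fun z => ∑ i ∈ s, b i z) := by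
  classical
  induction s using Finset.induction_on with
  | empty => simpa using IsAmp.zero U
  | insert i s hi ih =>
    simp_rw [Finset.sum_insert hi]
    exact (hb i (by simp)).add (ih fun j hj => hb j (by simp [hj]))

/-- The product of a symbol and a test symbol is an amplitude. -/
theorem IsAmp.mul_testSym {U : Set (E n)} (hU : IsOpen U) {q : E n → E n → ℂ}
    (hq : ContDiffOn ℝ ∞ (fun z : E n × E n => q z.1 z.2) (U ×ˢ {0}ᶜ)) {f : E n → ℂ}
    (hf : f ∈ TestSym n) : IsAmp U (fun z => q z.1 z.2 * f z.2) := by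
  refine ⟨?_, tsupport f, hf.2.1, fun h => TestSym.tsupport_subset hf h rfl, fun _ _ ζ hζ => by
    simp [image_eq_zero_of_notMem_tsupport hζ]⟩
  rintro ⟨x, ζ⟩ ⟨hx, -⟩
  refine ContDiffAt.contDiffWithinAt ?_
  by_cases hζ : ζ ∈ tsupport f
  · exact (hq.contDiffAt ((hU.prod isOpen_compl_singleton).mem_nhds
      ⟨hx, TestSym.tsupport_subset hf hζ⟩)).mul (hf.1.comp contDiff_snd).contDiffAt
  · have : (fun z : E n × E n => q z.1 z.2 * f z.2) =ᶠ[𝓝 (x, ζ)] fun _ => 0 := by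
      have h1 := (continuous_snd.tendsto (x, ζ)).eventually
        (notMem_tsupport_iff_eventuallyEq.1 hζ)
      filter_upwards [h1] with z hz
      simp [hz]
    exact contDiffAt_const.congr_of_eventuallyEq this

/-- The operator `i ∑ ∂²/∂xᵢ∂ζᵢ`. -/
def Lop (b : E n × E n → ℂ) : E n × E n → ℂ := fun z =>
  Complex.I * ∑ i, dd (0, e i) (dd (e i, 0) b) z

theorem IsAmp.Lop {U : Set (E n)} (hU : IsOpen U) {b : E n × E n → ℂ} (hb : IsAmp U b) :
    IsAmp U (Lop b) :=
  (IsAmp.sum Finset.univ fun i _ => (hb.dd hU (e i, 0)).dd hU (0, e i)).const_mul Complex.I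

theorem IsAmp.Lop_iterate {U : Set (E n)} (hU : IsOpen U) {b : E n × E n → ℂ} (hb : IsAmp U b)
    (r : ℕ) : IsAmp U (RiemPsiDO.Lop^[r] b) := by
  induction r with
  | zero => exact hb
  | succ r ih => rw [Function.iterate_succ_apply']; exact ih.Lop hU

/-- The coefficients of the expansion of an amplitude at `y₀`. -/
def ampCoeff {U : Set (E n)} (hU : IsOpen U) {y₀ : E n} (hy : y₀ ∈ U) {b : E n × E n → ℂ}
    (hb : IsAmp U b) (r : ℕ) : TestSym n :=
  ((r.factorial : ℂ)⁻¹) • ⟨fun ζ => (Lop^[r] b) (y₀, ζ), (hb.Lop_iterate hU r).slice_mem hy⟩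

/-- The oscillating integral with amplitude `b`. -/
def amp (y₀ : E n) (h : ℝ) (b : E n × E n → ℂ) (x : E n) : ℂ :=
  cn n * ∫ ζ, ee (h⁻¹ • (x - y₀)) ζ * b (x, ζ)

/-- The wave packet at `y₀` with profile `f`. -/
def packet (y₀ : E n) (h : ℝ) (f : E n → ℂ) (x : E n) : ℂ :=
  cn n * ∫ ζ, ee (h⁻¹ • (x - y₀)) ζ * f ζ

/-- The integral of the amplitude `b` along the segment from `y₀` to `x`. -/
def segInt (y₀ z x : E n) (b : E n × E n → ℂ) (t : ℝ) : ℂ :=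
  ∫ ζ, ee z ζ * b (y₀ + t • (x - y₀), ζ)

theorem mem_of_segment {U : Set (E n)} (hc : Convex ℝ U) {y₀ x : E n} (hy : y₀ ∈ U) (hx : x ∈ U)
    {t : ℝ} (ht : t ∈ Icc (0 : ℝ) 1) : y₀ + t • (x - y₀) ∈ U :=
  hc.add_smul_sub_mem hy hx ht

theorem hasDerivAt_segInt {U : Set (E n)} (hU : IsOpen U) (hcv : Convex ℝ U) {y₀ x : E n}
    (hy : y₀ ∈ U) (hx : x ∈ U) {b : E n × E n → ℂ} (hb : IsAmp U b) {h : ℝ} (hh : 0 < h) {t : ℝ}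
    (ht : t ∈ Icc (0 : ℝ) 1) :
    HasDerivAt (segInt y₀ (h⁻¹ • (x - y₀)) x b) (h * segInt y₀ (h⁻¹ • (x - y₀)) x (Lop b) t) t := by
  obtain ⟨B, hB, h0, hs⟩ := hb.supp
  set z := h⁻¹ • (x - y₀) with hz
  set I : Set ℝ := (fun t : ℝ => y₀ + t • (x - y₀)) ⁻¹' U with hI
  have hIo : IsOpen I := hU.preimage (by fun_prop)
  have htI : t ∈ I := mem_of_segment hcv hy hx ht
  have hU' : IsOpen (U ×ˢ (univ : Set (E n))) := hU.prod isOpen_univ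
  have hcs : ContDiffOn ℝ ∞ (fun w : ℝ × E n => ee z w.2 * b (y₀ + w.1 • (x - y₀), w.2))
      (I ×ˢ univ) := by
    refine ContDiffOn.mul ?_ ?_
    · exact (contDiff_ee.comp (contDiff_const.prodMk contDiff_snd)).contDiffOn
    · exact hb.smooth.comp (by fun_prop) fun w hw => ⟨hw.1, mem_univ _⟩
  have hmain := contDiffOn_integral_of_support (n := n) (Y := ℝ) hIo hB
    (hIo.prod isOpen_univ) (fun s hs ζ _ => ⟨hs, mem_univ ζ⟩) hcs
    (fun s hsI ζ hζ => by simp [hs _ hsI ζ hζ])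
  have hd : DifferentiableAt ℝ (segInt y₀ z x b) t :=
    (hmain.1.contDiffAt (hIo.mem_nhds htI)).differentiableAt (by simp)
  have hval : deriv (segInt y₀ z x b) t = h * segInt y₀ z x (Lop b) t := by
    rw [← fderiv_apply_one_eq_deriv]
    refine (hmain.2 t htI 1).trans ?_
    set p := y₀ + t • (x - y₀) with hp
    have hpU : p ∈ U := htI
    have e1 : ∀ ζ, fderiv ℝ (fun s : ℝ => ee z ζ * b (y₀ + s • (x - y₀), ζ)) t 1 =
        ∑ i, (-(h : ℂ) * Complex.I) * (dd (e i) (ee z) ζ * dd (e i, 0) b (p, ζ)) := by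
      intro ζ
      have hdb : DifferentiableAt ℝ b (p, ζ) :=
        differentiableAt_of_contDiffOn hU' hb.smooth ⟨hpU, mem_univ _⟩
      have hl : HasDerivAt (fun s : ℝ => (y₀ + s • (x - y₀), ζ)) (x - y₀, 0) t := by
        have : HasDerivAt (fun s : ℝ => y₀ + s • (x - y₀)) (x - y₀) t := by
          simpa using ((hasDerivAt_id t).smul_const (x - y₀)).const_add y₀
        exact this.prodMk (hasDerivAt_const t ζ)
      have h2 : HasDerivAt (fun s : ℝ => b (y₀ + s • (x - y₀), ζ))
          (fderiv ℝ b (p, ζ) (x - y₀, 0)) t :=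
        HasFDerivAt.comp_hasDerivAt (l := b) t hdb.hasFDerivAt hl
      rw [fderiv_apply_one_eq_deriv, (h2.const_mul (ee z ζ)).deriv]
      have h3 : (x - y₀, (0 : E n)) = ∑ i, (x - y₀) i • ((e i : E n), (0 : E n)) := by
        have := (EuclideanSpace.basisFun (Fin n) ℝ).sum_repr (x - y₀)
        simp only [EuclideanSpace.basisFun_repr, EuclideanSpace.basisFun_apply] at this
        refine Prod.ext ?_ ?_
        · rw [Prod.fst_sum]; simpa [e] using this.symm
        · rw [Prod.snd_sum]; simp
      rw [h3, map_sum, Finset.mul_sum]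
      refine Finset.sum_congr rfl fun i _ => ?_
      rw [map_smul, dd_ee]
      have h4 : (z i : ℂ) = (h : ℂ)⁻¹ * ((x - y₀) i : ℂ) := by
        rw [hz]; simp
      have hh' : (h : ℂ) ≠ 0 := by exact_mod_cast hh.ne'
      rw [h4]
      simp only [dd, Complex.real_smul]
      field_simp
      rw [Complex.I_sq]
      ring
    have hmem : ∀ i, (fun ζ => dd (e i, 0) b (p, ζ)) ∈ TestSym n := fun i =>
      (hb.dd hU (e i, 0)).slice_mem hpU
    have hee : ContDiffOn ℝ ∞ (ee z) ({0}ᶜ : Set (E n)) := (contDiff_ee_right z).contDiffOn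
    have h_int : ∀ i, Integrable (fun ζ => dd (e i) (ee z) ζ * dd (e i, 0) b (p, ζ)) := fun i =>
      TestSym.integrable_mul (contDiffOn_dd isOpen_compl_singleton hee _) (hmem i)
    simp_rw [e1]
    rw [integral_finsetSum _ fun i _ => (h_int i).const_mul _]
    have e2 : ∀ i, ∫ ζ, (-(h : ℂ) * Complex.I) * (dd (e i) (ee z) ζ * dd (e i, 0) b (p, ζ)) =
        h * ∫ ζ, ee z ζ * (Complex.I * dd (0, e i) (dd (e i, 0) b) (p, ζ)) := by
      intro i
      have h5 := TestSym.integral_mul_dd hee (hmem i) (e i)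
      rw [integral_const_mul, ← neg_eq_iff_eq_neg.2 h5]
      have h6 : ∀ ζ, ee z ζ * (Complex.I * dd (0, e i) (dd (e i, 0) b) (p, ζ)) =
          Complex.I * (ee z ζ * dd (e i) (fun ζ => dd (e i, 0) b (p, ζ)) ζ) := by
        intro ζ
        have := dd_slice_right (b := dd (e i, 0) b) (z := (p, ζ))
          (differentiableAt_of_contDiffOn hU' (hb.dd hU (e i, 0)).smooth ⟨hpU, mem_univ _⟩) (e i)
        rw [← this]
        ring
      simp_rw [h6]
      rw [integral_const_mul]
      ring
    simp_rw [e2]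
    rw [← Finset.mul_sum, ← integral_finsetSum]
    · congr 1
      refine integral_congr_ae (Eventually.of_forall fun ζ => ?_)
      simp only [Lop, Finset.mul_sum]
      rfl
    · intro i _
      refine TestSym.integrable_mul hee (f := fun ζ => Complex.I *
        dd (0, e i) (dd (e i, 0) b) (p, ζ)) ?_
      exact (((hb.dd hU (e i, 0)).dd hU (0, e i)).const_mul Complex.I).slice_mem hpU
  rw [← hval]
  exact hd.hasDerivAt

/-- The remainder amplitude of the expansion of order `N + 1`. -/
def remAmp (y₀ : E n) (N : ℕ) (b : E n × E n → ℂ) (z : E n × E n) : ℂ :=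
  ∫ t in Icc (0 : ℝ) 1, (((1 - t) ^ N / N.factorial : ℝ) : ℂ) *
    (Lop^[N + 1] b) (y₀ + t • (z.1 - y₀), z.2)

theorem isAmp_remAmp {U : Set (E n)} (hU : IsOpen U) (hcv : Convex ℝ U) {y₀ : E n} (hy : y₀ ∈ U)
    {b : E n × E n → ℂ} (hb : IsAmp U b) (N : ℕ) : IsAmp U (remAmp y₀ N b) := by
  have hL := hb.Lop_iterate hU (N + 1)
  obtain ⟨B, hB, h0, hs⟩ := hL.supp
  refine ⟨?_, B, hB, h0, fun x hx ζ hζ => ?_⟩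
  · set Ω : Set ((E n × E n) × ℝ) := (fun w => y₀ + w.2 • (w.1.1 - y₀)) ⁻¹' U
    have hΩ : IsOpen Ω := hU.preimage (by fun_prop)
    refine (contDiffOn_integral_of_isCompact (μ := (volume : Measure ℝ)) (hU.prod isOpen_univ)
      isCompact_Icc hΩ (fun z hz t ht => mem_of_segment hcv hy hz.1 ht) (G := fun w =>
        (((1 - w.2) ^ N / N.factorial : ℝ) : ℂ) *
          (Lop^[N + 1] b) (y₀ + w.2 • (w.1.1 - y₀), w.1.2)) ?_).1
    refine ContDiffOn.mul ?_ ?_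
    · refine ContDiff.contDiffOn ?_
      exact Complex.ofRealCLM.contDiff.comp
        (((contDiff_const.sub contDiff_snd).pow N).div_const _)
    · exact hL.smooth.comp (by fun_prop) fun w hw => ⟨hw, mem_univ _⟩
  · rw [remAmp]
    refine setIntegral_eq_zero_of_forall_eq_zero fun t ht => ?_
    rw [hs _ (mem_of_segment hcv hy hx ht) ζ hζ, mul_zero]

theorem continuousOn_segInt {U : Set (E n)} (hU : IsOpen U) (hcv : Convex ℝ U) {y₀ x : E n}
    (hy : y₀ ∈ U) (hx : x ∈ U) {b : E n × E n → ℂ} (hb : IsAmp U b) {h : ℝ} (hh : 0 < h) :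
    ContinuousOn (segInt y₀ (h⁻¹ • (x - y₀)) x b) (Icc 0 1) := fun _ ht =>
  (hasDerivAt_segInt hU hcv hy hx hb hh ht).continuousAt.continuousWithinAt

/-- Expansion of an oscillating integral at the base point. -/
theorem amp_eq_sum_add {U : Set (E n)} (hU : IsOpen U) (hcv : Convex ℝ U) {y₀ x : E n}
    (hy : y₀ ∈ U) (hx : x ∈ U) {b : E n × E n → ℂ} (hb : IsAmp U b) {h : ℝ} (hh : 0 < h) (N : ℕ) :
    amp y₀ h b x = ∑ r ∈ Finset.range (N + 1), (h : ℂ) ^ r * packet y₀ h (ampCoeff hU hy hb r) x +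
      (h : ℂ) ^ (N + 1) * amp y₀ h (remAmp y₀ N b) x := by
  set z := h⁻¹ • (x - y₀) with hz
  set F : ℕ → ℝ → ℂ := fun r => segInt y₀ z x (Lop^[r] b) with hF
  have hFd : ∀ r, ∀ t ∈ Icc (0 : ℝ) 1, HasDerivAt (F r) (h * F (r + 1) t) t := by
    intro r t ht
    have := hasDerivAt_segInt hU hcv hy hx (hb.Lop_iterate hU r) hh ht
    simp only [hF, Function.iterate_succ_apply']
    exact this
  set c : ℕ → ℝ → ℂ := fun r t => (((1 - t) ^ r / r.factorial : ℝ) : ℂ) with hc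
  set S : ℕ → ℝ → ℂ := fun N t => ∑ r ∈ Finset.range N, (h : ℂ) ^ r * (c r t * F r t) with hS
  have hcd : ∀ r t, HasDerivAt (c (r + 1)) (-c r t) t := by
    intro r t
    have h1 : HasDerivAt (fun t : ℝ => (1 - t) ^ (r + 1) / ((r + 1).factorial : ℝ))
        (-((1 - t) ^ r / r.factorial)) t := by
      have h2 : HasDerivAt (fun t : ℝ => 1 - t) (-1) t := by
        simpa using (hasDerivAt_id t).const_sub 1
      have h3 := (h2.pow (r + 1)).div_const ((r + 1).factorial : ℝ)
      refine h3.congr_deriv ?_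
      rw [Nat.factorial_succ]
      push_cast
      have : ((r : ℝ) + 1) ≠ 0 := by positivity
      have h4 : (r.factorial : ℝ) ≠ 0 := by positivity
      field_simp
    have := h1.ofReal_comp
    simpa [hc] using this
  have hSd : ∀ N, ∀ t ∈ Icc (0 : ℝ) 1,
      HasDerivAt (S (N + 1)) ((h : ℂ) ^ (N + 1) * (c N t * F (N + 1) t)) t := by
    intro N t ht
    induction N with
    | zero =>
      have e1 : S (0 + 1) = F 0 := by
        ext t; simp [hS, hc]
      rw [e1]
      refine (hFd 0 t ht).congr_deriv ?_
      simp [hc]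
    | succ N ih =>
      have e1 : S (N + 1 + 1) = fun t => S (N + 1) t + (h : ℂ) ^ (N + 1) *
          (c (N + 1) t * F (N + 1) t) := by
        ext t; simp only [hS]; rw [Finset.sum_range_succ]
      rw [e1]
      refine (ih.add (((hcd N t).mul (hFd (N + 1) t ht)).const_mul ((h : ℂ) ^ (N + 1)))).congr_deriv
        ?_
      ring
  have hcont : ContinuousOn (fun t => (h : ℂ) ^ (N + 1) * (c N t * F (N + 1) t)) (Icc 0 1) := by
    refine continuousOn_const.mul (ContinuousOn.mul ?_ ?_)
    · exact (Complex.continuous_ofReal.comp (by fun_prop)).continuousOn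
    · exact continuousOn_segInt hU hcv hy hx (hb.Lop_iterate hU (N + 1)) hh
  have hFTC : ∫ t in (0 : ℝ)..1, (h : ℂ) ^ (N + 1) * (c N t * F (N + 1) t) =
      S (N + 1) 1 - S (N + 1) 0 := by
    refine intervalIntegral.integral_eq_sub_of_hasDerivAt (fun t ht => ?_) ?_
    · rw [uIcc_of_le zero_le_one] at ht
      exact hSd N t ht
    · refine ContinuousOn.intervalIntegrable ?_
      rwa [uIcc_of_le zero_le_one]
  have hS1 : S (N + 1) 1 = F 0 1 := by
    simp only [hS]
    rw [Finset.sum_range_succ', Finset.sum_eq_zero]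
    · simp [hc]
    · intro r _; simp [hc]
  have hamp : amp y₀ h b x = cn n * F 0 1 := by
    simp [amp, hF, segInt, hz]
  have hpk : ∀ r, packet y₀ h (ampCoeff hU hy hb r) x = cn n * (c r 0 * F r 0) := by
    intro r
    simp only [packet, hF, segInt, hc, ampCoeff, ← hz]
    congr 1
    rw [← integral_const_mul]
    refine integral_congr_ae (Eventually.of_forall fun ζ => ?_)
    simp
    ring
  have hrem : amp y₀ h (remAmp y₀ N b) x = cn n * ∫ t in (0 : ℝ)..1, c N t * F (N + 1) t := by
    have hL := hb.Lop_iterate hU (N + 1)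
    obtain ⟨B, hB, h0, hs⟩ := hL.supp
    rw [amp, ← hz]
    congr 1
    rw [intervalIntegral.integral_of_le zero_le_one, ← integral_Icc_eq_integral_Ioc]
    simp only [remAmp, hF, segInt, ← integral_const_mul]
    have hBz : ∀ ζ ∉ B, ∀ t ∈ Icc (0 : ℝ) 1, (Lop^[N + 1] b) (y₀ + t • (x - y₀), ζ) = 0 :=
      fun ζ hζ t ht => hs _ (mem_of_segment hcv hy hx ht) ζ hζ
    have e1 : ∫ ζ, ∫ t in Icc (0 : ℝ) 1, ee z ζ * ((((1 - t) ^ N / N.factorial : ℝ) : ℂ) *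
        (Lop^[N + 1] b) (y₀ + t • (x - y₀), ζ)) =
        ∫ ζ in B, ∫ t in Icc (0 : ℝ) 1, ee z ζ * ((((1 - t) ^ N / N.factorial : ℝ) : ℂ) *
        (Lop^[N + 1] b) (y₀ + t • (x - y₀), ζ)) := by
      refine (setIntegral_eq_integral_of_forall_compl_eq_zero fun ζ hζ => ?_).symm
      refine setIntegral_eq_zero_of_forall_eq_zero fun t ht => ?_
      rw [hBz ζ hζ t ht]; simp
    have e2 : ∫ t in Icc (0 : ℝ) 1, ∫ ζ, c N t * (ee z ζ *
        (Lop^[N + 1] b) (y₀ + t • (x - y₀), ζ)) =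
        ∫ t in Icc (0 : ℝ) 1, ∫ ζ in B, c N t * (ee z ζ *
        (Lop^[N + 1] b) (y₀ + t • (x - y₀), ζ)) := by
      refine setIntegral_congr_fun measurableSet_Icc fun t ht => ?_
      refine (setIntegral_eq_integral_of_forall_compl_eq_zero fun ζ hζ => ?_).symm
      rw [hBz ζ hζ t ht]; simp
    rw [e1, e2, integral_integral_swap]
    · refine setIntegral_congr_fun measurableSet_Icc fun t ht => ?_
      refine setIntegral_congr_fun hB.measurableSet fun ζ hζ => ?_
      simp only [hc]
      ring
    · rw [Measure.prod_restrict]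
      refine ContinuousOn.integrableOn_compact (hB.prod isCompact_Icc) ?_
      refine ContinuousOn.mul ?_ (ContinuousOn.mul ?_ ?_)
      · exact (continuous_ee.comp (continuous_const.prodMk continuous_fst)).continuousOn
      · exact (Complex.continuous_ofReal.comp (by fun_prop)).continuousOn
      · exact hL.smooth.continuousOn.comp (f := fun w : E n × ℝ => (y₀ + w.2 • (x - y₀), w.1))
          (by fun_prop) fun w hw => ⟨mem_of_segment hcv hy hx hw.2, mem_univ _⟩
  rw [hamp, ← hS1, eq_add_of_sub_eq' hFTC.symm, hrem]
  simp only [hS, hpk]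
  rw [intervalIntegral.integral_const_mul, mul_add, Finset.mul_sum]
  congr 1
  · exact Finset.sum_congr rfl fun r _ => by ring
  · ring

end RiemPsiDO

end

noncomputable section
namespace RiemPsiDO
open Set Filter Topology

variable {n : ℕ}

/-! ### Packets as rescaled Schwartz functions -/

/-- Test symbols are Schwartz functions. -/
def TestSym.toSchwartz (f : TestSym n) : SchwartzMap (E n) ℂ :=
  f.2.2.1.toSchwartzMap f.2.1

open scoped FourierTransform in
theorem packet_eq_fourierInv (y₀ : E n) (h : ℝ) (f : TestSym n) (x : E n) :
    packet y₀ h f x = cn n *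
      (𝓕⁻ (TestSym.toSchwartz f)) ((((2 * Real.pi)⁻¹ * h⁻¹) • ContinuousLinearMap.id ℝ (E n))
        (x - y₀)) := by
  rw [SchwartzMap.fourierInv_coe, Real.fourierInv_eq', packet]
  congr 1
  refine integral_congr_ae (Eventually.of_forall fun ζ => ?_)
  have : (2 * Real.pi * (inner ℝ ζ ((((2 * Real.pi)⁻¹ * h⁻¹) • ContinuousLinearMap.id ℝ (E n))
        (x - y₀)) : ℝ)) = inner ℝ (h⁻¹ • (x - y₀)) ζ := by
    have h2 : 2 * Real.pi ≠ 0 := Real.two_pi_pos.ne'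
    simp only [_root_.smul_apply, ContinuousLinearMap.id_apply, inner_smul_right,
      real_inner_comm ζ]
    rw [← mul_assoc, ← mul_assoc, mul_inv_cancel₀ h2, one_mul]
  simp only [this, smul_eq_mul, ee, mul_comm Complex.I]
  rfl

theorem contDiff_packet (y₀ : E n) (h : ℝ) (f : TestSym n) : ContDiff ℝ ∞ (packet y₀ h f) := by
  have : packet y₀ h f = fun x => packet y₀ h f x := rfl
  rw [this]
  simp_rw [packet_eq_fourierInv]
  exact contDiff_const.mul ((SchwartzMap.smooth _ _).comp
    ((ContinuousLinearMap.contDiff _).comp (contDiff_id.sub contDiff_const)))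

open scoped FourierTransform in
/-- The derivatives of a packet are concentrated at its base point. -/
theorem packet_decay (y₀ : E n) (f : TestSym n) (j K : ℕ) : ∃ C : ℝ, 0 ≤ C ∧ ∀ h : ℝ, 0 < h →
    ∀ x, ‖x - y₀‖ ^ K * ‖iteratedFDeriv ℝ j (packet y₀ h f) x‖ ≤ C * h ^ ((K : ℤ) - j) := by
  set F : SchwartzMap (E n) ℂ := 𝓕⁻ (TestSym.toSchwartz f)
  obtain ⟨C, hC, hF⟩ := F.decay K j
  refine ⟨‖cn n‖ * (C * (2 * Real.pi) ^ K * ((2 * Real.pi)⁻¹) ^ j), by positivity,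
    fun h hh x => ?_⟩
  set c : ℝ := (2 * Real.pi)⁻¹ * h⁻¹ with hc
  have hc0 : 0 < c := by positivity
  set L : E n →L[ℝ] E n := c • ContinuousLinearMap.id ℝ (E n) with hL
  have hLn : ‖L‖ ≤ c := by
    rw [hL, norm_smul, Real.norm_of_nonneg hc0.le]
    exact mul_le_of_le_one_right hc0.le ContinuousLinearMap.norm_id_le
  have h1 : packet y₀ h f = fun x => (fun x => (cn n • (F : E n → ℂ)) (L x)) (x - y₀) := by
    ext x; exact packet_eq_fourierInv y₀ h f x
  have h2 : iteratedFDeriv ℝ j (packet y₀ h f) x =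
      iteratedFDeriv ℝ j (fun x => (cn n • (F : E n → ℂ)) (L x)) (x - y₀) := by
    rw [h1]
    exact iteratedFDeriv_comp_sub (f := fun x => (cn n • (F : E n → ℂ)) (L x)) j y₀ x
  have hFs : ContDiff ℝ ∞ (F : E n → ℂ) := F.smooth _
  have hFs' : ContDiff ℝ ∞ (cn n • (F : E n → ℂ)) := contDiff_const.smul hFs
  have h3 := ContinuousLinearMap.iteratedFDeriv_comp_right L hFs' (x - y₀) (i := j)
    (by exact_mod_cast le_top)
  have h4 : iteratedFDeriv ℝ j (fun x => (cn n • (F : E n → ℂ)) (L x)) (x - y₀) =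
    (iteratedFDeriv ℝ j (cn n • (F : E n → ℂ)) (L (x - y₀))).compContinuousLinearMap
      fun _ => L := h3
  have h5 : ‖iteratedFDeriv ℝ j (packet y₀ h f) x‖ ≤
      ‖cn n‖ * ‖iteratedFDeriv ℝ j F (L (x - y₀))‖ * c ^ j := by
    rw [h2, h4]
    refine (ContinuousMultilinearMap.norm_compContinuousLinearMap_le _ _).trans ?_
    rw [iteratedFDeriv_const_smul_apply (hFs.contDiffAt.of_le (by exact_mod_cast le_top)),
      norm_smul]
    simp only [Finset.prod_const, Finset.card_univ, Fintype.card_fin]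
    gcongr
  have h6 : ‖x - y₀‖ = c⁻¹ * ‖L (x - y₀)‖ := by
    rw [hL, _root_.smul_apply, norm_smul, Real.norm_of_nonneg hc0.le,
      inv_mul_cancel_left₀ hc0.ne']
    rfl
  have h7 := hF (L (x - y₀))
  calc ‖x - y₀‖ ^ K * ‖iteratedFDeriv ℝ j (packet y₀ h f) x‖
      ≤ (c⁻¹ * ‖L (x - y₀)‖) ^ K * (‖cn n‖ * ‖iteratedFDeriv ℝ j F (L (x - y₀))‖ * c ^ j) := by
        rw [h6]; gcongr
    _ = ‖cn n‖ * ((‖L (x - y₀)‖ ^ K * ‖iteratedFDeriv ℝ j F (L (x - y₀))‖) * (c⁻¹ ^ K * c ^ j)) := by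
        rw [mul_pow]; ring
    _ ≤ ‖cn n‖ * (C * (c⁻¹ ^ K * c ^ j)) := by gcongr
    _ = _ := by
        have e1 : c⁻¹ ^ K * c ^ j = (2 * Real.pi) ^ K * ((2 * Real.pi)⁻¹) ^ j *
            h ^ ((K : ℤ) - j) := by
          rw [hc, zpow_sub₀ hh.ne', zpow_natCast, zpow_natCast, mul_inv, inv_inv, inv_inv,
            mul_pow (2 * Real.pi) h, mul_pow _ h⁻¹, inv_pow h]
          ring
        rw [e1]; ring

/-! ### Families of functions of order `N` in the small parameter -/

section Small
variable {F : Type*} [NormedAddCommGroup F] [NormedSpace ℝ F]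

/-- Families of functions, depending on `0 < h ≤ 1`, whose derivatives of order `k` on `V` are
`O(h^{N-k})`. -/
def Small (V : Set F) (N : ℤ) (w : ℝ → F → ℂ) : Prop :=
  (∀ h ∈ Ioc (0 : ℝ) 1, ContDiffOn ℝ ∞ (w h) V) ∧
  ∀ k : ℕ, ∃ C : ℝ, ∀ h ∈ Ioc (0 : ℝ) 1, ∀ x ∈ V,
    ‖iteratedFDeriv ℝ k (w h) x‖ ≤ C * h ^ (N - k)

theorem zpow_le_zpow_of_le_one {h : ℝ} (hh : h ∈ Ioc (0 : ℝ) 1) {a b : ℤ} (hab : a ≤ b) :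
    h ^ b ≤ h ^ a := zpow_le_zpow_right_of_le_one₀ hh.1 hh.2 hab

theorem Small.bound {V : Set F} {N : ℤ} {w : ℝ → F → ℂ} (hw : Small V N w) (k : ℕ) :
    ∃ C : ℝ, 0 ≤ C ∧ ∀ i ≤ k, ∀ h ∈ Ioc (0 : ℝ) 1, ∀ x ∈ V,
      ‖iteratedFDeriv ℝ i (w h) x‖ ≤ C * h ^ (N - i) := by
  choose C hC using hw.2
  refine ⟨∑ i ∈ Finset.range (k + 1), |C i|, Finset.sum_nonneg fun _ _ => abs_nonneg _,
    fun i hi h hh x hx => (hC i h hh x hx).trans ?_⟩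
  have : 0 ≤ h ^ (N - i) := (zpow_pos hh.1 _).le
  gcongr
  exact (le_abs_self _).trans (Finset.single_le_sum (f := fun i => |C i|)
    (fun _ _ => abs_nonneg _) (Finset.mem_range.2 (Nat.lt_succ_of_le hi)))

theorem Small.mono {V V' : Set F} {N N' : ℤ} {w : ℝ → F → ℂ} (hw : Small V N w)
    (hV : V' ⊆ V) (hN : N' ≤ N) : Small V' N' w := by
  refine ⟨fun h hh => (hw.1 h hh).mono hV, fun k => ?_⟩
  obtain ⟨C, hC, hb⟩ := hw.bound k
  refine ⟨C, fun h hh x hx => (hb k le_rfl h hh x (hV hx)).trans ?_⟩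
  exact mul_le_mul_of_nonneg_left (zpow_le_zpow_of_le_one hh (by omega)) hC

theorem Small.congr {V : Set F} (hV : IsOpen V) {N : ℤ} {w w' : ℝ → F → ℂ}
    (hw : Small V N w) (h : ∀ h ∈ Ioc (0 : ℝ) 1, ∀ x ∈ V, w' h x = w h x) : Small V N w' := by
  refine ⟨fun t ht => (hw.1 t ht).congr (h t ht), fun k => ?_⟩
  obtain ⟨C, hC⟩ := hw.2 k
  refine ⟨C, fun t ht x hx => ?_⟩
  have : w' t =ᶠ[𝓝 x] w t := Filter.mem_of_superset (hV.mem_nhds hx) (h t ht)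
  rw [(this.iteratedFDeriv ℝ k).eq_of_nhds]
  exact hC t ht x hx

theorem contDiffAt_nat_of_contDiffOn {V : Set F} (hV : IsOpen V) {f : F → ℂ}
    (hf : ContDiffOn ℝ ∞ f V) {x : F} (hx : x ∈ V) (k : ℕ) : ContDiffAt ℝ k f x :=
  (hf.contDiffAt (hV.mem_nhds hx)).of_le (by exact_mod_cast le_top)

theorem Small.add {V : Set F} (hV : IsOpen V) {N : ℤ} {w w' : ℝ → F → ℂ}
    (hw : Small V N w) (hw' : Small V N w') : Small V N (fun h x => w h x + w' h x) := by
  refine ⟨fun h hh => (hw.1 h hh).add (hw'.1 h hh), fun k => ?_⟩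
  obtain ⟨C, hC⟩ := hw.2 k
  obtain ⟨C', hC'⟩ := hw'.2 k
  refine ⟨C + C', fun h hh x hx => ?_⟩
  have := iteratedFDeriv_add_apply (contDiffAt_nat_of_contDiffOn hV (hw.1 h hh) hx k)
    (contDiffAt_nat_of_contDiffOn hV (hw'.1 h hh) hx k)
  have e1 : (fun x => w h x + w' h x) = w h + w' h := rfl
  beta_reduce
  rw [e1, this, add_mul]
  exact (norm_add_le _ _).trans (add_le_add (hC h hh x hx) (hC' h hh x hx))

theorem Small.const_mul {V : Set F} (hV : IsOpen V) {N a : ℤ} {w : ℝ → F → ℂ}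
    (hw : Small V N w) {c : ℝ → ℂ} {A : ℝ} (hc : ∀ h ∈ Ioc (0 : ℝ) 1, ‖c h‖ ≤ A * h ^ a) :
    Small V (N + a) (fun h x => c h * w h x) := by
  refine ⟨fun h hh => contDiffOn_const.mul (hw.1 h hh), fun k => ?_⟩
  obtain ⟨C, hC, hb⟩ := hw.bound k
  refine ⟨A * C, fun h hh x hx => ?_⟩
  have := iteratedFDeriv_const_smul_apply (a := c h)
    (contDiffAt_nat_of_contDiffOn hV (hw.1 h hh) hx k)
  have e1 : (fun x => c h * w h x) = c h • w h := rfl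
  beta_reduce
  rw [e1, this, norm_smul]
  have hA : 0 ≤ A * h ^ a := (norm_nonneg _).trans (hc h hh)
  refine (mul_le_mul (hc h hh) (hb k le_rfl h hh x hx) (norm_nonneg _) hA).trans (le_of_eq ?_)
  rw [show N + a - k = a + (N - k) by ring, zpow_add₀ hh.1.ne']
  ring

theorem Small.zpow_mul {V : Set F} (hV : IsOpen V) {N : ℤ} {w : ℝ → F → ℂ}
    (hw : Small V N w) (a : ℤ) : Small V (N + a) (fun h x => (h : ℂ) ^ a * w h x) :=
  hw.const_mul hV (A := 1) fun h hh => by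
    rw [norm_zpow, Complex.norm_real, Real.norm_of_nonneg hh.1.le, one_mul]

theorem Small.smul {V : Set F} (hV : IsOpen V) {N : ℤ} {w : ℝ → F → ℂ}
    (hw : Small V N w) (c : ℂ) : Small V N (fun h x => c * w h x) := by
  simpa using hw.const_mul hV (a := 0) (c := fun _ => c) (A := ‖c‖) fun h hh => by simp

theorem Small.sub {V : Set F} (hV : IsOpen V) {N : ℤ} {w w' : ℝ → F → ℂ}
    (hw : Small V N w) (hw' : Small V N w') : Small V N (fun h x => w h x - w' h x) := by
  simpa [sub_eq_add_neg] using hw.add hV (hw'.smul hV (-1))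

theorem Small.zero (V : Set F) (N : ℤ) : Small V N (fun _ _ => 0) :=
  ⟨fun _ _ => contDiffOn_const, fun k => ⟨0, fun h hh x hx => by simp⟩⟩

theorem Small.sum {ι : Type*} {V : Set F} (hV : IsOpen V) {N : ℤ} (s : Finset ι)
    {w : ι → ℝ → F → ℂ} (hw : ∀ i ∈ s, Small V N (w i)) :
    Small V N (fun h x => ∑ i ∈ s, w i h x) := by
  classical
  induction s using Finset.induction_on with
  | empty => simpa using Small.zero V N
  | insert i s hi ih =>
    simp_rw [Finset.sum_insert hi]
    exact (hw i (by simp)).add hV (ih fun j hj => hw j (by simp [hj]))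

theorem Small.mul {V : Set F} (hV : IsOpen V) {N N' : ℤ} {w w' : ℝ → F → ℂ}
    (hw : Small V N w) (hw' : Small V N' w') : Small V (N + N') (fun h x => w h x * w' h x) := by
  refine ⟨fun h hh => (hw.1 h hh).mul (hw'.1 h hh), fun k => ?_⟩
  obtain ⟨C, hC, hb⟩ := hw.bound k
  obtain ⟨C', hC', hb'⟩ := hw'.bound k
  refine ⟨∑ i ∈ Finset.range (k + 1), (k.choose i : ℝ) * (C * C'), fun h hh x hx => ?_⟩
  refine (norm_iteratedFDeriv_mul_le_of_isOpen hV (hw.1 h hh) (hw'.1 h hh) hx k).trans ?_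
  rw [Finset.sum_mul]
  refine Finset.sum_le_sum fun i hi => ?_
  have hik : i ≤ k := Nat.lt_succ_iff.1 (Finset.mem_range.1 hi)
  have h1 := hb i hik h hh x hx
  have h2 := hb' (k - i) (Nat.sub_le _ _) h hh x hx
  have h0 : 0 < h := hh.1
  calc _ ≤ (k.choose i : ℝ) * (C * h ^ (N - i)) * (C' * h ^ (N' - (k - i : ℕ))) := by gcongr
    _ = _ := by
      rw [Nat.cast_sub hik, show N + N' - (k : ℤ) = (N - i) + (N' - (k - i)) by ring,
        zpow_add₀ h0.ne']
      ring

/-- A fixed function with bounded derivatives. -/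
theorem Small.of_bound {V : Set F} {χ : F → ℂ} (hχ : ContDiffOn ℝ ∞ χ V)
    (hb : ∀ k : ℕ, ∃ C : ℝ, ∀ x ∈ V, ‖iteratedFDeriv ℝ k χ x‖ ≤ C) : Small V 0 (fun _ => χ) := by
  refine ⟨fun _ _ => hχ, fun k => ?_⟩
  obtain ⟨C, hC⟩ := hb k
  refine ⟨|C|, fun h hh x hx => (hC x hx).trans ((le_abs_self _).trans ?_)⟩
  refine le_mul_of_one_le_right (abs_nonneg _) ?_
  have := zpow_le_zpow_of_le_one hh (show (0 : ℤ) - k ≤ 0 by omega)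
  simpa using this

theorem bound_of_isCompact {F : Type*} [NormedAddCommGroup F] [NormedSpace ℝ F]
    {G : Type*} [NormedAddCommGroup G] [NormedSpace ℝ G] {U V K : Set F} (hU : IsOpen U)
    (hK : IsCompact K) (hVK : V ⊆ K) (hKU : K ⊆ U) {χ : F → G} (hχ : ContDiffOn ℝ ∞ χ U) (k : ℕ) :
    ∃ C : ℝ, ∀ x ∈ V, ‖iteratedFDeriv ℝ k χ x‖ ≤ C := by
  have h2 : ContinuousOn (iteratedFDeriv ℝ k χ) U := by
    have := hχ.continuousOn_iteratedFDerivWithin (m := k) (by exact_mod_cast le_top)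
      hU.uniqueDiffOn
    exact this.congr fun z hz => (iteratedFDerivWithin_of_isOpen k hU hz).symm
  obtain ⟨C, hC⟩ := hK.exists_bound_of_continuousOn (h2.mono hKU)
  exact ⟨C, fun x hx => hC x (hVK hx)⟩

theorem Small.of_isCompact {U V K : Set F} (hU : IsOpen U) (hK : IsCompact K) (hVK : V ⊆ K)
    (hKU : K ⊆ U) {χ : F → ℂ} (hχ : ContDiffOn ℝ ∞ χ U) : Small V 0 (fun _ => χ) :=
  Small.of_bound (hχ.mono (hVK.trans hKU)) (bound_of_isCompact hU hK hVK hKU hχ)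

end Small

theorem Small.packet (V : Set (E n)) (y₀ : E n) (f : TestSym n) :
    Small V 0 (fun h => packet y₀ h f) := by
  refine ⟨fun h _ => (contDiff_packet y₀ h f).contDiffOn, fun k => ?_⟩
  obtain ⟨C, -, hC⟩ := packet_decay y₀ f k 0
  exact ⟨C, fun h hh x _ => by simpa using hC h hh.1 x⟩

/-- Packets are negligible away from their base point. -/
theorem mul_packet_decay {V : Set (E n)} (hV : IsOpen V) {y₀ : E n} {θ : E n → ℂ}
    (hθ : ContDiffOn ℝ ∞ θ V) (hb : ∀ k : ℕ, ∃ C : ℝ, ∀ x ∈ V, ‖iteratedFDeriv ℝ k θ x‖ ≤ C)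
    (h0 : θ =ᶠ[𝓝 y₀] 0) (f : TestSym n) (k K N : ℕ) : ∃ C : ℝ, 0 ≤ C ∧ ∀ h ∈ Ioc (0 : ℝ) 1,
      ∀ x ∈ V, (1 + ‖x - y₀‖) ^ K *
        ‖iteratedFDeriv ℝ k (fun x => θ x * RiemPsiDO.packet y₀ h f x) x‖ ≤ C * h ^ N := by
  obtain ⟨r, hr, hball⟩ := Metric.eventually_nhds_iff_ball.1 h0
  choose D hD using hb
  choose C hC0 hC using fun j : ℕ => packet_decay y₀ f j (K + (N + k))
  have hC' : 0 ≤ ∑ i ∈ Finset.range (k + 1), (k.choose i : ℝ) * (|D i| *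
      ((1 + r⁻¹) ^ K * (r⁻¹) ^ (N + k) * C (k - i))) :=
    Finset.sum_nonneg fun i _ => mul_nonneg (Nat.cast_nonneg _)
      (mul_nonneg (abs_nonneg _) (mul_nonneg (by positivity) (hC0 _)))
  refine ⟨_, hC', fun h hh x hx => ?_⟩
  have hh0 := hh.1
  by_cases hxr : x ∈ Metric.ball y₀ r
  · have e1 : (fun x => θ x * RiemPsiDO.packet y₀ h f x) =ᶠ[𝓝 x] fun _ => 0 := by
      filter_upwards [Metric.isOpen_ball.mem_nhds hxr] with z hz
      simp [hball z hz]
    rw [(e1.iteratedFDeriv ℝ k).eq_of_nhds]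
    simp only [iteratedFDeriv_fun_zero, Pi.zero_apply, norm_zero, mul_zero]
    exact mul_nonneg hC' (by positivity)
  · refine (mul_le_mul_of_nonneg_left (norm_iteratedFDeriv_mul_le_of_isOpen hV hθ
      (contDiff_packet y₀ h f).contDiffOn hx k) (by positivity)).trans ?_
    rw [Finset.sum_mul, Finset.mul_sum]
    refine Finset.sum_le_sum fun i hi => ?_
    have hik : i ≤ k := Nat.lt_succ_iff.1 (Finset.mem_range.1 hi)
    have hxr' : r ≤ ‖x - y₀‖ := by simpa [dist_eq_norm] using hxr
    set d := ‖x - y₀‖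
    set P := ‖iteratedFDeriv ℝ (k - i) (RiemPsiDO.packet y₀ h f) x‖
    have h1 : d ^ (K + (N + k)) * P ≤ C (k - i) * h ^ N := by
      refine (hC (k - i) h hh0 x).trans (mul_le_mul_of_nonneg_left ?_ (hC0 _))
      rw [← zpow_natCast h N]
      exact zpow_le_zpow_of_le_one hh (by omega)
    have hd0 : 0 < d := hr.trans_le hxr'
    have h2 : 1 + d ≤ (1 + r⁻¹) * d := by
      have : 1 ≤ r⁻¹ * d := by rw [← div_eq_inv_mul]; exact (one_le_div hr).2 hxr'
      linarith
    have h3 : 1 ≤ r⁻¹ * d := by rw [← div_eq_inv_mul]; exact (one_le_div hr).2 hxr'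
    have h4 : (1 + d) ^ K * P ≤ (1 + r⁻¹) ^ K * (r⁻¹) ^ (N + k) * C (k - i) * h ^ N := by
      calc (1 + d) ^ K * P ≤ ((1 + r⁻¹) * d) ^ K * ((r⁻¹ * d) ^ (N + k) * P) := by
            gcongr
            exact le_mul_of_one_le_left (norm_nonneg _) (one_le_pow₀ h3)
        _ = (1 + r⁻¹) ^ K * (r⁻¹) ^ (N + k) * (d ^ (K + (N + k)) * P) := by
            rw [mul_pow, mul_pow, pow_add d]; ring
        _ ≤ (1 + r⁻¹) ^ K * (r⁻¹) ^ (N + k) * (C (k - i) * h ^ N) := by gcongr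
        _ = _ := by ring
    calc _ = (k.choose i : ℝ) * ‖iteratedFDeriv ℝ i θ x‖ * ((1 + d) ^ K * P) := by ring
      _ ≤ (k.choose i : ℝ) * |D i| *
          ((1 + r⁻¹) ^ K * (r⁻¹) ^ (N + k) * C (k - i) * h ^ N) := by
          have : ‖iteratedFDeriv ℝ i θ x‖ ≤ |D i| := (hD i x hx).trans (le_abs_self _)
          gcongr
      _ = _ := by ring

theorem Small.mul_packet {V : Set (E n)} (hV : IsOpen V) {y₀ : E n} {θ : E n → ℂ}
    (hθ : ContDiffOn ℝ ∞ θ V) (hb : ∀ k : ℕ, ∃ C : ℝ, ∀ x ∈ V, ‖iteratedFDeriv ℝ k θ x‖ ≤ C)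
    (h0 : θ =ᶠ[𝓝 y₀] 0) (f : TestSym n) (N : ℤ) :
    Small V N (fun h x => θ x * RiemPsiDO.packet y₀ h f x) := by
  refine ⟨fun h _ => hθ.mul (contDiff_packet y₀ h f).contDiffOn, fun k => ?_⟩
  obtain ⟨C, hC0, hC⟩ := mul_packet_decay hV hθ hb h0 f k 0 N.toNat
  refine ⟨C, fun h hh x hx => ?_⟩
  have := hC h hh x hx
  rw [pow_zero, one_mul] at this
  refine this.trans (mul_le_mul_of_nonneg_left ?_ hC0)
  rw [← zpow_natCast]
  exact zpow_le_zpow_of_le_one hh (by omega)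

/-- Oscillating integrals whose amplitudes are of order `N`. -/
theorem Small.amp {V : Set (E n)} (hV : IsOpen V) {B : Set (E n)} (hB : IsCompact B)
    {b : ℝ → E n × E n → ℂ} {N : ℤ} (hb : ∀ h ∈ Ioc (0 : ℝ) 1, ContDiffOn ℝ ∞ (b h) (V ×ˢ univ))
    (hs : ∀ h ∈ Ioc (0 : ℝ) 1, ∀ x ∈ V, ∀ ζ ∉ B, b h (x, ζ) = 0)
    (hbd : ∀ k : ℕ, ∃ C : ℝ, ∀ h ∈ Ioc (0 : ℝ) 1, ∀ x ∈ V, ∀ ζ ∈ B,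
      ‖iteratedFDeriv ℝ k (fun x => b h (x, ζ)) x‖ ≤ C * h ^ N) (y₀ : E n) :
    Small V N (fun h => amp y₀ h (b h)) := by
  obtain ⟨R₀, hR₀⟩ := hB.isBounded.exists_norm_le
  set R := max R₀ 0
  have hR0 : 0 ≤ R := le_max_right _ _
  have hR : ∀ ζ ∈ B, ‖ζ‖ ≤ R := fun ζ hζ => (hR₀ ζ hζ).trans (le_max_left _ _)
  choose C hC using hbd
  set D : ℕ → ℝ := fun k => ∑ i ∈ Finset.range (k + 1), |C i|
  have hDnn : ∀ k, 0 ≤ D k := fun k => Finset.sum_nonneg fun _ _ => abs_nonneg _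
  have key : ∀ h ∈ Ioc (0 : ℝ) 1, ContDiffOn ℝ ∞ (RiemPsiDO.amp y₀ h (b h)) V ∧
      ∀ k : ℕ, ∀ x ∈ V, ‖iteratedFDeriv ℝ k (RiemPsiDO.amp y₀ h (b h)) x‖ ≤
        ∫ ζ, B.indicator (fun _ => ‖cn n‖ * ((2 * (1 + h⁻¹ * R)) ^ k * (D k * h ^ N))) ζ := by
    intro h hh
    have hh0 := hh.1
    have hinv : |h⁻¹| = h⁻¹ := abs_of_pos (inv_pos.2 hh0)
    have hbs : ∀ ζ, ContDiffOn ℝ ∞ (fun x => b h (x, ζ)) V := fun ζ =>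
      (hb h hh).comp (by fun_prop) fun x hx => ⟨hx, mem_univ _⟩
    have := contDiffOn_integral_mul_of_contDiffOn_prod (μ := (volume : Measure (E n))) hV
      isOpen_univ (Eventually.of_forall fun _ => mem_univ _)
      (G := fun z : E n × E n => ee (h⁻¹ • (z.1 - y₀)) z.2 * b h z)
      (((contDiff_ee.comp (by fun_prop : ContDiff ℝ ∞ fun z : E n × E n =>
        (h⁻¹ • (z.1 - y₀), z.2))).contDiffOn).mul (hb h hh))
      (w := fun _ => cn n) aestronglyMeasurable_const
      (β := fun k => B.indicator fun _ =>
        ‖cn n‖ * ((2 * (1 + h⁻¹ * R)) ^ k * (D k * h ^ N)))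
      (fun k => (integrableOn_const hB.measure_lt_top.ne).integrable_indicator hB.measurableSet)
      (fun k ζ _ x hx => ?_)
    · have e1 : RiemPsiDO.amp y₀ h (b h) = fun x => ∫ ζ, cn n * (ee (h⁻¹ • (x - y₀)) ζ *
          b h (x, ζ)) := by
        ext x; rw [RiemPsiDO.amp, integral_const_mul]
      rw [e1]
      exact this
    · by_cases hζ : ζ ∈ B
      · rw [indicator_of_mem hζ]
        refine mul_le_mul_of_nonneg_left ?_ (norm_nonneg _)
        refine (norm_iteratedFDeriv_ee_mul_le hV (hbs ζ) h⁻¹ y₀ ζ hx (C := D k * h ^ N)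
          fun i hi => ?_).trans ?_
        · refine (hC i h hh x hx ζ hζ).trans ?_
          have : C i ≤ D k := (le_abs_self _).trans (Finset.single_le_sum (f := fun i => |C i|)
            (fun _ _ => abs_nonneg _) (Finset.mem_range.2 (Nat.lt_succ_of_le hi)))
          gcongr
        · rw [hinv]
          have := hDnn k
          have := hR ζ hζ
          gcongr
      · rw [indicator_of_notMem hζ]
        have e2 : (fun x => ee (h⁻¹ • (x - y₀)) ζ * b h (x, ζ)) =ᶠ[𝓝 x] fun _ => 0 := by
          filter_upwards [hV.mem_nhds hx] with x hx
          rw [hs h hh x hx ζ hζ, mul_zero]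
        rw [(e2.iteratedFDeriv ℝ k).eq_of_nhds]
        simp
  refine ⟨fun h hh => (key h hh).1, fun k => ⟨volume.real B * (‖cn n‖ *
    ((2 * (1 + R)) ^ k * D k)), fun h hh x hx => ((key h hh).2 k x hx).trans ?_⟩⟩
  rw [integral_indicator hB.measurableSet, setIntegral_const, smul_eq_mul]
  have hh0 := hh.1
  have e3 : 1 + h⁻¹ * R ≤ h⁻¹ * (1 + R) := by
    have : 1 ≤ h⁻¹ := one_le_inv₀ hh0 |>.2 hh.2
    linarith
  have := hDnn k
  calc volume.real B * (‖cn n‖ * ((2 * (1 + h⁻¹ * R)) ^ k * (D k * h ^ N)))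
      ≤ volume.real B * (‖cn n‖ * ((2 * (h⁻¹ * (1 + R))) ^ k * (D k * h ^ N))) := by gcongr
    _ = _ := by
      rw [zpow_sub₀ hh0.ne', zpow_natCast, mul_pow, mul_pow, mul_pow, inv_pow]
      field_simp

theorem IsAmp.small {U V K : Set (E n)} (hU : IsOpen U) (hV : IsOpen V) (hK : IsCompact K)
    (hVK : V ⊆ K) (hKU : K ⊆ U) {b : E n × E n → ℂ} (hb : IsAmp U b) (y₀ : E n) :
    Small V 0 (fun h => amp y₀ h b) := by
  obtain ⟨B, hB, h0, hs⟩ := hb.supp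
  refine Small.amp hV hB (fun _ _ => hb.smooth.mono (prod_mono_left (hVK.trans hKU)))
    (fun _ _ x hx => hs x (hKU (hVK hx))) (fun k => ?_) y₀
  have hU' : IsOpen (U ×ˢ (univ : Set (E n))) := hU.prod isOpen_univ
  obtain ⟨C, hC⟩ := (hK.prod hB).exists_bound_of_continuousOn
    ((continuousOn_iteratedFDeriv_slice k hU' hb.smooth).mono
      (prod_mono hKU (subset_univ _)))
  exact ⟨C, fun h hh x hx ζ hζ => by simpa using hC (x, ζ) ⟨hVK hx, hζ⟩⟩

end RiemPsiDO

end

noncomputable section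
namespace RiemPsiDO
open Set Filter Topology

variable {n : ℕ}

/-! ### Asymptotic expansions in packets -/

theorem integrable_ee_mul (z : E n) (f : TestSym n) :
    Integrable (fun ζ => ee z ζ * (f : E n → ℂ) ζ) :=
  TestSym.integrable_mul (contDiff_ee_right z).contDiffOn f.2

/-- The value of the packet at a point, as a linear functional of the profile. -/
def packetL (y₀ : E n) (h : ℝ) (x : E n) : TestSym n →ₗ[ℂ] ℂ where
  toFun f := packet y₀ h f x
  map_add' f g := by
    simp only [packet, Submodule.coe_add, Pi.add_apply, mul_add]
    rw [integral_add (integrable_ee_mul _ f) (integrable_ee_mul _ g), mul_add]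
  map_smul' c f := by
    simp only [packet, Submodule.coe_smul, Pi.smul_apply, smul_eq_mul, RingHom.id_apply]
    simp_rw [mul_left_comm _ c]
    rw [integral_const_mul]
    ring

theorem packetL_apply (y₀ : E n) (h : ℝ) (x : E n) (f : TestSym n) :
    packetL y₀ h x f = packet y₀ h f x := rfl

theorem packet_at (y₀ z : E n) {h : ℝ} (hh : 0 < h) (f : TestSym n) :
    packet y₀ h f (y₀ + h • z) = cn n * ∫ ζ, ee z ζ * (f : E n → ℂ) ζ := by
  rw [packet, add_sub_cancel_left, smul_smul, inv_mul_cancel₀ hh.ne', one_smul]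

open scoped FourierTransform in
/-- Injectivity of the Fourier transform on test symbols. -/
theorem TestSym.eq_zero_of_integral_ee (f : TestSym n)
    (h : ∀ z : E n, ∫ ζ, ee z ζ * (f : E n → ℂ) ζ = 0) : f = 0 := by
  have h1 : 𝓕⁻ (TestSym.toSchwartz f) = 0 := by
    ext z
    have := packet_eq_fourierInv 0 1 f ((2 * Real.pi) • z)
    rw [packet, h, mul_zero] at this
    have h2 : (((2 * Real.pi)⁻¹ * 1⁻¹) • ContinuousLinearMap.id ℝ (E n))
        ((2 * Real.pi) • z - 0) = z := by
      simp [smul_smul]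
      field_simp
      simp
    rw [h2] at this
    exact ((mul_eq_zero.1 this.symm).resolve_left (cn_ne_zero n))
  have h3 : TestSym.toSchwartz f = 0 := by
    have := congrArg (fun g => 𝓕 g) h1
    simpa using this
  ext ζ
  exact congrArg (fun g : SchwartzMap (E n) ℂ => g ζ) h3

/-- On `V` the family `w` has the asymptotic expansion `∑ h^{μ+l} packet (g l)`. -/
def HasExp (V : Set (E n)) (y₀ : E n) (μ : ℤ) (g : ℕ → TestSym n) (w : ℝ → E n → ℂ) : Prop :=
  ∀ N : ℕ, Small V (μ + N) (fun h x => w h x -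
    ∑ l ∈ Finset.range N, (h : ℂ) ^ (μ + l) * packet y₀ h (g l) x)

theorem HasExp.add_small {V : Set (E n)} (hV : IsOpen V) {y₀ : E n} {μ : ℤ} {g : ℕ → TestSym n}
    {w w' : ℝ → E n → ℂ} (hw : HasExp V y₀ μ g w)
    (hs : ∀ N : ℕ, Small V N (fun h x => w' h x - w h x)) : HasExp V y₀ μ g w' := by
  intro N
  refine (((hs (μ + N).toNat).mono subset_rfl (by omega)).add hV (hw N)).congr hV
    fun h _ x _ => ?_
  ring

theorem HasExp.congr {V : Set (E n)} (hV : IsOpen V) {y₀ : E n} {μ : ℤ} {g : ℕ → TestSym n}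
    {w w' : ℝ → E n → ℂ} (hw : HasExp V y₀ μ g w)
    (hs : ∀ h ∈ Ioc (0 : ℝ) 1, ∀ x ∈ V, w' h x = w h x) : HasExp V y₀ μ g w' :=
  hw.add_small hV fun N => (Small.zero V N).congr hV fun h hh x hx => by
    rw [hs h hh x hx, sub_self]

theorem HasExp.smul {V : Set (E n)} (hV : IsOpen V) {y₀ : E n} {μ : ℤ} {g : ℕ → TestSym n}
    {w : ℝ → E n → ℂ} (hw : HasExp V y₀ μ g w) (c : ℂ) :
    HasExp V y₀ μ (fun l => c • g l) (fun h x => c * w h x) := by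
  intro N
  refine ((hw N).smul hV c).congr hV fun h _ x _ => ?_
  rw [mul_sub, Finset.mul_sum]
  congr 1
  refine Finset.sum_congr rfl fun l _ => ?_
  rw [← packetL_apply, map_smul, packetL_apply, smul_eq_mul]
  ring

/-- Multiplication by a function equal to `1` near the base point. -/
theorem HasExp.cutoff {V : Set (E n)} (hV : IsOpen V) {y₀ : E n} {μ : ℤ} {g : ℕ → TestSym n}
    {w : ℝ → E n → ℂ} (hw : HasExp V y₀ μ g w) {χ : E n → ℂ} (hχ : ContDiffOn ℝ ∞ χ V)
    (hb : ∀ k : ℕ, ∃ C : ℝ, ∀ x ∈ V, ‖iteratedFDeriv ℝ k χ x‖ ≤ C) (h1 : χ =ᶠ[𝓝 y₀] 1) :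
    HasExp V y₀ μ g (fun h x => χ x * w h x) := by
  have hs := Small.of_bound hχ hb
  have hone : Small V 0 (fun (_ : ℝ) (_ : E n) => (1 : ℂ)) :=
    Small.of_bound contDiffOn_const fun k => ⟨1, fun x _ => by
      rcases Nat.eq_zero_or_pos k with rfl | hk
      · simp
      · simp [iteratedFDeriv_const_of_ne hk.ne']⟩
  have hbd : ∀ k : ℕ, ∃ C : ℝ, ∀ x ∈ V, ‖iteratedFDeriv ℝ k (fun x => χ x - 1) x‖ ≤ C := by
    intro k
    obtain ⟨C, hC⟩ := (hs.sub hV hone).2 k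
    exact ⟨C * 1 ^ ((0 : ℤ) - k), fun x hx => hC 1 ⟨one_pos, le_rfl⟩ x hx⟩
  intro N
  have h2 : ∀ l : ℕ, Small V (μ + N) (fun h x => (h : ℂ) ^ (μ + l) *
      ((χ x - 1) * packet y₀ h (g l) x)) := fun l => by
    have := (Small.mul_packet hV (hχ.sub contDiffOn_const) hbd
      (by filter_upwards [h1] with x hx; simp [hx]) (g l) ((N : ℤ) - l)).zpow_mul hV (μ + l)
    exact this.mono subset_rfl (by omega)
  have h3 := hs.mul hV (hw N)
  rw [zero_add] at h3
  refine (h3.add hV (Small.sum hV (Finset.range N) fun l _ => h2 l)).congr hV fun h _ x _ => ?_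
  rw [mul_sub, Finset.mul_sum, sub_add, ← Finset.sum_sub_distrib]
  congr 1
  refine Finset.sum_congr rfl fun l _ => ?_
  ring

theorem bind_identity {h : ℝ} (hh0 : (h : ℂ) ≠ 0) (y₀ x : E n) (μ ν : ℤ) (w : ℂ) (w' : ℕ → ℂ)
    (g : ℕ → ℕ → TestSym n) (N L : ℕ) :
    w - ∑ k ∈ Finset.range N, (h : ℂ) ^ (μ + ν + k) *
      packet y₀ h (∑ p ∈ Finset.HasAntidiagonal.antidiagonal k, g p.1 p.2 : TestSym n) x =
    (w - ∑ l ∈ Finset.range (N + L), (h : ℂ) ^ (μ + l) * w' l) +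
      ∑ l ∈ Finset.range (N + L), (h : ℂ) ^ (μ + l) * (w' l -
        ∑ i ∈ Finset.range (N - l), (h : ℂ) ^ (ν + i) * packet y₀ h (g l i) x) := by
  rw [sub_add]
  congr 1
  rw [← Finset.sum_sub_distrib]
  have e1 : ∀ l ∈ Finset.range (N + L), (h : ℂ) ^ (μ + l) * w' l - (h : ℂ) ^ (μ + l) *
      (w' l - ∑ i ∈ Finset.range (N - l), (h : ℂ) ^ (ν + i) * packet y₀ h (g l i) x) =
      ∑ i ∈ Finset.range (N - l), (h : ℂ) ^ (μ + ν + (l + i : ℕ)) * packet y₀ h (g l i) x := by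
    intro l _
    rw [mul_sub, sub_sub_cancel, Finset.mul_sum]
    refine Finset.sum_congr rfl fun i _ => ?_
    rw [← mul_assoc, ← zpow_add₀ hh0]
    congr 2
    push_cast; ring
  rw [Finset.sum_congr rfl e1]
  have e2 : ∑ l ∈ Finset.range (N + L), ∑ i ∈ Finset.range (N - l),
      (h : ℂ) ^ (μ + ν + (l + i : ℕ)) * packet y₀ h (g l i) x =
      ∑ l ∈ Finset.range N, ∑ i ∈ Finset.range (N - l),
      (h : ℂ) ^ (μ + ν + (l + i : ℕ)) * packet y₀ h (g l i) x := by
    rw [Finset.sum_range_add, add_eq_left]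
    refine Finset.sum_eq_zero fun l _ => ?_
    rw [show N - (N + l) = 0 by omega]
    simp
  rw [e2, ← Finset.sum_range_diag_flip N (fun l i => (h : ℂ) ^ (μ + ν + (l + i : ℕ)) *
    packet y₀ h (g l i) x)]
  refine Finset.sum_congr rfl fun k _ => ?_
  rw [← packetL_apply, map_sum, Finset.mul_sum,
    Finset.Nat.sum_antidiagonal_eq_sum_range_succ (fun i j => (h : ℂ) ^ (μ + ν + k) *
      packetL y₀ h x (g i j))]
  refine Finset.sum_congr rfl fun i hi => ?_
  rw [show i + (k - i) = k by have := Finset.mem_range.1 hi; omega]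
  rfl

/-- Expansion of a family which is expanded in families with an expansion. -/
theorem HasExp.bind {V : Set (E n)} (hV : IsOpen V) {y₀ : E n} {μ ν : ℤ} {L : ℕ}
    {w : ℝ → E n → ℂ} {w' : ℕ → ℝ → E n → ℂ} {g : ℕ → ℕ → TestSym n}
    (h1 : ∀ N : ℕ, Small V (μ + ν + N - L) (fun h x => w h x -
      ∑ l ∈ Finset.range N, (h : ℂ) ^ (μ + l) * w' l h x))
    (h2 : ∀ l, HasExp V y₀ ν (g l) (w' l)) :
    HasExp V y₀ (μ + ν) (fun k => ∑ p ∈ Finset.HasAntidiagonal.antidiagonal k, g p.1 p.2) w := by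
  intro N
  have h3 := (h1 (N + L)).mono (N' := μ + ν + N) subset_rfl (by push_cast; omega)
  have h4 := fun l : ℕ => ((h2 l (N - l)).zpow_mul hV (μ + l)).mono (N' := μ + ν + N)
    subset_rfl (by omega)
  refine (h3.add hV (Small.sum hV (Finset.range (N + L)) fun l _ => h4 l)).congr hV
    fun h hh x _ => bind_identity (by exact_mod_cast hh.1.ne') y₀ x μ ν _ (fun l => w' l h x) g N L

/-- Expansions in the sense of uniform convergence, without derivatives. -/
def WExp (V : Set (E n)) (y₀ : E n) (μ : ℤ) (g : ℕ → TestSym n) (w : ℝ → E n → ℂ) : Prop :=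
  ∀ N : ℕ, ∃ C : ℝ, ∀ h ∈ Ioc (0 : ℝ) 1, ∀ x ∈ V, ‖w h x -
    ∑ l ∈ Finset.range N, (h : ℂ) ^ (μ + l) * packet y₀ h (g l) x‖ ≤ C * h ^ (μ + N)

theorem Small.bound_zero {V : Set (E n)} {N : ℤ} {w : ℝ → E n → ℂ} (hw : Small V N w) :
    ∃ C : ℝ, ∀ h ∈ Ioc (0 : ℝ) 1, ∀ x ∈ V, ‖w h x‖ ≤ C * h ^ N := by
  obtain ⟨C, hC⟩ := hw.2 0
  exact ⟨C, fun h hh x hx => by simpa using hC h hh x hx⟩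

theorem HasExp.wExp {V : Set (E n)} {y₀ : E n} {μ : ℤ} {g : ℕ → TestSym n}
    {w : ℝ → E n → ℂ} (hw : HasExp V y₀ μ g w) : WExp V y₀ μ g w := fun N => (hw N).bound_zero

theorem WExp.mono {V V' : Set (E n)} {y₀ : E n} {μ : ℤ} {g : ℕ → TestSym n}
    {w : ℝ → E n → ℂ} (hw : WExp V y₀ μ g w) (h : V' ⊆ V) : WExp V' y₀ μ g w := fun N => by
  obtain ⟨C, hC⟩ := hw N
  exact ⟨C, fun t ht x hx => hC t ht x (h hx)⟩

theorem WExp.add_small {V : Set (E n)} {y₀ : E n} {μ : ℤ} {g : ℕ → TestSym n}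
    {w w' : ℝ → E n → ℂ} (hw : WExp V y₀ μ g w) (hs : ∀ N : ℕ, ∃ C : ℝ, ∀ h ∈ Ioc (0 : ℝ) 1,
      ∀ x ∈ V, ‖w' h x - w h x‖ ≤ C * h ^ N) : WExp V y₀ μ g w' := fun N => by
  obtain ⟨C, hC⟩ := hw N
  obtain ⟨C', hC'⟩ := hs (μ + N).toNat
  refine ⟨C + |C'|, fun h hh x hx => ?_⟩
  have h1 : h ^ (μ + N).toNat ≤ h ^ (μ + N) := by
    rw [← zpow_natCast]
    exact zpow_le_zpow_of_le_one hh (by omega)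
  have h2 := (hC' h hh x hx).trans (mul_le_mul (le_abs_self C') h1 (pow_nonneg hh.1.le _)
    (abs_nonneg _))
  calc _ = ‖(w h x - ∑ l ∈ Finset.range N, (h : ℂ) ^ (μ + l) * packet y₀ h (g l) x) +
        (w' h x - w h x)‖ := by congr 1; ring
    _ ≤ _ := norm_add_le _ _
    _ ≤ _ := by rw [add_mul]; exact add_le_add (hC h hh x hx) h2

theorem WExp.bind {V : Set (E n)} {y₀ : E n} {μ ν : ℤ} {L : ℕ}
    {w : ℝ → E n → ℂ} {w' : ℕ → ℝ → E n → ℂ} {g : ℕ → ℕ → TestSym n}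
    (h1 : ∀ N : ℕ, ∃ C : ℝ, ∀ h ∈ Ioc (0 : ℝ) 1, ∀ x ∈ V, ‖w h x -
      ∑ l ∈ Finset.range N, (h : ℂ) ^ (μ + l) * w' l h x‖ ≤ C * h ^ (μ + ν + N - L))
    (h2 : ∀ l, WExp V y₀ ν (g l) (w' l)) :
    WExp V y₀ (μ + ν) (fun k => ∑ p ∈ Finset.HasAntidiagonal.antidiagonal k, g p.1 p.2) w := by
  intro N
  obtain ⟨C, hC⟩ := h1 (N + L)
  choose D hD using fun l => h2 l (N - l)
  refine ⟨C + ∑ l ∈ Finset.range (N + L), |D l|, fun h hh x hx => ?_⟩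
  rw [bind_identity (by exact_mod_cast hh.1.ne') y₀ x μ ν _ (fun l => w' l h x) g N L, add_mul,
    Finset.sum_mul]
  refine (norm_add_le _ _).trans (add_le_add ?_ ((norm_sum_le _ _).trans
    (Finset.sum_le_sum fun l _ => ?_)))
  · have := hC h hh x hx
    rwa [show μ + ν + (N + L : ℕ) - L = μ + ν + N by push_cast; ring] at this
  · rw [norm_mul, norm_zpow, Complex.norm_real, Real.norm_of_nonneg hh.1.le]
    have hp : (0 : ℝ) ≤ h ^ (μ + l) := zpow_nonneg hh.1.le _
    have hp' : (0 : ℝ) ≤ h ^ (ν + (N - l : ℕ)) := zpow_nonneg hh.1.le _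
    calc _ ≤ h ^ (μ + l) * (|D l| * h ^ (ν + (N - l : ℕ))) :=
          mul_le_mul_of_nonneg_left ((hD l h hh x hx).trans
            (mul_le_mul_of_nonneg_right (le_abs_self _) hp')) hp
      _ = |D l| * h ^ (μ + l + (ν + (N - l : ℕ))) := by rw [zpow_add₀ hh.1.ne' (μ + l)]; ring
      _ ≤ _ := mul_le_mul_of_nonneg_left (zpow_le_zpow_of_le_one hh (by omega)) (abs_nonneg _)

theorem WExp.unique {V : Set (E n)} (hV : IsOpen V) {y₀ : E n} (hy : y₀ ∈ V) {μ : ℤ}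
    {g g' : ℕ → TestSym n} {w : ℝ → E n → ℂ} (hg : WExp V y₀ μ g w)
    (hg' : WExp V y₀ μ g' w) : g = g' := by
  ext1 l
  induction l using Nat.strong_induction_on with
  | _ l ih =>
    refine (sub_eq_zero.1 (TestSym.eq_zero_of_integral_ee _ fun z => ?_)).symm
    set c : ℂ := ∫ ζ, ee z ζ * ((g' l - g l : TestSym n) : E n → ℂ) ζ with hc
    obtain ⟨C₁, hC₁⟩ := hg (l + 1)
    obtain ⟨C₂, hC₂⟩ := hg' (l + 1)
    set C := C₁ + C₂ with hCdef
    have hev : ∀ᶠ h in 𝓝[>] (0 : ℝ), ‖cn n * c‖ ≤ C * h := by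
      have ht : Tendsto (fun h : ℝ => y₀ + h • z) (𝓝[>] 0) (𝓝 y₀) := by
        have : Continuous (fun h : ℝ => y₀ + h • z) := by fun_prop
        simpa using (this.tendsto 0).mono_left nhdsWithin_le_nhds
      filter_upwards [ht.eventually (hV.mem_nhds hy), Ioc_mem_nhdsGT (zero_lt_one' ℝ)]
        with h hhV hh
      have h1 := (norm_sub_le _ _).trans (add_le_add (hC₁ h hh _ hhV) (hC₂ h hh _ hhV))
      have hh0 : (h : ℂ) ≠ 0 := by exact_mod_cast hh.1.ne'
      rw [← add_mul, ← hCdef] at h1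
      have e1 : w h (y₀ + h • z) - ∑ i ∈ Finset.range (l + 1), (h : ℂ) ^ (μ + i) *
            packet y₀ h (g i) (y₀ + h • z) - (w h (y₀ + h • z) -
            ∑ i ∈ Finset.range (l + 1), (h : ℂ) ^ (μ + i) * packet y₀ h (g' i) (y₀ + h • z)) =
          (h : ℂ) ^ (μ + l) * (cn n * c) := by
        rw [sub_sub_sub_cancel_left, ← Finset.sum_sub_distrib, Finset.sum_range_succ,
          Finset.sum_eq_zero, zero_add, ← mul_sub, ← packetL_apply, ← packetL_apply, ← map_sub,
          packetL_apply, packet_at _ _ hh.1]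
        intro i hi
        rw [ih i (Finset.mem_range.1 hi), sub_self]
      rw [e1, norm_mul, norm_zpow, Complex.norm_real, Real.norm_of_nonneg hh.1.le] at h1
      have e2 : h ^ (μ + ((l + 1 : ℕ) : ℤ)) = h ^ (μ + l) * h := by
        rw [← zpow_add_one₀ hh.1.ne']
        congr 1
        push_cast; ring
      rw [e2, mul_left_comm] at h1
      exact le_of_mul_le_mul_left h1 (zpow_pos hh.1 _)
    have h0 : Tendsto (fun h : ℝ => C * h) (𝓝[>] 0) (𝓝 0) := by
      have : Continuous (fun h : ℝ => C * h) := by fun_prop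
      simpa using (this.tendsto 0).mono_left nhdsWithin_le_nhds
    have h5 : ‖cn n * c‖ ≤ 0 := ge_of_tendsto h0 hev
    exact (mul_eq_zero.1 (norm_le_zero_iff.1 h5)).resolve_left (cn_ne_zero n)

theorem hasExp_amp {U V K : Set (E n)} (hU : IsOpen U) (hcv : Convex ℝ U) {y₀ : E n}
    (hy : y₀ ∈ U) (hV : IsOpen V) (hK : IsCompact K) (hVK : V ⊆ K) (hKU : K ⊆ U)
    {b : E n × E n → ℂ} (hb : IsAmp U b) :
    HasExp V y₀ 0 (ampCoeff hU hy hb) (fun h => amp y₀ h b) := by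
  intro N
  rcases N with _ | N
  · simpa using hb.small hU hV hK hVK hKU y₀
  · have h1 := ((isAmp_remAmp hU hcv hy hb N).small hU hV hK hVK hKU y₀).zpow_mul hV
      ((N + 1 : ℕ) : ℤ)
    refine h1.congr hV fun h hh x hx => ?_
    beta_reduce
    rw [amp_eq_sum_add hU hcv hy (hKU (hVK hx)) hb hh.1 N]
    simp only [zero_add, zpow_natCast]
    ring

/-! ### The operators on profiles defined by linear families of amplitudes -/

theorem ampCoeff_apply {U : Set (E n)} (hU : IsOpen U) {y₀ : E n} (hy : y₀ ∈ U)
    {b : E n × E n → ℂ} (hb : IsAmp U b) (r : ℕ) (ζ : E n) :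
    (ampCoeff hU hy hb r : E n → ℂ) ζ = (r.factorial : ℂ)⁻¹ * (Lop^[r] b) (y₀, ζ) := rfl

theorem Lop_congr {U : Set (E n)} (hU : IsOpen U) {b c : E n × E n → ℂ}
    (h : EqOn b c (U ×ˢ univ)) : EqOn (Lop b) (Lop c) (U ×ˢ univ) := by
  intro z hz
  have hU' : IsOpen (U ×ˢ (univ : Set (E n))) := hU.prod isOpen_univ
  simp only [Lop]
  congr 1
  refine Finset.sum_congr rfl fun i _ => ?_
  exact dd_congr hU' (dd_congr hU' h _) _ z hz

theorem Lop_add {U : Set (E n)} (hU : IsOpen U) {b c : E n × E n → ℂ}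
    (hb : ContDiffOn ℝ ∞ b (U ×ˢ univ)) (hc : ContDiffOn ℝ ∞ c (U ×ˢ univ)) :
    EqOn (Lop (fun z => b z + c z)) (fun z => Lop b z + Lop c z) (U ×ˢ univ) := by
  intro z hz
  have hU' : IsOpen (U ×ˢ (univ : Set (E n))) := hU.prod isOpen_univ
  simp only [Lop]
  rw [← mul_add, ← Finset.sum_add_distrib]
  congr 1
  refine Finset.sum_congr rfl fun i _ => ?_
  rw [← dd_add (differentiableAt_of_contDiffOn hU' (contDiffOn_dd hU' hb _) hz)
    (differentiableAt_of_contDiffOn hU' (contDiffOn_dd hU' hc _) hz)]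
  refine dd_congr hU' (fun z hz => ?_) _ z hz
  exact dd_add (differentiableAt_of_contDiffOn hU' hb hz)
    (differentiableAt_of_contDiffOn hU' hc hz) _

theorem Lop_const_mul {U : Set (E n)} (hU : IsOpen U) {b : E n × E n → ℂ}
    (hb : ContDiffOn ℝ ∞ b (U ×ˢ univ)) (a : ℂ) :
    EqOn (Lop (fun z => a * b z)) (fun z => a * Lop b z) (U ×ˢ univ) := by
  intro z hz
  have hU' : IsOpen (U ×ˢ (univ : Set (E n))) := hU.prod isOpen_univ
  simp only [Lop, Finset.mul_sum]
  refine Finset.sum_congr rfl fun i _ => ?_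
  rw [mul_left_comm a]
  congr 1
  rw [← dd_const_mul (differentiableAt_of_contDiffOn hU' (contDiffOn_dd hU' hb _) hz)]
  refine dd_congr hU' (fun z hz => ?_) _ z hz
  exact dd_const_mul (differentiableAt_of_contDiffOn hU' hb hz) _ _

theorem Lop_iterate_add {U : Set (E n)} (hU : IsOpen U) {b c : E n × E n → ℂ} (hb : IsAmp U b)
    (hc : IsAmp U c) (r : ℕ) :
    EqOn (Lop^[r] (fun z => b z + c z)) (fun z => Lop^[r] b z + Lop^[r] c z) (U ×ˢ univ) := by
  induction r with
  | zero => exact fun _ _ => rfl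
  | succ r ih =>
    simp only [Function.iterate_succ_apply']
    exact (Lop_congr hU ih).trans
      (Lop_add hU (hb.Lop_iterate hU r).smooth (hc.Lop_iterate hU r).smooth)

theorem Lop_iterate_const_mul {U : Set (E n)} (hU : IsOpen U) {b : E n × E n → ℂ}
    (hb : IsAmp U b) (a : ℂ) (r : ℕ) :
    EqOn (Lop^[r] (fun z => a * b z)) (fun z => a * Lop^[r] b z) (U ×ˢ univ) := by
  induction r with
  | zero => exact fun _ _ => rfl
  | succ r ih =>
    simp only [Function.iterate_succ_apply']
    exact (Lop_congr hU ih).trans (Lop_const_mul hU (hb.Lop_iterate hU r).smooth a)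

/-- The operator on profiles given by the coefficients of a linear family of amplitudes. -/
def ampEnd {U : Set (E n)} (hU : IsOpen U) {y₀ : E n} (hy : y₀ ∈ U)
    (β : TestSym n →ₗ[ℂ] (E n × E n → ℂ)) (hβ : ∀ f, IsAmp U (β f)) (r : ℕ) :
    Module.End ℂ (TestSym n) where
  toFun f := ampCoeff hU hy (hβ f) r
  map_add' f g := by
    ext ζ
    have h1 : β (f + g) = fun z => β f z + β g z := by rw [map_add]; rfl
    have := Lop_iterate_add hU (hβ f) (hβ g) r (⟨hy, mem_univ ζ⟩ : (y₀, ζ) ∈ U ×ˢ univ)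
    simp only [Submodule.coe_add, Pi.add_apply, ampCoeff_apply, h1, this, mul_add]
  map_smul' a f := by
    ext ζ
    have h1 : β (a • f) = fun z => a * β f z := by rw [map_smul]; rfl
    have := Lop_iterate_const_mul hU (hβ f) a r (⟨hy, mem_univ ζ⟩ : (y₀, ζ) ∈ U ×ˢ univ)
    simp only [Submodule.coe_smul, Pi.smul_apply, ampCoeff_apply, h1, this, smul_eq_mul,
      RingHom.id_apply]
    ring

end RiemPsiDO

end

noncomputable section
namespace RiemPsiDO
open Set Filter Topology

variable {n : ℕ}

/-! ### Fourier transforms -/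

theorem quantize_eq (p : E n → E n → ℂ) (u : E n → ℂ) (x : E n) :
    quantize p u x = cn n * ∫ ξ, ee x ξ * p x ξ * fourier u ξ := rfl

theorem fourier_eq (u : E n → ℂ) (ξ : E n) : fourier u ξ = ∫ y, ee (-y) ξ * u y := by
  simp only [fourier, ee, inner_neg_left]
  congr 1
  ext y
  push_cast
  ring_nf

open scoped FourierTransform in
theorem fourier_eq_fourierIntegral (u : E n → ℂ) (ξ : E n) :
    fourier u ξ = 𝓕 u ((2 * Real.pi)⁻¹ • ξ) := by
  rw [Real.fourier_eq', fourier]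
  congr 1
  ext y
  have h2 : Real.pi ≠ 0 := Real.pi_ne_zero
  have : -2 * Real.pi * inner ℝ y ((2 * Real.pi)⁻¹ • ξ) = -(inner ℝ y ξ : ℝ) := by
    rw [inner_smul_right]; field_simp
  rw [this, smul_eq_mul]
  push_cast
  ring_nf

open scoped FourierTransform in
theorem fourier_packet (y₀ : E n) {h : ℝ} (hh : 0 < h) (f : TestSym n) (ξ : E n) :
    fourier (packet y₀ h f) ξ = ee (-y₀) ξ * ((h : ℂ) ^ n * (f : E n → ℂ) (h • ξ)) := by
  set c : ℝ := (2 * Real.pi)⁻¹ * h⁻¹ with hc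
  have hpi := Real.pi_pos
  have hc0 : 0 < c := by positivity
  set F : SchwartzMap (E n) ℂ := 𝓕⁻ (TestSym.toSchwartz f) with hF
  set Φ : E n → ℂ := fun v => ee (-(c⁻¹ • v)) ξ * F v with hΦ
  have h1 : ∀ y, ee (-y) ξ * packet y₀ h f y =
      (ee (-y₀) ξ * cn n) * (fun y => Φ (c • y)) (y - y₀) := by
    intro y
    rw [packet_eq_fourierInv]
    have e1 : ((c • ContinuousLinearMap.id ℝ (E n)) (y - y₀)) = c • (y - y₀) := rfl
    rw [← hc, e1]
    simp only [hΦ, smul_smul, inv_mul_cancel₀ hc0.ne', one_smul]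
    have e2 : -y = -y₀ + -(y - y₀) := by abel
    rw [e2, ee_add_left]
    ring
  rw [fourier_eq]
  simp_rw [h1]
  rw [integral_const_mul, integral_sub_right_eq_self (fun y => Φ (c • y)) y₀,
    Measure.integral_comp_smul]
  have h2 : ∫ v, Φ v = (f : E n → ℂ) (h • ξ) := by
    have h3 : 𝓕 F = TestSym.toSchwartz f := by rw [hF]; simp
    have h4 : (f : E n → ℂ) (h • ξ) = (𝓕 F) (h • ξ) := by rw [h3]; rfl
    rw [h4, SchwartzMap.fourier_coe, Real.fourier_eq']
    congr 1
    ext v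
    have e3 : -2 * Real.pi * inner ℝ v (h • ξ) = inner ℝ (-(c⁻¹ • v)) ξ := by
      rw [inner_smul_right, inner_neg_left, inner_smul_left, hc]
      simp
      ring
    rw [hΦ, e3, smul_eq_mul]
    simp only [ee, mul_comm Complex.I]
  rw [h2, finrank_euclideanSpace_fin, abs_of_pos (by positivity), Complex.real_smul]
  have e4 : cn n * (((c ^ n)⁻¹ : ℝ) : ℂ) = (h : ℂ) ^ n := by
    rw [cn, hc]
    push_cast
    have : (Real.pi : ℂ) ≠ 0 := by exact_mod_cast hpi.ne'
    have : (h : ℂ) ≠ 0 := by exact_mod_cast hh.ne'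
    rw [← inv_pow, ← mul_pow]
    congr 1
    field_simp
  rw [← e4]
  ring

theorem quantize_packet (p : E n → E n → ℂ) (y₀ : E n) {h : ℝ} (hh : 0 < h) (f : TestSym n)
    (x : E n) : quantize p (packet y₀ h f) x =
      amp y₀ h (fun z => p z.1 (h⁻¹ • z.2) * (f : E n → ℂ) z.2) x := by
  rw [quantize_eq, amp]
  congr 1
  set Ψ : E n → ℂ := fun ζ => ee (h⁻¹ • (x - y₀)) ζ * (p x (h⁻¹ • ζ) * (f : E n → ℂ) ζ) with hΨ
  have h1 : ∀ ξ, ee x ξ * p x ξ * fourier (packet y₀ h f) ξ = (h : ℂ) ^ n * Ψ (h • ξ) := by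
    intro ξ
    rw [fourier_packet y₀ hh]
    simp only [hΨ, smul_smul, inv_mul_cancel₀ hh.ne', one_smul, ee_smul_left]
    rw [sub_eq_add_neg, ee_add_left]
    ring
  simp_rw [h1]
  rw [integral_const_mul, Measure.integral_comp_smul, finrank_euclideanSpace_fin,
    abs_of_pos (by positivity), Complex.real_smul, ← mul_assoc]
  push_cast
  rw [mul_inv_cancel₀ (pow_ne_zero _ (by exact_mod_cast hh.ne')), one_mul]

theorem integrable_one_add_norm_pow (y₀ : E n) :
    Integrable (fun x : E n => ((1 + ‖x - y₀‖) ^ (n + 1))⁻¹) := by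
  have h1 : Integrable (fun x : E n => (1 + ‖x‖) ^ (-((n : ℝ) + 1))) :=
    integrable_one_add_norm (by rw [finrank_euclideanSpace_fin]; linarith)
  refine (h1.comp_sub_right y₀).congr (Eventually.of_forall fun x => ?_)
  have : (0 : ℝ) ≤ 1 + ‖x - y₀‖ := by positivity
  beta_reduce
  rw [Real.rpow_neg this, ← Real.rpow_natCast]
  push_cast
  rfl

theorem one_add_pow_le {t : ℝ} (ht : 0 ≤ t) (M : ℕ) : (1 + t) ^ M ≤ 2 ^ M * (1 + t ^ M) := by
  rcases le_total t 1 with h | h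
  · calc (1 + t) ^ M ≤ 2 ^ M := by gcongr; linarith
      _ ≤ _ := le_mul_of_one_le_right (by positivity) (le_add_of_nonneg_right (by positivity))
  · calc (1 + t) ^ M ≤ (2 * t) ^ M := by gcongr; linarith
      _ = 2 ^ M * t ^ M := mul_pow _ _ _
      _ ≤ _ := by gcongr; linarith

open scoped FourierTransform in
theorem fourier_decay (y₀ : E n) (M : ℕ) : ∃ C : ℝ, 0 ≤ C ∧ ∀ (u : E n → ℂ) (A : ℝ),
    ContDiff ℝ ∞ u →
    (∀ j ≤ M, ∀ x, (1 + ‖x - y₀‖) ^ (n + 1) * ‖iteratedFDeriv ℝ j u x‖ ≤ A) →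
    ∀ ξ, (1 + ‖ξ‖) ^ M * ‖fourier u ξ‖ ≤ C * A := by
  set I₀ : ℝ := ∫ x : E n, ((1 + ‖x - y₀‖) ^ (n + 1))⁻¹ with hI₀
  have hI0 : 0 ≤ I₀ := integral_nonneg fun x => by positivity
  refine ⟨2 ^ M * (2 * I₀ + (2 * Real.pi) ^ M * (2 ^ M * ((M + 1) * I₀))), by positivity,
    fun u A hu hA ξ => ?_⟩
  have hA' : ∀ j ≤ M, ∀ x, ‖iteratedFDeriv ℝ j u x‖ ≤ A * ((1 + ‖x - y₀‖) ^ (n + 1))⁻¹ := by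
    intro j hj x
    rw [← div_eq_mul_inv, le_div_iff₀ (by positivity), mul_comm]
    exact hA j hj x
  have h_int : ∀ j ≤ M, Integrable (fun x => ‖iteratedFDeriv ℝ j u x‖) := fun j hj =>
    ((integrable_one_add_norm_pow y₀).const_mul A).mono'
      ((hu.continuous_iteratedFDeriv (by exact_mod_cast le_top)).norm.aestronglyMeasurable)
      (Eventually.of_forall fun x => by simpa using hA' j hj x)
  have hle : ∀ j ≤ M, ∫ x, ‖iteratedFDeriv ℝ j u x‖ ≤ A * I₀ := fun j hj => by
    rw [hI₀, ← integral_const_mul]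
    exact integral_mono (h_int j hj) ((integrable_one_add_norm_pow y₀).const_mul A) (hA' j hj)
  have hAI : 0 ≤ A * I₀ := (integral_nonneg fun _ => norm_nonneg _).trans (hle 0 (Nat.zero_le _))
  set w : E n := (2 * Real.pi)⁻¹ • ξ with hw
  have hfw : fourier u ξ = 𝓕 u w := fourier_eq_fourierIntegral u ξ
  have key : ∀ j ≤ M, ‖w‖ ^ j * ‖𝓕 u w‖ ≤ 2 ^ j * ((j + 1) * (A * I₀)) := by
    intro j hj
    have := Real.pow_mul_norm_iteratedFDeriv_fourier_le (K := 0) (N := M) (f := u)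
      (hu.of_le (by exact_mod_cast le_top)) (fun k l hk hl => by
        have hk0 : k = 0 := by simpa using hk
        subst hk0
        simpa using h_int l (by exact_mod_cast hl)) (k := 0) (n := j) le_rfl
        (by exact_mod_cast hj) w
    rw [norm_iteratedFDeriv_zero] at this
    refine this.trans ?_
    simp only [pow_zero, one_mul, Nat.cast_zero, mul_zero, zero_add, Finset.range_one]
    refine mul_le_mul_of_nonneg_left ?_ (by positivity)
    rw [Finset.sum_product]
    simp only [Finset.sum_singleton, pow_zero, one_mul]
    calc _ ≤ ∑ _i ∈ Finset.range (j + 1), A * I₀ := Finset.sum_le_sum fun i hi => hle i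
          ((Nat.lt_succ_iff.1 (Finset.mem_range.1 hi)).trans hj)
      _ = _ := by simp
  have hξ : ‖ξ‖ = 2 * Real.pi * ‖w‖ := by
    rw [hw, norm_smul, Real.norm_of_nonneg (by positivity), ← mul_assoc,
      mul_inv_cancel₀ Real.two_pi_pos.ne', one_mul]
  have k0 := key 0 (Nat.zero_le _)
  have kM := key M le_rfl
  simp only [pow_zero, one_mul, Nat.cast_zero, zero_add] at k0
  have h1 : (1 + ‖ξ‖) ^ M * ‖𝓕 u w‖ ≤ 2 ^ M * (1 + ‖ξ‖ ^ M) * ‖𝓕 u w‖ :=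
    mul_le_mul_of_nonneg_right (one_add_pow_le (norm_nonneg _) M) (norm_nonneg _)
  rw [hfw]
  refine h1.trans ?_
  rw [hξ, mul_pow]
  generalize ‖𝓕 u w‖ = a at k0 kM
  have h2 : (2 * Real.pi) ^ M * (‖w‖ ^ M * a) ≤
      (2 * Real.pi) ^ M * (2 ^ M * ((M + 1) * (A * I₀))) :=
    mul_le_mul_of_nonneg_left kM (by positivity)
  have h3 : 2 ^ M * (a + (2 * Real.pi) ^ M * (‖w‖ ^ M * a)) ≤
      2 ^ M * (2 * (A * I₀) + (2 * Real.pi) ^ M * (2 ^ M * ((M + 1) * (A * I₀)))) :=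
    mul_le_mul_of_nonneg_left (by linarith) (by positivity)
  calc _ = 2 ^ M * (a + (2 * Real.pi) ^ M * (‖w‖ ^ M * a)) := by ring
    _ ≤ _ := h3
    _ = _ := by ring

/-! ### Bounds for symbols -/

theorem norm_iteratedFDeriv_iteratedFDeriv_zero (G : E n → E n → ℂ) (a : ℕ) (x ξ : E n) :
    ‖iteratedFDeriv ℝ a (fun x' => iteratedFDeriv ℝ 0 (fun ξ' => G x' ξ') ξ) x‖ =
      ‖iteratedFDeriv ℝ a (fun x' => G x' ξ) x‖ := by
  have : (fun x' => iteratedFDeriv ℝ 0 (fun ξ' => G x' ξ') ξ) =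
      (continuousMultilinearCurryFin0 ℝ (E n) ℂ).symm ∘ fun x' => G x' ξ := by
    ext1 x'; rw [iteratedFDeriv_zero_eq_comp]; rfl
  rw [this, LinearIsometryEquiv.norm_iteratedFDeriv_comp_left]

theorem IsSymbol.contDiffOn_sub {U : Set (E n)} {m : ℤ} {p : E n → E n → ℂ}
    {q : ℕ → E n → E n → ℂ} (hp : IsSymbol U m p q) (N : ℕ) :
    ContDiffOn ℝ ∞ (fun z : E n × E n => p z.1 z.2 - ∑ j ∈ Finset.range N, q j z.1 z.2)
      (U ×ˢ {0}ᶜ) :=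
  (hp.1.mono (prod_mono_right (subset_univ _))).sub
    (ContDiffOn.sum fun j _ => (hp.2.1 j).1)

theorem IsSymbol.bound {U : Set (E n)} (hU : IsOpen U) {m : ℤ} {p : E n → E n → ℂ}
    {q : ℕ → E n → E n → ℂ} (hp : IsSymbol U m p q) {K : Set (E n)} (hK : IsCompact K)
    (hKU : K ⊆ U) {c : ℝ} (hc : 0 < c) (N k : ℕ) : ∃ C : ℝ, 0 ≤ C ∧ ∀ x ∈ K, ∀ ξ : E n, c ≤ ‖ξ‖ →
      ‖iteratedFDeriv ℝ k (fun x' => p x' ξ - ∑ j ∈ Finset.range N, q j x' ξ) x‖ ≤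
        C * ‖ξ‖ ^ (m - N) := by
  obtain ⟨C₁, hC₁⟩ := hp.2.2 N K hK hKU k 0
  have hΩ : IsOpen (U ×ˢ ({0}ᶜ : Set (E n))) := hU.prod isOpen_compl_singleton
  have hcont := (continuousOn_iteratedFDeriv_slice k hΩ (hp.contDiffOn_sub N)).norm
  set S : Set (E n) := Metric.closedBall 0 1 \ Metric.ball 0 c
  have hS : IsCompact S := (isCompact_closedBall 0 1).diff Metric.isOpen_ball
  have hS0 : S ⊆ {0}ᶜ := by
    intro ξ hξ h0
    refine hξ.2 ?_
    rw [mem_singleton_iff.1 h0]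
    exact Metric.mem_ball_self hc
  have hne : ∀ z ∈ K ×ˢ S, ‖z.2‖ ≠ 0 := fun z hz => norm_ne_zero_iff.2 (hS0 hz.2)
  have hcont2 : ContinuousOn (fun z : E n × E n => (‖z.2‖ ^ (m - N))⁻¹ * ‖iteratedFDeriv ℝ k
      (fun x => p x z.2 - ∑ j ∈ Finset.range N, q j x z.2) z.1‖) (K ×ˢ S) := by
    refine ContinuousOn.mul (ContinuousOn.inv₀ (ContinuousOn.zpow₀
      (continuous_snd.norm.continuousOn) _ fun z hz => Or.inl (hne z hz))
      fun z hz => zpow_ne_zero _ (hne z hz)) (hcont.mono (prod_mono hKU hS0))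
  obtain ⟨C₂, hC₂⟩ := (hK.prod hS).exists_bound_of_continuousOn hcont2
  refine ⟨|C₁| + |C₂|, by positivity, fun x hx ξ hξ => ?_⟩
  have hξ0 : 0 < ‖ξ‖ := hc.trans_le hξ
  have hz := zpow_pos hξ0 (m - N)
  rcases le_total 1 ‖ξ‖ with h1 | h1
  · have := hC₁ x hx ξ h1
    rw [norm_iteratedFDeriv_iteratedFDeriv_zero
      (fun x' ξ' => p x' ξ' - ∑ j ∈ Finset.range N, q j x' ξ')] at this
    refine this.trans ?_
    simp only [Nat.cast_zero, sub_zero]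
    refine mul_le_mul_of_nonneg_right ((le_abs_self _).trans ?_) hz.le
    exact le_add_of_nonneg_right (abs_nonneg _)
  · have h2 := hC₂ (x, ξ) ⟨hx, by simpa using h1, by simpa using hξ⟩
    rw [Real.norm_of_nonneg (mul_nonneg (inv_nonneg.2 (zpow_nonneg (norm_nonneg _) _))
      (norm_nonneg _))] at h2
    rw [inv_mul_le_iff₀ hz] at h2
    refine h2.trans ?_
    rw [mul_comm]
    refine mul_le_mul_of_nonneg_right ((le_abs_self _).trans ?_) hz.le
    exact le_add_of_nonneg_left (abs_nonneg _)

theorem IsSymbol.bound_zero {U : Set (E n)} (hU : IsOpen U) {m : ℤ} {p : E n → E n → ℂ}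
    {q : ℕ → E n → E n → ℂ} (hp : IsSymbol U m p q) {K : Set (E n)} (hK : IsCompact K)
    (hKU : K ⊆ U) (k : ℕ) : ∃ C : ℝ, 0 ≤ C ∧ ∀ i ≤ k, ∀ x ∈ K, ∀ ξ : E n,
      ‖iteratedFDeriv ℝ i (fun x' => p x' ξ) x‖ ≤ C * (1 + ‖ξ‖) ^ m.toNat := by
  have hΩ : IsOpen (U ×ˢ (univ : Set (E n))) := hU.prod isOpen_univ
  have main : ∀ i : ℕ, ∃ C : ℝ, 0 ≤ C ∧ ∀ x ∈ K, ∀ ξ : E n,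
      ‖iteratedFDeriv ℝ i (fun x' => p x' ξ) x‖ ≤ C * (1 + ‖ξ‖) ^ m.toNat := by
    intro i
    obtain ⟨C₁, hC₁, h1⟩ := hp.bound hU hK hKU one_pos 0 i
    obtain ⟨C₂, hC₂⟩ := (hK.prod (isCompact_closedBall (0 : E n) 1)).exists_bound_of_continuousOn
      ((continuousOn_iteratedFDeriv_slice i hΩ hp.1).mono (prod_mono hKU (subset_univ _)))
    refine ⟨C₁ + |C₂|, by positivity, fun x hx ξ => ?_⟩
    rcases le_total 1 ‖ξ‖ with h | h
    · have := h1 x hx ξ h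
      simp only [Finset.range_zero, Finset.sum_empty, sub_zero, Nat.cast_zero] at this
      refine this.trans (mul_le_mul (le_add_of_nonneg_right (abs_nonneg _)) ?_
        (zpow_nonneg (norm_nonneg _) _) (by positivity))
      calc ‖ξ‖ ^ m ≤ ‖ξ‖ ^ (m.toNat : ℤ) := zpow_le_zpow_right₀ h (Int.self_le_toNat m)
        _ = ‖ξ‖ ^ m.toNat := zpow_natCast _ _
        _ ≤ _ := by gcongr; linarith
    · have := hC₂ (x, ξ) ⟨hx, by simpa using h⟩
      refine this.trans (((le_abs_self _).trans (le_add_of_nonneg_left hC₁)).trans ?_)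
      refine le_mul_of_one_le_right (by positivity) (one_le_pow₀ ?_)
      exact le_add_of_nonneg_right (norm_nonneg _)
  choose C hC0 hC using main
  refine ⟨∑ i ∈ Finset.range (k + 1), C i, Finset.sum_nonneg fun i _ => hC0 i,
    fun i hi x hx ξ => (hC i x hx ξ).trans ?_⟩
  gcongr
  exact Finset.single_le_sum (fun i _ => hC0 i) (Finset.mem_range.2 (Nat.lt_succ_of_le hi))

theorem stronglyMeasurable_fourier {u : E n → ℂ} (hu : Continuous u) :
    StronglyMeasurable (fourier u) := by
  have h : Continuous (fun z : E n × E n => ee (-z.2) z.1 * u z.2) :=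
    (continuous_ee.comp (continuous_snd.neg.prodMk continuous_fst)).mul (hu.comp continuous_snd)
  have := h.stronglyMeasurable.integral_prod_right' (ν := (volume : Measure (E n)))
  rwa [show fourier u = fun ξ => ∫ y, ee (-y) ξ * u y from funext (fourier_eq u)]

theorem integrable_quantize {U : Set (E n)} (hU : IsOpen U) {m : ℤ} {p : E n → E n → ℂ}
    {q : ℕ → E n → E n → ℂ} (hp : IsSymbol U m p q) {x : E n} (hx : x ∈ U) {u : E n → ℂ}
    (hu : Continuous u) {C : ℝ}
    (hd : ∀ ξ, (1 + ‖ξ‖) ^ (m.toNat + (n + 1)) * ‖fourier u ξ‖ ≤ C) :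
    Integrable (fun ξ => ee x ξ * p x ξ * fourier u ξ) := by
  obtain ⟨A, hA, hb⟩ := hp.bound_zero hU (isCompact_singleton (x := x))
    (singleton_subset_iff.2 hx) 0
  have hpc : Continuous (p x) := continuousOn_univ.1
    (hp.1.continuousOn.comp (f := fun ξ => (x, ξ)) (by fun_prop) fun ξ _ => ⟨hx, mem_univ _⟩)
  have hec : Continuous (ee x) := (contDiff_ee_right x).continuous
  refine ((integrable_one_add_norm_pow (0 : E n)).const_mul (A * C)).mono'
    ((hec.mul hpc).aestronglyMeasurable.mul
      (stronglyMeasurable_fourier hu).aestronglyMeasurable) (Eventually.of_forall fun ξ => ?_)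
  have h1 := hb 0 le_rfl x rfl ξ
  rw [norm_iteratedFDeriv_zero] at h1
  rw [norm_mul, norm_mul, norm_ee, one_mul, sub_zero, ← div_eq_mul_inv,
    le_div_iff₀ (by positivity)]
  calc ‖p x ξ‖ * ‖fourier u ξ‖ * (1 + ‖ξ‖) ^ (n + 1)
      ≤ A * (1 + ‖ξ‖) ^ m.toNat * ‖fourier u ξ‖ * (1 + ‖ξ‖) ^ (n + 1) := by gcongr
    _ = A * ((1 + ‖ξ‖) ^ (m.toNat + (n + 1)) * ‖fourier u ξ‖) := by rw [pow_add]; ring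
    _ ≤ A * C := by gcongr; exact hd ξ

theorem small_quantize {U V K : Set (E n)} (hU : IsOpen U) (hV : IsOpen V) (hK : IsCompact K)
    (hVK : V ⊆ K) (hKU : K ⊆ U) {m : ℤ} {p : E n → E n → ℂ}
    {q : ℕ → E n → E n → ℂ} (hp : IsSymbol U m p q) {u : ℝ → E n → ℂ}
    (hu : ∀ h ∈ Ioc (0 : ℝ) 1, Continuous (u h))
    (hd : ∀ M N : ℕ, ∃ C : ℝ, ∀ h ∈ Ioc (0 : ℝ) 1, ∀ ξ,
      (1 + ‖ξ‖) ^ M * ‖fourier (u h) ξ‖ ≤ C * h ^ N) (N : ℕ) :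
    Small V N (fun h => quantize p (u h)) := by
  choose A hA0 hA using hp.bound_zero hU hK hKU
  choose C hC using hd
  set I₀ : ℝ := ∫ ξ : E n, ((1 + ‖ξ - 0‖) ^ (n + 1))⁻¹ with hI₀
  have key : ∀ h ∈ Ioc (0 : ℝ) 1,
      ContDiffOn ℝ ∞ (fun x => ∫ ξ, fourier (u h) ξ * (ee x ξ * p x ξ)) V ∧
      ∀ k : ℕ, ∀ x ∈ V, ‖iteratedFDeriv ℝ k
        (fun x => ∫ ξ, fourier (u h) ξ * (ee x ξ * p x ξ)) x‖ ≤
        ∫ ξ : E n, (2 ^ k * A k * (C (k + m.toNat + (n + 1)) N * h ^ N)) *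
          ((1 + ‖ξ - 0‖) ^ (n + 1))⁻¹ := by
    intro h hh
    refine contDiffOn_integral_mul_of_contDiffOn_prod (μ := (volume : Measure (E n))) hV
      isOpen_univ (Eventually.of_forall fun _ => mem_univ _)
      (G := fun z : E n × E n => ee z.1 z.2 * p z.1 z.2)
      (contDiff_ee.contDiffOn.mul (hp.1.mono (prod_mono_left (hVK.trans hKU))))
      (w := fourier (u h)) (stronglyMeasurable_fourier (hu h hh)).aestronglyMeasurable
      (β := fun k ξ => (2 ^ k * A k * (C (k + m.toNat + (n + 1)) N * h ^ N)) *
          ((1 + ‖ξ - 0‖) ^ (n + 1))⁻¹)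
      (fun k => (integrable_one_add_norm_pow (0 : E n)).const_mul _) (fun k ξ _ x hx => ?_)
    have hsl : ContDiffOn ℝ ∞ (fun x => p x ξ) V :=
      hp.1.comp (f := fun x => (x, ξ)) (by fun_prop) fun x hx => ⟨hKU (hVK hx), mem_univ _⟩
    have h1 := norm_iteratedFDeriv_ee_mul_le hV hsl 1 0 ξ hx (k := k)
      (C := A k * (1 + ‖ξ‖) ^ m.toNat) fun i hi => hA k i hi x (hVK hx) ξ
    simp only [one_smul, sub_zero, abs_one, one_mul] at h1
    rw [← div_eq_mul_inv, le_div_iff₀ (by positivity), sub_zero]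
    have h2 := hC (k + m.toNat + (n + 1)) N h hh ξ
    have := hA0 k
    calc _ ≤ ‖fourier (u h) ξ‖ * ((2 * (1 + ‖ξ‖)) ^ k * (A k * (1 + ‖ξ‖) ^ m.toNat)) *
          (1 + ‖ξ‖) ^ (n + 1) := by gcongr
      _ = 2 ^ k * A k * ((1 + ‖ξ‖) ^ (k + m.toNat + (n + 1)) * ‖fourier (u h) ξ‖) := by
          rw [pow_add, pow_add, mul_pow]; ring
      _ ≤ _ := by gcongr
  have hs : Small V N (fun h x => ∫ ξ, fourier (u h) ξ * (ee x ξ * p x ξ)) := by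
    refine ⟨fun h hh => (key h hh).1, fun k => ⟨2 ^ k * A k *
      |C (k + m.toNat + (n + 1)) N| * I₀, fun h hh x hx => ((key h hh).2 k x hx).trans ?_⟩⟩
    rw [integral_const_mul, ← hI₀]
    have hI0 : 0 ≤ I₀ := integral_nonneg fun x => by positivity
    have h3 : h ^ N ≤ h ^ ((N : ℤ) - k) := by
      rw [← zpow_natCast]; exact zpow_le_zpow_of_le_one hh (by omega)
    have := hA0 k
    have hh0 := hh.1
    calc _ ≤ 2 ^ k * A k * (|C (k + m.toNat + (n + 1)) N| * h ^ ((N : ℤ) - k)) * I₀ := by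
          gcongr
          exact le_abs_self _
      _ = _ := by ring
  refine (hs.smul hV (cn n)).congr hV fun h _ x _ => ?_
  beta_reduce
  rw [quantize_eq]
  congr 2
  ext ξ
  ring

end RiemPsiDO

end

noncomputable section
namespace RiemPsiDO
open Set Filter Topology

variable {n : ℕ}

/-! ### Operators with smooth kernels applied to packets -/

/-- Multiplication of profiles by a function which is smooth away from the origin. -/
def TestSym.mulL (p : E n → ℂ) (hp : ContDiffOn ℝ ∞ p {0}ᶜ) : Module.End ℂ (TestSym n) where
  toFun f := ⟨fun ξ => p ξ * (f : E n → ℂ) ξ, TestSym.mul_mem hp f.2⟩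
  map_add' f g := by ext ξ; simp [mul_add]
  map_smul' c f := by ext ξ; simp [mul_left_comm]

theorem TestSym.mulL_apply (p : E n → ℂ) (hp : ContDiffOn ℝ ∞ p {0}ᶜ) (f : TestSym n) (ξ : E n) :
    (TestSym.mulL p hp f : E n → ℂ) ξ = p ξ * (f : E n → ℂ) ξ := rfl

theorem ee_comm (z ζ : E n) : ee z ζ = ee ζ z := by
  rw [ee, ee, real_inner_comm]

theorem dd_packet (y₀ : E n) (h : ℝ) (f : TestSym n) (i : Fin n) (y : E n) :
    dd (e i) (packet y₀ h f) y = Complex.I * (h : ℂ)⁻¹ *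
      packet y₀ h (TestSym.mulL _ (contDiff_coord i).contDiffOn f) y := by
  have hs : ContDiff ℝ ∞ (fun z : E n × E n => ee (h⁻¹ • (z.1 - y₀)) z.2 * (f : E n → ℂ) z.2) :=
    (contDiff_ee.comp (by fun_prop : ContDiff ℝ ∞ fun z : E n × E n =>
        (h⁻¹ • (z.1 - y₀), z.2))).mul (f.2.1.comp contDiff_snd)
  have h1 := contDiffOn_integral_of_support (n := n) (Y := E n) isOpen_univ f.2.2.1 isOpen_univ
    (fun _ _ _ _ => mem_univ _) hs.contDiffOn (fun x _ ζ hζ => by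
      simp [image_eq_zero_of_notMem_tsupport hζ])
  have hd : DifferentiableAt ℝ (fun x => ∫ ζ, ee (h⁻¹ • (x - y₀)) ζ * (f : E n → ℂ) ζ) y :=
    differentiableAt_of_contDiffOn isOpen_univ h1.1 (mem_univ y)
  have e1 : dd (e i) (packet y₀ h f) y = cn n *
      dd (e i) (fun x => ∫ ζ, ee (h⁻¹ • (x - y₀)) ζ * (f : E n → ℂ) ζ) y :=
    dd_const_mul hd _ _
  have e2 : dd (e i) (fun x => ∫ ζ, ee (h⁻¹ • (x - y₀)) ζ * (f : E n → ℂ) ζ) y =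
      ∫ ζ, fderiv ℝ (fun x => ee (h⁻¹ • (x - y₀)) ζ * (f : E n → ℂ) ζ) y (e i) :=
    h1.2 y (mem_univ y) (e i)
  have e3 : ∀ ζ, fderiv ℝ (fun x => ee (h⁻¹ • (x - y₀)) ζ * (f : E n → ℂ) ζ) y (e i) =
      Complex.I * (h : ℂ)⁻¹ * (ee (h⁻¹ • (y - y₀)) ζ * ((ζ i : ℂ) * (f : E n → ℂ) ζ)) := by
    intro ζ
    have e4 : ∀ x, ee (h⁻¹ • (x - y₀)) ζ * (f : E n → ℂ) ζ =
        (ee (h⁻¹ • ζ) (-y₀) * (f : E n → ℂ) ζ) * ee (h⁻¹ • ζ) x := by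
      intro x
      rw [ee_smul_left, ee_comm, sub_eq_add_neg, ee_add_right]
      ring
    simp_rw [e4]
    refine (dd_const_mul ((contDiff_ee_right (h⁻¹ • ζ)).differentiable (by simp) y) _ _).trans ?_
    rw [dd_ee]
    have e5 := e4 y
    simp
    linear_combination (-(Complex.I * (h : ℂ)⁻¹ * (ζ i : ℂ))) * e5
  rw [e1, e2]
  simp_rw [e3]
  rw [integral_const_mul, packet]
  simp only [TestSym.mulL_apply]
  ring

theorem contDiffOn_coord_div (i : Fin n) :
    ContDiffOn ℝ ∞ (fun ζ : E n => (ζ i : ℂ) * (((‖ζ‖ ^ 2 : ℝ) : ℂ))⁻¹) {0}ᶜ := by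
  refine (contDiff_coord i).contDiffOn.mul (ContDiffOn.inv ?_ fun ζ hζ => ?_)
  · exact (Complex.ofRealCLM.contDiff.comp (contDiff_norm_sq ℝ)).contDiffOn
  · have : ζ ≠ 0 := hζ
    simpa using this

/-- A packet is a sum of derivatives of packets. -/
theorem packet_eq_sum_dd (y₀ : E n) {h : ℝ} (hh : 0 < h) (f : TestSym n) (y : E n) :
    packet y₀ h f y = ∑ i, (-Complex.I * h) *
      dd (e i) (packet y₀ h (TestSym.mulL _ (contDiffOn_coord_div i) f)) y := by
  have hh' : (h : ℂ) ≠ 0 := by exact_mod_cast hh.ne'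
  have h1 : f = ∑ i, TestSym.mulL _ (contDiff_coord i).contDiffOn
      (TestSym.mulL _ (contDiffOn_coord_div i) f) := by
    ext ζ
    rw [AddSubmonoidClass.coe_finsetSum, Finset.sum_apply]
    simp only [TestSym.mulL_apply]
    by_cases h0 : ζ = 0
    · simp [h0, f.2.2.2.eq_of_nhds]
    · have h2 : ((‖ζ‖ ^ 2 : ℝ) : ℂ) = ∑ i, (ζ i : ℂ) * (ζ i : ℂ) := by
        rw [EuclideanSpace.norm_sq_eq]
        push_cast
        refine Finset.sum_congr rfl fun i _ => ?_
        rw [← sq]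
        exact_mod_cast congrArg ((↑) : ℝ → ℂ) (sq_abs (ζ i))
      have h3 : ((‖ζ‖ ^ 2 : ℝ) : ℂ) ≠ 0 := by simpa using h0
      have h4 : ∀ i, (ζ i : ℂ) * ((ζ i : ℂ) * (((‖ζ‖ ^ 2 : ℝ) : ℂ))⁻¹ * (f : E n → ℂ) ζ) =
          (ζ i : ℂ) * (ζ i : ℂ) * ((((‖ζ‖ ^ 2 : ℝ) : ℂ))⁻¹ * (f : E n → ℂ) ζ) := fun i => by ring
      simp_rw [h4]
      rw [← Finset.sum_mul, ← h2, mul_inv_cancel_left₀ h3]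
  conv_lhs => rw [h1]
  rw [← packetL_apply, map_sum]
  refine Finset.sum_congr rfl fun i _ => ?_
  rw [dd_packet, packetL_apply]
  have : (-Complex.I * (h : ℂ)) * (Complex.I * (h : ℂ)⁻¹) = 1 := by
    field_simp
    simp
  rw [← mul_assoc, this, one_mul]

/-- Smooth kernels applied to packets give negligible functions. -/
theorem small_integral_packet {U V K B : Set (E n)} (hU : IsOpen U) (hV : IsOpen V)
    (hK : IsCompact K) (hVK : V ⊆ K) (hKU : K ⊆ U) (hB : IsCompact B) (y₀ : E n) (N : ℕ) :
    ∀ (G : E n × E n → ℂ), ContDiffOn ℝ ∞ G (U ×ˢ univ) →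
      (∀ x ∈ U, ∀ y ∉ B, G (x, y) = 0) → ∀ f : TestSym n,
      Small V N (fun h x => ∫ y, packet y₀ h f y * G (x, y)) := by
  have hU' : IsOpen (U ×ˢ (univ : Set (E n))) := hU.prod isOpen_univ
  induction N with
  | zero =>
    intro G hG hs f
    obtain ⟨A, hA, hAb⟩ := packet_decay y₀ f 0 0
    have hb : ∀ k : ℕ, ∃ C : ℝ, ∀ z ∈ K ×ˢ B,
        ‖iteratedFDeriv ℝ k (fun x => G (x, z.2)) z.1‖ ≤ C := fun k =>
      (hK.prod hB).exists_bound_of_continuousOn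
        ((continuousOn_iteratedFDeriv_slice k hU' hG).mono (prod_mono hKU (subset_univ _)))
    choose C hC using hb
    have key : ∀ h ∈ Ioc (0 : ℝ) 1, _ := fun h hh =>
      contDiffOn_integral_mul_of_contDiffOn_prod (μ := (volume : Measure (E n))) hV
        isOpen_univ (Eventually.of_forall fun _ => mem_univ _)
        (hG.mono (prod_mono_left (hVK.trans hKU))) (w := packet y₀ h f)
        (contDiff_packet y₀ h f).continuous.aestronglyMeasurable
        (β := fun k => B.indicator fun _ => A * |C k|)
        (fun k => (integrableOn_const hB.measure_lt_top.ne).integrable_indicator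
          hB.measurableSet) (fun k y _ x hx => by
        by_cases hy : y ∈ B
        · rw [indicator_of_mem hy]
          have h1 := hAb h hh.1 y
          simp only [pow_zero, one_mul, norm_iteratedFDeriv_zero, Nat.cast_zero, sub_self,
            zpow_zero, mul_one] at h1
          exact mul_le_mul h1 ((hC k (x, y) ⟨hVK hx, hy⟩).trans (le_abs_self _))
            (norm_nonneg _) hA
        · rw [indicator_of_notMem hy]
          have e2 : (fun x => G (x, y)) =ᶠ[𝓝 x] fun _ => 0 := by
            filter_upwards [hV.mem_nhds hx] with x hx
            exact hs x (hKU (hVK hx)) y hy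
          rw [(e2.iteratedFDeriv ℝ k).eq_of_nhds]
          simp)
    refine ⟨fun h hh => (key h hh).1, fun k => ⟨∫ y, B.indicator (fun _ => A * |C k|) y,
      fun h hh x hx => ((key h hh).2 k x hx).trans ?_⟩⟩
    refine le_mul_of_one_le_right (integral_nonneg fun y => ?_) ?_
    · exact indicator_nonneg (fun _ _ => by positivity) y
    · have := zpow_le_zpow_of_le_one hh (show ((0 : ℕ) : ℤ) - k ≤ 0 by simp)
      simpa using this
  | succ N ih =>
    intro G hG hs f
    have hsl : ∀ x ∈ U, ContDiff ℝ ∞ (fun y => G (x, y)) := fun x hx => by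
      rw [← contDiffOn_univ]
      exact hG.comp (by fun_prop) fun y _ => ⟨hx, mem_univ _⟩
    have hcs : ∀ x ∈ U, HasCompactSupport (fun y => G (x, y)) := fun x hx =>
      HasCompactSupport.intro hB (hs x hx)
    have h1 : ∀ i, Small V (N + 1 : ℕ) (fun h x => (Complex.I * h) * ∫ y,
        packet y₀ h (TestSym.mulL _ (contDiffOn_coord_div i) f) y * dd (0, e i) G (x, y)) := by
      intro i
      have := (ih (dd (0, e i) G) (contDiffOn_dd hU' hG _) (fun x hx y hy =>
        dd_eq_zero (hU.prod hB.isClosed.isOpen_compl) (fun z hz => hs z.1 hz.1 z.2 hz.2) _ (x, y)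
          ⟨hx, hy⟩) (TestSym.mulL _ (contDiffOn_coord_div i) f)).const_mul hV (a := 1)
          (c := fun h => Complex.I * h) (A := 1) (fun h hh => by
            rw [norm_mul, Complex.norm_I, Complex.norm_real, Real.norm_of_nonneg hh.1.le]; simp)
      exact_mod_cast this
    refine (Small.sum hV Finset.univ fun i _ => h1 i).congr hV fun h hh x hx => ?_
    have hxU := hKU (hVK hx)
    have e1 : ∀ y, packet y₀ h f y * G (x, y) = ∑ i, (-Complex.I * h) *
        (dd (e i) (packet y₀ h (TestSym.mulL _ (contDiffOn_coord_div i) f)) y * G (x, y)) := by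
      intro y
      rw [packet_eq_sum_dd y₀ hh.1, Finset.sum_mul]
      exact Finset.sum_congr rfl fun i _ => by ring
    simp_rw [e1]
    rw [integral_finsetSum]
    · refine Finset.sum_congr rfl fun i _ => ?_
      have h2 := integral_mul_dd isOpen_univ
        (contDiff_packet y₀ h (TestSym.mulL _ (contDiffOn_coord_div i) f)).contDiffOn (hsl x hxU)
        (hcs x hxU) (subset_univ _) (e i)
      rw [integral_const_mul, ← neg_eq_iff_eq_neg.2 h2]
      have e2 : ∀ y, dd (e i) (fun y => G (x, y)) y = dd (0, e i) G (x, y) := fun y =>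
        dd_slice_right (b := G) (z := (x, y))
          (differentiableAt_of_contDiffOn hU' hG ⟨hxU, mem_univ _⟩) (e i)
      simp_rw [e2]
      ring
    · intro i _
      exact (integrable_mul_of_tsupport_subset isOpen_univ (contDiff_dd
        (contDiff_packet y₀ h (TestSym.mulL _ (contDiffOn_coord_div i) f)) (e i)).contDiffOn
        (hsl x hxU) (hcs x hxU) (subset_univ _)).const_mul _

/-! ### Pseudodifferential operators applied to packets -/

/-- Multiplication of profiles by a symbol. -/
def mulAmp (q : E n → E n → ℂ) : TestSym n →ₗ[ℂ] (E n × E n → ℂ) where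
  toFun f z := q z.1 z.2 * (f : E n → ℂ) z.2
  map_add' f g := by ext z; simp [mul_add]
  map_smul' c f := by ext z; simp [mul_left_comm]

/-- The action on profiles of the pseudodifferential operator with symbol `∑ q_j`. -/
def symSeries {U : Set (E n)} (hU : IsOpen U) {y₀ : E n} (hy : y₀ ∈ U) (q : ℕ → E n → E n → ℂ)
    (hq : ∀ j, ContDiffOn ℝ ∞ (fun z : E n × E n => q j z.1 z.2) (U ×ˢ {0}ᶜ)) :
    PowerSeries (Module.End ℂ (TestSym n)) :=
  PowerSeries.mk fun k => ∑ p ∈ Finset.HasAntidiagonal.antidiagonal k,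
    ampEnd hU hy (mulAmp (q p.1)) (fun f => IsAmp.mul_testSym hU (hq p.1) f.2) p.2

theorem amp_sub {V : Set (E n)} {b c : E n × E n → ℂ} (hb : IsAmp V b) (hc : IsAmp V c) {x : E n}
    (hx : x ∈ V) (y₀ : E n) (h : ℝ) :
    amp y₀ h (fun z => b z - c z) x = amp y₀ h b x - amp y₀ h c x := by
  simp only [amp]
  rw [← mul_sub, ← integral_sub (integrable_ee_mul _ ⟨_, hb.slice_mem hx⟩)
    (integrable_ee_mul _ ⟨_, hc.slice_mem hx⟩)]
  simp only [mul_sub]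

theorem amp_sum {ι : Type*} {V : Set (E n)} (s : Finset ι) {b : ι → E n × E n → ℂ}
    (hb : ∀ i ∈ s, IsAmp V (b i)) (c : ι → ℂ) {x : E n} (hx : x ∈ V) (y₀ : E n) (h : ℝ) :
    amp y₀ h (fun z => ∑ i ∈ s, c i * b i z) x = ∑ i ∈ s, c i * amp y₀ h (b i) x := by
  simp only [amp, Finset.mul_sum]
  rw [integral_finsetSum, Finset.mul_sum]
  · refine Finset.sum_congr rfl fun i _ => ?_
    simp_rw [mul_left_comm _ (c i)]
    rw [integral_const_mul, mul_left_comm]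
  · intro i hi
    simp_rw [mul_left_comm _ (c i)]
    exact (integrable_ee_mul _ ⟨_, (hb i hi).slice_mem hx⟩).const_mul _

theorem hasExp_amp_symbol {U : Set (E n)} (hU : IsOpen U) {y₀ : E n} (hy : y₀ ∈ U) {ρ : ℝ}
    (hρ : 0 < ρ) (hball : Metric.ball y₀ (2 * ρ) ⊆ U) {m : ℤ} {p : E n → E n → ℂ}
    {q : ℕ → E n → E n → ℂ} (hp : IsSymbol U m p q) (f : TestSym n) :
    HasExp (Metric.ball y₀ ρ) y₀ (-m)
      (fun k => PowerSeries.coeff k (symSeries hU hy q fun j => (hp.2.1 j).1) f)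
      (fun h => amp y₀ h (fun z => p z.1 (h⁻¹ • z.2) * (f : E n → ℂ) z.2)) := by
  set V := Metric.ball y₀ ρ with hVdef
  set K := Metric.closedBall y₀ ρ
  set W := Metric.ball y₀ (2 * ρ)
  have hV : IsOpen V := Metric.isOpen_ball
  have hK : IsCompact K := isCompact_closedBall _ _
  have hVK : V ⊆ K := Metric.ball_subset_closedBall
  have hKW : K ⊆ W := Metric.closedBall_subset_ball (by linarith)
  have hKU : K ⊆ U := hKW.trans hball
  have hW : IsOpen W := Metric.isOpen_ball
  have hWc : Convex ℝ W := convex_ball _ _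
  have hyW : y₀ ∈ W := Metric.mem_ball_self (by positivity)
  have hq := fun j => (hp.2.1 j).1
  have hqW : ∀ j, IsAmp W (mulAmp (q j) f) := fun j =>
    (IsAmp.mul_testSym hU (hq j) f.2).mono hball
  have hpf : ∀ h ∈ Ioc (0 : ℝ) 1, IsAmp U (fun z => p z.1 (h⁻¹ • z.2) * (f : E n → ℂ) z.2) :=
    fun h hh => IsAmp.mul_testSym (q := fun x ζ => p x (h⁻¹ • ζ)) hU
      (hp.1.comp (f := fun z : E n × E n => (z.1, h⁻¹ • z.2)) (by fun_prop)
        fun z hz => ⟨hz.1, mem_univ _⟩) f.2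
  have hbind := HasExp.bind (n := n) hV (y₀ := y₀) (μ := -m) (ν := 0) (L := 0)
    (w := fun h => amp y₀ h (fun z => p z.1 (h⁻¹ • z.2) * (f : E n → ℂ) z.2))
    (w' := fun j h => amp y₀ h (mulAmp (q j) f)) (g := fun j => ampCoeff hW hyW (hqW j)) ?_
    (fun j => hasExp_amp hW hWc hyW hV hK hVK hKW (hqW j))
  · rw [add_zero] at hbind
    convert hbind using 2 with k
    rw [symSeries, PowerSeries.coeff_mk, LinearMap.sum_apply]
    refine Finset.sum_congr rfl fun p _ => ?_
    rfl
  · intro N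
    set B := tsupport (f : E n → ℂ) with hBdef
    have hB : IsCompact B := f.2.2.1
    have h0B : (0 : E n) ∉ B := fun h => TestSym.tsupport_subset f.2 h rfl
    obtain ⟨c, hc, hcB⟩ : ∃ c : ℝ, 0 < c ∧ ∀ ζ ∈ B, c ≤ ‖ζ‖ := by
      obtain ⟨c, hc, hcB⟩ := Metric.isOpen_iff.1 hB.isClosed.isOpen_compl 0 h0B
      refine ⟨c, hc, fun ζ hζ => not_lt.1 fun h => hcB (mem_ball_zero_iff.2 h) hζ⟩
    set b : ℝ → E n × E n → ℂ := fun h z => (p z.1 (h⁻¹ • z.2) -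
      ∑ j ∈ Finset.range N, q j z.1 (h⁻¹ • z.2)) * (f : E n → ℂ) z.2 with hb
    have hbs : ∀ h ∈ Ioc (0 : ℝ) 1, IsAmp U (b h) := fun h hh =>
      IsAmp.mul_testSym (q := fun x ζ => p x (h⁻¹ • ζ) - ∑ j ∈ Finset.range N, q j x (h⁻¹ • ζ)) hU
      ((hp.contDiffOn_sub N).comp (f := fun z : E n × E n => (z.1, h⁻¹ • z.2)) (by fun_prop)
        fun z hz => ⟨hz.1, smul_ne_zero (inv_ne_zero hh.1.ne') hz.2⟩) f.2
    obtain ⟨R, hR⟩ := hB.exists_bound_of_continuousOn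
      (f := fun ζ => (‖ζ‖ ^ (m - N) : ℝ) * (f : E n → ℂ) ζ) (by
        refine ContinuousOn.mul ?_ f.2.1.continuous.continuousOn
        refine Complex.continuous_ofReal.comp_continuousOn ?_
        exact ContinuousOn.zpow₀ continuous_norm.continuousOn _
          fun ζ hζ => Or.inl (norm_ne_zero_iff.2 (TestSym.tsupport_subset f.2 hζ)))
    have hsm : Small V (-m + N) (fun h => amp y₀ h (b h)) := by
      refine Small.amp hV hB (fun h hh => (hbs h hh).smooth.mono
        (prod_mono_left (hVK.trans hKU))) (fun h hh x hx ζ hζ => ?_) (fun k => ?_) y₀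
      · simp [hb, image_eq_zero_of_notMem_tsupport hζ]
      · obtain ⟨C, hC0, hC⟩ := hp.bound hU hK hKU hc N k
        refine ⟨C * R, fun h hh x hx ζ hζ => ?_⟩
        have hh0 := hh.1
        have h1 : c ≤ ‖h⁻¹ • ζ‖ := by
          rw [norm_smul, Real.norm_of_nonneg (inv_pos.2 hh0).le]
          exact (hcB ζ hζ).trans (le_mul_of_one_le_left (norm_nonneg _)
            ((one_le_inv₀ hh0).2 hh.2))
        have h2 := hC x (hVK hx) _ h1
        have h3 : (fun x => b h (x, ζ)) = (f : E n → ℂ) ζ • fun x => p x (h⁻¹ • ζ) -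
            ∑ j ∈ Finset.range N, q j x (h⁻¹ • ζ) := by
          ext x; simp [hb, mul_comm]
        have hne : h⁻¹ • ζ ≠ 0 := norm_pos_iff.1 (hc.trans_le h1)
        have hsl : ContDiffOn ℝ ∞ (fun x => p x (h⁻¹ • ζ) -
            ∑ j ∈ Finset.range N, q j x (h⁻¹ • ζ)) U :=
          (hp.contDiffOn_sub N).comp (f := fun x => (x, h⁻¹ • ζ)) (by fun_prop)
            fun x hx => ⟨hx, hne⟩
        rw [h3, iteratedFDeriv_const_smul_apply
          (contDiffAt_nat_of_contDiffOn hU hsl (hKU (hVK hx)) k), norm_smul]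
        have h4 := hR ζ hζ
        rw [norm_mul, Complex.norm_real, Real.norm_of_nonneg (zpow_nonneg (norm_nonneg _) _)] at h4
        have h5 : ‖h⁻¹ • ζ‖ ^ (m - (N : ℤ)) = h ^ (-m + (N : ℤ)) * ‖ζ‖ ^ (m - (N : ℤ)) := by
          rw [norm_smul, Real.norm_of_nonneg (inv_pos.2 hh0).le, mul_zpow, inv_zpow, ← zpow_neg]
          congr 2
          ring
        rw [h5] at h2
        calc _ ≤ ‖(f : E n → ℂ) ζ‖ * (C * (h ^ (-m + (N : ℤ)) * ‖ζ‖ ^ (m - (N : ℤ)))) := by gcongr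
          _ = C * h ^ (-m + (N : ℤ)) * (‖ζ‖ ^ (m - (N : ℤ)) * ‖(f : E n → ℂ) ζ‖) := by ring
          _ ≤ C * h ^ (-m + (N : ℤ)) * R := by gcongr
          _ = _ := by ring
    refine (hsm.mono subset_rfl (by push_cast; omega)).congr hV fun h hh x hx => ?_
    have hxU := hKU (hVK hx)
    have hh0 : (h : ℂ) ≠ 0 := by exact_mod_cast hh.1.ne'
    beta_reduce
    have hq' : ∀ j, IsAmp U (mulAmp (q j) f) := fun j => IsAmp.mul_testSym hU (hq j) f.2
    rw [← amp_sum (V := U) (Finset.range N) (b := fun j => mulAmp (q j) f) (fun j _ => hq' j)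
      (fun j => (h : ℂ) ^ (-m + (j : ℤ))) hxU, ← amp_sub (hpf h hh) (IsAmp.sum _ fun j _ =>
        (hq' j).const_mul _) hxU]
    simp only [amp]
    congr 1
    refine integral_congr_ae (Eventually.of_forall fun ζ => ?_)
    simp only [hb, mulAmp, LinearMap.coe_mk, AddHom.coe_mk]
    congr 1
    by_cases hζ : ζ = 0
    · simp [hζ, f.2.2.2.eq_of_nhds]
    · rw [sub_mul, Finset.sum_mul]
      congr 1
      refine Finset.sum_congr rfl fun j _ => ?_
      rw [(hp.2.1 j).2 x hxU ζ hζ h⁻¹ (inv_pos.2 hh.1)]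
      push_cast
      rw [inv_zpow, ← zpow_neg, mul_assoc]
      congr 2
      ring

theorem bound_of_hasCompactSupport {χ : E n → ℂ} (hχ : ContDiff ℝ ∞ χ) (hc : HasCompactSupport χ)
    (k : ℕ) : ∃ C : ℝ, ∀ x, ‖iteratedFDeriv ℝ k χ x‖ ≤ C :=
  (hc.iteratedFDeriv k).exists_bound_of_continuous
    (hχ.continuous_iteratedFDeriv (by exact_mod_cast le_top))

theorem bound_sub_one {χ : E n → ℂ} (hχ : ContDiff ℝ ∞ χ) (hc : HasCompactSupport χ)
    (k : ℕ) : ∃ C : ℝ, ∀ x ∈ univ, ‖iteratedFDeriv ℝ k (fun x => χ x - 1) x‖ ≤ C := by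
  have hone : Small univ 0 (fun (_ : ℝ) (_ : E n) => (1 : ℂ)) :=
    Small.of_bound contDiffOn_const fun k => ⟨1, fun x _ => by
      rcases Nat.eq_zero_or_pos k with rfl | hk
      · simp
      · simp [iteratedFDeriv_const_of_ne hk.ne']⟩
  have hs := Small.of_bound (V := univ) hχ.contDiffOn fun k => by
    simpa using bound_of_hasCompactSupport hχ hc k
  obtain ⟨C, hC⟩ := (hs.sub isOpen_univ hone).2 k
  exact ⟨C * 1 ^ ((0 : ℤ) - k), fun x hx => hC 1 ⟨one_pos, le_rfl⟩ x hx⟩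

/-- A pseudodifferential operator applied to a localized packet. -/
theorem hasExp_quantize {U : Set (E n)} (hU : IsOpen U) {y₀ : E n} (hy : y₀ ∈ U) {ρ : ℝ}
    (hρ : 0 < ρ) (hball : Metric.ball y₀ (2 * ρ) ⊆ U) {m : ℤ} {p : E n → E n → ℂ}
    {q : ℕ → E n → E n → ℂ} (hp : IsSymbol U m p q) {χ : E n → ℂ} (hχ : ContDiff ℝ ∞ χ)
    (hχc : HasCompactSupport χ) (hχ1 : χ =ᶠ[𝓝 y₀] 1) (f : TestSym n) :
    HasExp (Metric.ball y₀ ρ) y₀ (-m)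
      (fun k => PowerSeries.coeff k (symSeries hU hy q fun j => (hp.2.1 j).1) f)
      (fun h => quantize p (fun y => χ y * packet y₀ h f y)) := by
  have hV : IsOpen (Metric.ball y₀ ρ) := Metric.isOpen_ball
  have hK : IsCompact (Metric.closedBall y₀ ρ) := isCompact_closedBall _ _
  have hKU : Metric.closedBall y₀ ρ ⊆ U :=
    (Metric.closedBall_subset_ball (by linarith)).trans hball
  set u : ℝ → E n → ℂ := fun h y => (χ y - 1) * packet y₀ h f y with hu
  have hus : ∀ h, ContDiff ℝ ∞ (u h) := fun h =>
    (hχ.sub contDiff_const).mul (contDiff_packet y₀ h f)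
  have hdec := mul_packet_decay (n := n) isOpen_univ (y₀ := y₀) (θ := fun x => χ x - 1)
    (hχ.sub contDiff_const).contDiffOn (bound_sub_one hχ hχc)
    (by filter_upwards [hχ1] with x hx; simp [hx]) f
  have hd : ∀ M N : ℕ, ∃ C : ℝ, ∀ h ∈ Ioc (0 : ℝ) 1, ∀ ξ,
      (1 + ‖ξ‖) ^ M * ‖fourier (u h) ξ‖ ≤ C * h ^ N := by
    intro M N
    obtain ⟨C, hC0, hC⟩ := fourier_decay y₀ M
    choose A hA0 hA using fun j => hdec j (n + 1) N
    refine ⟨C * ∑ j ∈ Finset.range (M + 1), A j, fun h hh ξ => ?_⟩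
    rw [mul_assoc]
    refine hC (u h) _ (hus h) (fun j hj x => (hA j h hh x (mem_univ _)).trans ?_) ξ
    have := hh.1
    gcongr
    exact Finset.single_le_sum (fun j _ => hA0 j) (Finset.mem_range.2 (Nat.lt_succ_of_le hj))
  have hsm := small_quantize hU hV hK Metric.ball_subset_closedBall hKU hp (u := u)
    (fun h _ => (hus h).continuous) hd
  refine (hasExp_amp_symbol hU hy hρ hball hp f).add_small hV fun N =>
    (hsm N).congr hV fun h hh x hx => ?_
  have hxU := hKU (Metric.ball_subset_closedBall hx)
  beta_reduce
  rw [← quantize_packet p y₀ hh.1 f x]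
  have hpi : Integrable (packet y₀ h f) := by
    obtain ⟨A, hA0, hA⟩ := packet_decay y₀ f 0 (n + 1)
    obtain ⟨A', hA0', hA'⟩ := packet_decay y₀ f 0 0
    refine ((integrable_one_add_norm_pow y₀).const_mul (2 ^ (n + 1) *
      (A' + A * h ^ (((n + 1 : ℕ) : ℤ) - (0 : ℕ))))).mono'
      (contDiff_packet y₀ h f).continuous.aestronglyMeasurable (Eventually.of_forall fun y => ?_)
    have h1 := hA h hh.1 y
    have h2 := hA' h hh.1 y
    rw [norm_iteratedFDeriv_zero] at h1 h2
    simp only [pow_zero, one_mul, Nat.cast_zero, sub_self, zpow_zero, mul_one] at h2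
    rw [← div_eq_mul_inv, le_div_iff₀ (by positivity), mul_comm]
    calc _ ≤ 2 ^ (n + 1) * (1 + ‖y - y₀‖ ^ (n + 1)) * ‖packet y₀ h f y‖ :=
          mul_le_mul_of_nonneg_right (one_add_pow_le (norm_nonneg _) _) (norm_nonneg _)
      _ = 2 ^ (n + 1) * (‖packet y₀ h f y‖ + ‖y - y₀‖ ^ (n + 1) * ‖packet y₀ h f y‖) := by ring
      _ ≤ _ := mul_le_mul_of_nonneg_left (add_le_add h2 h1) (by positivity)
  have hee : ∀ ξ, Continuous fun y : E n => ee (-y) ξ := fun ξ =>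
    continuous_ee.comp (continuous_neg.prodMk continuous_const)
  have hci : Integrable (fun y => χ y * packet y₀ h f y) :=
    (hχ.continuous.mul (contDiff_packet y₀ h f).continuous).integrable_of_hasCompactSupport
      hχc.mul_right
  have hmul : ∀ {v : E n → ℂ}, Integrable v → ∀ ξ, Integrable (fun y => ee (-y) ξ * v y) := by
    intro v hv ξ
    exact hv.bdd_mul (c := 1) (hee ξ).aestronglyMeasurable
      (Eventually.of_forall fun y => (norm_ee _ _).le)
  have hfo : ∀ ξ, fourier (u h) ξ = fourier (fun y => χ y * packet y₀ h f y) ξ -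
      fourier (packet y₀ h f) ξ := by
    intro ξ
    rw [fourier_eq, fourier_eq, fourier_eq, ← integral_sub (hmul hci ξ) (hmul hpi ξ)]
    congr 1
    ext y
    simp only [hu]
    ring
  obtain ⟨C, hC⟩ := hd (m.toNat + (n + 1)) 0
  have hI1 := integrable_quantize hU hp hxU (hus h).continuous (C := C) fun ξ => by
    simpa using hC h hh ξ
  have hI2 : Integrable (fun ξ => ee x ξ * p x ξ * fourier (packet y₀ h f) ξ) := by
    have hps : ContDiff ℝ ∞ (p x) := contDiffOn_univ.1
      (hp.1.comp (f := fun ξ => (x, ξ)) (by fun_prop) fun ξ _ => ⟨hxU, mem_univ _⟩)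
    have : Continuous (fun ξ => ee x ξ * p x ξ * fourier (packet y₀ h f) ξ) := by
      refine ((contDiff_ee_right x).continuous.mul hps.continuous).mul ?_
      rw [show fourier (packet y₀ h f) = fun ξ => ee (-y₀) ξ * ((h : ℂ) ^ n *
        (f : E n → ℂ) (h • ξ)) from funext (fourier_packet y₀ hh.1 f)]
      exact (contDiff_ee_right _).continuous.mul (continuous_const.mul
        (f.2.1.continuous.comp (continuous_const_smul h)))
    refine this.integrable_of_hasCompactSupport (HasCompactSupport.mul_left ?_)
    rw [show fourier (packet y₀ h f) = fun ξ => ee (-y₀) ξ * ((h : ℂ) ^ n *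
        (f : E n → ℂ) (h • ξ)) from funext (fourier_packet y₀ hh.1 f)]
    refine HasCompactSupport.mul_left (HasCompactSupport.mul_left ?_)
    exact f.2.2.1.comp_homeomorph (Homeomorph.smulOfNeZero h hh.1.ne')
  rw [quantize_eq, quantize_eq, quantize_eq, ← mul_sub]
  congr 1
  rw [sub_eq_iff_eq_add, ← integral_add hI1 hI2]
  congr 1
  ext ξ
  rw [hfo]
  ring

end RiemPsiDO

end

noncomputable section
namespace RiemPsiDO
open Set Filter Topology

variable {n : ℕ}

/-! ### Change of variables in packets -/

/-- The adjoint, as a real linear map. -/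
def adjL (n : ℕ) : (E n →L[ℝ] E n) →L[ℝ] (E n →L[ℝ] E n) :=
  LinearMap.toContinuousLinearMap
    { toFun := ContinuousLinearMap.adjoint
      map_add' := map_add _
      map_smul' := by intro c x; simp }

theorem inner_adjL (T : E n →L[ℝ] E n) (x y : E n) :
    (inner ℝ (T x) y : ℝ) = inner ℝ x (adjL n T y) :=
  (ContinuousLinearMap.adjoint_inner_right T x y).symm

theorem det_adjL (T : E n →L[ℝ] E n) :
    LinearMap.det (adjL n T : E n →ₗ[ℝ] E n) = LinearMap.det (T : E n →ₗ[ℝ] E n) := by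
  have h1 : (adjL n T : E n →ₗ[ℝ] E n) = LinearMap.adjoint (T : E n →ₗ[ℝ] E n) := by
    rw [LinearMap.eq_adjoint_iff]
    intro x y
    exact ContinuousLinearMap.adjoint_inner_left T y x
  set b := EuclideanSpace.basisFun (Fin n) ℝ
  rw [h1, ← LinearMap.det_toMatrix b.toBasis, LinearMap.toMatrix_adjoint, Matrix.det_conjTranspose,
    LinearMap.det_toMatrix]
  simp

theorem contDiff_det : ContDiff ℝ ∞ (fun T : E n →L[ℝ] E n => LinearMap.det (T : E n →ₗ[ℝ] E n)) := by
  set b := EuclideanSpace.basisFun (Fin n) ℝ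
  have h1 : (fun T : E n →L[ℝ] E n => LinearMap.det (T : E n →ₗ[ℝ] E n)) = fun T =>
      ∑ σ : Equiv.Perm (Fin n), ((Equiv.Perm.sign σ : ℤ) : ℝ) * ∏ i, (T (b i)) (σ i) := by
    ext T
    rw [← LinearMap.det_toMatrix b.toBasis, Matrix.det_apply']
    refine Finset.sum_congr rfl fun σ _ => ?_
    congr 1
    refine Finset.prod_congr rfl fun i _ => ?_
    rw [LinearMap.toMatrix_apply]
    simp [b]
  rw [h1]
  refine ContDiff.sum fun σ _ => contDiff_const.mul (contDiff_prod fun i _ => ?_)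
  exact ((EuclideanSpace.proj (σ i) : E n →L[ℝ] ℝ).comp
    (ContinuousLinearMap.apply ℝ (E n) (b i))).contDiff

theorem integral_comp_equiv (A : E n ≃L[ℝ] E n) (g : E n → ℂ) :
    ∫ ζ, g (A ζ) = (|LinearMap.det ((A : E n →L[ℝ] E n) : E n →ₗ[ℝ] E n)|⁻¹ : ℝ) * ∫ η, g η := by
  have hdet : LinearMap.det ((A : E n →L[ℝ] E n) : E n →ₗ[ℝ] E n) ≠ 0 :=
    (LinearEquiv.isUnit_det' A.toLinearEquiv).ne_zero
  have h1 := Measure.map_linearMap_addHaar_eq_smul_addHaar (volume : Measure (E n)) hdet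
  have h2 : ∫ ζ, g (A ζ) = ∫ η, g η ∂(Measure.map A volume) :=
    (A.toHomeomorph.measurableEmbedding.integral_map g).symm
  have h3 : Measure.map A volume = Measure.map
    ((A : E n →L[ℝ] E n) : E n →ₗ[ℝ] E n) (volume : Measure (E n)) := rfl
  rw [h2, h3, h1, integral_smul_measure, ENNReal.toReal_ofReal (abs_nonneg _), abs_inv,
    Complex.real_smul]

/-- The averaged derivative of `κ` along the segment from `x₀` to `x`. -/
def avgDeriv (κ : E n → E n) (x₀ x : E n) : E n →L[ℝ] E n :=
  ∫ t in Icc (0 : ℝ) 1, fderiv ℝ κ (x₀ + t • (x - x₀))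

theorem contDiffOn_avgDeriv {κ : E n → E n} {W : Set (E n)} (hW : IsOpen W) (hc : Convex ℝ W)
    (hκ : ContDiffOn ℝ ∞ κ W) {x₀ : E n} (hx₀ : x₀ ∈ W) :
    ContDiffOn ℝ ∞ (avgDeriv κ x₀) W := by
  set Ω : Set (E n × ℝ) := (fun w => x₀ + w.2 • (w.1 - x₀)) ⁻¹' W
  have hΩ : IsOpen Ω := hW.preimage (by fun_prop)
  refine (contDiffOn_integral_of_isCompact (μ := (volume : Measure ℝ)) hW isCompact_Icc hΩ
    (fun x hx t ht => mem_of_segment hc hx₀ hx ht)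
    (G := fun w => fderiv ℝ κ (x₀ + w.2 • (w.1 - x₀))) ?_).1
  exact (hκ.fderiv_of_isOpen hW (m := ∞) (by simp)).comp (by fun_prop) fun w hw => hw

theorem avgDeriv_apply {κ : E n → E n} {W : Set (E n)} (hW : IsOpen W) (hc : Convex ℝ W)
    (hκ : ContDiffOn ℝ ∞ κ W) {x₀ x : E n} (hx₀ : x₀ ∈ W) (hx : x ∈ W) :
    avgDeriv κ x₀ x (x - x₀) = κ x - κ x₀ := by
  have hcont : ContinuousOn (fun t : ℝ => fderiv ℝ κ (x₀ + t • (x - x₀))) (Icc 0 1) :=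
    (hκ.fderiv_of_isOpen hW (m := ∞) (by simp)).continuousOn.comp (by fun_prop)
      fun t ht => mem_of_segment hc hx₀ hx ht
  have h_int : IntegrableOn (fun t : ℝ => fderiv ℝ κ (x₀ + t • (x - x₀))) (Icc 0 1) :=
    hcont.integrableOn_compact isCompact_Icc
  rw [avgDeriv, ContinuousLinearMap.integral_apply h_int,
    integral_Icc_eq_integral_Ioc, ← intervalIntegral.integral_of_le zero_le_one]
  have := intervalIntegral.integral_eq_sub_of_hasDerivAt (a := 0) (b := 1)
    (f := fun t : ℝ => κ (x₀ + t • (x - x₀)))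
    (f' := fun t => fderiv ℝ κ (x₀ + t • (x - x₀)) (x - x₀)) (fun t ht => ?_) ?_
  · simpa using this
  · rw [uIcc_of_le zero_le_one] at ht
    have h1 : HasFDerivAt κ (fderiv ℝ κ (x₀ + t • (x - x₀))) (x₀ + t • (x - x₀)) :=
      ((hκ.contDiffAt (hW.mem_nhds (mem_of_segment hc hx₀ hx ht))).differentiableAt
        (by simp)).hasFDerivAt
    have h2 : HasDerivAt (fun s : ℝ => x₀ + s • (x - x₀)) (x - x₀) t := by
      simpa using ((hasDerivAt_id t).smul_const (x - x₀)).const_add x₀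
    exact HasFDerivAt.comp_hasDerivAt (l := κ) t h1 h2
  · refine ContinuousOn.intervalIntegrable ?_
    rw [uIcc_of_le zero_le_one]
    exact hcont.clm_apply continuousOn_const

theorem avgDeriv_self (κ : E n → E n) (x₀ : E n) : avgDeriv κ x₀ x₀ = fderiv ℝ κ x₀ := by
  simp [avgDeriv]

/-- The amplitude obtained from the profile `f` by a change of variables. -/
def coordAmp (N : E n → E n ≃L[ℝ] E n) (d : E n → ℝ) : TestSym n →ₗ[ℂ] (E n × E n → ℂ) where
  toFun f z := (d z.1 : ℂ) * (f : E n → ℂ) (N z.1 z.2)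
  map_add' f g := by ext z; simp [mul_add]
  map_smul' c f := by ext z; simp [mul_left_comm]

/-- The data describing the action of the coordinate change `κ` on packets at `κ x₀`. -/
structure IsCoordChange (κ : E n → E n) (x₀ : E n) (U : Set (E n)) (N : E n → E n ≃L[ℝ] E n)
    (d : E n → ℝ) : Prop where
  contDiffOn_N : ContDiffOn ℝ ∞ (fun x => (N x : E n →L[ℝ] E n)) U
  bound : ∃ R : ℝ, ∀ x ∈ U, ‖(N x : E n →L[ℝ] E n)‖ ≤ R ∧ ‖((N x).symm : E n →L[ℝ] E n)‖ ≤ R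
  contDiffOn_d : ContDiffOn ℝ ∞ d U
  d_base : d x₀ = |LinearMap.det (fderiv ℝ κ x₀ : E n →ₗ[ℝ] E n)|⁻¹
  packet_eq : ∀ x ∈ U, ∀ (h : ℝ) (f : TestSym n),
    packet (κ x₀) h f (κ x) = amp x₀ h (coordAmp N d f) x

theorem exists_isCoordChange {κ : E n → E n} {Ω : Set (E n)} (hΩ : IsOpen Ω)
    (hκ : ContDiffOn ℝ ∞ κ Ω) {x₀ : E n} (hx₀ : x₀ ∈ Ω) (hinv : (fderiv ℝ κ x₀).IsInvertible) :
    ∃ δ > 0, Metric.ball x₀ δ ⊆ Ω ∧ ∃ N d, IsCoordChange κ x₀ (Metric.ball x₀ δ) N d := by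
  obtain ⟨ρ, hρ, hρΩ⟩ := Metric.isOpen_iff.1 hΩ x₀ hx₀
  set W := Metric.ball x₀ ρ with hWdef
  have hW : IsOpen W := Metric.isOpen_ball
  have hWc : Convex ℝ W := convex_ball _ _
  have hx₀W : x₀ ∈ W := Metric.mem_ball_self hρ
  have hκW := hκ.mono hρΩ
  set A : E n → E n →L[ℝ] E n := fun x => adjL n (avgDeriv κ x₀ x) with hA
  have hAs : ContDiffOn ℝ ∞ A W := (adjL n).contDiff.comp_contDiffOn
    (contDiffOn_avgDeriv hW hWc hκW hx₀W)
  have hdet0 : LinearMap.det (A x₀ : E n →ₗ[ℝ] E n) ≠ 0 := by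
    obtain ⟨T, hT⟩ := hinv
    rw [hA]
    simp only
    rw [det_adjL, avgDeriv_self, ← hT]
    exact (LinearEquiv.isUnit_det' T.toLinearEquiv).ne_zero
  have hdetc : ContinuousOn (fun x => LinearMap.det (A x : E n →ₗ[ℝ] E n)) W :=
    (contDiff_det.comp_contDiffOn hAs).continuousOn
  have hev : ∀ᶠ x in 𝓝 x₀, x ∈ W ∧ LinearMap.det (A x : E n →ₗ[ℝ] E n) ≠ 0 :=
    Filter.Eventually.and (hW.mem_nhds hx₀W)
      ((hdetc.continuousAt (hW.mem_nhds hx₀W)).eventually_ne hdet0)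
  obtain ⟨ρ', hρ', hball⟩ := Metric.eventually_nhds_iff_ball.1 hev
  set δ := ρ' / 2
  have hδ : 0 < δ := by positivity
  have hsub : Metric.closedBall x₀ δ ⊆ Metric.ball x₀ ρ' :=
    Metric.closedBall_subset_ball (half_lt_self hρ')
  have hex : ∀ x, ∃ T : E n ≃L[ℝ] E n, x ∈ Metric.ball x₀ ρ' → (T : E n →L[ℝ] E n) = A x := by
    intro x
    by_cases hx : x ∈ Metric.ball x₀ ρ'
    · refine ⟨(LinearEquiv.ofIsUnitDet (f := (A x : E n →ₗ[ℝ] E n)) (v :=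
        (EuclideanSpace.basisFun (Fin n) ℝ).toBasis) (v' :=
        (EuclideanSpace.basisFun (Fin n) ℝ).toBasis) ?_).toContinuousLinearEquiv, fun _ => ?_⟩
      · rw [LinearMap.det_toMatrix]
        exact isUnit_iff_ne_zero.2 (hball x hx).2
      · ext v; rfl
    · exact ⟨ContinuousLinearEquiv.refl ℝ (E n), fun h => absurd h hx⟩
  choose T hT using hex
  have hTs : ContDiffOn ℝ ∞ (fun x => ((T x).symm : E n →L[ℝ] E n)) (Metric.ball x₀ ρ') := by
    have h1 : ContDiffOn ℝ ∞ (fun x => ContinuousLinearMap.inverse (A x))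
        (Metric.ball x₀ ρ') := by
      intro x hx
      have h2 : ContDiffAt ℝ ∞ ContinuousLinearMap.inverse (A x) := by
        rw [← hT x hx]; exact contDiffAt_map_inverse (T x)
      exact (h2.comp x (hAs.contDiffAt (hW.mem_nhds (hball x hx).1))).contDiffWithinAt
    refine h1.congr fun x hx => ?_
    rw [← hT x hx, ContinuousLinearMap.inverse_equiv]
  have hbd : ∀ {F : E n → E n →L[ℝ] E n}, ContDiffOn ℝ ∞ F (Metric.ball x₀ ρ') →
      ∃ R, ∀ x ∈ Metric.closedBall x₀ δ, ‖F x‖ ≤ R := fun hF =>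
    (isCompact_closedBall x₀ δ).exists_bound_of_continuousOn (hF.continuousOn.mono hsub)
  obtain ⟨R₁, hR₁⟩ := hbd hTs
  obtain ⟨R₂, hR₂⟩ := hbd (hAs.mono fun x hx => (hball x hx).1)
  refine ⟨δ, hδ, fun x hx => hρΩ (hball x (hsub (Metric.ball_subset_closedBall hx))).1,
    fun x => (T x).symm, fun x => |LinearMap.det (A x : E n →ₗ[ℝ] E n)|⁻¹, ?_, ?_, ?_, ?_, ?_⟩
  · exact hTs.mono (Metric.ball_subset_closedBall.trans hsub)
  · refine ⟨max R₁ R₂, fun x hx => ?_⟩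
    have hx' := Metric.ball_subset_closedBall hx
    refine ⟨(hR₁ x hx').trans (le_max_left _ _), ?_⟩
    simp only [ContinuousLinearEquiv.symm_symm]
    rw [hT x (hsub hx')]
    exact (hR₂ x hx').trans (le_max_right _ _)
  · intro x hx
    have hx' := hsub (Metric.ball_subset_closedBall hx)
    have h1 : ContDiffAt ℝ ∞ (fun x => LinearMap.det (A x : E n →ₗ[ℝ] E n)) x :=
      (contDiff_det.comp_contDiffOn hAs).contDiffAt (hW.mem_nhds (hball x hx').1)
    refine ContDiffAt.contDiffWithinAt (ContDiffAt.inv ?_ (abs_ne_zero.2 (hball x hx').2))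
    exact (contDiffAt_abs (hball x hx').2).comp x h1
  · simp only [hA]
    rw [det_adjL, avgDeriv_self]
  · intro x hx h f
    have hx' := hsub (Metric.ball_subset_closedBall hx)
    have hxW := (hball x hx').1
    rw [packet, amp]
    congr 1
    have h1 : ∀ ζ, ee (h⁻¹ • (κ x - κ x₀)) ζ * (f : E n → ℂ) ζ =
        (fun η => ee (h⁻¹ • (x - x₀)) η * (f : E n → ℂ) ((T x).symm η)) (T x ζ) := by
      intro ζ
      have h2 : T x ζ = A x ζ := by
        rw [← hT x hx']; rfl
      beta_reduce
      rw [ContinuousLinearEquiv.symm_apply_apply, h2]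
      congr 1
      rw [← avgDeriv_apply hW hWc hκW hx₀W hxW, ee, ee, inner_smul_left, inner_smul_left,
        inner_adjL]
    rw [integral_congr_ae (Eventually.of_forall h1), integral_comp_equiv (T x)
      (fun η => ee (h⁻¹ • (x - x₀)) η * (f : E n → ℂ) ((T x).symm η)), hT x hx', ← integral_const_mul]
    congr 1
    ext η
    simp only [coordAmp, LinearMap.coe_mk, AddHom.coe_mk]
    ring

theorem IsCoordChange.isAmp {κ : E n → E n} {x₀ : E n} {U : Set (E n)}
    {N : E n → E n ≃L[ℝ] E n} {d : E n → ℝ} (hN : IsCoordChange κ x₀ U N d) (f : TestSym n) :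
    IsAmp U (coordAmp N d f) := by
  obtain ⟨R₀, hR₀⟩ := hN.bound
  set R := max R₀ 1
  have hR1 : 0 < R := lt_of_lt_of_le one_pos (le_max_right _ _)
  have hR : ∀ x ∈ U, ∀ v, ‖N x v‖ ≤ R * ‖v‖ ∧ ‖(N x).symm v‖ ≤ R * ‖v‖ := fun x hx v =>
    ⟨((N x : E n →L[ℝ] E n).le_opNorm v).trans (mul_le_mul_of_nonneg_right
      ((hR₀ x hx).1.trans (le_max_left _ _)) (norm_nonneg _)),
     (((N x).symm : E n →L[ℝ] E n).le_opNorm v).trans (mul_le_mul_of_nonneg_right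
      ((hR₀ x hx).2.trans (le_max_left _ _)) (norm_nonneg _))⟩
  refine ⟨?_, ?_⟩
  · refine ContDiffOn.mul ?_ ?_
    · exact Complex.ofRealCLM.contDiff.comp_contDiffOn
        (hN.contDiffOn_d.comp contDiffOn_fst fun z hz => hz.1)
    · refine f.2.1.comp_contDiffOn ?_
      exact (hN.contDiffOn_N.comp contDiffOn_fst fun z hz => hz.1).clm_apply contDiffOn_snd
  · have hB : IsCompact (tsupport (f : E n → ℂ)) := f.2.2.1
    have h0B : (0 : E n) ∉ tsupport (f : E n → ℂ) := fun h => TestSym.tsupport_subset f.2 h rfl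
    obtain ⟨c, hc, hcB⟩ := Metric.isOpen_iff.1 hB.isClosed.isOpen_compl 0 h0B
    obtain ⟨D, hD⟩ := hB.isBounded.exists_norm_le
    refine ⟨Metric.closedBall 0 (R * D) \ Metric.ball 0 (c / R),
      (isCompact_closedBall 0 _).diff Metric.isOpen_ball,
      fun h => h.2 (Metric.mem_ball_self (by positivity)), fun x hx ζ hζ => ?_⟩
    simp only [coordAmp, LinearMap.coe_mk, AddHom.coe_mk]
    by_contra hne
    have h1 : N x ζ ∈ tsupport (f : E n → ℂ) := by
      by_contra h
      exact hne (by rw [image_eq_zero_of_notMem_tsupport h, mul_zero])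
    refine hζ ⟨?_, fun h2 => hcB ?_ h1⟩
    · rw [mem_closedBall_zero_iff]
      have := (hR x hx (N x ζ)).2
      rw [ContinuousLinearEquiv.symm_apply_apply] at this
      exact this.trans (mul_le_mul_of_nonneg_left (hD _ h1) hR1.le)
    · rw [mem_ball_zero_iff] at h2 ⊢
      calc _ ≤ R * ‖ζ‖ := (hR x hx ζ).1
        _ < R * (c / R) := by gcongr
        _ = c := by field_simp

/-- The action on profiles of a coordinate change. -/
def coordSeries {κ : E n → E n} {x₀ : E n} {U : Set (E n)} (hU : IsOpen U) (hx₀ : x₀ ∈ U)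
    {N : E n → E n ≃L[ℝ] E n} {d : E n → ℝ} (hN : IsCoordChange κ x₀ U N d) :
    PowerSeries (Module.End ℂ (TestSym n)) :=
  PowerSeries.mk fun r => ampEnd hU hx₀ (coordAmp N d) hN.isAmp r

theorem hasExp_packet_comp {κ : E n → E n} {x₀ : E n} {U V K : Set (E n)} (hU : IsOpen U)
    (hcv : Convex ℝ U) (hx₀ : x₀ ∈ U) {N : E n → E n ≃L[ℝ] E n} {d : E n → ℝ}
    (hN : IsCoordChange κ x₀ U N d) (hV : IsOpen V) (hK : IsCompact K) (hVK : V ⊆ K)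
    (hKU : K ⊆ U) (f : TestSym n) :
    HasExp V x₀ 0 (fun r => PowerSeries.coeff r (coordSeries hU hx₀ hN) f)
      (fun h x => packet (κ x₀) h f (κ x)) := by
  have h1 := (hasExp_amp hU hcv hx₀ hV hK hVK hKU (hN.isAmp f)).congr hV
    (w' := fun h x => packet (κ x₀) h f (κ x))
    (fun h _ x hx => hN.packet_eq x (hKU (hVK hx)) h f)
  convert h1 using 2 with r
  rw [coordSeries, PowerSeries.coeff_mk]
  rfl

/-! ### Residues -/

/-- Integration by parts for the operator `Lop`. -/
theorem integral_mul_Lop {U : Set (E n)} (hU : IsOpen U) {b : E n × E n → ℂ} (hb : IsAmp U b)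
    {q : E n → ℂ} (hq : ContDiffOn ℝ ∞ q {0}ᶜ) {x : E n} (hx : x ∈ U) :
    ∫ ζ, q ζ * Lop b (x, ζ) = -Complex.I *
      ∑ i, dd (e i) (fun x => ∫ ζ, dd (e i) q ζ * b (x, ζ)) x := by
  have hU' : IsOpen (U ×ˢ (univ : Set (E n))) := hU.prod isOpen_univ
  obtain ⟨B, hB, h0, hs⟩ := hb.supp
  have hmem : ∀ i, (fun ζ => dd (e i, 0) b (x, ζ)) ∈ TestSym n := fun i =>
    (hb.dd hU (e i, 0)).slice_mem hx
  have h1 : ∀ ζ, q ζ * Lop b (x, ζ) = ∑ i, Complex.I *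
      (q ζ * dd (e i) (fun ζ => dd (e i, 0) b (x, ζ)) ζ) := by
    intro ζ
    simp only [Lop, Finset.mul_sum]
    refine Finset.sum_congr rfl fun i _ => ?_
    rw [← dd_slice_right (b := dd (e i, 0) b) (z := (x, ζ))
      (differentiableAt_of_contDiffOn hU' (hb.dd hU (e i, 0)).smooth ⟨hx, mem_univ _⟩) (e i)]
    ring
  simp_rw [h1]
  rw [integral_finsetSum _ fun i _ =>
    (TestSym.integrable_mul hq (TestSym.dd_mem (hmem i) (e i))).const_mul _, Finset.mul_sum]
  refine Finset.sum_congr rfl fun i _ => ?_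
  rw [integral_const_mul, TestSym.integral_mul_dd hq (hmem i)]
  have h2 := (contDiffOn_integral_of_support (n := n) (Y := E n) (U := U) hU hB
    (c := fun z => dd (e i) q z.2 * b z) (Ω := U ×ˢ {0}ᶜ) (hU.prod isOpen_compl_singleton)
    (fun x hx ζ hζ => ⟨hx, fun h => h0 (by rwa [show ζ = 0 from h] at hζ)⟩)
    (((contDiffOn_dd isOpen_compl_singleton hq (e i)).comp contDiffOn_snd fun z hz => hz.2).mul
      (hb.smooth.mono (prod_mono_right (subset_univ _))))
    (fun x hx ζ hζ => by simp [hs x hx ζ hζ])).2 x hx (e i)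
  have h3 : dd (e i) (fun x => ∫ ζ, dd (e i) q ζ * b (x, ζ)) x =
      ∫ ζ, dd (e i) q ζ * dd (e i, 0) b (x, ζ) := by
    refine h2.trans (integral_congr_ae (Eventually.of_forall fun ζ => ?_))
    have hd : DifferentiableAt ℝ b (x, ζ) :=
      differentiableAt_of_contDiffOn hU' hb.smooth ⟨hx, mem_univ _⟩
    have hd' : DifferentiableAt ℝ (fun x => b (x, ζ)) x :=
      hd.comp (f := fun x => (x, ζ)) x (by fun_prop)
    have h4 := dd_const_mul hd' (dd (e i) q ζ) (e i)
    refine h4.trans ?_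
    congr 1
    exact dd_slice_left hd (e i)
  rw [h3]
  ring

theorem integral_Lop_iterate {U : Set (E n)} (hU : IsOpen U) {b : E n × E n → ℂ}
    (hb : IsAmp U b) {x : E n} (hx : x ∈ U) {r : ℕ} (hr : r ≠ 0) :
    ∫ ζ, (Lop^[r] b) (x, ζ) = 0 := by
  obtain ⟨r, rfl⟩ := Nat.exists_eq_succ_of_ne_zero hr
  have := integral_mul_Lop hU (hb.Lop_iterate hU r) (q := fun _ => 1) contDiffOn_const hx
  simp only [one_mul] at this
  rw [Nat.succ_eq_add_one, Function.iterate_succ_apply', this]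
  simp [dd]

theorem integral_mul_Lop_iterate_bump {κ : E n → E n} {x₀ : E n} {U : Set (E n)} (hU : IsOpen U)
    {N : E n → E n ≃L[ℝ] E n} {d : E n → ℝ} (hN : IsCoordChange κ x₀ U N d) (r : ℕ) :
    ∀ q : E n → ℂ, Homog (-n + (r + 1 : ℕ)) q → ∀ x ∈ U,
      ∫ ζ, q ζ * (Lop^[r + 1] (coordAmp N d ⟨bump, bump_mem⟩)) (x, ζ) = 0 := by
  have hb := hN.isAmp ⟨bump, bump_mem⟩
  induction r with
  | zero =>
    intro q hq x hx
    simp only [zero_add, Function.iterate_one]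
    rw [integral_mul_Lop hU hb hq.1 hx]
    have h1 : ∀ i, dd (e i) (fun x => ∫ ζ, dd (e i) q ζ *
        coordAmp N d ⟨bump, bump_mem⟩ (x, ζ)) x = 0 := by
      intro i
      refine dd_eq_zero hU (fun x hx => ?_) _ x hx
      have h2 := integral_dd_mul_bump_comp (G := q) (by
        convert hq using 1; push_cast; ring) (e i) (N x)
      simp only [coordAmp, LinearMap.coe_mk, AddHom.coe_mk]
      simp_rw [mul_left_comm _ ((d x : ℝ) : ℂ)]
      rw [integral_const_mul, h2, mul_zero]
    simp [h1]
  | succ r ih =>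
    intro q hq x hx
    rw [Function.iterate_succ_apply', integral_mul_Lop hU (hb.Lop_iterate hU (r + 1)) hq.1 hx]
    have h1 : ∀ i, dd (e i) (fun x => ∫ ζ, dd (e i) q ζ *
        (Lop^[r + 1] (coordAmp N d ⟨bump, bump_mem⟩)) (x, ζ)) x = 0 := by
      intro i
      refine dd_eq_zero hU (fun x hx => ih _ ?_ x hx) _ x hx
      have := hq.dd (e i)
      convert this using 1
      push_cast; ring
    rw [Finset.sum_eq_zero fun i _ => h1 i, mul_zero]

/-- Integration of profiles against a function. -/
def evL (q : E n → ℂ) (hq : ContDiffOn ℝ ∞ q {0}ᶜ) : TestSym n →ₗ[ℂ] ℂ where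
  toFun f := ∫ ζ, q ζ * (f : E n → ℂ) ζ
  map_add' f g := by
    simp only [Submodule.coe_add, Pi.add_apply, mul_add]
    exact integral_add (TestSym.integrable_mul hq f.2) (TestSym.integrable_mul hq g.2)
  map_smul' c f := by
    simp only [Submodule.coe_smul, Pi.smul_apply, smul_eq_mul, RingHom.id_apply]
    simp_rw [mul_left_comm _ c]
    rw [integral_const_mul]

/-- Integration of profiles. -/
def ev : TestSym n →ₗ[ℂ] ℂ := evL (fun _ => 1) contDiffOn_const

theorem ev_apply (f : TestSym n) : ev f = ∫ ζ, (f : E n → ℂ) ζ := by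
  simp [ev, evL]

theorem ev_ampEnd {U : Set (E n)} (hU : IsOpen U) {y₀ : E n} (hy : y₀ ∈ U)
    (β : TestSym n →ₗ[ℂ] (E n × E n → ℂ)) (hβ : ∀ f, IsAmp U (β f)) {r : ℕ} (hr : r ≠ 0)
    (f : TestSym n) : ev (ampEnd hU hy β hβ r f) = 0 := by
  rw [ev_apply]
  have : ∀ ζ, (ampEnd hU hy β hβ r f : E n → ℂ) ζ =
    (r.factorial : ℂ)⁻¹ * (Lop^[r] (β f)) (y₀, ζ) := fun ζ => rfl
  simp_rw [this]
  rw [integral_const_mul, integral_Lop_iterate hU (hβ f) hy hr, mul_zero]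

theorem ev_coordSeries {κ : E n → E n} {x₀ : E n} {U : Set (E n)} (hU : IsOpen U) (hx₀ : x₀ ∈ U)
    {N : E n → E n ≃L[ℝ] E n} {d : E n → ℝ} (hN : IsCoordChange κ x₀ U N d) (r : ℕ)
    (f : TestSym n) :
    ev (PowerSeries.coeff r (coordSeries hU hx₀ hN) f) = if r = 0 then ev f else 0 := by
  rw [coordSeries, PowerSeries.coeff_mk]
  split_ifs with hr
  · subst hr
    have h1 := hN.packet_eq x₀ hx₀ 1 f
    simp only [packet, amp, sub_self, smul_zero, ee_zero_left, one_mul] at h1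
    rw [ev_apply, ev_apply]
    have := mul_left_cancel₀ (cn_ne_zero n) h1
    rw [this]
    refine integral_congr_ae (Eventually.of_forall fun ζ => ?_)
    have h2 : (ampEnd hU hx₀ (coordAmp N d) hN.isAmp 0 f : E n → ℂ) ζ =
      ((0 : ℕ).factorial : ℂ)⁻¹ * (Lop^[0] (coordAmp N d f)) (x₀, ζ) := rfl
    rw [h2]
    simp
  · exact ev_ampEnd hU hx₀ _ _ hr f

theorem evL_coordSeries_bump {κ : E n → E n} {x₀ : E n} {U : Set (E n)} (hU : IsOpen U)
    (hx₀ : x₀ ∈ U) {N : E n → E n ≃L[ℝ] E n} {d : E n → ℝ} (hN : IsCoordChange κ x₀ U N d) (r : ℕ)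
    {q : E n → ℂ} (hq : Homog (-n + r) q) :
    evL q hq.1 (PowerSeries.coeff r (coordSeries hU hx₀ hN) ⟨bump, bump_mem⟩) =
      if r = 0 then (d x₀ : ℂ) * ∫ ζ, q ζ * bump ζ else 0 := by
  rw [coordSeries, PowerSeries.coeff_mk]
  have h2 : ∀ ζ, (ampEnd hU hx₀ (coordAmp N d) hN.isAmp r ⟨bump, bump_mem⟩ : E n → ℂ) ζ =
      (r.factorial : ℂ)⁻¹ * (Lop^[r] (coordAmp N d ⟨bump, bump_mem⟩)) (x₀, ζ) := fun ζ => rfl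
  simp only [evL, LinearMap.coe_mk, AddHom.coe_mk, h2]
  simp_rw [mul_left_comm _ ((r.factorial : ℂ)⁻¹)]
  rw [integral_const_mul]
  rcases r with _ | r
  · simp only [Function.iterate_zero, id, Nat.factorial_zero, Nat.cast_one, inv_one, one_mul,
      if_true, coordAmp, LinearMap.coe_mk, AddHom.coe_mk]
    simp_rw [mul_left_comm _ ((d x₀ : ℝ) : ℂ)]
    rw [integral_const_mul, integral_mul_bump_comp (by simpa using hq)]
  · rw [integral_mul_Lop_iterate_bump hU hN r q hq x₀ hx₀]
    simp

end RiemPsiDO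

end

noncomputable section
namespace RiemPsiDO
open Set Filter Topology
variable {n : ℕ}

/-- Functions of `(x, ξ)` which are smooth on `U × (ℝⁿ ∖ 0)`. -/
def SymOn (U : Set (E n)) (P : E n → E n → ℂ) : Prop :=
  ContDiffOn ℝ ∞ (fun z : E n × E n => P z.1 z.2) (U ×ˢ {0}ᶜ)

/-- The partial derivative of a symbol with respect to `x_i`. -/
def dx (i : Fin n) (P : E n → E n → ℂ) : E n → E n → ℂ := fun y ζ => dd (e i) (fun y => P y ζ) y

theorem SymOn.diffAt {U : Set (E n)} (hU : IsOpen U) {P : E n → E n → ℂ} (hP : SymOn U P) {x ζ : E n}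
    (hx : x ∈ U) (hζ : ζ ≠ 0) : DifferentiableAt ℝ (fun z : E n × E n => P z.1 z.2) (x, ζ) :=
  differentiableAt_of_contDiffOn (hU.prod isOpen_compl_singleton) hP ⟨hx, hζ⟩

theorem SymOn.diffAt_left {U : Set (E n)} (hU : IsOpen U) {P : E n → E n → ℂ} (hP : SymOn U P)
    {x ζ : E n} (hx : x ∈ U) (hζ : ζ ≠ 0) : DifferentiableAt ℝ (fun x => P x ζ) x :=
  (hP.diffAt hU hx hζ).comp (f := fun x => (x, ζ)) x (by fun_prop)

theorem SymOn.slice {U : Set (E n)} {P : E n → E n → ℂ} (hP : SymOn U P) {x : E n}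
    (hx : x ∈ U) : ContDiffOn ℝ ∞ (P x) {0}ᶜ :=
  ContDiffOn.comp (g := fun z : E n × E n => P z.1 z.2) (f := fun ζ => (x, ζ)) hP (by fun_prop)
    fun _ hζ => ⟨hx, hζ⟩

theorem SymOn.dx_eq {U : Set (E n)} (hU : IsOpen U) {P : E n → E n → ℂ} (hP : SymOn U P) (i : Fin n) :
    ∀ z ∈ U ×ˢ ({0}ᶜ : Set (E n)), dx i P z.1 z.2 =
      dd (e i, 0) (fun z : E n × E n => P z.1 z.2) z := fun _ hz =>
  dd_slice_left (b := fun z : E n × E n => P z.1 z.2) (hP.diffAt hU hz.1 hz.2) (e i)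

theorem SymOn.dx {U : Set (E n)} (hU : IsOpen U) {P : E n → E n → ℂ} (hP : SymOn U P) (i : Fin n) :
    SymOn U (dx i P) :=
  (contDiffOn_dd (hU.prod isOpen_compl_singleton) hP (e i, 0)).congr (hP.dx_eq hU i)

theorem SymOn.dx_comm {U : Set (E n)} (hU : IsOpen U) {P : E n → E n → ℂ} (hP : SymOn U P)
    (i j : Fin n) {x ζ : E n} (hx : x ∈ U) (hζ : ζ ≠ 0) :
    RiemPsiDO.dx i (RiemPsiDO.dx j P) x ζ = RiemPsiDO.dx j (RiemPsiDO.dx i P) x ζ := by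
  have hΩ : IsOpen (U ×ˢ ({0}ᶜ : Set (E n))) := hU.prod isOpen_compl_singleton
  have h : (x, ζ) ∈ U ×ˢ ({0}ᶜ : Set (E n)) := ⟨hx, hζ⟩
  rw [(hP.dx hU j).dx_eq hU i _ h, (hP.dx hU i).dx_eq hU j _ h,
    dd_congr hΩ (hP.dx_eq hU j) _ _ h, dd_congr hΩ (hP.dx_eq hU i) _ _ h, dd_comm hΩ hP h]

theorem dd_integral_mul_testSym {U : Set (E n)} (hU : IsOpen U) {P : E n → E n → ℂ}
    (hP : SymOn U P) {f : E n → ℂ} (hf : f ∈ TestSym n) {x : E n} (hx : x ∈ U) (i : Fin n) :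
    dd (e i) (fun x => ∫ ζ, P x ζ * f ζ) x = ∫ ζ, dx i P x ζ * f ζ := by
  have h2 := (contDiffOn_integral_of_support (n := n) (Y := E n) (U := U) hU hf.2.1
    (c := fun z => P z.1 z.2 * f z.2) (Ω := U ×ˢ {0}ᶜ) (hU.prod isOpen_compl_singleton)
    (fun x hx ζ hζ => ⟨hx, TestSym.tsupport_subset hf hζ⟩)
    (hP.mul (hf.1.comp contDiff_snd).contDiffOn)
    (fun x hx ζ hζ => by simp [image_eq_zero_of_notMem_tsupport hζ])).2 x hx (e i)
  refine h2.trans (integral_congr_ae (Eventually.of_forall fun ζ => ?_))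
  by_cases hζ : ζ = 0
  · have h0 : f ζ = 0 := by rw [hζ]; exact hf.2.2.eq_of_nhds
    simp [h0]
  · have h4 := dd_const_mul (hP.diffAt_left hU hx hζ) (f ζ) (e i)
    simp only [mul_comm (f ζ)] at h4
    exact h4

/-- The terms of the expansion of the symbol of a composition:
`star r q p / r! = ∑_{|α| = r} (-i)^r ∂_ξ^α q ∂_x^α p / α!`. -/
def star : ℕ → (E n → ℂ) → (E n → E n → ℂ) → E n → E n → ℂ
  | 0, q, P => fun y ζ => q ζ * P y ζ
  | r + 1, q, P => fun y ζ => -Complex.I * ∑ i, star r (dd (e i) q) (dx i P) y ζ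

theorem symOn_star {U : Set (E n)} (hU : IsOpen U) (r : ℕ) : ∀ {q : E n → ℂ}
    {P : E n → E n → ℂ}, ContDiffOn ℝ ∞ q {0}ᶜ → SymOn U P → SymOn U (star r q P) := by
  induction r with
  | zero => intro q P hq hP; exact (hq.comp contDiffOn_snd fun z hz => hz.2).mul hP
  | succ r ih =>
    intro q P hq hP
    exact contDiffOn_const.mul (ContDiffOn.sum fun i _ =>
      ih (contDiffOn_dd isOpen_compl_singleton hq (e i)) (hP.dx hU i))

theorem dx_congr {U : Set (E n)} (hU : IsOpen U) {P P' : E n → E n → ℂ}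
    (h : ∀ x ∈ U, ∀ ζ ≠ 0, P x ζ = P' x ζ) (i : Fin n) :
    ∀ x ∈ U, ∀ ζ ≠ 0, dx i P x ζ = dx i P' x ζ := fun x hx ζ hζ =>
  dd_congr hU (fun y hy => h y hy ζ hζ) _ x hx

theorem star_congr {U : Set (E n)} (hU : IsOpen U) (r : ℕ) : ∀ {q : E n → ℂ}
    {P P' : E n → E n → ℂ}, (∀ x ∈ U, ∀ ζ ≠ 0, P x ζ = P' x ζ) →
    ∀ x ∈ U, ∀ ζ ≠ 0, star r q P x ζ = star r q P' x ζ := by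
  induction r with
  | zero => intro q P P' h x hx ζ hζ; simp only [star, h x hx ζ hζ]
  | succ r ih =>
    intro q P P' h x hx ζ hζ
    simp only [star]
    congr 1
    exact Finset.sum_congr rfl fun i _ => ih (dx_congr hU h i) x hx ζ hζ

theorem dx_star {U : Set (E n)} (hU : IsOpen U) (r : ℕ) : ∀ {q : E n → ℂ}
    {P : E n → E n → ℂ}, ContDiffOn ℝ ∞ q {0}ᶜ → SymOn U P → ∀ i, ∀ x ∈ U, ∀ ζ ≠ 0,
    dx i (star r q P) x ζ = star r q (dx i P) x ζ := by
  induction r with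
  | zero =>
    intro q P hq hP i x hx ζ hζ
    exact dd_const_mul (hP.diffAt_left hU hx hζ) (q ζ) (e i)
  | succ r ih =>
    intro q P hq hP i x hx ζ hζ
    have hs : ∀ j, SymOn U (star r (dd (e j) q) (dx j P)) := fun j =>
      symOn_star hU r (contDiffOn_dd isOpen_compl_singleton hq (e j)) (hP.dx hU j)
    have hd := fun j => (hs j).diffAt_left hU hx hζ
    have h1 := dd_const_mul (F := fun x => ∑ j, star r (dd (e j) q) (dx j P) x ζ) (z := x)
      (DifferentiableAt.fun_sum fun j _ => hd j) (-Complex.I) (e i)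
    rw [dd_sum Finset.univ (fun j _ => hd j)] at h1
    refine h1.trans ?_
    simp only [star]
    congr 1
    refine Finset.sum_congr rfl fun j _ => ?_
    refine (ih (contDiffOn_dd isOpen_compl_singleton hq (e j)) (hP.dx hU j) i x hx ζ hζ).trans ?_
    exact star_congr hU r (fun x hx ζ hζ => hP.dx_comm hU i j hx hζ) x hx ζ hζ

theorem integral_mul_Lop_iterate {U : Set (E n)} (hU : IsOpen U) {P : E n → E n → ℂ}
    (hP : SymOn U P) {f : E n → ℂ} (hf : f ∈ TestSym n) (r : ℕ) : ∀ {q : E n → ℂ},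
    ContDiffOn ℝ ∞ q {0}ᶜ → ∀ x ∈ U,
    ∫ ζ, q ζ * (Lop^[r] (fun z => P z.1 z.2 * f z.2)) (x, ζ) = ∫ ζ, star r q P x ζ * f ζ := by
  have hb := IsAmp.mul_testSym hU hP hf
  induction r with
  | zero => intro q hq x hx; simp [star, mul_assoc]
  | succ r ih =>
    intro q hq x hx
    rw [Function.iterate_succ_apply', integral_mul_Lop hU (hb.Lop_iterate hU r) hq hx]
    have hdq := fun i : Fin n => contDiffOn_dd isOpen_compl_singleton hq (e i)
    have hi : ∀ i, Integrable fun ζ => star r (dd (e i) q) (dx i P) x ζ * f ζ := fun i =>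
      TestSym.integrable_mul ((symOn_star hU r (hdq i) (hP.dx hU i)).slice hx) hf
    simp only [star, mul_assoc, Finset.sum_mul]
    rw [integral_const_mul, integral_finsetSum _ fun i _ => hi i]
    congr 1
    refine Finset.sum_congr rfl fun i _ => ?_
    rw [dd_congr hU (fun y hy => ih (hdq i) y hy) (e i) x hx,
      dd_integral_mul_testSym hU (symOn_star hU r (hdq i) hP) hf hx i]
    refine integral_congr_ae (Eventually.of_forall fun ζ => ?_)
    by_cases hζ : ζ = 0
    · have h0 : f ζ = 0 := by rw [hζ]; exact hf.2.2.eq_of_nhds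
      simp [h0]
    · simp only [dx_star hU r (hdq i) hP i x hx ζ hζ]

theorem IsHomogSymbol.dx {U : Set (E n)} (hU : IsOpen U) {d : ℤ} {P : E n → E n → ℂ}
    (hP : IsHomogSymbol U d P) (i : Fin n) : IsHomogSymbol U d (dx i P) := by
  have hs : SymOn U P := hP.1
  refine ⟨hs.dx hU i, fun x hx ξ hξ t ht => ?_⟩
  have h1 := dd_congr hU (F := fun x => P x (t • ξ)) (G := fun x => (t : ℂ) ^ d * P x ξ)
    (fun y hy => hP.2 y hy ξ hξ t ht) (e i) x hx
  exact h1.trans (dd_const_mul (hs.diffAt_left hU hx hξ) _ _)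

theorem homog_star {U : Set (E n)} (hU : IsOpen U) (r : ℕ) : ∀ {q : E n → ℂ} {d d' : ℤ}
    {P : E n → E n → ℂ}, Homog d q → IsHomogSymbol U d' P → ∀ x ∈ U,
    Homog (d + d' - r) (star r q P x) := by
  induction r with
  | zero => intro q d d' P hq hP x hx; simpa [star] using hq.mul (hP.homog hx)
  | succ r ih =>
    intro q d d' P hq hP x hx
    refine (Homog.sum fun i _ => ?_).const_mul _
    have := ih (hq.dd (e i)) (hP.dx hU i) x hx
    convert this using 1
    push_cast; ring

/-- The symbol, over the point `y`, of the parametrix of an operator with symbol `∑ p_j`. -/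
def symInv (p : ℕ → E n → E n → ℂ) (y : E n) (k : ℕ) : E n → ℂ := fun ζ =>
  (p 0 y ζ)⁻¹ * ((if k = 0 then 1 else 0) - ∑ l : Fin k,
    ∑ s ∈ Finset.HasAntidiagonal.antidiagonal (k - l),
      (s.2.factorial : ℂ)⁻¹ * star s.2 (symInv p y l) (p s.1) y ζ)
termination_by k
decreasing_by exact l.2

theorem symInv_eq (p : ℕ → E n → E n → ℂ) (y : E n) (k : ℕ) : symInv p y k = fun ζ =>
    (p 0 y ζ)⁻¹ * ((if k = 0 then 1 else 0) - ∑ l : Fin k,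
      ∑ s ∈ Finset.HasAntidiagonal.antidiagonal (k - l),
        (s.2.factorial : ℂ)⁻¹ * star s.2 (symInv p y l) (p s.1) y ζ) := by
  funext ζ
  rw [symInv]

theorem homog_symInv {U : Set (E n)} (hU : IsOpen U) {m : ℤ} {p : ℕ → E n → E n → ℂ}
    (hp : ∀ j : ℕ, IsHomogSymbol U (m - j) (p j)) {y : E n} (hy : y ∈ U)
    (h0 : ∀ ζ ≠ 0, p 0 y ζ ≠ 0) (k : ℕ) : Homog (-m - k) (symInv p y k) := by
  induction k using Nat.strong_induction_on with
  | _ k ih =>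
    rw [symInv_eq]
    have hinv : Homog (-m) (fun ζ => (p 0 y ζ)⁻¹) := by
      simpa using Homog.inv ((hp 0).homog hy) h0
    have h1 : Homog (-k) (fun ζ : E n => (if k = 0 then (1 : ℂ) else 0) - ∑ l : Fin k,
        ∑ s ∈ Finset.HasAntidiagonal.antidiagonal (k - l),
          (s.2.factorial : ℂ)⁻¹ * star s.2 (symInv p y l) (p s.1) y ζ) := by
      have h2 : Homog (-k) (fun ζ : E n => ∑ l : Fin k,
        ∑ s ∈ Finset.HasAntidiagonal.antidiagonal (k - l),
          (s.2.factorial : ℂ)⁻¹ * star s.2 (symInv p y l) (p s.1) y ζ) := by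
        refine Homog.sum fun l _ => Homog.sum fun s hs => Homog.const_mul ?_ _
        have h3 := homog_star hU s.2 (ih l l.2) (hp s.1) y hy
        have h4 := Finset.HasAntidiagonal.mem_antidiagonal.1 hs
        have := l.2
        convert h3 using 1
        omega
      rcases Nat.eq_zero_or_pos k with rfl | hk
      · have : Homog (n := n) 0 (fun _ => 1) := ⟨contDiffOn_const, by simp⟩
        simpa using this
      · simpa [hk.ne'] using h2.const_mul (-1)
    simpa [sub_eq_add_neg] using hinv.mul h1

/-- `∫ (A_k f) = ∫ a_k f` with `a_k` homogeneous of degree `μ - k`. -/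
structure Rep (μ : ℤ) (A : PowerSeries (Module.End ℂ (TestSym n))) (a : ℕ → E n → ℂ) : Prop where
  homog : ∀ k : ℕ, Homog (μ - k) (a k)
  ev_coeff : ∀ (k : ℕ) (f : TestSym n), ev (PowerSeries.coeff k A f) = ∫ ζ, a k ζ * (f : E n → ℂ) ζ

/-- The residue of an intertwined pair of series transforms as a density. -/
theorem Rep.integral_bump {μ : ℤ} {A B : PowerSeries (Module.End ℂ (TestSym n))}
    {a b : ℕ → E n → ℂ} (hA : Rep μ A a) (hB : Rep μ B b) {κ : E n → E n} {x₀ : E n}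
    {U : Set (E n)} (hU : IsOpen U) (hx₀ : x₀ ∈ U) {N : E n → E n ≃L[ℝ] E n} {d : E n → ℝ}
    (hN : IsCoordChange κ x₀ U N d)
    (h : coordSeries hU hx₀ hN * A = B * coordSeries hU hx₀ hN) {k : ℕ} (hk : μ - k = -n) :
    ∫ ζ, a k ζ * bump ζ = d x₀ * ∫ ζ, b k ζ * bump ζ := by
  have h1 := congrArg (fun S : PowerSeries (Module.End ℂ (TestSym n)) => ev (PowerSeries.coeff k S ⟨bump, bump_mem⟩)) h
  simp only [PowerSeries.coeff_mul, LinearMap.sum_apply, map_sum, Module.End.mul_apply,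
    ev_coordSeries, hB.ev_coeff] at h1
  rw [Finset.sum_eq_single (0, k), Finset.sum_eq_single (k, 0)] at h1
  · simp only [if_true, hA.ev_coeff] at h1
    rw [h1]
    have h2 := evL_coordSeries_bump hU hx₀ hN 0 (q := b k) (by simpa [hk] using hB.homog k)
    simpa [evL] using h2
  · rintro ⟨l, i⟩ hli hne
    have hs : l + i = k := Finset.HasAntidiagonal.mem_antidiagonal.1 hli
    have hi : i ≠ 0 := by rintro rfl; exact hne (by simpa using hs)
    have hh : Homog (-n + i) (b l) := by
      convert hB.homog l using 1; omega
    simpa [evL, hi] using evL_coordSeries_bump hU hx₀ hN i hh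
  · simp
  · rintro ⟨i, l⟩ hli hne
    have hs : i + l = k := Finset.HasAntidiagonal.mem_antidiagonal.1 hli
    have hi : i ≠ 0 := by rintro rfl; exact hne (by simpa using hs)
    simp [hi]
  · simp

theorem coeff_symSeries_apply {U : Set (E n)} (hU : IsOpen U) {y₀ : E n} (hy : y₀ ∈ U)
    {q : ℕ → E n → E n → ℂ} (hq : ∀ j, SymOn U (q j)) (k : ℕ) (f : TestSym n) (ζ : E n) :
    (PowerSeries.coeff k (symSeries hU hy q hq) f : E n → ℂ) ζ =
      ∑ s ∈ Finset.HasAntidiagonal.antidiagonal k, (s.2.factorial : ℂ)⁻¹ *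
        (Lop^[s.2] (fun z => q s.1 z.1 z.2 * (f : E n → ℂ) z.2)) (y₀, ζ) := by
  have h : PowerSeries.coeff k (symSeries hU hy q hq) = ∑ p ∈ Finset.HasAntidiagonal.antidiagonal k,
    ampEnd hU hy (mulAmp (q p.1)) (fun f => IsAmp.mul_testSym hU (hq p.1) f.2) p.2 :=
    PowerSeries.coeff_mk _ _
  rw [h, LinearMap.sum_apply, AddSubmonoidClass.coe_finsetSum, Finset.sum_apply]
  rfl

theorem integral_mul_coeff_symSeries {U : Set (E n)} (hU : IsOpen U) {y₀ : E n} (hy : y₀ ∈ U)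
    {q : ℕ → E n → E n → ℂ} (hq : ∀ j, SymOn U (q j)) (k : ℕ) (f : TestSym n) {a : E n → ℂ}
    (ha : ContDiffOn ℝ ∞ a {0}ᶜ) :
    ∫ ζ, a ζ * (PowerSeries.coeff k (symSeries hU hy q hq) f : E n → ℂ) ζ =
      ∫ ζ, (∑ s ∈ Finset.HasAntidiagonal.antidiagonal k, (s.2.factorial : ℂ)⁻¹ *
        star s.2 a (q s.1) y₀ ζ) * (f : E n → ℂ) ζ := by
  simp_rw [coeff_symSeries_apply, Finset.mul_sum, Finset.sum_mul]
  have hb := fun s : ℕ × ℕ => (IsAmp.mul_testSym hU (hq s.1) f.2).Lop_iterate hU s.2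
  rw [integral_finsetSum, integral_finsetSum]
  · refine Finset.sum_congr rfl fun s _ => ?_
    simp_rw [mul_left_comm (a _), mul_assoc]
    rw [integral_const_mul, integral_const_mul,
      integral_mul_Lop_iterate hU (hq s.1) f.2 s.2 ha y₀ hy]
  · intro s _
    simp_rw [mul_assoc]
    exact (TestSym.integrable_mul ((symOn_star hU s.2 ha (hq s.1)).slice hy) f.2).const_mul _
  · intro s _
    simp_rw [mul_left_comm (a _)]
    exact (TestSym.integrable_mul ha ((hb s).slice_mem hy)).const_mul _

theorem rep_symSeries {U : Set (E n)} (hU : IsOpen U) {y₀ : E n} (hy : y₀ ∈ U) {m : ℤ}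
    {q : ℕ → E n → E n → ℂ} (hq : ∀ j : ℕ, IsHomogSymbol U (m - j) (q j)) :
    Rep m (symSeries hU hy q fun j => (hq j).1) (fun k => q k y₀) := by
  refine ⟨fun k => (hq k).homog hy, fun k f => ?_⟩
  rw [symSeries, PowerSeries.coeff_mk, LinearMap.sum_apply, map_sum,
    Finset.sum_eq_single (k, 0)]
  · rw [ev_apply]
    refine integral_congr_ae (Eventually.of_forall fun ζ => ?_)
    change ((0 : ℕ).factorial : ℂ)⁻¹ * (Lop^[0] (mulAmp (q k) f)) (y₀, ζ) = _
    simp [mulAmp]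
  · rintro ⟨l, i⟩ hli hne
    have hs : l + i = k := Finset.HasAntidiagonal.mem_antidiagonal.1 hli
    have hi : i ≠ 0 := by rintro rfl; exact hne (by simpa using hs)
    exact ev_ampEnd hU hy _ _ hi f
  · simp

theorem coeff_zero_symSeries {U : Set (E n)} (hU : IsOpen U) {y₀ : E n} (hy : y₀ ∈ U)
    {q : ℕ → E n → E n → ℂ} (hq : ∀ j, SymOn U (q j)) :
    PowerSeries.coeff 0 (symSeries hU hy q hq) = TestSym.mulL (q 0 y₀) ((hq 0).slice hy) := by
  ext f ζ
  rw [coeff_symSeries_apply]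
  simp [TestSym.mulL_apply]

/-- The inverse of multiplication by a nowhere vanishing function. -/
def mulUnit (p : E n → ℂ) (hp : ContDiffOn ℝ ∞ p {0}ᶜ) (h0 : ∀ ζ ≠ 0, p ζ ≠ 0) :
    (Module.End ℂ (TestSym n))ˣ where
  val := TestSym.mulL p hp
  inv := TestSym.mulL (fun ζ => (p ζ)⁻¹) (hp.inv h0)
  val_inv := by
    ext f ζ
    by_cases hζ : ζ = 0
    · have : (f : E n → ℂ) ζ = 0 := by rw [hζ]; exact f.2.2.2.eq_of_nhds
      simp [Module.End.mul_apply, TestSym.mulL_apply, this]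
    · simp [Module.End.mul_apply, TestSym.mulL_apply, h0 ζ hζ]
  inv_val := by
    ext f ζ
    by_cases hζ : ζ = 0
    · have : (f : E n → ℂ) ζ = 0 := by rw [hζ]; exact f.2.2.2.eq_of_nhds
      simp [Module.End.mul_apply, TestSym.mulL_apply, this]
    · simp [Module.End.mul_apply, TestSym.mulL_apply, h0 ζ hζ]

theorem exists_symSeries_inv {U : Set (E n)} (hU : IsOpen U) {y₀ : E n} (hy : y₀ ∈ U)
    {q : ℕ → E n → E n → ℂ} (hq : ∀ j, SymOn U (q j)) (h0 : ∀ ζ ≠ 0, q 0 y₀ ζ ≠ 0) :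
    ∃ R, R * symSeries hU hy q hq = 1 ∧ symSeries hU hy q hq * R = 1 := by
  have h := coeff_zero_symSeries hU hy hq
  rw [PowerSeries.coeff_zero_eq_constantCoeff_apply] at h
  refine ⟨PowerSeries.invOfUnit _ (mulUnit (q 0 y₀) ((hq 0).slice hy) h0),
    PowerSeries.invOfUnit_mul _ _ h, PowerSeries.mul_invOfUnit _ _ h⟩

theorem rep_symInv {U : Set (E n)} (hU : IsOpen U) {y₀ : E n} (hy : y₀ ∈ U) {m : ℤ}
    {q : ℕ → E n → E n → ℂ} (hq : ∀ j : ℕ, IsHomogSymbol U (m - j) (q j))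
    (h0 : ∀ ζ ≠ 0, q 0 y₀ ζ ≠ 0) {R : PowerSeries (Module.End ℂ (TestSym n))}
    (hR : R * symSeries hU hy q (fun j => (hq j).1) = 1) : Rep (-m) R (symInv q y₀) := by
  refine ⟨homog_symInv hU hq hy h0, fun k => ?_⟩
  have hsym : ∀ j, SymOn U (q j) := fun j => (hq j).1
  induction k using Nat.strong_induction_on with
  | _ k ih =>
    intro f
    set g : TestSym n := TestSym.mulL (fun ζ => (q 0 y₀ ζ)⁻¹) (((hsym 0).slice hy).inv h0) f with hg
    have hgf : PowerSeries.coeff 0 (symSeries hU hy q hsym) g = f := by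
      rw [coeff_zero_symSeries]
      exact congrArg (fun T => T f) (mulUnit (q 0 y₀) ((hsym 0).slice hy) h0).val_inv
    have hlow : ∀ l : Fin k, ContDiffOn ℝ ∞ (fun ζ : E n =>
        ∑ s ∈ Finset.HasAntidiagonal.antidiagonal (k - l),
          (s.2.factorial : ℂ)⁻¹ * star s.2 (symInv q y₀ l) (q s.1) y₀ ζ) {0}ᶜ := fun l =>
      ContDiffOn.sum fun s _ => contDiffOn_const.mul
        ((symOn_star hU s.2 (homog_symInv hU hq hy h0 l).1 (hsym s.1)).slice hy)
    have h1 := congrArg (fun S : PowerSeries (Module.End ℂ (TestSym n)) => ev (PowerSeries.coeff k S g)) hR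
    simp only [PowerSeries.coeff_mul, LinearMap.sum_apply, map_sum, Module.End.mul_apply] at h1
    rw [Finset.Nat.sum_antidiagonal_eq_sum_range_succ_mk, Finset.sum_range_succ, Nat.sub_self,
      hgf, ← Fin.sum_univ_eq_sum_range (fun l => ev (PowerSeries.coeff l R
        (PowerSeries.coeff (k - l) (symSeries hU hy q hsym) g))) k] at h1
    have h2 : ∀ l : Fin k, ev (PowerSeries.coeff l R
        (PowerSeries.coeff (k - l) (symSeries hU hy q hsym) g)) =
        ∫ ζ, (∑ s ∈ Finset.HasAntidiagonal.antidiagonal (k - l),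
          (s.2.factorial : ℂ)⁻¹ * star s.2 (symInv q y₀ l) (q s.1) y₀ ζ) * (g : E n → ℂ) ζ := by
      intro l
      rw [ih l l.2, integral_mul_coeff_symSeries hU hy hsym _ _ (homog_symInv hU hq hy h0 l).1]
    rw [Finset.sum_congr rfl fun l _ => h2 l, ← integral_finsetSum _ fun l _ =>
      TestSym.integrable_mul (hlow l) g.2] at h1
    have h3 : ev (PowerSeries.coeff k (1 : PowerSeries (Module.End ℂ (TestSym n))) g) =
        ∫ ζ, (if k = 0 then (1 : ℂ) else 0) * (g : E n → ℂ) ζ := by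
      rw [PowerSeries.coeff_one]
      split_ifs with hk
      · simp [ev_apply]
      · simp
    rw [h3, ← eq_sub_iff_add_eq', ← integral_sub
      (TestSym.integrable_mul contDiffOn_const g.2) (integrable_finsetSum _ fun l _ =>
        TestSym.integrable_mul (hlow l) g.2)] at h1
    rw [h1]
    refine integral_congr_ae (Eventually.of_forall fun ζ => ?_)
    simp only
    rw [symInv_eq, hg, TestSym.mulL_apply, ← Finset.sum_mul, ← sub_mul]
    ring

end RiemPsiDO

end

noncomputable section
namespace RiemPsiDO
open Set Filter Topology
variable {n : ℕ}

/-- Smooth functions with compact support in `U`. -/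
def TestOn (U : Set (E n)) : Submodule ℂ (E n → ℂ) where
  carrier := {f | ContDiff ℝ ∞ f ∧ HasCompactSupport f ∧ tsupport f ⊆ U}
  add_mem' ha hb := ⟨ha.1.add hb.1, ha.2.1.add hb.2.1,
    (tsupport_add _ _).trans (union_subset ha.2.2 hb.2.2)⟩
  zero_mem' := ⟨contDiff_const, HasCompactSupport.zero, by simp [tsupport]⟩
  smul_mem' c f hf := ⟨contDiff_const.smul hf.1, hf.2.1.smul_left (f := fun _ => c),
    (closure_mono (Function.support_const_smul_subset c f)).trans hf.2.2⟩

theorem TestOn.mul_mem {U : Set (E n)} {χ f : E n → ℂ} (hχ : χ ∈ TestOn U)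
    (hf : ContDiffOn ℝ ∞ f U) (hU : IsOpen U) : (fun x => χ x * f x) ∈ TestOn U := by
  refine ⟨?_, hχ.2.1.mul_right, (tsupport_mul_subset_left (f := χ)).trans hχ.2.2⟩
  simp_rw [mul_comm (χ _)]
  exact contDiff_mul_of_tsupport_subset hU hf hχ.1 hχ.2.2

/-- Transport to the manifold of a function supported in the range of the coordinates. -/
def push {M : Mfd.{u} n} (φ : Coord M) (v : E n → ℂ) : M → ℂ := φ.source.indicator (v ∘ φ)

section Push
variable {M : Mfd.{u} n} {φ : Coord M}

theorem push_apply {v : E n → ℂ} {x : M} (hx : x ∈ φ.source) : push φ v x = v (φ x) :=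
  indicator_of_mem hx _

theorem push_symm {v : E n → ℂ} {y : E n} (hy : y ∈ φ.target) : push φ v (φ.symm y) = v y := by
  rw [push_apply (φ.map_target hy), φ.right_inv hy]

theorem inCoord_push {v : E n → ℂ} (hv : tsupport v ⊆ φ.target) : inCoord φ (push φ v) = v := by
  ext y
  by_cases hy : y ∈ φ.target
  · rw [inCoord, indicator_of_mem hy, Function.comp_apply, push_symm hy]
  · rw [inCoord, indicator_of_notMem hy, image_eq_zero_of_notMem_tsupport fun h => hy (hv h)]

theorem isCompact_image_symm {K : Set (E n)} (hK : IsCompact K) (h : K ⊆ φ.target) :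
    IsCompact (φ.symm '' K) := hK.image_of_continuousOn (φ.continuousOn_symm.mono h)

theorem tsupport_push_subset {v : E n → ℂ} (hc : HasCompactSupport v) (hv : tsupport v ⊆ φ.target) :
    tsupport (push φ v) ⊆ φ.symm '' tsupport v := by
  refine closure_minimal (fun x hx => ?_) (isCompact_image_symm hc hv).isClosed
  have h1 : x ∈ φ.source := by
    by_contra h; exact hx (indicator_of_notMem h _)
  rw [Function.mem_support, push_apply h1] at hx
  exact ⟨φ x, subset_tsupport _ hx, φ.left_inv h1⟩

theorem tsupport_push_subset_source {v : E n → ℂ} (hv : v ∈ TestOn φ.target) :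
    tsupport (push φ v) ⊆ φ.source := by
  refine (tsupport_push_subset hv.2.1 hv.2.2).trans ?_
  rintro _ ⟨y, hy, rfl⟩
  exact φ.map_target (hv.2.2 hy)

theorem contMDiffOn_coord (hφ : IsCoord φ) : ContMDiffOn (𝓡 n) (𝓡 n) ∞ φ φ.source :=
  contMDiffOn_of_mem_maximalAtlas hφ

theorem contMDiffOn_coord_symm (hφ : IsCoord φ) :
    ContMDiffOn (𝓡 n) (𝓡 n) ∞ φ.symm φ.target :=
  contMDiffOn_symm_of_mem_maximalAtlas hφ

theorem contDiffOn_comp_symm (hφ : IsCoord φ) {f : M → ℂ} (hf : f ∈ Smooth M) :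
    ContDiffOn ℝ ∞ (f ∘ φ.symm) φ.target :=
  contMDiffOn_iff_contDiffOn.1 (ContMDiff.comp_contMDiffOn hf (contMDiffOn_coord_symm hφ))

theorem push_mem (hφ : IsCoord φ) {v : E n → ℂ} (hv : v ∈ TestOn φ.target) : push φ v ∈ Test M := by
  refine ⟨contMDiff_of_tsupport fun x hx => ?_, (isCompact_image_symm hv.2.1 hv.2.2).of_isClosed_subset
    (isClosed_tsupport _) (tsupport_push_subset hv.2.1 hv.2.2)⟩
  have hx' := tsupport_push_subset_source hv hx
  have h1 : ContMDiffAt (𝓡 n) 𝓘(ℝ, ℂ) ∞ (v ∘ φ) x :=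
    (ContDiff.contMDiff hv.1).contMDiffAt.comp x
      ((contMDiffOn_coord hφ).contMDiffAt (φ.open_source.mem_nhds hx'))
  refine h1.congr_of_eventuallyEq ?_
  filter_upwards [φ.open_source.mem_nhds hx'] with y hy using push_apply hy

/-- `push` as a linear map. -/
def pushL (φ : Coord M) (hφ : IsCoord φ) : TestOn φ.target →ₗ[ℂ] Test M where
  toFun v := ⟨push φ v, push_mem hφ v.2⟩
  map_add' v w := by
    ext x; by_cases hx : x ∈ φ.source <;> simp [push, hx]
  map_smul' c v := by
    ext x; by_cases hx : x ∈ φ.source <;> simp [push, hx]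

theorem coe_pushL (hφ : IsCoord φ) (v : TestOn φ.target) :
    (pushL φ hφ v : M → ℂ) = push φ v := rfl

theorem tsupport_inCoord_subset {v : M → ℂ} (hc : HasCompactSupport v) (hv : tsupport v ⊆ φ.source) :
    tsupport (inCoord φ v) ⊆ φ '' tsupport v := by
  have hK : IsCompact (φ '' tsupport v) := hc.isCompact.image_of_continuousOn (φ.continuousOn.mono hv)
  refine closure_minimal (fun y hy => ?_) hK.isClosed
  have h1 : y ∈ φ.target := by
    by_contra h; exact hy (indicator_of_notMem h _)
  rw [Function.mem_support, inCoord, indicator_of_mem h1] at hy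
  exact ⟨φ.symm y, subset_tsupport _ hy, φ.right_inv h1⟩

theorem inCoord_mem (hφ : IsCoord φ) {v : M → ℂ} (hv : v ∈ Test M) (hs : tsupport v ⊆ φ.source) :
    inCoord φ v ∈ TestOn φ.target := by
  have h1 := tsupport_inCoord_subset hv.2 hs
  have h2 : φ '' tsupport v ⊆ φ.target := by
    rintro _ ⟨x, hx, rfl⟩; exact φ.map_source (hs hx)
  have hK : IsCompact (φ '' tsupport v) :=
    hv.2.isCompact.image_of_continuousOn (φ.continuousOn.mono hs)
  refine ⟨?_, hK.of_isClosed_subset (isClosed_tsupport _) h1, h1.trans h2⟩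
  refine contDiff_iff_contDiffAt.2 fun y => ?_
  by_cases hy : y ∈ φ.target
  · refine ((contDiffOn_comp_symm hφ hv.1).contDiffAt (φ.open_target.mem_nhds hy)).congr_of_eventuallyEq
      ?_
    filter_upwards [φ.open_target.mem_nhds hy] with z hz using indicator_of_mem hz _
  · have : y ∉ tsupport (inCoord φ v) := fun h => hy (h2 (h1 h))
    exact contDiffAt_const.congr_of_eventuallyEq (notMem_tsupport_iff_eventuallyEq.1 this)

theorem push_inCoord {v : M → ℂ} (hs : tsupport v ⊆ φ.source) : push φ (inCoord φ v) = v := by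
  ext x
  by_cases hx : x ∈ φ.source
  · rw [push_apply hx, inCoord, indicator_of_mem (φ.map_source hx), Function.comp_apply,
      φ.left_inv hx]
  · rw [push, indicator_of_notMem hx, image_eq_zero_of_notMem_tsupport fun h => hx (hs h)]

theorem pushL_inCoord (hφ : IsCoord φ) (v : Test M) (hs : tsupport (v : M → ℂ) ⊆ φ.source) :
    pushL φ hφ ⟨inCoord φ v, inCoord_mem hφ v.2 hs⟩ = v :=
  Subtype.ext (push_inCoord hs)

theorem exists_testOn {U : Set (E n)} (hU : IsOpen U) {y₀ : E n} (hy : y₀ ∈ U) :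
    ∃ χ ∈ TestOn U, χ =ᶠ[𝓝 y₀] 1 := by
  obtain ⟨ε, hε, hb⟩ := Metric.isOpen_iff.1 hU y₀ hy
  let b : ContDiffBump y₀ := ⟨ε / 4, ε / 2, by positivity, by linarith⟩
  have hs : tsupport (fun x => ((b x : ℝ) : ℂ)) ⊆ Metric.closedBall y₀ (ε / 2) := by
    rw [← b.tsupport_eq]
    exact closure_mono fun x hx h => hx (by simp [h])
  refine ⟨fun x => ((b x : ℝ) : ℂ), ⟨Complex.ofRealCLM.contDiff.comp b.contDiff,
    (isCompact_closedBall y₀ (ε / 2)).of_isClosed_subset (isClosed_tsupport _) hs,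
    hs.trans ((Metric.closedBall_subset_ball (by linarith)).trans hb)⟩, ?_⟩
  filter_upwards [b.eventuallyEq_one] with x hx
  simp [hx]

/-- The test functions concentrating at a point. -/
def testPacket {U : Set (E n)} (hU : IsOpen U) (χ : TestOn U) (y₀ : E n) (h : ℝ) :
    TestSym n →ₗ[ℂ] TestOn U where
  toFun f := ⟨fun y => (χ : E n → ℂ) y * packet y₀ h f y,
    TestOn.mul_mem χ.2 (contDiff_packet y₀ h f).contDiffOn hU⟩
  map_add' f g := by
    ext y
    change _ * packet y₀ h (f + g : TestSym n) y = _ * packet y₀ h f y + _ * packet y₀ h g y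
    rw [← packetL_apply, map_add, mul_add]
    rfl
  map_smul' c f := by
    ext y
    change _ * packet y₀ h (c • f : TestSym n) y = c * (_ * packet y₀ h f y)
    rw [← packetL_apply, map_smul, smul_eq_mul, mul_left_comm]
    rfl

theorem small_integral_kernel {U U' V K : Set (E n)} (hU : IsOpen U) (hU' : IsOpen U')
    (hV : IsOpen V) (hK : IsCompact K) (hVK : V ⊆ K) (hKU : K ⊆ U) {k : E n → E n → ℂ}
    (hk : ContDiffOn ℝ ∞ (fun z : E n × E n => k z.1 z.2) (U ×ˢ U')) (χ : TestOn U') (y₀ : E n)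
    (f : TestSym n) (N : ℕ) : Small V N (fun h x =>
      ∫ y in U', k x y * (testPacket hU' χ y₀ h f : E n → ℂ) y) := by
  have hG : ContDiffOn ℝ ∞ (fun z : E n × E n => k z.1 z.2 * (χ : E n → ℂ) z.2) (U ×ˢ univ) := by
    rintro ⟨x, y⟩ ⟨hx, -⟩
    refine ContDiffAt.contDiffWithinAt ?_
    by_cases hy : y ∈ tsupport (χ : E n → ℂ)
    · exact (hk.contDiffAt ((hU.prod hU').mem_nhds ⟨hx, χ.2.2.2 hy⟩)).mul
        ((χ.2.1.comp contDiff_snd).contDiffAt)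
    · refine contDiffAt_const (c := (0 : ℂ)) |>.congr_of_eventuallyEq ?_
      have h1 : ∀ᶠ z : E n × E n in 𝓝 (x, y), (χ : E n → ℂ) z.2 = 0 :=
        continuous_snd.tendsto (x, y) |>.eventually (notMem_tsupport_iff_eventuallyEq.1 hy)
      filter_upwards [h1] with z hz
      simp [hz]
  refine (small_integral_packet hU hV hK hVK hKU χ.2.2.1.isCompact y₀ N _ hG
    (fun x _ y hy => by simp [image_eq_zero_of_notMem_tsupport hy]) f).congr hV
    fun h _ x hx => ?_
  rw [setIntegral_eq_integral_of_forall_compl_eq_zero]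
  · refine integral_congr_ae (Eventually.of_forall fun y => ?_)
    simp only [testPacket, LinearMap.coe_mk, AddHom.coe_mk]
    ring
  · intro y hy
    rw [image_eq_zero_of_notMem_tsupport fun h => hy ((testPacket hU' χ y₀ _ f).2.2.2 h), mul_zero]

theorem small_smoothKernel {ψ : Coord M} (hψ : IsCoord ψ) {P : Op M}
    (hP : HasSmoothKernel P φ ψ) {V K : Set (E n)} (hV : IsOpen V) (hK : IsCompact K) (hVK : V ⊆ K)
    (hKU : K ⊆ φ.target) (χ : TestOn ψ.target) (y₀ : E n) (f : TestSym n) (N : ℕ) :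
    Small V N (fun h x =>
      (P (pushL ψ hψ (testPacket ψ.open_target χ y₀ h f)) : M → ℂ) (φ.symm x)) := by
  obtain ⟨k, hk, hkP⟩ := hP
  refine (small_integral_kernel φ.open_target ψ.open_target hV hK hVK hKU hk χ y₀ f N).congr hV
    fun h _ x hx => ?_
  have hx' := hKU (hVK hx)
  have hv := (testPacket ψ.open_target χ y₀ h f).2
  rw [hkP _ (by rw [coe_pushL]; exact tsupport_push_subset_source hv) _ (φ.map_target hx'),
    coe_pushL, inCoord_push hv.2.2, φ.right_inv hx']

/-- The action of a pseudodifferential operator on concentrating test functions. -/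
theorem hasExp_of_hasSymbol {P : Op M} (hφ : IsCoord φ) {m : ℤ} {q : ℕ → E n → E n → ℂ}
    (hP : HasSymbol m P φ q) (χ : TestOn φ.target) {y₀ : E n} (hy : y₀ ∈ φ.target)
    (h1 : (χ : E n → ℂ) =ᶠ[𝓝 y₀] 1) {ρ : ℝ} (hρ : 0 < ρ)
    (hball : Metric.ball y₀ (2 * ρ) ⊆ φ.target) (hq : ∀ j, SymOn φ.target (q j)) (f : TestSym n) :
    HasExp (Metric.ball y₀ ρ) y₀ (-m)
      (fun k => PowerSeries.coeff k (symSeries φ.open_target hy q hq) f)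
      (fun h x => (P (pushL φ hφ (testPacket φ.open_target χ y₀ h f)) : M → ℂ) (φ.symm x)) := by
  obtain ⟨p, r, hp, hr, hP⟩ := hP
  have hsub : Metric.closedBall y₀ ρ ⊆ φ.target :=
    (Metric.closedBall_subset_ball (by linarith)).trans hball
  refine (hasExp_quantize φ.open_target hy hρ hball hp χ.2.1 χ.2.2.1 h1 f).add_small
    Metric.isOpen_ball fun N => (small_integral_kernel φ.open_target φ.open_target
      Metric.isOpen_ball (isCompact_closedBall y₀ ρ) Metric.ball_subset_closedBall hsub hr χ y₀ f
      N).congr Metric.isOpen_ball fun h _ x hx => ?_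
  have hx' := hsub (Metric.ball_subset_closedBall hx)
  have hv := (testPacket φ.open_target χ y₀ h f).2
  rw [hP _ (by rw [coe_pushL]; exact tsupport_push_subset_source hv) _ (φ.map_target hx'),
    coe_pushL, inCoord_push hv.2.2, φ.right_inv hx']
  exact add_sub_cancel_left _ _

theorem HasSymbol.homog {P : Op M} {m : ℤ} {q : ℕ → E n → E n → ℂ}
    (hP : HasSymbol m P φ q) (j : ℕ) : IsHomogSymbol φ.target (m - j) (q j) := by
  obtain ⟨p, r, hp, -⟩ := hP
  exact hp.2.1 j

theorem exists_ball {U : Set (E n)} (hU : IsOpen U) {y₀ : E n} (hy : y₀ ∈ U) :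
    ∃ ρ > 0, Metric.ball y₀ (2 * ρ) ⊆ U := by
  obtain ⟨ε, hε, hb⟩ := Metric.isOpen_iff.1 hU y₀ hy
  exact ⟨ε / 2, by positivity, by rwa [mul_div_cancel₀ _ two_ne_zero]⟩

/-- The action on profiles depends only on the operator modulo smoothing operators. -/
theorem symSeries_eq_of_smoothing {P P' : Op M} (hφ : IsCoord φ) {m : ℤ}
    {q q' : ℕ → E n → E n → ℂ} (hP : HasSymbol m P φ q) (hP' : HasSymbol m P' φ q') {c : ℂ}
    (hs : IsSmoothing (P' - c • P)) {y₀ : E n} (hy : y₀ ∈ φ.target) :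
    symSeries φ.open_target hy q' (fun j => (hP'.homog j).1) =
      PowerSeries.mk fun k => c • PowerSeries.coeff k
        (symSeries φ.open_target hy q (fun j => (hP.homog j).1)) := by
  obtain ⟨ρ, hρ, hball⟩ := exists_ball φ.open_target hy
  obtain ⟨χ, hχ, h1⟩ := exists_testOn φ.open_target hy
  have hsub : Metric.closedBall y₀ ρ ⊆ φ.target :=
    (Metric.closedBall_subset_ball (by linarith)).trans hball
  ext1 k
  refine LinearMap.ext fun f => ?_
  have e1 := hasExp_of_hasSymbol hφ hP ⟨χ, hχ⟩ hy h1 hρ hball (fun j => (hP.homog j).1) f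
  have e2 := hasExp_of_hasSymbol hφ hP' ⟨χ, hχ⟩ hy h1 hρ hball (fun j => (hP'.homog j).1) f
  have e3 := (e1.smul Metric.isOpen_ball c).add_small Metric.isOpen_ball fun N =>
    (small_smoothKernel hφ (hs φ φ hφ hφ) Metric.isOpen_ball (isCompact_closedBall y₀ ρ)
      Metric.ball_subset_closedBall hsub ⟨χ, hχ⟩ y₀ f N).congr Metric.isOpen_ball
      (w' := fun h x => (P' (pushL φ hφ (testPacket φ.open_target ⟨χ, hχ⟩ y₀ h f)) : M → ℂ)
        (φ.symm x) - c * (P (pushL φ hφ (testPacket φ.open_target ⟨χ, hχ⟩ y₀ h f)) : M → ℂ)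
        (φ.symm x)) fun h _ x _ => rfl
  have := congrFun (e2.wExp.unique Metric.isOpen_ball (Metric.mem_ball_self hρ) e3.wExp) k
  simpa using this

/-- Continuity of an operator, on families of functions with fixed support. -/
theorem IsContinuousOp.family_bound {P : Op M} (hP : IsContinuousOp P) (hφ : IsCoord φ)
    {ψ : Coord M} (hψ : IsCoord ψ) {K V L : Set (E n)} (hK : IsCompact K) (hKV : K ⊆ V)
    (hV : V ⊆ φ.target) (hL : IsCompact L) (hLψ : L ⊆ ψ.target) : ∃ N₀ : ℕ, ∀ (N : ℤ)
      (v : ℝ → TestOn φ.target), (∀ h, tsupport (v h : E n → ℂ) ⊆ K) →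
      Small V N (fun h => (v h : E n → ℂ)) → ∃ C : ℝ, ∀ h ∈ Ioc (0 : ℝ) 1, ∀ x ∈ L,
        ‖(P (pushL φ hφ (v h)) : M → ℂ) (ψ.symm x)‖ ≤ C * h ^ (N - N₀) := by
  obtain ⟨N₀, C, hC⟩ := hP φ ψ hφ hψ (φ.symm '' K) (ψ.symm '' L)
    (isCompact_image_symm hK (hKV.trans hV))
    (by rintro _ ⟨y, hy, rfl⟩; exact φ.map_target (hV (hKV hy))) (isCompact_image_symm hL hLψ)
    (by rintro _ ⟨y, hy, rfl⟩; exact ψ.map_target (hLψ hy)) 0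
  refine ⟨N₀, fun N v hv hs => ?_⟩
  obtain ⟨A, hA, hb⟩ := hs.bound N₀
  refine ⟨C * A, fun h hh x hx => ?_⟩
  have h1 := hC (pushL φ hφ (v h)) (A * h ^ (N - N₀)) ((tsupport_push_subset (v h).2.2.1
    (v h).2.2.2).trans (image_mono (hv h))) (fun i hi y => ?_) (ψ.symm x) ⟨x, hx, rfl⟩
  · rw [norm_iteratedFDeriv_zero, Function.comp_apply, ψ.right_inv (hLψ hx), ← mul_assoc] at h1
    exact h1
  · rw [coe_pushL, inCoord_push (v h).2.2.2]
    by_cases hy : y ∈ V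
    · exact (hb i hi h hh y hy).trans (mul_le_mul_of_nonneg_left
        (zpow_le_zpow_of_le_one hh (by omega)) hA)
    · have : y ∉ tsupport (iteratedFDeriv ℝ i (v h : E n → ℂ)) := fun h' =>
        hy (hKV (hv h (tsupport_iteratedFDeriv_subset i h')))
      rw [image_eq_zero_of_notMem_tsupport this, norm_zero]
      exact mul_nonneg hA (zpow_nonneg hh.1.le _)

end Push

end RiemPsiDO

end

noncomputable section
namespace RiemPsiDO
open Set Filter Topology
variable {n : ℕ} {M : Mfd.{u} n} {φ ψ : Coord M}

theorem testPacket_apply {U : Set (E n)} (hU : IsOpen U) (χ : TestOn U) (y₀ : E n) (h : ℝ)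
    (f : TestSym n) (y : E n) :
    (testPacket hU χ y₀ h f : E n → ℂ) y = (χ : E n → ℂ) y * packet y₀ h f y := rfl

/-- The action of a pseudodifferential operator on a family with a known expansion. -/
theorem wExp_apply {P : Op M} (hc : IsContinuousOp P) (hφ : IsCoord φ) {m : ℤ}
    {q : ℕ → E n → E n → ℂ} (hP : HasSymbol m P φ q) (hq : ∀ j, SymOn φ.target (q j))
    (χ : TestOn φ.target) {y₀ : E n}
    (hy : y₀ ∈ φ.target) (h1 : (χ : E n → ℂ) =ᶠ[𝓝 y₀] 1) {ρ : ℝ} (hρ : 0 < ρ)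
    (hball : Metric.ball y₀ (2 * ρ) ⊆ φ.target) {V : Set (E n)} (hV : IsOpen V)
    (hχV : tsupport (χ : E n → ℂ) ⊆ V) (hVt : V ⊆ φ.target) {μ : ℤ} {g : ℕ → TestSym n}
    {s : ℝ → E n → ℂ} (hs : HasExp V y₀ μ g s) (v : ℝ → TestOn φ.target)
    (hv : ∀ h x, (v h : E n → ℂ) x = (χ : E n → ℂ) x * s h x) :
    WExp (Metric.ball y₀ ρ) y₀ (μ + -m)
      (fun k => ∑ p ∈ Finset.HasAntidiagonal.antidiagonal k,
        PowerSeries.coeff p.2 (symSeries φ.open_target hy q hq) (g p.1))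
      (fun h x => (P (pushL φ hφ (v h)) : M → ℂ) (φ.symm x)) := by
  have hsub : Metric.closedBall y₀ ρ ⊆ φ.target :=
    (Metric.closedBall_subset_ball (by linarith)).trans hball
  obtain ⟨N₀, hN₀⟩ := hc.family_bound hφ hφ χ.2.2.1.isCompact hχV hVt
    (isCompact_closedBall y₀ ρ) hsub
  refine WExp.bind (L := (N₀ - m).toNat) (g := fun l k =>
    PowerSeries.coeff k (symSeries φ.open_target hy q hq) (g l))
    (w' := fun l h x => (P (pushL φ hφ (testPacket φ.open_target χ y₀ h (g l))) : M → ℂ)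
      (φ.symm x)) (fun N => ?_)
    fun l => (hasExp_of_hasSymbol hφ hP χ hy h1 hρ hball hq (g l)).wExp
  have hval : ∀ h x, ((v h - ∑ l ∈ Finset.range N, (h : ℂ) ^ (μ + l) •
      testPacket φ.open_target χ y₀ h (g l) : TestOn φ.target) : E n → ℂ) x =
      (χ : E n → ℂ) x * (s h x - ∑ l ∈ Finset.range N, (h : ℂ) ^ (μ + l) *
        packet y₀ h (g l) x) := by
    intro h x
    rw [Submodule.coe_sub, AddSubmonoidClass.coe_finsetSum, Pi.sub_apply, Finset.sum_apply, hv,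
      mul_sub, Finset.mul_sum]
    congr 1
    refine Finset.sum_congr rfl fun l _ => ?_
    rw [Submodule.coe_smul, Pi.smul_apply, testPacket_apply, smul_eq_mul, mul_left_comm]
  have hsup : ∀ h, tsupport ((v h - ∑ l ∈ Finset.range N, (h : ℂ) ^ (μ + l) •
      testPacket φ.open_target χ y₀ h (g l) : TestOn φ.target) : E n → ℂ) ⊆
      tsupport (χ : E n → ℂ) := fun h => by
    refine closure_minimal (fun x hx => ?_) (isClosed_tsupport _)
    rw [Function.mem_support, hval] at hx
    exact subset_tsupport _ (left_ne_zero_of_mul hx)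
  obtain ⟨C, hC⟩ := hN₀ (μ + N) (fun h => v h - ∑ l ∈ Finset.range N, (h : ℂ) ^ (μ + l) •
    testPacket φ.open_target χ y₀ h (g l)) hsup (by
      have := (Small.of_bound (V := V) χ.2.1.contDiffOn fun k => by
        obtain ⟨C, hC⟩ := bound_of_hasCompactSupport χ.2.1 χ.2.2.1 k
        exact ⟨C, fun x _ => hC x⟩).mul hV (hs N)
      rw [zero_add] at this
      exact this.congr hV fun h _ x _ => hval h x)
  refine ⟨|C|, fun h hh x hx => ?_⟩
  have h2 := hC h hh x (Metric.ball_subset_closedBall hx)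
  have h3 : (P (pushL φ hφ (v h - ∑ l ∈ Finset.range N, (h : ℂ) ^ (μ + l) •
      testPacket φ.open_target χ y₀ h (g l))) : M → ℂ) (φ.symm x) =
      (P (pushL φ hφ (v h)) : M → ℂ) (φ.symm x) - ∑ l ∈ Finset.range N, (h : ℂ) ^ (μ + l) *
        (P (pushL φ hφ (testPacket φ.open_target χ y₀ h (g l))) : M → ℂ) (φ.symm x) := by
    rw [map_sub, map_sub, map_sum, map_sum, Submodule.coe_sub, AddSubmonoidClass.coe_finsetSum,
      Pi.sub_apply, Finset.sum_apply]
    congr 1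
    refine Finset.sum_congr rfl fun l _ => ?_
    rw [map_smul, map_smul]
    rfl
  rw [h3] at h2
  refine h2.trans (mul_le_mul (le_abs_self C) (zpow_le_zpow_of_le_one hh ?_)
    (zpow_nonneg hh.1.le _) (abs_nonneg _))
  omega

/-- The action on profiles in two systems of coordinates. -/
theorem coordSeries_mul_symSeries {P : Op M} (hc : IsContinuousOp P) (hφ : IsCoord φ)
    (hψ : IsCoord ψ) {m : ℤ} {q q' : ℕ → E n → E n → ℂ} (hP : HasSymbol m P φ q)
    (hP' : HasSymbol m P ψ q') {y : E n} {U : Set (E n)} (hU : IsOpen U) (hcv : Convex ℝ U)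
    (hy : y ∈ U) (hUψ : U ⊆ ψ.target) (hUφ : ∀ z ∈ U, ψ.symm z ∈ φ.source)
    {N : E n → E n ≃L[ℝ] E n} {d : E n → ℝ} (hN : IsCoordChange (φ ∘ ψ.symm) y U N d)
    (hy' : φ (ψ.symm y) ∈ φ.target) :
    coordSeries hU hy hN * symSeries φ.open_target hy' q (fun j => (hP.homog j).1) =
      symSeries ψ.open_target (hUψ hy) q' (fun j => (hP'.homog j).1) * coordSeries hU hy hN := by
  set κ : E n → E n := φ ∘ ψ.symm with hκ
  set y' : E n := φ (ψ.symm y) with hy'def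
  obtain ⟨ρ', hρ', hb'⟩ := exists_ball hU hy
  obtain ⟨ρ, hρ, hb⟩ := exists_ball φ.open_target hy'
  have hcl : Metric.closedBall y ρ' ⊆ U :=
    (Metric.closedBall_subset_ball (by linarith)).trans hb'
  have hκc : ContinuousOn κ U := fun z hz => ContinuousAt.continuousWithinAt
    ((φ.continuousAt (hUφ z hz)).comp (ψ.continuousAt_symm (hUψ hz)))
  have hκy : ContinuousAt κ y := hκc.continuousAt (hU.mem_nhds hy)
  -- a cut-off supported in both charts
  set O : Set (E n) := φ.target ∩ φ.symm ⁻¹' (ψ.source ∩ ψ ⁻¹' Metric.ball y ρ') with hO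
  have hOo : IsOpen O := φ.symm.isOpen_inter_preimage (ψ.isOpen_inter_preimage Metric.isOpen_ball)
  have hyO : y' ∈ O := by
    refine ⟨hy', ?_⟩
    rw [mem_preimage, hy'def, φ.left_inv (hUφ y hy)]
    exact ⟨ψ.map_target (hUψ hy), by rw [mem_preimage, ψ.right_inv (hUψ hy)]; exact Metric.mem_ball_self hρ'⟩
  obtain ⟨χ, hχ, hχ1⟩ := exists_testOn hOo hyO
  have hχφ : χ ∈ TestOn φ.target := ⟨hχ.1, hχ.2.1, hχ.2.2.trans inter_subset_left⟩
  have hpush : ∀ v : TestOn φ.target, tsupport (v : E n → ℂ) ⊆ tsupport χ →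
      tsupport (push φ (v : E n → ℂ)) ⊆ ψ.source ∩ ψ ⁻¹' Metric.ball y ρ' := by
    intro v hv
    refine (tsupport_push_subset v.2.2.1 v.2.2.2).trans ?_
    rintro _ ⟨z, hz, rfl⟩
    exact (hχ.2.2 (hv hz)).2
  have hχs := hpush ⟨χ, hχφ⟩ subset_rfl
  set χ' : TestOn ψ.target := ⟨inCoord ψ (push φ χ), inCoord_mem hψ (push_mem hφ hχφ)
    (hχs.trans inter_subset_left)⟩ with hχ'
  have hχ'V : tsupport (χ' : E n → ℂ) ⊆ Metric.ball y ρ' := by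
    refine (tsupport_inCoord_subset (push_mem hφ hχφ).2 (hχs.trans inter_subset_left)).trans ?_
    rintro _ ⟨x, hx, rfl⟩
    exact (hχs hx).2
  have hχ'1 : (χ' : E n → ℂ) =ᶠ[𝓝 y] 1 := by
    filter_upwards [hκy.eventually hχ1, hU.mem_nhds hy] with z hz hzU
    change inCoord ψ (push φ χ) z = 1
    rw [inCoord, indicator_of_mem (hUψ hzU), Function.comp_apply, push_apply (hUφ z hzU)]
    exact hz
  have hsupp : ∀ h f, tsupport (testPacket φ.open_target ⟨χ, hχφ⟩ y' h f : E n → ℂ) ⊆ tsupport χ :=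
    fun h f => tsupport_mul_subset_left (f := χ)
  have hin : ∀ h f, tsupport (pushL φ hφ (testPacket φ.open_target ⟨χ, hχφ⟩ y' h f) : M → ℂ) ⊆
      ψ.source := fun h f => (hpush _ (hsupp h f)).trans inter_subset_left
  ext1 k
  refine LinearMap.ext fun f => ?_
  set v : ℝ → TestOn ψ.target := fun h => ⟨_, inCoord_mem hψ
    (pushL φ hφ (testPacket φ.open_target ⟨χ, hχφ⟩ y' h f)).2 (hin h f)⟩ with hv
  have hvP : ∀ h, pushL ψ hψ (v h) = pushL φ hφ (testPacket φ.open_target ⟨χ, hχφ⟩ y' h f) :=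
    fun h => pushL_inCoord hψ _ (hin h f)
  have hs := hasExp_packet_comp hU hcv hy hN Metric.isOpen_ball (isCompact_closedBall y ρ')
    Metric.ball_subset_closedBall hcl f
  have e1 := wExp_apply hc hψ hP' (fun j => (hP'.homog j).1) χ' (hUψ hy) hχ'1 hρ'
    (hb'.trans hUψ) Metric.isOpen_ball hχ'V
    (Metric.ball_subset_closedBall.trans (hcl.trans hUψ)) hs v (fun h z => by
      change inCoord ψ (push φ _) z = inCoord ψ (push φ χ) z * _
      by_cases hz : z ∈ ψ.target
      · rw [inCoord, indicator_of_mem hz, inCoord, indicator_of_mem hz, Function.comp_apply,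
          Function.comp_apply]
        by_cases hz' : ψ.symm z ∈ φ.source
        · rw [push_apply hz', push_apply hz']
          rfl
        · rw [push, indicator_of_notMem hz', push, indicator_of_notMem hz', zero_mul]
      · rw [inCoord, indicator_of_notMem hz, inCoord, indicator_of_notMem hz, zero_mul])
  have e2 := (hasExp_of_hasSymbol hφ hP ⟨χ, hχφ⟩ hy' hχ1 hρ hb (fun j => (hP.homog j).1) f).wExp
  obtain ⟨r, hr, hrV⟩ := Metric.mem_nhds_iff.1 (inter_mem (Metric.ball_mem_nhds y hρ')
    (hκy.preimage_mem_nhds (Metric.ball_mem_nhds _ hρ)))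
  have hs' := fun g => (hasExp_packet_comp hU hcv hy hN Metric.isOpen_ball
    (isCompact_closedBall y ρ') Metric.ball_subset_closedBall hcl g).wExp.mono
    (hrV.trans inter_subset_left)
  have e3 := WExp.bind (V := Metric.ball y r) (L := 0) (μ := -m) (ν := 0)
    (w := fun h z => (P (pushL ψ hψ (v h)) : M → ℂ) (ψ.symm z))
    (w' := fun l h z => packet (κ y) h (PowerSeries.coeff l
      (symSeries φ.open_target hy' q fun j => (hP.homog j).1) f) (κ z))
    (fun N => by
      obtain ⟨C, hC⟩ := e2 N
      refine ⟨C, fun h hh z hz => ?_⟩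
      have hzU : z ∈ U := hcl (Metric.ball_subset_closedBall (hrV hz).1)
      have h2 := hC h hh (κ z) (hrV hz).2
      beta_reduce at h2
      rw [show φ.symm (κ z) = ψ.symm z from φ.left_inv (hUφ z hzU), ← hvP h] at h2
      rw [show -m + 0 + (N : ℤ) - (0 : ℕ) = -m + N by simp]
      exact h2)
    (fun l => hs' _)
  have e1' := e1.mono (hrV.trans inter_subset_left)
  rw [show (0 : ℤ) + -m = -m + 0 by ring] at e1'
  have := congrFun (e3.unique Metric.isOpen_ball (Metric.mem_ball_self hr) e1') k
  rw [PowerSeries.coeff_mul, PowerSeries.coeff_mul, LinearMap.sum_apply, LinearMap.sum_apply,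
    ← Finset.Nat.sum_antidiagonal_swap]
  refine this.trans ?_
  rw [← Finset.Nat.sum_antidiagonal_swap]
  rfl

end RiemPsiDO

end

noncomputable section
namespace RiemPsiDO
open Set Filter Topology
variable {n : ℕ} {M : Mfd.{u} n} {φ ψ : Coord M}

theorem smooth_mul {f g : M → ℂ} (hf : f ∈ Smooth M) (hg : g ∈ Smooth M) :
    (fun x => f x * g x) ∈ Smooth M :=
  (contDiff_mul (𝕜 := ℝ) (𝔸 := ℂ)).contMDiff.comp (ContMDiff.prodMk_space hf hg)

/-- Operators preserve negligible families, even when the supports do not lie in a chart. -/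
theorem IsContinuousOp.negligible {P : Op M} (hc : IsContinuousOp P) (hφ : IsCoord φ)
    {L : Set (E n)} (hL : IsCompact L) (hLφ : L ⊆ φ.target) {z : ℝ → Test M} {K : Set M}
    (hK : IsCompact K) (hz : ∀ h, tsupport (z h : M → ℂ) ⊆ K)
    (hloc : ∀ x ∈ K, ∃ ψ : Coord M, IsCoord ψ ∧ x ∈ ψ.source ∧ ∃ W : Set (E n), IsOpen W ∧
      ψ x ∈ W ∧ W ⊆ ψ.target ∧ ∀ N : ℕ, Small W N (fun h y => (z h : M → ℂ) (ψ.symm y)))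
    (N : ℕ) : ∃ C : ℝ, ∀ h ∈ Ioc (0 : ℝ) 1, ∀ x ∈ L,
      ‖(P (z h) : M → ℂ) (φ.symm x)‖ ≤ C * h ^ N := by
  have : LocallyCompactSpace M := ChartedSpace.locallyCompactSpace (E n) M
  choose ψ hψ hxψ W hWo hxW hWt hsm using hloc
  obtain ⟨t, ht⟩ := hK.elim_nhds_subcover' (fun x hx => (ψ x hx).source ∩ ψ x hx ⁻¹' W x hx)
    fun x hx => ((ψ x hx).isOpen_inter_preimage (hWo x hx)).mem_nhds ⟨hxψ x hx, hxW x hx⟩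
  obtain ⟨f, hf⟩ := SmoothPartitionOfUnity.exists_isSubordinate (ι := t) (𝓡 n) hK.isClosed
    (fun i => (ψ i.1.1 i.1.2).source ∩ ψ i.1.1 i.1.2 ⁻¹' W i.1.1 i.1.2)
    (fun i => (ψ _ _).isOpen_inter_preimage (hWo _ _)) (fun x hx => by
      obtain ⟨i, hi, hxi⟩ := mem_iUnion₂.1 (ht hx)
      exact mem_iUnion.2 ⟨⟨i, hi⟩, hxi⟩)
  have hfs : ∀ i, (fun x => ((f i x : ℝ) : ℂ)) ∈ Smooth M := fun i =>
    Complex.ofRealCLM.contDiff.contMDiff.comp (f i).contMDiff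
  have hts : ∀ i h, tsupport (fun x => ((f i x : ℝ) : ℂ) * (z h : M → ℂ) x) ⊆
      tsupport (f i) ∩ K := by
    intro i h
    refine closure_minimal (fun x hx => ?_) ((isClosed_tsupport _).inter hK.isClosed)
    have hx1 := left_ne_zero_of_mul hx
    exact ⟨subset_tsupport _ (by simpa using hx1), hz h (subset_tsupport _ (right_ne_zero_of_mul hx))⟩
  set zi : t → ℝ → Test M := fun i h => ⟨fun x => ((f i x : ℝ) : ℂ) * (z h : M → ℂ) x,
    smooth_mul (hfs i) (z h).2.1, hK.of_isClosed_subset (isClosed_tsupport _)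
      ((hts i h).trans inter_subset_right)⟩ with hzi
  have hsum : ∀ h, z h = ∑ i, zi i h := by
    intro h
    ext x
    rw [AddSubmonoidClass.coe_finsetSum, Finset.sum_apply]
    simp only [hzi, ← Finset.sum_mul]
    by_cases hx : x ∈ K
    · have := f.sum_eq_one hx
      rw [finsum_eq_sum_of_fintype] at this
      rw [← Complex.ofReal_sum, this, Complex.ofReal_one, one_mul]
    · rw [image_eq_zero_of_notMem_tsupport fun h' => hx (hz h h'), mul_zero]
  have hi : ∀ i : t, ∃ C : ℝ, ∀ h ∈ Ioc (0 : ℝ) 1, ∀ x ∈ L,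
      ‖(P (zi i h) : M → ℂ) (φ.symm x)‖ ≤ C * h ^ N := by
    intro i
    have hiψ := hψ i.1.1 i.1.2
    have hiW := hWo i.1.1 i.1.2
    have hiWt := hWt i.1.1 i.1.2
    have hiS := hsm i.1.1 i.1.2
    have hif : tsupport (f i) ⊆ (ψ i.1.1 i.1.2).source ∩ ψ i.1.1 i.1.2 ⁻¹' W i.1.1 i.1.2 := hf i
    generalize ψ i.1.1 i.1.2 = ψ at *
    generalize W i.1.1 i.1.2 = W at *
    have hsrc : tsupport (f i) ∩ K ⊆ ψ.source := inter_subset_left.trans (hif.trans inter_subset_left)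
    have hKi : IsCompact (ψ '' (tsupport (f i) ∩ K)) :=
      (hK.inter_left (isClosed_tsupport _)).image_of_continuousOn (ψ.continuousOn.mono hsrc)
    have hKW : ψ '' (tsupport (f i) ∩ K) ⊆ W := by
      rintro _ ⟨x, hx, rfl⟩; exact (hif hx.1).2
    obtain ⟨B, hB, hKB, hBW⟩ := exists_compact_between hKi hiW hKW
    have hin : ∀ h, tsupport (zi i h : M → ℂ) ⊆ ψ.source := fun h => (hts i h).trans hsrc
    obtain ⟨N₀, hN₀⟩ := hc.family_bound hiψ hφ hKi hKB (interior_subset.trans (hBW.trans hiWt)) hL hLφ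
    obtain ⟨C, hC⟩ := hN₀ ((N + N₀ : ℕ) : ℤ)
      (fun h => ⟨inCoord ψ (zi i h), inCoord_mem hiψ (zi i h).2 (hin h)⟩)
      (fun h => (tsupport_inCoord_subset (zi i h).2.2 (hin h)).trans (image_mono (hts i h))) (by
        have h1 := (Small.of_isCompact hiW hB interior_subset hBW
          ((contDiffOn_comp_symm hiψ (hfs i)).mono hiWt)).mul isOpen_interior
          ((hiS (N + N₀)).mono (interior_subset.trans hBW) le_rfl)
        rw [zero_add] at h1
        refine h1.congr isOpen_interior fun h _ y hy => ?_
        exact indicator_of_mem (hiWt (hBW (interior_subset hy))) _)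
    refine ⟨C, fun h hh x hx => ?_⟩
    have := hC h hh x hx
    rw [pushL_inCoord hiψ (zi i h) (hin h)] at this
    rwa [show ((N + N₀ : ℕ) : ℤ) - N₀ = N by push_cast; ring, zpow_natCast] at this
  choose C hC using hi
  refine ⟨∑ i, C i, fun h hh x hx => ?_⟩
  rw [hsum h, map_sum, AddSubmonoidClass.coe_finsetSum, Finset.sum_apply, Finset.sum_mul]
  exact (norm_sum_le _ _).trans (Finset.sum_le_sum fun i _ => hC i h hh x hx)

theorem hasExp_packet {V : Set (E n)} (hV : IsOpen V) (y₀ : E n) (f : TestSym n) :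
    HasExp V y₀ 0 (fun l => if l = 0 then f else 0) (fun h => packet y₀ h f) := by
  rintro (_ | N)
  · simpa using Small.packet V y₀ f
  · refine (Small.zero V _).congr hV fun h _ x _ => ?_
    rw [Finset.sum_eq_single 0]
    · simp
    · intro l _ hl
      simp [hl, packet]
    · simp

theorem isCoord_restr (hφ : IsCoord φ) {s : Set M} (hs : IsOpen s) : IsCoord (φ.restr s) :=
  restr_mem_maximalAtlas (contDiffGroupoid ∞ (𝓡 n)) hφ hs

/-- The action on profiles of a parametrix is inverse to that of the operator. -/
theorem symSeries_mul_of_isParametrix {P Q : Op M} (hc : IsContinuousOp P) {m : ℤ}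
    (hPQ : IsParametrix m P Q) (hφ : IsCoord φ) {p q : ℕ → E n → E n → ℂ}
    (hP : HasSymbol m P φ p) (hQ : HasSymbol (-m) Q φ q) {y₀ : E n} (hy : y₀ ∈ φ.target) :
    symSeries φ.open_target hy p (fun j => (hP.homog j).1) *
      symSeries φ.open_target hy q (fun j => (hQ.homog j).1) = 1 := by
  obtain ⟨hQΨ, T, T₀, hT, hTT₀, hS', hS, -⟩ := hPQ
  obtain ⟨ρ, hρ, hball⟩ := exists_ball φ.open_target hy
  have hbt : ∀ {r}, r < 2 * ρ → Metric.closedBall y₀ r ⊆ φ.target := fun hr =>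
    (Metric.closedBall_subset_ball hr).trans hball
  obtain ⟨χ, hχ, hχ1⟩ := exists_testOn (n := n) (U := Metric.ball y₀ (ρ / 4)) Metric.isOpen_ball
    (Metric.mem_ball_self (by positivity))
  have hχφ : χ ∈ TestOn φ.target := ⟨hχ.1, hχ.2.1, hχ.2.2.trans
    (Metric.ball_subset_closedBall.trans (hbt (by linarith)))⟩
  let b : ContDiffBump y₀ := ⟨ρ / 2, 3 * ρ / 4, by positivity, by linarith⟩
  have hbs : tsupport (fun x => ((b x : ℝ) : ℂ)) ⊆ Metric.closedBall y₀ (3 * ρ / 4) := by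
    rw [← b.tsupport_eq]
    exact closure_mono fun x hx h => hx (by simp [h])
  set χ₂ : TestOn φ.target := ⟨fun x => ((b x : ℝ) : ℂ), Complex.ofRealCLM.contDiff.comp b.contDiff,
    (isCompact_closedBall y₀ _).of_isClosed_subset (isClosed_tsupport _) hbs,
    hbs.trans (hbt (by linarith))⟩ with hχ₂
  have hχ₂1 : ∀ x ∈ Metric.ball y₀ (ρ / 2), (χ₂ : E n → ℂ) x = 1 := fun x hx => by
    simp only [hχ₂]
    rw [b.one_of_mem_closedBall (Metric.ball_subset_closedBall hx), Complex.ofReal_one]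
  ext1 k
  refine LinearMap.ext fun f => ?_
  set u : ℝ → Test M := fun h => pushL φ hφ (testPacket φ.open_target ⟨χ, hχφ⟩ y₀ h f) with hu
  have hT₀u : ∀ h x, (T₀ (u h) : M → ℂ) x = (Q (u h) : M → ℂ) x -
      ((Q - T ∘ₗ incl M) (u h) : M → ℂ) x := by
    intro h x
    have h1 : (incl M (T₀ (u h)) : M → ℂ) x = (T (incl M (u h)) : M → ℂ) x :=
      congrArg (fun A : Op M => (A (u h) : M → ℂ) x) hTT₀
    have h2 : (incl M (T₀ (u h)) : M → ℂ) x = (T₀ (u h) : M → ℂ) x := rfl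
    rw [← h2, h1]
    simp
  -- expansion of `T₀ u` near the base point
  have hρt : Metric.closedBall y₀ ρ ⊆ φ.target := hbt (by linarith)
  have e1 : HasExp (Metric.ball y₀ ρ) y₀ (- -m) (fun l => PowerSeries.coeff l
      (symSeries φ.open_target hy q fun j => (hQ.homog j).1) f)
      (fun h x => (T₀ (u h) : M → ℂ) (φ.symm x)) := by
    refine (hasExp_of_hasSymbol hφ hQ ⟨χ, hχφ⟩ hy hχ1 hρ hball (fun j => (hQ.homog j).1) f).add_small
      Metric.isOpen_ball fun N => ((small_smoothKernel hφ (hS' φ φ hφ hφ) Metric.isOpen_ball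
        (isCompact_closedBall y₀ ρ) Metric.ball_subset_closedBall hρt ⟨χ, hχφ⟩ y₀ f N).smul
        Metric.isOpen_ball (-1)).congr Metric.isOpen_ball fun h _ x _ => ?_
    rw [hT₀u, sub_sub_cancel_left, neg_one_mul]
  set v : ℝ → TestOn φ.target := fun h => ⟨fun x => (χ₂ : E n → ℂ) x *
    (T₀ (u h) : M → ℂ) (φ.symm x), TestOn.mul_mem χ₂.2
      (contDiffOn_comp_symm hφ (T₀ (u h)).2.1) φ.open_target⟩ with hv
  have e2 := wExp_apply hc hφ hP (fun j => (hP.homog j).1) χ₂ hy (by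
      filter_upwards [Metric.ball_mem_nhds y₀ (show 0 < ρ / 2 by positivity)] with x hx
      exact hχ₂1 x hx) hρ hball
    Metric.isOpen_ball (hbs.trans (Metric.closedBall_subset_ball (by linarith)))
    (Metric.ball_subset_closedBall.trans hρt) e1 v (fun h x => rfl)
  -- the remaining part is negligible
  set z : ℝ → Test M := fun h => T₀ (u h) - pushL φ hφ (v h) with hz
  have hzval : ∀ h x, (z h : M → ℂ) x = (1 - push φ χ₂ x) * (T₀ (u h) : M → ℂ) x := by
    intro h x
    change (T₀ (u h) : M → ℂ) x - push φ (v h) x = _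
    by_cases hx : x ∈ φ.source
    · rw [push_apply hx, push_apply hx]
      simp only [hv]
      rw [φ.left_inv hx]
      ring
    · rw [push, indicator_of_notMem hx, push, indicator_of_notMem hx]
      ring
  have hKc : IsCompact (φ.symm '' Metric.closedBall y₀ (ρ / 4)) :=
    isCompact_image_symm (isCompact_closedBall _ _) (hbt (by linarith))
  obtain ⟨L, hL, hTL⟩ := hT.2 _ hKc
  have husupp : ∀ h, tsupport (u h : M → ℂ) ⊆ φ.symm '' Metric.closedBall y₀ (ρ / 4) := fun h =>
    (tsupport_push_subset (testPacket φ.open_target ⟨χ, hχφ⟩ y₀ h f).2.2.1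
      (testPacket φ.open_target ⟨χ, hχφ⟩ y₀ h f).2.2.2).trans (image_mono
      ((tsupport_mul_subset_left (f := χ)).trans (hχ.2.2.trans Metric.ball_subset_closedBall)))
  have hzs : ∀ h, tsupport (z h : M → ℂ) ⊆ L := by
    intro h
    refine closure_minimal (fun x hx => ?_) hL.isClosed
    by_contra hxL
    have h1 : (T₀ (u h) : M → ℂ) x = (T (incl M (u h)) : M → ℂ) x :=
      congrArg (fun A : Op M => (A (u h) : M → ℂ) x) hTT₀
    have h2 := hTL (incl M (u h)) (fun x hx =>
      image_eq_zero_of_notMem_tsupport (f := (u h : M → ℂ)) fun h' => hx (husupp h h')) x hxL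
    rw [Function.mem_support, hzval, h1, h2, mul_zero] at hx
    exact hx rfl
  have hloc : ∀ x ∈ L, ∃ ψ : Coord M, IsCoord ψ ∧ x ∈ ψ.source ∧ ∃ W : Set (E n), IsOpen W ∧
      ψ x ∈ W ∧ W ⊆ ψ.target ∧ ∀ N : ℕ, Small W N (fun h y => (z h : M → ℂ) (ψ.symm y)) := by
    intro x _
    by_cases hx : x ∈ φ.source ∩ φ ⁻¹' Metric.ball y₀ (ρ / 2)
    · have hW : Metric.ball y₀ (ρ / 2) ⊆ φ.target :=
        Metric.ball_subset_closedBall.trans (hbt (by linarith))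
      refine ⟨φ, hφ, hx.1, Metric.ball y₀ (ρ / 2), Metric.isOpen_ball, hx.2, hW, fun N =>
        (Small.zero _ N).congr Metric.isOpen_ball fun h _ y hy => ?_⟩
      rw [hzval, push_symm (hW hy), hχ₂1 y hy, sub_self, zero_mul]
    · have hO₂ : IsOpen (φ.symm '' Metric.closedBall y₀ (ρ / 4))ᶜ := hKc.isClosed.isOpen_compl
      have hO₁ : IsOpen (φ.source ∩ φ ⁻¹' Metric.ball y₀ (ρ / 4)) :=
        φ.isOpen_inter_preimage Metric.isOpen_ball
      have hxO : x ∈ (φ.symm '' Metric.closedBall y₀ (ρ / 4))ᶜ := by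
        rintro ⟨y, hy, rfl⟩
        refine hx ⟨φ.map_target (hbt (by linarith) hy), ?_⟩
        rw [mem_preimage, φ.right_inv (hbt (by linarith) hy)]
        exact Metric.closedBall_subset_ball (by linarith) hy
      have hψ : IsCoord ((chartAt (E n) x).restr (φ.symm '' Metric.closedBall y₀ (ρ / 4))ᶜ) :=
        isCoord_restr (IsManifold.chart_mem_maximalAtlas x) hO₂
      have hxψ : x ∈ ((chartAt (E n) x).restr (φ.symm '' Metric.closedBall y₀ (ρ / 4))ᶜ).source := by
        rw [OpenPartialHomeomorph.restr_source' _ _ hO₂]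
        exact ⟨mem_chart_source _ x, hxO⟩
      have hdisj : Disjoint ((chartAt (E n) x).restr (φ.symm '' Metric.closedBall y₀ (ρ / 4))ᶜ).source
          (φ.restr (φ.source ∩ φ ⁻¹' Metric.ball y₀ (ρ / 4))).source := by
        rw [OpenPartialHomeomorph.restr_source' _ _ hO₂, OpenPartialHomeomorph.restr_source' _ _ hO₁]
        refine disjoint_left.2 fun w hw hw' => hw.2 ⟨φ w, Metric.ball_subset_closedBall hw'.2.2,
          φ.left_inv hw'.1⟩
      generalize (chartAt (E n) x).restr (φ.symm '' Metric.closedBall y₀ (ρ / 4))ᶜ = ψ at *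
      set φ' := φ.restr (φ.source ∩ φ ⁻¹' Metric.ball y₀ (ρ / 4)) with hφ'def
      have hφ' : IsCoord φ' := isCoord_restr hφ hO₁
      have hφ's : φ'.source = φ.source ∩ φ ⁻¹' Metric.ball y₀ (ρ / 4) := by
        rw [hφ'def, OpenPartialHomeomorph.restr_source' _ _ hO₁]
        exact inter_eq_right.2 inter_subset_left
      have hφ't : Metric.ball y₀ (ρ / 4) ⊆ φ'.target := by
        intro y hy
        have hyt : y ∈ φ.target := hbt (by linarith) (Metric.ball_subset_closedBall hy)
        have h1 : φ.symm y ∈ φ'.source := by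
          rw [hφ's]
          exact ⟨φ.map_target hyt, by rwa [mem_preimage, φ.right_inv hyt]⟩
        have h2 := φ'.map_source h1
        have h3 : φ' (φ.symm y) = y := φ.right_inv hyt
        rwa [h3] at h2
      have hχ' : χ ∈ TestOn φ'.target := ⟨hχ.1, hχ.2.1, hχ.2.2.trans hφ't⟩
      have hpu : ∀ h, pushL φ' hφ' (testPacket φ'.open_target ⟨χ, hχ'⟩ y₀ h f) = u h := by
        intro h
        ext w
        change push φ' (fun y => χ y * packet y₀ h f y) w = push φ (fun y => χ y * packet y₀ h f y) w
        by_cases hw : w ∈ φ'.source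
        · rw [push_apply hw, push_apply (by rw [hφ's] at hw; exact hw.1)]
          rfl
        · rw [push, indicator_of_notMem hw]
          by_cases hw' : w ∈ φ.source
          · rw [push_apply hw']
            have : φ w ∉ tsupport χ := fun h' => hw (by rw [hφ's]; exact ⟨hw', hχ.2.2 h'⟩)
            rw [image_eq_zero_of_notMem_tsupport this, zero_mul]
          · rw [push, indicator_of_notMem hw']
      obtain ⟨r, hr, hrt⟩ := exists_ball ψ.open_target (ψ.map_source hxψ)
      have hclt : Metric.closedBall (ψ x) r ⊆ ψ.target :=
        (Metric.closedBall_subset_ball (by linarith)).trans hrt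
      refine ⟨ψ, hψ, hxψ, Metric.ball (ψ x) r, Metric.isOpen_ball, Metric.mem_ball_self hr,
        Metric.ball_subset_closedBall.trans hclt, fun N => ?_⟩
      have s1 := small_smoothKernel hφ' (hQΨ.offDiagonal ψ φ' hψ hφ' hdisj) Metric.isOpen_ball
        (isCompact_closedBall _ r) Metric.ball_subset_closedBall hclt ⟨χ, hχ'⟩ y₀ f N
      have s2 := small_smoothKernel hφ' (hS' ψ φ' hψ hφ') Metric.isOpen_ball
        (isCompact_closedBall _ r) Metric.ball_subset_closedBall hclt ⟨χ, hχ'⟩ y₀ f N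
      have hone : (fun _ => 1 : M → ℂ) ∈ Smooth M := contMDiff_const
      have s3 := (Small.of_isCompact ψ.open_target (isCompact_closedBall _ r)
        Metric.ball_subset_closedBall hclt (contDiffOn_comp_symm hψ
          (sub_mem hone (push_mem hφ χ₂.2).1))).mul Metric.isOpen_ball (s1.sub Metric.isOpen_ball s2)
      rw [zero_add] at s3
      refine s3.congr Metric.isOpen_ball fun h _ y _ => ?_
      rw [hzval, hT₀u, hpu h]
      rfl
  have e3 : WExp (Metric.ball y₀ ρ) y₀ (- -m + -m) _
      (fun h x => (P (T₀ (u h)) : M → ℂ) (φ.symm x)) := e2.add_small fun N => by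
    obtain ⟨C, hC⟩ := hc.negligible hφ (isCompact_closedBall y₀ ρ) hρt hL hzs hloc N
    refine ⟨C, fun h hh x hx => ?_⟩
    have h1 := hC h hh x (Metric.ball_subset_closedBall hx)
    have h2 : (P (z h) : M → ℂ) (φ.symm x) = (P (T₀ (u h)) : M → ℂ) (φ.symm x) -
        (P (pushL φ hφ (v h)) : M → ℂ) (φ.symm x) := by
      simp only [hz]
      rw [map_sub]
      rfl
    rwa [h2] at h1
  have e4 : WExp (Metric.ball y₀ ρ) y₀ 0 (fun l => if l = 0 then f else 0)
      (fun h x => (P (T₀ (u h)) : M → ℂ) (φ.symm x)) := by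
    refine (((hasExp_packet Metric.isOpen_ball y₀ f).cutoff Metric.isOpen_ball
      hχ.1.contDiffOn (fun k => by
        obtain ⟨C, hC⟩ := bound_of_hasCompactSupport hχ.1 hχ.2.1 k
        exact ⟨C, fun x _ => hC x⟩) hχ1).add_small Metric.isOpen_ball fun N =>
      (small_smoothKernel hφ (hS φ φ hφ hφ) Metric.isOpen_ball (isCompact_closedBall y₀ ρ)
        Metric.ball_subset_closedBall hρt ⟨χ, hχφ⟩ y₀ f N).congr Metric.isOpen_ball
        fun h _ x hx => ?_).wExp
    have h1 : (u h : M → ℂ) (φ.symm x) = χ x * packet y₀ h f x :=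
      push_symm (hρt (Metric.ball_subset_closedBall hx))
    rw [← h1]
    rfl
  rw [neg_neg, add_neg_cancel] at e3
  have := congrFun (e3.unique Metric.isOpen_ball (Metric.mem_ball_self hρ) e4) k
  rw [PowerSeries.coeff_mul, LinearMap.sum_apply, ← Finset.Nat.sum_antidiagonal_swap,
    PowerSeries.coeff_one]
  refine this.trans ?_
  split_ifs <;> rfl

end RiemPsiDO

end

noncomputable section
namespace RiemPsiDO
open Set Filter Topology
variable {n : ℕ}

/-- The inverse Fourier transform of an amplitude in its second variable. -/
def osc (b : E n × E n → ℂ) (x z : E n) : ℂ := cn n * ∫ ζ, ee z ζ * b (x, ζ)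

theorem IsAmp.bound_slice {U : Set (E n)} (hU : IsOpen U) {b : E n × E n → ℂ} (hb : IsAmp U b)
    {K B : Set (E n)} (hK : IsCompact K) (hKU : K ⊆ U) (hB : IsCompact B) (k : ℕ) :
    ∃ C : ℝ, 0 ≤ C ∧ ∀ i ≤ k, ∀ x ∈ K, ∀ ζ ∈ B, ‖iteratedFDeriv ℝ i (fun x => b (x, ζ)) x‖ ≤ C := by
  have h1 : ∀ i, ∃ C : ℝ, ∀ x ∈ K, ∀ ζ ∈ B, ‖iteratedFDeriv ℝ i (fun x => b (x, ζ)) x‖ ≤ C := by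
    intro i
    obtain ⟨C, hC⟩ := (hK.prod hB).exists_bound_of_continuousOn
      ((continuousOn_iteratedFDeriv_slice i (hU.prod isOpen_univ) hb.smooth).mono
        (prod_mono hKU (subset_univ _)))
    exact ⟨C, fun x hx ζ hζ => hC (x, ζ) ⟨hx, hζ⟩⟩
  choose C hC using h1
  refine ⟨∑ i ∈ Finset.range (k + 1), |C i|, Finset.sum_nonneg fun _ _ => abs_nonneg _,
    fun i hi x hx ζ hζ => (hC i x hx ζ hζ).trans ?_⟩
  exact (le_abs_self _).trans (Finset.single_le_sum (f := fun i => |C i|)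
    (fun _ _ => abs_nonneg _) (Finset.mem_range.2 (Nat.lt_succ_of_le hi)))

theorem norm_iteratedFDeriv_comp_fst_le {V : Set (E n)} (hV : IsOpen V) {g : E n → ℂ}
    (hg : ContDiffOn ℝ ∞ g V) (j : ℕ) {p : E n × E n} (hp : p.1 ∈ V) :
    ‖iteratedFDeriv ℝ j (fun p : E n × E n => g p.1) p‖ ≤ ‖iteratedFDeriv ℝ j g p.1‖ := by
  have hpre : IsOpen (ContinuousLinearMap.fst ℝ (E n) (E n) ⁻¹' V) := hV.preimage continuous_fst
  have h3 := ContinuousLinearMap.iteratedFDerivWithin_comp_right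
    (ContinuousLinearMap.fst ℝ (E n) (E n)) (i := j) (n := ∞)
    hg hV.uniqueDiffOn hpre.uniqueDiffOn (x := p) hp (by exact_mod_cast le_top)
  have h5 : (ContinuousLinearMap.fst ℝ (E n) (E n)) p ∈ V := hp
  have h4 := (iteratedFDerivWithin_of_isOpen (f := g ∘ ContinuousLinearMap.fst ℝ (E n) (E n)) j hpre
    hp).symm.trans h3
  rw [iteratedFDerivWithin_of_isOpen j hV h5] at h4
  change ‖iteratedFDeriv ℝ j (g ∘ ContinuousLinearMap.fst ℝ (E n) (E n)) p‖ ≤ _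
  rw [h4]
  refine (ContinuousMultilinearMap.norm_compContinuousLinearMap_le _ _).trans ?_
  exact mul_le_of_le_one_right (norm_nonneg _) (Finset.prod_le_one
    (fun _ _ => norm_nonneg _) fun _ _ => ContinuousLinearMap.norm_fst_le ℝ (E n) (E n))

theorem IsAmp.small_osc {U V K : Set (E n)} (hU : IsOpen U) (hV : IsOpen V) (hK : IsCompact K)
    (hVK : V ⊆ K) (hKU : K ⊆ U) {b : E n × E n → ℂ} (hb : IsAmp U b) :
    Small (V ×ˢ (univ : Set (E n))) 0 (fun h p => osc b p.1 (h⁻¹ • p.2)) := by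
  obtain ⟨B, hB, h0, hs⟩ := hb.supp
  obtain ⟨R₀, hR₀⟩ := hB.isBounded.exists_norm_le
  set R := max R₀ 1
  have hR1 : 1 ≤ R := le_max_right _ _
  have hR0 : 0 ≤ R := zero_le_one.trans hR1
  have hR : ∀ ζ ∈ B, ‖ζ‖ ≤ R := fun ζ hζ => (hR₀ ζ hζ).trans (le_max_left _ _)
  choose C hC0 hC using hb.bound_slice hU hK hKU hB
  have hVo : IsOpen (V ×ˢ (univ : Set (E n))) := hV.prod isOpen_univ
  have key : ∀ h ∈ Ioc (0 : ℝ) 1, ContDiffOn ℝ ∞ (fun p : E n × E n => osc b p.1 (h⁻¹ • p.2))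
      (V ×ˢ univ) ∧ ∀ k : ℕ, ∀ p ∈ V ×ˢ (univ : Set (E n)),
      ‖iteratedFDeriv ℝ k (fun p : E n × E n => osc b p.1 (h⁻¹ • p.2)) p‖ ≤
        ∫ ζ, B.indicator (fun _ => ‖cn n‖ * (2 ^ k * ((h⁻¹ * R) ^ k * C k))) ζ := by
    intro h hh
    have hh0 := hh.1
    have hinv : |h⁻¹| = h⁻¹ := abs_of_pos (inv_pos.2 hh0)
    have h1h : 1 ≤ h⁻¹ * R := by
      have : 1 ≤ h⁻¹ := one_le_inv₀ hh0 |>.2 hh.2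
      nlinarith
    have hbs : ∀ ζ, ContDiffOn ℝ ∞ (fun x => b (x, ζ)) V := fun ζ =>
      hb.smooth.comp (by fun_prop) fun x hx => ⟨hKU (hVK hx), mem_univ _⟩
    have := contDiffOn_integral_mul_of_contDiffOn_prod (μ := (volume : Measure (E n))) hVo
      isOpen_univ (Eventually.of_forall fun _ => mem_univ _)
      (G := fun z : (E n × E n) × E n => ee (h⁻¹ • z.1.2) z.2 * b (z.1.1, z.2))
      (((contDiff_ee.comp (by fun_prop : ContDiff ℝ ∞ fun z : (E n × E n) × E n =>
        (h⁻¹ • z.1.2, z.2))).contDiffOn).mul (hb.smooth.comp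
          (by fun_prop : ContDiff ℝ ∞ fun z : (E n × E n) × E n => (z.1.1, z.2)).contDiffOn
          fun z hz => ⟨hKU (hVK hz.1.1), mem_univ _⟩))
      (w := fun _ => cn n) aestronglyMeasurable_const
      (β := fun k => B.indicator fun _ => ‖cn n‖ * (2 ^ k * ((h⁻¹ * R) ^ k * C k)))
      (fun k => (integrableOn_const hB.measure_lt_top.ne).integrable_indicator hB.measurableSet)
      (fun k ζ _ p hp => ?_)
    · have e1 : (fun p : E n × E n => osc b p.1 (h⁻¹ • p.2)) = fun p => ∫ ζ, cn n *
          (ee (h⁻¹ • p.2) ζ * b (p.1, ζ)) := by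
        ext p; rw [osc, integral_const_mul]
      rw [e1]
      exact this
    · by_cases hζ : ζ ∈ B
      · rw [indicator_of_mem hζ]
        refine mul_le_mul_of_nonneg_left ?_ (norm_nonneg _)
        have hee : (fun p : E n × E n => ee (h⁻¹ • p.2) ζ) = fun p => Complex.exp (Complex.I *
            (((h⁻¹ • innerSL ℝ ζ).comp (ContinuousLinearMap.snd ℝ (E n) (E n))) p : ℝ)) := by
          ext p
          simp [ee, inner_smul_left, real_inner_comm]
        have hL : ‖(h⁻¹ • innerSL ℝ ζ).comp (ContinuousLinearMap.snd ℝ (E n) (E n))‖ ≤ h⁻¹ * R := by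
          refine (ContinuousLinearMap.opNorm_comp_le _ _).trans ?_
          rw [norm_smul, innerSL_apply_norm, Real.norm_eq_abs, hinv]
          calc h⁻¹ * ‖ζ‖ * ‖ContinuousLinearMap.snd ℝ (E n) (E n)‖ ≤ h⁻¹ * R * 1 := by
                gcongr
                · exact hR ζ hζ
                · exact ContinuousLinearMap.norm_snd_le ℝ (E n) (E n)
            _ = _ := mul_one _
        refine (norm_iteratedFDeriv_mul_le_of_isOpen hVo (f := fun p : E n × E n =>
          ee (h⁻¹ • p.2) ζ) (g := fun p => b (p.1, ζ)) (contDiff_ee.comp (by fun_prop :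
          ContDiff ℝ ∞ fun p : E n × E n => (h⁻¹ • p.2, ζ))).contDiffOn
          ((hbs ζ).comp contDiffOn_fst fun p hp => hp.1) hp k).trans ?_
        calc _ ≤ ∑ i ∈ Finset.range (k + 1), (k.choose i : ℝ) * ((h⁻¹ * R) ^ k * C k) := by
              refine Finset.sum_le_sum fun i hi => ?_
              have hik : i ≤ k := Nat.lt_succ_iff.1 (Finset.mem_range.1 hi)
              rw [mul_assoc]
              refine mul_le_mul_of_nonneg_left (mul_le_mul ?_ ?_ (norm_nonneg _) (by positivity))
                (Nat.cast_nonneg _)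
              · rw [hee]
                exact (norm_iteratedFDeriv_exp_le _ i _).trans
                  ((pow_le_pow_left₀ (norm_nonneg _) hL i).trans (pow_le_pow_right₀ h1h hik))
              · exact (norm_iteratedFDeriv_comp_fst_le hV (hbs ζ) (k - i) hp.1).trans
                  (hC k _ (Nat.sub_le _ _) p.1 (hVK hp.1) ζ hζ)
          _ = _ := by
              rw [← Finset.sum_mul, ← Nat.cast_sum, Nat.sum_range_choose]
              push_cast; ring
      · rw [indicator_of_notMem hζ]
        have e2 : (fun p : E n × E n => ee (h⁻¹ • p.2) ζ * b (p.1, ζ)) =ᶠ[𝓝 p] fun _ => 0 := by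
          filter_upwards [hVo.mem_nhds hp] with p hp
          rw [hs p.1 (hKU (hVK hp.1)) ζ hζ, mul_zero]
        rw [(e2.iteratedFDeriv ℝ k).eq_of_nhds]
        simp
  refine ⟨fun h hh => (key h hh).1, fun k => ⟨volume.real B * (‖cn n‖ * (2 ^ k * (R ^ k * C k))),
    fun h hh x hx => ((key h hh).2 k x hx).trans (le_of_eq ?_)⟩⟩
  rw [integral_indicator hB.measurableSet, setIntegral_const, smul_eq_mul, zero_sub, zpow_neg,
    zpow_natCast, mul_pow, inv_pow]
  ring

theorem contDiffOn_osc {U : Set (E n)} (hU : IsOpen U) {b : E n × E n → ℂ} (hb : IsAmp U b) :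
    ContDiffOn ℝ ∞ (fun p : E n × E n => osc b p.1 p.2) (U ×ˢ univ) := by
  rintro ⟨x, z⟩ ⟨hx, -⟩
  obtain ⟨ρ, hρ, hball⟩ := exists_ball hU hx
  have h1 := (hb.small_osc hU Metric.isOpen_ball (isCompact_closedBall x ρ)
    Metric.ball_subset_closedBall ((Metric.closedBall_subset_ball (by linarith)).trans hball)).1 1
    ⟨one_pos, le_rfl⟩
  simp only [inv_one, one_smul] at h1
  exact (h1.contDiffAt ((Metric.isOpen_ball.prod isOpen_univ).mem_nhds
    ⟨Metric.mem_ball_self hρ, mem_univ _⟩)).contDiffWithinAt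

theorem coord_mul_osc {U : Set (E n)} (hU : IsOpen U) {b : E n × E n → ℂ} (hb : IsAmp U b) {x : E n}
    (hx : x ∈ U) (i : Fin n) (z : E n) :
    (z i : ℂ) * osc b x z = Complex.I * osc (dd (0, e i) b) x z := by
  have h1 := TestSym.integral_mul_dd (contDiff_ee_right z).contDiffOn (hb.slice_mem hx) (e i)
  have h2 : ∀ ζ, dd (e i) (fun ζ => b (x, ζ)) ζ = dd (0, e i) b (x, ζ) := fun ζ =>
    dd_slice_right (z := (x, ζ)) (differentiableAt_of_contDiffOn (hU.prod isOpen_univ) hb.smooth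
      ⟨hx, mem_univ _⟩) (e i)
  simp_rw [h2, dd_ee, mul_assoc] at h1
  rw [integral_const_mul, integral_const_mul] at h1
  simp only [osc]
  rw [h1]
  linear_combination ((z i : ℂ) * cn n * ∫ ζ, ee z ζ * b (x, ζ)) * Complex.I_mul_I

theorem IsAmp.small_osc_pow {U V K W L : Set (E n)} (hU : IsOpen U) (hV : IsOpen V)
    (hK : IsCompact K) (hVK : V ⊆ K) (hKU : K ⊆ U) (hW : IsOpen W) (hL : IsCompact L) (hWL : W ⊆ L)
    (hL0 : L ⊆ {0}ᶜ) (N : ℕ) : ∀ {b : E n × E n → ℂ}, IsAmp U b →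
    Small (V ×ˢ W) N (fun h p => osc b p.1 (h⁻¹ • p.2)) := by
  have hVW : IsOpen (V ×ˢ W) := hV.prod hW
  induction N with
  | zero => intro b hb; exact (hb.small_osc hU hV hK hVK hKU).mono (prod_mono_right (subset_univ _)) le_rfl
  | succ N ih =>
    intro b hb
    have h1 : ∀ i : Fin n, Small (V ×ˢ W) 0 (fun (_ : ℝ) (p : E n × E n) =>
        (p.2 i : ℂ) * (((‖p.2‖ ^ 2 : ℝ) : ℂ))⁻¹) := fun i => by
      refine Small.of_isCompact (U := U ×ˢ {0}ᶜ) (hU.prod isOpen_compl_singleton) (hK.prod hL)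
        (prod_mono hVK hWL) (prod_mono hKU hL0) ?_
      exact (contDiffOn_coord_div i).comp contDiffOn_snd fun p hp => hp.2
    have h2 := Small.sum hVW Finset.univ fun i _ =>
      ((h1 i).mul hVW (ih (hb.dd hU (0, e i)))).smul hVW Complex.I
    have h3 := h2.zpow_mul hVW 1
    rw [zero_add] at h3
    push_cast
    refine h3.congr hVW fun h hh p hp => ?_
    have hh0 : (h : ℂ) ≠ 0 := by exact_mod_cast hh.1.ne'
    have hp0 : p.2 ≠ 0 := hL0 (hWL hp.2)
    have hn : ((‖p.2‖ ^ 2 : ℝ) : ℂ) ≠ 0 := by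
      exact_mod_cast (pow_pos (norm_pos_iff.2 hp0) 2).ne'
    have h4 : ∀ i, Complex.I * ((p.2 i : ℂ) * (((‖p.2‖ ^ 2 : ℝ) : ℂ))⁻¹ *
        osc (RiemPsiDO.dd (0, e i) b) p.1 (h⁻¹ • p.2)) =
        ((p.2 i : ℂ) ^ 2 * (((‖p.2‖ ^ 2 : ℝ) : ℂ))⁻¹ * (h : ℂ)⁻¹) * osc b p.1 (h⁻¹ • p.2) := by
      intro i
      have := coord_mul_osc hU hb (hKU (hVK hp.1)) i (h⁻¹ • p.2)
      simp only [PiLp.smul_apply, smul_eq_mul, Complex.ofReal_mul, Complex.ofReal_inv] at this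
      linear_combination (-(p.2 i : ℂ) * (((‖p.2‖ ^ 2 : ℝ) : ℂ))⁻¹) * this
    rw [Finset.sum_congr rfl fun i _ => h4 i, ← Finset.sum_mul, ← Finset.sum_mul, ← Finset.sum_mul]
    have h5 : ∑ i, (p.2 i : ℂ) ^ 2 = ((‖p.2‖ ^ 2 : ℝ) : ℂ) := by
      rw [EuclideanSpace.real_norm_sq_eq]
      push_cast
      rfl
    rw [h5, mul_inv_cancel₀ hn, one_mul, zpow_one, mul_inv_cancel_left₀ hh0]

theorem IsAmp.norm_osc_le {U K : Set (E n)} (hU : IsOpen U) (hK : IsCompact K) (hKU : K ⊆ U) (N : ℕ) :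
    ∀ {b : E n × E n → ℂ}, IsAmp U b →
    ∃ C : ℝ, 0 ≤ C ∧ ∀ x ∈ K, ∀ z, ‖z‖ ^ N * ‖osc b x z‖ ≤ C := by
  induction N with
  | zero =>
    intro b hb
    obtain ⟨B, hB, h0, hs⟩ := hb.supp
    obtain ⟨C, hC0, hC⟩ := hb.bound_slice hU hK hKU hB 0
    refine ⟨‖cn n‖ * (C * volume.real B), by positivity, fun x hx z => ?_⟩
    rw [pow_zero, one_mul, osc, norm_mul]
    refine mul_le_mul_of_nonneg_left ?_ (norm_nonneg _)
    rw [← setIntegral_eq_integral_of_forall_compl_eq_zero (s := B) fun ζ hζ => by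
      rw [hs x (hKU hx) ζ hζ, mul_zero]]
    refine norm_setIntegral_le_of_norm_le_const hB.measure_lt_top fun ζ hζ => ?_
    rw [norm_mul, norm_ee, one_mul]
    simpa using hC 0 le_rfl x hx ζ hζ
  | succ N ih =>
    intro b hb
    choose C hC0 hC using fun i : Fin n => ih (hb.dd hU (0, e i))
    refine ⟨∑ i, C i, Finset.sum_nonneg fun i _ => hC0 i, fun x hx z => ?_⟩
    have h1 : ‖z‖ ≤ ∑ i, |z i| := by
      conv_lhs => rw [← (EuclideanSpace.basisFun (Fin n) ℝ).sum_repr z]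
      refine (norm_sum_le _ _).trans (Finset.sum_le_sum fun i _ => ?_)
      rw [norm_smul]
      simp
    calc ‖z‖ ^ (N + 1) * ‖osc b x z‖ = ‖z‖ * (‖z‖ ^ N * ‖osc b x z‖) := by ring
      _ ≤ (∑ i, |z i|) * (‖z‖ ^ N * ‖osc b x z‖) := by gcongr
      _ = ∑ i, ‖z‖ ^ N * ‖osc (RiemPsiDO.dd (0, e i) b) x z‖ := by
        rw [Finset.sum_mul]
        refine Finset.sum_congr rfl fun i _ => ?_
        have := congrArg norm (coord_mul_osc hU hb (hKU hx) i z)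
        rw [norm_mul, norm_mul, Complex.norm_I, one_mul, Complex.norm_real, Real.norm_eq_abs] at this
        rw [← this]
        ring
      _ ≤ _ := Finset.sum_le_sum fun i _ => hC i x hx z

theorem IsAmp.norm_osc_sub_le {U K : Set (E n)} (hU : IsOpen U) (hK : IsCompact K) (hKU : K ⊆ U)
    {b : E n × E n → ℂ} (hb : IsAmp U b) :
    ∃ C : ℝ, 0 ≤ C ∧ ∀ x ∈ K, ∀ z, ‖osc b x z - osc b x 0‖ ≤ C * ‖z‖ := by
  obtain ⟨B, hB, h0, hs⟩ := hb.supp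
  obtain ⟨C, hC0, hC⟩ := hb.bound_slice hU hK hKU hB 0
  obtain ⟨R₀, hR₀⟩ := hB.isBounded.exists_norm_le
  refine ⟨‖cn n‖ * (|R₀| * C * volume.real B), by positivity, fun x hx z => ?_⟩
  have hi : ∀ w, Integrable fun ζ => ee w ζ * b (x, ζ) := fun w =>
    TestSym.integrable_mul (contDiff_ee_right w).contDiffOn (hb.slice_mem (hKU hx))
  rw [osc, osc, ← mul_sub, ← integral_sub (hi z) (hi 0), norm_mul, mul_assoc]
  refine mul_le_mul_of_nonneg_left ?_ (norm_nonneg _)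
  rw [← setIntegral_eq_integral_of_forall_compl_eq_zero (s := B) fun ζ hζ => by
      rw [hs x (hKU hx) ζ hζ, mul_zero, mul_zero, sub_zero]]
  refine (norm_setIntegral_le_of_norm_le_const (C := ‖z‖ * |R₀| * C) hB.measure_lt_top
    fun ζ hζ => ?_).trans (le_of_eq (by ring))
  rw [ee_zero_left, ← sub_mul, norm_mul]
  have h1 : ‖ee z ζ - 1‖ ≤ ‖z‖ * |R₀| := by
    refine (Real.norm_exp_I_mul_ofReal_sub_one_le).trans ?_
    exact (norm_inner_le_norm z ζ).trans
      (mul_le_mul_of_nonneg_left ((hR₀ ζ hζ).trans (le_abs_self _)) (norm_nonneg _))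
  have h2 : ‖b (x, ζ)‖ ≤ C := by simpa using hC 0 le_rfl x hx ζ hζ
  gcongr

end RiemPsiDO

end

noncomputable section
namespace RiemPsiDO
open Set Filter Topology
variable {n : ℕ}

theorem integral_inv_sq_Ioi {c : ℝ} (hc : 0 < c) :
    IntegrableOn (fun σ : ℝ => (σ ^ 2)⁻¹) (Ioi c) ∧ ∫ σ in Ioi c, (σ ^ 2)⁻¹ = c⁻¹ := by
  have h1 : EqOn (fun σ : ℝ => σ ^ (-2 : ℝ)) (fun σ : ℝ => (σ ^ 2)⁻¹) (Ioi c) := fun σ hσ => by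
    have : 0 < σ := hc.trans hσ
    simp only
    rw [Real.rpow_neg this.le, Real.rpow_two]
  refine ⟨(integrableOn_Ioi_rpow_of_lt (by norm_num) hc).congr_fun h1 measurableSet_Ioi, ?_⟩
  rw [← setIntegral_congr_fun measurableSet_Ioi h1, integral_Ioi_rpow_of_lt (by norm_num) hc]
  rw [show (-2 : ℝ) + 1 = -1 by norm_num, Real.rpow_neg_one]
  ring

/-- The integrand `σ^{s-1} Φ(x, σz)`. -/
def radial (b : E n × E n → ℂ) (s : ℕ) (x z : E n) (σ : ℝ) : ℂ :=
  (σ : ℂ) ^ ((s : ℤ) - 1) * osc b x (σ • z)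

/-- The contribution of the large frequencies. -/
def tailInt (b : E n × E n → ℂ) (s : ℕ) (x z : E n) : ℂ := ∫ σ in Ioi (1 : ℝ), radial b s x z σ

/-- The contribution of the small frequencies. -/
def headInt (b : E n × E n → ℂ) (s : ℕ) (x z : E n) : ℂ := ∫ σ in Ioc (0 : ℝ) 1, radial b s x z σ

/-- The homogeneous function `∫_0^∞ σ^{s-1} Φ(x, σz) dσ`. -/
def homInt (b : E n × E n → ℂ) (s : ℕ) (x z : E n) : ℂ := ∫ σ in Ioi (0 : ℝ), radial b s x z σ

section
variable {U : Set (E n)} {b : E n × E n → ℂ}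

theorem norm_zpow_ofReal {σ : ℝ} (hσ : 0 < σ) (a : ℤ) : ‖(σ : ℂ) ^ a‖ = σ ^ a := by
  rw [norm_zpow, Complex.norm_real, Real.norm_of_nonneg hσ.le]

theorem continuous_osc (hU : IsOpen U) (hb : IsAmp U b) {x : E n} (hx : x ∈ U) :
    Continuous (osc b x) := by
  rw [← continuousOn_univ]
  exact (contDiffOn_osc hU hb).continuousOn.comp (f := fun z => (x, z)) (by fun_prop)
    fun z _ => ⟨hx, mem_univ _⟩

theorem continuousOn_radial (hU : IsOpen U) (hb : IsAmp U b) {x : E n} (hx : x ∈ U) (s : ℕ)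
    (z : E n) : ContinuousOn (radial b s x z) (Ioi 0) := by
  refine ContinuousOn.mul (fun σ hσ => ?_) ((continuous_osc hU hb hx).comp (by fun_prop)).continuousOn
  exact (ContinuousAt.zpow₀ (by fun_prop) _
    (Or.inl (by exact_mod_cast (ne_of_gt hσ : σ ≠ 0)))).continuousWithinAt

theorem norm_radial_le (hU : IsOpen U) (hb : IsAmp U b) {K : Set (E n)} (hK : IsCompact K)
    (hKU : K ⊆ U) (s : ℕ) : ∃ C : ℝ, 0 ≤ C ∧ ∀ x ∈ K, ∀ z ≠ 0, ∀ σ > 0,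
      ‖radial b s x z σ‖ ≤ C * (‖z‖ ^ (s + 1))⁻¹ * (σ ^ 2)⁻¹ := by
  obtain ⟨C, hC0, hC⟩ := hb.norm_osc_le hU hK hKU (s + 1)
  refine ⟨C, hC0, fun x hx z hz σ hσ => ?_⟩
  have hz' := norm_pos_iff.2 hz
  have h1 := hC x hx (σ • z)
  rw [norm_smul, Real.norm_of_nonneg hσ.le, mul_pow] at h1
  have h2 : ‖osc b x (σ • z)‖ ≤ C * (σ ^ (s + 1) * ‖z‖ ^ (s + 1))⁻¹ := by
    rw [← div_eq_mul_inv, le_div_iff₀ (by positivity), mul_comm]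
    exact h1
  rw [radial, norm_mul, norm_zpow_ofReal hσ]
  calc _ ≤ σ ^ ((s : ℤ) - 1) * (C * (σ ^ (s + 1) * ‖z‖ ^ (s + 1))⁻¹) := by gcongr
    _ = _ := by
      rw [zpow_sub_one₀ hσ.ne', zpow_natCast]
      field_simp
      ring

theorem integrableOn_radial_Ioi (hU : IsOpen U) (hb : IsAmp U b) {x : E n} (hx : x ∈ U) (s : ℕ)
    {z : E n} (hz : z ≠ 0) {c : ℝ} (hc : 0 < c) : IntegrableOn (radial b s x z) (Ioi c) := by
  obtain ⟨C, hC0, hC⟩ := norm_radial_le hU hb (isCompact_singleton (x := x))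
    (singleton_subset_iff.2 hx) s
  refine Integrable.mono' ((integral_inv_sq_Ioi hc).1.const_mul (C * (‖z‖ ^ (s + 1))⁻¹))
    (((continuousOn_radial hU hb hx s z).mono (Ioi_subset_Ioi hc.le)).aestronglyMeasurable
      measurableSet_Ioi) ?_
  exact (ae_restrict_iff' measurableSet_Ioi).2 (Eventually.of_forall fun σ hσ =>
    hC x rfl z hz σ (hc.trans hσ))

theorem norm_setIntegral_radial_le (hU : IsOpen U) (hb : IsAmp U b) {K : Set (E n)}
    (hK : IsCompact K) (hKU : K ⊆ U) (s : ℕ) : ∃ C : ℝ, 0 ≤ C ∧ ∀ x ∈ K, ∀ z ≠ 0, ∀ c > 0,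
      ‖∫ σ in Ioi c, radial b s x z σ‖ ≤ C * (‖z‖ ^ (s + 1))⁻¹ * c⁻¹ := by
  obtain ⟨C, hC0, hC⟩ := norm_radial_le hU hb hK hKU s
  refine ⟨C, hC0, fun x hx z hz c hc => ?_⟩
  have h1 := integral_inv_sq_Ioi hc
  refine (norm_integral_le_of_norm_le (h1.1.const_mul (C * (‖z‖ ^ (s + 1))⁻¹))
    ((ae_restrict_iff' measurableSet_Ioi).2 (Eventually.of_forall fun σ hσ =>
      hC x hx z hz σ (hc.trans hσ)))).trans (le_of_eq ?_)
  rw [integral_const_mul, h1.2]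

theorem contDiffOn_osc_smul (hU : IsOpen U) (hb : IsAmp U b) :
    ContDiffOn ℝ ∞ (fun q : (E n × E n) × ℝ => osc b q.1.1 (q.2 • q.1.2)) ((U ×ˢ univ) ×ˢ univ) := by
  have h1 : ContDiff ℝ ∞ fun q : (E n × E n) × ℝ => (q.1.1, q.2 • q.1.2) := by fun_prop
  exact (contDiffOn_osc hU hb).comp (f := fun q : (E n × E n) × ℝ => (q.1.1, q.2 • q.1.2))
    h1.contDiffOn fun q hq => ⟨hq.1.1, mem_univ _⟩

theorem continuousOn_zpow_ofReal (a : ℤ) : ContinuousOn (fun σ : ℝ => (σ : ℂ) ^ a) (Ioi 0) :=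
  fun σ hσ => (ContinuousAt.zpow₀ (by fun_prop) _
    (Or.inl (by exact_mod_cast (ne_of_gt hσ : σ ≠ 0)))).continuousWithinAt

theorem contDiffOn_tailInt (hU : IsOpen U) (hb : IsAmp U b) (s : ℕ) :
    ContDiffOn ℝ ∞ (fun p : E n × E n => tailInt b s p.1 p.2) (U ×ˢ {0}ᶜ) := by
  rintro ⟨x, z⟩ ⟨hx, hz⟩
  obtain ⟨ρ, hρ, hball⟩ := exists_ball hU hx
  obtain ⟨r, hr, hball'⟩ := exists_ball (isOpen_compl_singleton (x := (0 : E n))) hz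
  have hcl := (Metric.closedBall_subset_ball (show ρ < 2 * ρ by linarith)).trans hball
  have hcl' := (Metric.closedBall_subset_ball (show r < 2 * r by linarith)).trans hball'
  have hV : IsOpen (Metric.ball x ρ ×ˢ Metric.ball z r) := Metric.isOpen_ball.prod Metric.isOpen_ball
  choose C hC0 hC using fun k : ℕ => (hb.small_osc_pow hU Metric.isOpen_ball (isCompact_closedBall x ρ)
    Metric.ball_subset_closedBall hcl Metric.isOpen_ball (isCompact_closedBall z r)
    Metric.ball_subset_closedBall hcl' (k + s + 1)).bound k
  have h1 := contDiffOn_integral_mul_of_contDiffOn_prod (μ := volume.restrict (Ioi (1 : ℝ))) hV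
    isOpen_Ioi (ae_restrict_mem measurableSet_Ioi)
    ((contDiffOn_osc_smul hU hb).mono
      (prod_mono (prod_mono (Metric.ball_subset_closedBall.trans hcl) (subset_univ _))
        (subset_univ _)))
    (((continuousOn_zpow_ofReal ((s : ℤ) - 1)).mono
      (Ioi_subset_Ioi zero_le_one)).aestronglyMeasurable measurableSet_Ioi)
    (β := fun k σ => C k * (σ ^ 2)⁻¹)
    (fun k => (integral_inv_sq_Ioi one_pos).1.const_mul _) (fun k σ hσ p hp => by
      have hσ0 : (0 : ℝ) < σ := zero_lt_one.trans hσ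
      have h2 := hC k k le_rfl σ⁻¹ ⟨inv_pos.2 hσ0, inv_le_one_of_one_le₀ (le_of_lt hσ)⟩ p hp
      rw [inv_inv] at h2
      beta_reduce
      rw [norm_zpow_ofReal hσ0]
      calc _ ≤ σ ^ ((s : ℤ) - 1) * (C k * σ⁻¹ ^ (((k + s + 1 : ℕ) : ℤ) - k)) := by gcongr
        _ = _ := by
          rw [show ((k + s + 1 : ℕ) : ℤ) - k = (s : ℤ) - 1 + (2 : ℕ) by push_cast; ring,
            zpow_add₀ (inv_ne_zero hσ0.ne'), inv_zpow', zpow_neg, zpow_natCast, inv_pow]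
          have : σ ^ ((s : ℤ) - 1) ≠ 0 := zpow_ne_zero _ hσ0.ne'
          field_simp)
  exact (h1.1.contDiffAt (hV.mem_nhds ⟨Metric.mem_ball_self hρ,
    Metric.mem_ball_self hr⟩)).contDiffWithinAt

theorem contDiffOn_headInt (hU : IsOpen U) (hb : IsAmp U b) {s : ℕ} (hs : s ≠ 0) :
    ContDiffOn ℝ ∞ (fun p : E n × E n => headInt b s p.1 p.2) (U ×ˢ univ) := by
  obtain ⟨r, rfl⟩ : ∃ r, s = r + 1 := ⟨s - 1, by omega⟩
  have hG : ContDiffOn ℝ ∞ (fun q : (E n × E n) × ℝ => (q.2 : ℂ) ^ r * osc b q.1.1 (q.2 • q.1.2))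
      ((U ×ˢ univ) ×ˢ univ) := by
    have h0 : ContDiff ℝ ∞ fun q : (E n × E n) × ℝ => (q.2 : ℂ) ^ r :=
      (Complex.ofRealCLM.contDiff.comp contDiff_snd).pow r
    exact h0.contDiffOn.mul (contDiffOn_osc_smul hU hb)
  have hUo : IsOpen (U ×ˢ (univ : Set (E n))) := hU.prod isOpen_univ
  have hsub : ∀ p ∈ U ×ˢ (univ : Set (E n)), ∀ σ ∈ Icc (0 : ℝ) 1,
      (p, σ) ∈ (U ×ˢ (univ : Set (E n))) ×ˢ (univ : Set ℝ) := fun p hp σ _ => ⟨hp, mem_univ _⟩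
  have h1 := (contDiffOn_integral_of_isCompact (Y := E n × E n) (T := ℝ) (F := ℂ)
    (μ := (volume : Measure ℝ)) hUo isCompact_Icc (hUo.prod isOpen_univ) hsub hG).1
  refine h1.congr fun p _ => ?_
  rw [integral_Icc_eq_integral_Ioc, headInt]
  refine integral_congr_ae (Eventually.of_forall fun σ => ?_)
  change radial b (r + 1) p.1 p.2 σ = (σ : ℂ) ^ r * osc b p.1 (σ • p.2)
  rw [radial, Nat.cast_add, Nat.cast_one, add_sub_cancel_right, zpow_natCast]

theorem norm_radial_le_head (hU : IsOpen U) (hb : IsAmp U b) {K : Set (E n)} (hK : IsCompact K)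
    (hKU : K ⊆ U) {s : ℕ} (hs : s ≠ 0) : ∃ C : ℝ, 0 ≤ C ∧ ∀ x ∈ K, ∀ z, ∀ σ ∈ Ioc (0 : ℝ) 1,
      ‖radial b s x z σ‖ ≤ C := by
  obtain ⟨C, hC0, hC⟩ := hb.norm_osc_le hU hK hKU 0
  refine ⟨C, hC0, fun x hx z σ hσ => ?_⟩
  have h1 := hC x hx (σ • z)
  rw [pow_zero, one_mul] at h1
  rw [radial, norm_mul, norm_zpow_ofReal hσ.1]
  have h2 := zpow_le_zpow_of_le_one hσ (show (0 : ℤ) ≤ (s : ℤ) - 1 by omega)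
  rw [zpow_zero] at h2
  calc _ ≤ 1 * C := mul_le_mul h2 h1 (norm_nonneg _) zero_le_one
    _ = C := one_mul C

theorem norm_headInt_le (hU : IsOpen U) (hb : IsAmp U b) {K : Set (E n)} (hK : IsCompact K)
    (hKU : K ⊆ U) {s : ℕ} (hs : s ≠ 0) : ∃ C : ℝ, 0 ≤ C ∧ ∀ x ∈ K, ∀ z, ‖headInt b s x z‖ ≤ C := by
  obtain ⟨C, hC0, hC⟩ := norm_radial_le_head hU hb hK hKU hs
  refine ⟨C, hC0, fun x hx z => ?_⟩
  have := norm_setIntegral_le_of_norm_le_const (μ := volume) (s := Ioc (0 : ℝ) 1) (by simp)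
    (hC x hx z)
  simpa [headInt] using this

theorem homInt_eq (hU : IsOpen U) (hb : IsAmp U b) {s : ℕ} (hs : s ≠ 0) {x : E n} (hx : x ∈ U)
    {z : E n} (hz : z ≠ 0) : homInt b s x z = headInt b s x z + tailInt b s x z := by
  obtain ⟨C, hC0, hC⟩ := norm_radial_le_head hU hb (isCompact_singleton (x := x))
    (singleton_subset_iff.2 hx) hs
  rw [homInt, headInt, tailInt, ← setIntegral_union (Ioc_disjoint_Ioi le_rfl) measurableSet_Ioi _
    (integrableOn_radial_Ioi hU hb hx s hz one_pos), Ioc_union_Ioi_eq_Ioi zero_le_one]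
  refine Integrable.mono' (integrableOn_const (C := C) (by simp))
    (((continuousOn_radial hU hb hx s z).mono fun σ hσ => hσ.1).aestronglyMeasurable
      measurableSet_Ioc) ?_
  exact (ae_restrict_iff' measurableSet_Ioc).2 (Eventually.of_forall fun σ hσ => hC x rfl z σ hσ)

theorem isHomogSymbol_homInt (hU : IsOpen U) (hb : IsAmp U b) {s : ℕ} (hs : s ≠ 0) :
    IsHomogSymbol U (-s) (homInt b s) := by
  refine ⟨(((contDiffOn_headInt hU hb hs).mono (prod_mono_right (subset_univ _))).add
    (contDiffOn_tailInt hU hb s)).congr fun p hp => homInt_eq hU hb hs hp.1 hp.2,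
    fun x _ z _ t ht => ?_⟩
  have ht' : (t : ℂ) ≠ 0 := by exact_mod_cast ht.ne'
  have h1 := integral_comp_mul_left_Ioi (radial b s x z) 0 ht
  have h2 : ∀ σ : ℝ, radial b s x z (t * σ) = (t : ℂ) ^ ((s : ℤ) - 1) * radial b s x (t • z) σ := by
    intro σ
    rw [radial, radial, smul_smul, mul_comm σ t]
    push_cast
    rw [mul_zpow]
    ring
  simp_rw [h2] at h1
  rw [integral_const_mul, mul_zero, Complex.real_smul, Complex.ofReal_inv] at h1
  rw [homInt, homInt, zpow_neg]
  have h3 : (t : ℂ) ^ (s : ℤ) = (t : ℂ) ^ ((s : ℤ) - 1) * t := by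
    rw [zpow_sub_one₀ ht']; field_simp
  have h4 : (t : ℂ) ^ ((s : ℤ) - 1) ≠ 0 := zpow_ne_zero _ ht'
  rw [h3]
  field_simp at h1 ⊢
  linear_combination h1

/-- The logarithmic behaviour of the critical term. -/
theorem norm_tailInt_add_log_le (hU : IsOpen U) (hb : IsAmp U b) {K : Set (E n)} (hK : IsCompact K)
    (hKU : K ⊆ U) : ∃ C : ℝ, 0 ≤ C ∧ ∀ x ∈ K, ∀ z ≠ 0,
      ‖tailInt b 0 x z + osc b x 0 * (Real.log ‖z‖ : ℝ)‖ ≤ C * (1 + ‖z‖) := by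
  obtain ⟨C₁, hC₁0, hC₁⟩ := norm_setIntegral_radial_le hU hb hK hKU 0
  obtain ⟨C₂, hC₂0, hC₂⟩ := hb.norm_osc_sub_le hU hK hKU
  obtain ⟨C₃, hC₃0, hC₃⟩ := hb.norm_osc_le hU hK hKU 0
  refine ⟨C₁ + C₂ + C₃, by positivity, fun x hx z hz => ?_⟩
  have hz0 := norm_pos_iff.2 hz
  rcases le_total ‖z‖ 1 with hz1 | hz1
  · set T := ‖z‖⁻¹ with hT
    have hT1 : 1 ≤ T := (one_le_inv₀ hz0).2 hz1
    have hT0 : 0 < T := zero_lt_one.trans_le hT1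
    have hi : IntegrableOn (radial b 0 x z) (Ioc 1 T) :=
      (integrableOn_radial_Ioi hU hb (hKU hx) 0 hz one_pos).mono_set Ioc_subset_Ioi_self
    have hinv : IntegrableOn (fun σ : ℝ => osc b x 0 * ((σ⁻¹ : ℝ) : ℂ)) (Ioc 1 T) := by
      refine (ContinuousOn.integrableOn_Icc (ContinuousOn.mul continuousOn_const ?_)).mono_set
        Ioc_subset_Icc_self
      exact Complex.continuous_ofReal.comp_continuousOn
        (continuousOn_inv₀.mono fun σ hσ => (zero_lt_one.trans_le hσ.1).ne')
    have h1 : tailInt b 0 x z = (∫ σ in Ioc 1 T, radial b 0 x z σ) +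
        ∫ σ in Ioi T, radial b 0 x z σ := by
      rw [tailInt, ← setIntegral_union (Ioc_disjoint_Ioi le_rfl) measurableSet_Ioi hi
        (integrableOn_radial_Ioi hU hb (hKU hx) 0 hz hT0), Ioc_union_Ioi_eq_Ioi hT1]
    have h2 : ∫ σ in Ioc 1 T, osc b x 0 * ((σ⁻¹ : ℝ) : ℂ) = -(osc b x 0 * (Real.log ‖z‖ : ℝ)) := by
      rw [integral_const_mul, integral_complex_ofReal, ← intervalIntegral.integral_of_le hT1,
        integral_inv_of_pos one_pos hT0, div_one, hT, Real.log_inv]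
      push_cast; ring
    have h3 : tailInt b 0 x z + osc b x 0 * (Real.log ‖z‖ : ℝ) =
        (∫ σ in Ioc 1 T, (radial b 0 x z σ - osc b x 0 * ((σ⁻¹ : ℝ) : ℂ))) +
          ∫ σ in Ioi T, radial b 0 x z σ := by
      rw [integral_sub hi hinv, h2, h1]
      ring
    have h4 : ‖∫ σ in Ioc 1 T, (radial b 0 x z σ - osc b x 0 * ((σ⁻¹ : ℝ) : ℂ))‖ ≤ C₂ := by
      refine (norm_setIntegral_le_of_norm_le_const (C := C₂ * ‖z‖) (by simp) fun σ hσ => ?_).trans ?_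
      · have hσ0 : (0 : ℝ) < σ := zero_lt_one.trans hσ.1
        have e1 : radial b 0 x z σ - osc b x 0 * ((σ⁻¹ : ℝ) : ℂ) =
            ((σ⁻¹ : ℝ) : ℂ) * (osc b x (σ • z) - osc b x 0) := by
          rw [radial]
          simp
          ring
        rw [e1, norm_mul, Complex.norm_real, Real.norm_of_nonneg (inv_pos.2 hσ0).le]
        have := hC₂ x hx (σ • z)
        rw [norm_smul, Real.norm_of_nonneg hσ0.le] at this
        calc σ⁻¹ * _ ≤ σ⁻¹ * (C₂ * (σ * ‖z‖)) := by gcongr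
          _ = _ := by field_simp
      · rw [Real.volume_real_Ioc_of_le hT1]
        calc C₂ * ‖z‖ * (T - 1) ≤ C₂ * ‖z‖ * T := by gcongr; linarith
          _ = C₂ := by rw [hT, mul_assoc, mul_inv_cancel₀ hz0.ne', mul_one]
    have h5 := hC₁ x hx z hz T hT0
    rw [hT, inv_inv, zero_add, pow_one, mul_assoc, inv_mul_cancel₀ hz0.ne', mul_one] at h5
    rw [h3]
    refine (norm_add_le _ _).trans ?_
    nlinarith
  · have h5 := hC₁ x hx z hz 1 one_pos
    rw [inv_one, mul_one, zero_add, pow_one] at h5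
    have h6 := hC₃ x hx 0
    rw [pow_zero, one_mul] at h6
    have h7 : ‖z‖⁻¹ ≤ 1 := inv_le_one_of_one_le₀ hz1
    have h8 : ‖((Real.log ‖z‖ : ℝ) : ℂ)‖ ≤ ‖z‖ := by
      rw [Complex.norm_real, Real.norm_of_nonneg (Real.log_nonneg hz1)]
      linarith [Real.log_le_sub_one_of_pos hz0]
    refine (norm_add_le _ _).trans ?_
    rw [norm_mul]
    have h9 : C₁ * ‖z‖⁻¹ ≤ C₁ := mul_le_of_le_one_right hC₁0 h7
    have h10 : ‖osc b x 0‖ * ‖((Real.log ‖z‖ : ℝ) : ℂ)‖ ≤ C₃ * ‖z‖ := by gcongr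
    have h11 : ‖tailInt b 0 x z‖ ≤ C₁ * ‖z‖⁻¹ := h5
    nlinarith

end

end RiemPsiDO

end

noncomputable section
namespace RiemPsiDO
open Set Filter Topology
variable {n : ℕ}

/-- The kernel of a Fourier multiplier with integrable symbol. -/
theorem integral_mul_fourier {β : E n → ℂ} (hβ : Integrable β) {v : E n → ℂ} (hv : Continuous v)
    (hc : HasCompactSupport v) (x : E n) :
    cn n * ∫ ξ, ee x ξ * β ξ * fourier v ξ = ∫ y, (cn n * ∫ ξ, ee (x - y) ξ * β ξ) * v y := by
  have h1 : Integrable (fun z : E n × E n => ee (x - z.2) z.1 * (β z.1 * v z.2))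
      (volume.prod volume) := by
    refine (hβ.mul_prod (hv.integrable_of_hasCompactSupport hc)).bdd_mul (c := 1) ?_
      (Eventually.of_forall fun z => (norm_ee _ _).le)
    exact (continuous_ee.comp (f := fun z : E n × E n => (x - z.2, z.1))
      (by fun_prop)).aestronglyMeasurable
  have h2 : ∀ ξ, ee x ξ * β ξ * fourier v ξ = ∫ y, ee (x - y) ξ * (β ξ * v y) := fun ξ => by
    rw [fourier_eq, ← integral_const_mul]
    congr 1
    ext y
    rw [sub_eq_add_neg, ee_add_left]
    ring
  simp_rw [h2]
  rw [integral_integral_swap (f := fun ξ y => ee (x - y) ξ * (β ξ * v y)) h1, ← integral_const_mul]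
  congr 1
  ext y
  rw [mul_assoc, ← integral_mul_const]
  simp_rw [mul_assoc]

theorem hi_smul_eq_zero {R : ℝ} (hR : 1 ≤ R) {ξ : E n} (h : ‖ξ‖ ≤ R / 2) : hi (R⁻¹ • ξ) = 0 := by
  have h0 : 0 < R := zero_lt_one.trans_le hR
  refine hi_eq_zero ?_
  rw [norm_smul, Real.norm_of_nonneg (inv_pos.2 h0).le, inv_mul_le_iff₀ h0]
  linarith

theorem hasDerivAt_hi_smul {σ : ℝ} (hσ : 0 < σ) (ξ : E n) :
    HasDerivAt (fun σ : ℝ => hi (σ⁻¹ • ξ)) (-((σ : ℂ)⁻¹ * bump (σ⁻¹ • ξ))) σ := by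
  have h1 := (contDiff_hi.differentiable (by simp) (σ⁻¹ • ξ)).hasFDerivAt.comp_hasDerivAt σ
    ((hasDerivAt_inv hσ.ne').smul_const ξ)
  refine h1.congr_deriv ?_
  rw [bump, show (-(σ ^ 2)⁻¹) • ξ = (-σ⁻¹) • (σ⁻¹ • ξ) by
    rw [smul_smul]; congr 1; field_simp]
  rw [map_smul, Complex.real_smul]
  push_cast
  ring

section
variable {d : ℤ} {s : ℕ} {f : E n → ℂ} {b : E n × E n → ℂ} {x : E n}

theorem radial_eq (hf : Homog d f) (hd : d + n = s) (hb : ∀ ζ, b (x, ζ) = f ζ * bump ζ) (z : E n)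
    {σ : ℝ} (hσ : 0 < σ) :
    radial b s x z σ = cn n * ∫ ξ, ee z ξ * ((σ : ℂ)⁻¹ * bump (σ⁻¹ • ξ) * f ξ) := by
  have hσ' : (σ : ℂ) ≠ 0 := by exact_mod_cast hσ.ne'
  have h1 := Measure.integral_comp_smul (volume : Measure (E n))
    (fun ξ => ee z ξ * ((σ : ℂ)⁻¹ * bump (σ⁻¹ • ξ) * f ξ)) σ
  have h2 : ∀ ζ : E n, ee z (σ • ζ) * ((σ : ℂ)⁻¹ * bump (σ⁻¹ • σ • ζ) * f (σ • ζ)) =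
      (σ : ℂ) ^ (d - 1) * (ee (σ • z) ζ * b (x, ζ)) := by
    intro ζ
    rw [smul_smul, inv_mul_cancel₀ hσ.ne', one_smul, hb, ee_smul_left]
    rcases eq_or_ne ζ 0 with rfl | hζ
    · simp [bump]
    · rw [hf.2 ζ hζ σ hσ, zpow_sub_one₀ hσ']
      ring
  simp_rw [h2] at h1
  rw [integral_const_mul, finrank_euclideanSpace_fin, abs_of_pos (by positivity),
    Complex.real_smul] at h1
  have h3 : (σ : ℂ) ^ ((s : ℤ) - 1) = (σ : ℂ) ^ (d - 1) * (σ : ℂ) ^ n := by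
    rw [← zpow_natCast, ← zpow_add₀ hσ', ← hd]; ring_nf
  rw [radial, osc, h3]
  push_cast at h1
  have h4 : (σ : ℂ) ^ n ≠ 0 := pow_ne_zero _ hσ'
  rw [eq_inv_mul_iff_mul_eq₀ h4] at h1
  rw [← h1]
  ring

theorem integral_hi_sub_hi (hf : Homog d f) (hd : d + n = s)
    (hb : ∀ ζ, b (x, ζ) = f ζ * bump ζ) (z : E n) {R : ℝ} (hR : 1 ≤ R) :
    cn n * ∫ ξ, ee z ξ * ((hi ξ - hi (R⁻¹ • ξ)) * f ξ) = ∫ σ in Ioc 1 R, radial b s x z σ := by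
  set c : ℝ × E n → ℂ := fun w => ee z w.2 * ((hi w.2 - hi (w.1⁻¹ • w.2)) * f w.2) with hcdef
  set B : Set (E n) := Metric.closedBall 0 (R + 1) \ Metric.ball 0 (1 / 4)
  have hB : IsCompact B := (isCompact_closedBall 0 _).diff Metric.isOpen_ball
  have hs : ∀ σ ∈ Ioo (1 / 2 : ℝ) (R + 1), ∀ ξ ∉ B, c (σ, ξ) = 0 := by
    intro σ hσ ξ hξ
    have hσ0 : 0 < σ := by linarith [hσ.1]
    have hn' : ‖σ⁻¹ • ξ‖ = σ⁻¹ * ‖ξ‖ := by rw [norm_smul, Real.norm_of_nonneg (inv_pos.2 hσ0).le]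
    by_cases h1 : ‖ξ‖ < 1 / 4
    · have h2 : hi (σ⁻¹ • ξ) = 0 := hi_eq_zero (by
        rw [hn', inv_mul_le_iff₀ hσ0]; linarith [hσ.1])
      simp [hcdef, h2, hi_eq_zero (show ‖ξ‖ ≤ 1 / 2 by linarith)]
    · have h3 : R + 1 < ‖ξ‖ := by
        by_contra h
        exact hξ ⟨mem_closedBall_zero_iff.2 (not_lt.1 h), fun h' => h1 (mem_ball_zero_iff.1 h')⟩
      have h2 : hi (σ⁻¹ • ξ) = 1 := hi_eq_one (by
        rw [hn', le_inv_mul_iff₀ hσ0]; linarith [hσ.2])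
      simp [hcdef, h2, hi_eq_one (show 1 ≤ ‖ξ‖ by linarith)]
  have hcs : ContDiffOn ℝ ∞ c (Ioi 0 ×ˢ {0}ᶜ) := by
    have h1 : ContDiffOn ℝ ∞ (fun w : ℝ × E n => w.1⁻¹ • w.2) (Ioi 0 ×ˢ {0}ᶜ) :=
      (ContDiffOn.inv contDiffOn_fst fun w hw => ne_of_gt (show (0 : ℝ) < w.1 from hw.1)).smul
        contDiffOn_snd
    exact ((contDiff_ee_right z).comp contDiff_snd).contDiffOn.mul
      (((contDiff_hi.comp contDiff_snd).contDiffOn.sub (contDiff_hi.comp_contDiffOn h1)).mul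
        (hf.1.comp contDiffOn_snd fun w hw => hw.2))
  have hsub : ∀ σ ∈ Ioo (1 / 2 : ℝ) (R + 1), ∀ ξ ∈ B, (σ, ξ) ∈ Ioi (0 : ℝ) ×ˢ ({0}ᶜ : Set (E n)) := by
    refine fun σ hσ ξ hξ => ⟨(by linarith [hσ.1] : (0 : ℝ) < σ), ?_⟩
    rintro rfl
    exact hξ.2 (Metric.mem_ball_self (by norm_num))
  have key := contDiffOn_integral_of_support isOpen_Ioo hB
    (isOpen_Ioi.prod isOpen_compl_singleton) hsub hcs hs
  set G : ℝ → ℂ := fun σ => ∫ ξ, c (σ, ξ) with hG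
  have hmem : ∀ σ ∈ Icc 1 R, σ ∈ Ioo (1 / 2 : ℝ) (R + 1) := fun σ hσ =>
    ⟨by linarith [hσ.1], by linarith [hσ.2]⟩
  have hder : ∀ σ ∈ Icc 1 R, HasDerivAt (fun σ => cn n * G σ) (radial b s x z σ) σ := by
    intro σ hσ
    have hσ0 : 0 < σ := by linarith [hσ.1]
    have h1 : DifferentiableAt ℝ G σ := (key.1.contDiffAt
      (isOpen_Ioo.mem_nhds (hmem σ hσ))).differentiableAt (by simp)
    refine (h1.hasDerivAt.const_mul (cn n)).congr_deriv ?_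
    rw [radial_eq hf hd hb z hσ0]
    congr 1
    rw [← fderiv_apply_one_eq_deriv, key.2 σ (hmem σ hσ)]
    congr 1
    ext ξ
    rw [fderiv_apply_one_eq_deriv]
    have h2 := (((hasDerivAt_hi_smul hσ0 ξ).const_sub (hi ξ)).mul_const (f ξ)).const_mul (ee z ξ)
    rw [h2.deriv, neg_neg]
  have hcont : ContinuousOn (radial b s x z) (Icc 1 R) := by
    have h1 : ContinuousOn (fun σ => fderiv ℝ G σ 1) (Icc 1 R) :=
      ((key.1.continuousOn_fderiv_of_isOpen isOpen_Ioo (by simp)).clm_apply continuousOn_const).mono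
        hmem
    refine (ContinuousOn.mul (continuousOn_const (c := cn n)) h1).congr fun σ hσ => ?_
    have h2 := (hder σ hσ).deriv
    have h3 : DifferentiableAt ℝ G σ := (key.1.contDiffAt
      (isOpen_Ioo.mem_nhds (hmem σ hσ))).differentiableAt (by simp)
    rw [deriv_const_mul _ h3] at h2
    rw [← h2, ← fderiv_apply_one_eq_deriv]
    rfl
  have h1 := intervalIntegral.integral_eq_sub_of_hasDerivAt (a := 1) (b := R)
    (fun σ hσ => hder σ (by rwa [uIcc_of_le hR] at hσ))
    (by rw [intervalIntegrable_iff_integrableOn_Icc_of_le hR]; exact hcont.integrableOn_Icc)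
  rw [intervalIntegral.integral_of_le hR] at h1
  rw [h1]
  have h0 : G 1 = 0 := by simp [hG, hcdef]
  rw [h0, mul_zero, sub_zero]

theorem Homog.bound (hf : Homog d f) : ∃ C : ℝ, 0 ≤ C ∧ ∀ ξ : E n, 1 / 2 ≤ ‖ξ‖ →
    ‖f ξ‖ ≤ C * (1 + ‖ξ‖) ^ d.natAbs := by
  obtain ⟨C, hC⟩ := (isCompact_sphere (0 : E n) 1).exists_bound_of_continuousOn
    (hf.1.continuousOn.mono fun ξ hξ h => by
      rw [mem_singleton_iff.1 h] at hξ; simp at hξ)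
  refine ⟨|C| * 2 ^ d.natAbs, by positivity, fun ξ hξ => ?_⟩
  have h0 : 0 < ‖ξ‖ := by linarith
  have h1 := hf.2 (‖ξ‖⁻¹ • ξ) (smul_ne_zero (inv_ne_zero h0.ne') (norm_pos_iff.1 h0)) ‖ξ‖ h0
  rw [smul_smul, mul_inv_cancel₀ h0.ne', one_smul] at h1
  rw [h1, norm_mul, norm_zpow_ofReal h0]
  have h2 : ‖f (‖ξ‖⁻¹ • ξ)‖ ≤ |C| := (hC _ (by simp [norm_smul, h0.ne'])).trans (le_abs_self C)
  have h3 : ‖ξ‖ ^ d ≤ 2 ^ d.natAbs * (1 + ‖ξ‖) ^ d.natAbs := by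
    rcases Int.natAbs_eq d with h | h <;> rw [h]
    · rw [zpow_natCast, Int.natAbs_natCast, ← mul_pow]
      gcongr; linarith
    · rw [zpow_neg, zpow_natCast, ← inv_pow, Int.natAbs_neg, Int.natAbs_natCast, ← mul_pow]
      gcongr
      rw [inv_le_iff_one_le_mul₀ h0]
      nlinarith
  calc _ ≤ (2 ^ d.natAbs * (1 + ‖ξ‖) ^ d.natAbs) * |C| := by gcongr
    _ = _ := by ring

/-- The Fourier transform of a test function decreases rapidly. -/
theorem fourier_decay_of_testOn {v : E n → ℂ} (hv : ContDiff ℝ ∞ v) (hc : HasCompactSupport v)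
    (M : ℕ) : ∃ C : ℝ, 0 ≤ C ∧ ∀ ξ, (1 + ‖ξ‖) ^ M * ‖fourier v ξ‖ ≤ C := by
  obtain ⟨C, hC0, hC⟩ := fourier_decay (0 : E n) M
  have h1 : ∀ j : ℕ, ∃ A : ℝ, ∀ x, (1 + ‖x - 0‖) ^ (n + 1) * ‖iteratedFDeriv ℝ j v x‖ ≤ A := by
    intro j
    have h2 : Continuous fun x => ‖iteratedFDeriv ℝ j v x‖ :=
      (hv.continuous_iteratedFDeriv (m := j) (by exact_mod_cast le_top)).norm
    have h3 : Continuous fun x : E n => (1 + ‖x - 0‖) ^ (n + 1) := by fun_prop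
    have hcs : HasCompactSupport (fun x : E n => (1 + ‖x - 0‖) ^ (n + 1) * ‖iteratedFDeriv ℝ j v x‖) :=
      HasCompactSupport.mul_left (hc.iteratedFDeriv j).norm
    obtain ⟨A, hA⟩ := hcs.exists_bound_of_continuous (h3.mul h2)
    exact ⟨A, fun x => (le_abs_self _).trans (hA x)⟩
  choose A hA using h1
  have hA0 : ∀ j, 0 ≤ A j := fun j => le_trans (by positivity) (hA j 0)
  refine ⟨C * ∑ j ∈ Finset.range (M + 1), A j, mul_nonneg hC0 (Finset.sum_nonneg fun j _ => hA0 j),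
    hC v _ hv fun j hj x => (hA j x).trans ?_⟩
  exact Finset.single_le_sum (f := A) (fun j _ => hA0 j) (Finset.mem_range.2 (by omega))

theorem integrable_mul_fourier {v : E n → ℂ} (hv : ContDiff ℝ ∞ v) (hc : HasCompactSupport v)
    (D : ℕ) : Integrable (fun ξ => (1 + ‖ξ‖) ^ D * ‖fourier v ξ‖) := by
  obtain ⟨C, hC0, hC⟩ := fourier_decay_of_testOn hv hc (D + (n + 1))
  refine ((integrable_one_add_norm_pow (0 : E n)).const_mul C).mono'
    ((by fun_prop : Continuous fun ξ : E n => (1 + ‖ξ‖) ^ D).aestronglyMeasurable.mul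
      (stronglyMeasurable_fourier hv.continuous).norm.aestronglyMeasurable)
    (Eventually.of_forall fun ξ => ?_)
  rw [Real.norm_of_nonneg (by positivity), sub_zero, ← div_eq_mul_inv,
    le_div_iff₀ (by positivity)]
  calc _ = (1 + ‖ξ‖) ^ (D + (n + 1)) * ‖fourier v ξ‖ := by rw [pow_add]; ring
    _ ≤ C := hC ξ

theorem norm_hi_sub_hi_mul_le {C : ℝ} (hC : ∀ ξ : E n, 1 / 2 ≤ ‖ξ‖ →
    ‖f ξ‖ ≤ C * (1 + ‖ξ‖) ^ d.natAbs) (hC0 : 0 ≤ C) {R : ℝ} (hR : 1 ≤ R) (ξ : E n) :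
    ‖(hi ξ - hi (R⁻¹ • ξ)) * f ξ‖ ≤ 2 * C * (1 + ‖ξ‖) ^ d.natAbs := by
  rcases le_total ‖ξ‖ (1 / 2) with h | h
  · rw [hi_eq_zero h, hi_smul_eq_zero hR (by linarith)]
    simp only [sub_zero, zero_mul, norm_zero]
    positivity
  · rw [norm_mul, mul_assoc]
    refine mul_le_mul ((norm_sub_le _ _).trans ?_) (hC ξ h) (norm_nonneg _) (by norm_num)
    linarith [norm_hi_le ξ, norm_hi_le (R⁻¹ • ξ)]

theorem hi_sub_hi_mem {R : ℝ} (hR : 1 ≤ R) : (fun ξ : E n => hi ξ - hi (R⁻¹ • ξ)) ∈ TestSym n := by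
  refine ⟨contDiff_hi.sub (contDiff_hi.comp (by fun_prop)),
    HasCompactSupport.intro (isCompact_closedBall (0 : E n) R) fun ξ hξ => ?_, ?_⟩
  · have h0 : 0 < R := zero_lt_one.trans_le hR
    have h1 : R < ‖ξ‖ := not_le.1 fun h => hξ (mem_closedBall_zero_iff.2 h)
    rw [hi_eq_one (hR.trans h1.le), hi_eq_one, sub_self]
    rw [norm_smul, Real.norm_of_nonneg (inv_pos.2 h0).le, le_inv_mul_iff₀ h0]
    linarith
  · filter_upwards [Metric.ball_mem_nhds (0 : E n) (ε := 1 / 2) (by norm_num)] with ξ hξ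
    have h1 : ‖ξ‖ ≤ 1 / 2 := (mem_ball_zero_iff.1 hξ).le
    rw [hi_eq_zero h1, hi_smul_eq_zero hR (by linarith), sub_zero, Pi.zero_apply]

/-- The kernel of `hi * f` off the diagonal. -/
theorem integral_hi_mul_fourier {U : Set (E n)} (hU : IsOpen U) (hbU : IsAmp U b) (hx : x ∈ U)
    (hf : Homog d f) (hd : d + n = s) (hb : ∀ ζ, b (x, ζ) = f ζ * bump ζ) {v : E n → ℂ}
    (hv : ContDiff ℝ ∞ v) (hc : HasCompactSupport v) (hxv : x ∉ tsupport v) :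
    cn n * ∫ ξ, ee x ξ * (hi ξ * f ξ) * fourier v ξ = ∫ y, tailInt b s x (x - y) * v y := by
  obtain ⟨C, hC0, hC⟩ := hf.bound
  have hT : ∀ R : ℝ, 1 ≤ R → (fun ξ => (hi ξ - hi (R⁻¹ • ξ)) * f ξ) ∈ TestSym n := fun R hR => by
    simpa only [mul_comm] using TestSym.mul_mem hf.1 (hi_sub_hi_mem hR)
  have hev : ∀ᶠ R : ℝ in atTop, 1 ≤ R := eventually_ge_atTop 1
  have hL : Tendsto (fun R : ℝ => cn n * ∫ ξ, ee x ξ * ((hi ξ - hi (R⁻¹ • ξ)) * f ξ) * fourier v ξ)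
      atTop (𝓝 (cn n * ∫ ξ, ee x ξ * (hi ξ * f ξ) * fourier v ξ)) := by
    refine Tendsto.const_mul _ (tendsto_integral_filter_of_dominated_convergence _ ?_ ?_
      ((integrable_mul_fourier hv hc d.natAbs).const_mul (2 * C)) ?_)
    · filter_upwards [hev] with R hR
      exact ((contDiff_ee_right x).continuous.mul (hT R hR).1.continuous).aestronglyMeasurable.mul
        (stronglyMeasurable_fourier hv.continuous).aestronglyMeasurable
    · filter_upwards [hev] with R hR
      refine Eventually.of_forall fun ξ => ?_
      rw [norm_mul, norm_mul, norm_ee, one_mul, ← mul_assoc]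
      exact mul_le_mul_of_nonneg_right (norm_hi_sub_hi_mul_le hC hC0 hR ξ) (norm_nonneg _)
    · refine Eventually.of_forall fun ξ => tendsto_const_nhds.congr' ?_
      filter_upwards [hev, eventually_ge_atTop (2 * ‖ξ‖)] with R hR hR'
      rw [hi_smul_eq_zero hR (by linarith), sub_zero]
  obtain ⟨B, hB0, hB⟩ := norm_radial_le hU hbU (isCompact_singleton (x := x))
    (singleton_subset_iff.2 hx) s
  obtain ⟨δ, hδ, hball⟩ := Metric.isOpen_iff.1 (isClosed_tsupport v).isOpen_compl x hxv
  have hfar : ∀ y, v y ≠ 0 → δ ≤ ‖x - y‖ := fun y hy => by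
    by_contra h
    refine hball (a := y) ?_ (subset_tsupport _ hy)
    rw [Metric.mem_ball, dist_comm, dist_eq_norm]
    exact not_le.1 h
  have hI : ∀ R : ℝ, ∀ z ≠ 0, ‖∫ σ in Ioc 1 R, radial b s x z σ‖ ≤ B * (‖z‖ ^ (s + 1))⁻¹ := by
    intro R z hz
    have h2 := integral_inv_sq_Ioi one_pos
    refine (norm_integral_le_of_norm_le ((h2.1.mono_set Ioc_subset_Ioi_self).const_mul
      (B * (‖z‖ ^ (s + 1))⁻¹)) ((ae_restrict_iff' measurableSet_Ioc).2 (Eventually.of_forall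
        fun σ hσ => hB x rfl z hz σ (zero_lt_one.trans hσ.1)))).trans ?_
    rw [integral_const_mul]
    refine mul_le_of_le_one_right (by positivity) ?_
    calc _ ≤ ∫ σ in Ioi (1 : ℝ), (σ ^ 2)⁻¹ := setIntegral_mono_set h2.1
          (Eventually.of_forall fun σ => by positivity) Ioc_subset_Ioi_self.eventuallyLE
      _ = 1 := by rw [h2.2, inv_one]
  have hRt : Tendsto (fun R : ℝ => ∫ y, (∫ σ in Ioc 1 R, radial b s x (x - y) σ) * v y)
      atTop (𝓝 (∫ y, tailInt b s x (x - y) * v y)) := by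
    refine tendsto_integral_filter_of_dominated_convergence
      (fun y => B * (δ ^ (s + 1))⁻¹ * ‖v y‖) ?_ ?_
      ((hv.continuous.integrable_of_hasCompactSupport hc).norm.const_mul _) ?_
    · filter_upwards [hev] with R hR
      refine (Continuous.mul ?_ hv.continuous).aestronglyMeasurable
      simp_rw [← integral_hi_sub_hi hf hd hb _ hR]
      refine continuous_const.mul (continuous_of_dominated (bound := fun ξ =>
        ‖(hi ξ - hi (R⁻¹ • ξ)) * f ξ‖) (fun y => ?_) (fun y => ?_)
        (TestSym.integrable (hT R hR)).norm (Eventually.of_forall fun ξ => ?_))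
      · exact ((contDiff_ee_right _).continuous.mul (hT R hR).1.continuous).aestronglyMeasurable
      · exact Eventually.of_forall fun ξ => by rw [norm_mul, norm_ee, one_mul]
      · exact (continuous_ee.comp (f := fun y : E n => (x - y, ξ)) (by fun_prop)).mul continuous_const
    · filter_upwards [hev] with R hR
      refine Eventually.of_forall fun y => ?_
      rw [norm_mul]
      by_cases hy : v y = 0
      · simp [hy]
      have h1 := hfar y hy
      have h2 : x - y ≠ 0 := norm_pos_iff.1 (hδ.trans_le h1)
      refine mul_le_mul_of_nonneg_right ((hI R _ h2).trans ?_) (norm_nonneg _)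
      gcongr
    · refine Eventually.of_forall fun y => ?_
      by_cases hy : v y = 0
      · simp [hy]
      have h2 : x - y ≠ 0 := norm_pos_iff.1 (hδ.trans_le (hfar y hy))
      refine Tendsto.mul_const _ ((intervalIntegral_tendsto_integral_Ioi 1
        (integrableOn_radial_Ioi hU hbU hx s h2 one_pos) tendsto_id).congr' ?_)
      filter_upwards [hev] with R hR
      rw [intervalIntegral.integral_of_le (by simpa using hR), id]
  refine tendsto_nhds_unique (hL.congr' ?_) hRt
  filter_upwards [hev] with R hR
  rw [integral_mul_fourier (TestSym.integrable (hT R hR)) hv.continuous hc]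
  simp_rw [integral_hi_sub_hi hf hd hb _ hR]

end

end RiemPsiDO

end

noncomputable section
namespace RiemPsiDO
open Set Filter Topology
variable {n : ℕ}

theorem contDiffOn_hi_mul {U : Set (E n)} (hU : IsOpen U) {q : E n → E n → ℂ}
    (hq : ContDiffOn ℝ ∞ (fun z : E n × E n => q z.1 z.2) (U ×ˢ {0}ᶜ)) :
    ContDiffOn ℝ ∞ (fun z : E n × E n => hi z.2 * q z.1 z.2) (U ×ˢ univ) := by
  rintro ⟨x, ξ⟩ ⟨hx, -⟩
  refine ContDiffAt.contDiffWithinAt ?_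
  rcases eq_or_ne ξ 0 with rfl | h
  · refine (contDiffAt_const (c := (0 : ℂ))).congr_of_eventuallyEq ?_
    have : Tendsto Prod.snd (𝓝 (x, (0 : E n))) (𝓝 0) := continuous_snd.tendsto _
    filter_upwards [this.eventually hi_eventuallyEq_zero] with z hz
    rw [hz, Pi.zero_apply, zero_mul]
  · exact (contDiff_hi.comp contDiff_snd).contDiffAt.mul (hq.contDiffAt
      ((hU.prod isOpen_compl_singleton).mem_nhds ⟨hx, h⟩))

/-- The symbol `p` without its first `N` terms, regularized at the origin. -/
def remSym (p : E n → E n → ℂ) (q : ℕ → E n → E n → ℂ) (N : ℕ) (x ξ : E n) : ℂ :=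
  p x ξ - ∑ j ∈ Finset.range N, hi ξ * q j x ξ

section
variable {U : Set (E n)} {m : ℤ} {p : E n → E n → ℂ} {q : ℕ → E n → E n → ℂ}

theorem continuousOn_remSym (hU : IsOpen U) (hp : IsSymbol U m p q) (N : ℕ) :
    ContinuousOn (fun z : E n × E n => remSym p q N z.1 z.2) (U ×ˢ univ) :=
  hp.1.continuousOn.sub (continuousOn_finsetSum _ fun j _ =>
    (contDiffOn_hi_mul hU (hp.2.1 j).1).continuousOn)

theorem norm_remSym_le (hU : IsOpen U) (hp : IsSymbol U m p q) {N : ℕ} (hN : m - N ≤ -(n + 1))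
    {K : Set (E n)} (hK : IsCompact K) (hKU : K ⊆ U) : ∃ C : ℝ, 0 ≤ C ∧ ∀ x ∈ K, ∀ ξ : E n,
      ‖remSym p q N x ξ‖ ≤ C * ((1 + ‖ξ‖) ^ (n + 1))⁻¹ := by
  obtain ⟨C₁, hC₁0, hC₁⟩ := hp.bound hU hK hKU one_pos N 0
  obtain ⟨C₂, hC₂⟩ := (hK.prod (isCompact_closedBall (0 : E n) 1)).exists_bound_of_continuousOn
    ((continuousOn_remSym hU hp N).mono (prod_mono hKU (subset_univ _)))
  refine ⟨(C₁ + |C₂|) * 2 ^ (n + 1), by positivity, fun x hx ξ => ?_⟩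
  rw [mul_assoc]
  rcases le_total ‖ξ‖ 1 with h | h
  · have h1 : 1 ≤ 2 ^ (n + 1) * ((1 + ‖ξ‖) ^ (n + 1))⁻¹ := by
      rw [← div_eq_mul_inv, one_le_div (by positivity)]
      gcongr; linarith
    calc _ ≤ |C₂| := (hC₂ (x, ξ) ⟨hx, mem_closedBall_zero_iff.2 h⟩).trans (le_abs_self _)
      _ ≤ C₁ + |C₂| := by linarith
      _ ≤ _ := le_mul_of_one_le_right (by positivity) h1
  · have h1 := hC₁ x hx ξ h
    rw [norm_iteratedFDeriv_zero] at h1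
    have h2 : remSym p q N x ξ = p x ξ - ∑ j ∈ Finset.range N, q j x ξ := by
      simp [remSym, hi_eq_one h]
    have h3 : ‖ξ‖ ^ (m - N) ≤ 2 ^ (n + 1) * ((1 + ‖ξ‖) ^ (n + 1))⁻¹ := by
      refine (zpow_le_zpow_right₀ h hN).trans ?_
      rw [zpow_neg, ← div_eq_mul_inv, le_div_iff₀ (by positivity), inv_mul_le_iff₀ (by positivity),
        ← mul_comm]
      rw [show ((n : ℤ) + 1) = ((n + 1 : ℕ) : ℤ) by push_cast; rfl, zpow_natCast, ← mul_pow]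
      gcongr; linarith
    rw [h2]
    calc _ ≤ C₁ * (2 ^ (n + 1) * ((1 + ‖ξ‖) ^ (n + 1))⁻¹) := h1.trans (by gcongr)
      _ ≤ _ := by gcongr; linarith [abs_nonneg C₂]

/-- The kernel of the regular part. -/
def remKer (p : E n → E n → ℂ) (q : ℕ → E n → E n → ℂ) (N : ℕ) (x z : E n) : ℂ :=
  cn n * ∫ ξ, ee z ξ * remSym p q N x ξ

theorem continuous_remSym (hU : IsOpen U) (hp : IsSymbol U m p q) (N : ℕ) {x : E n} (hx : x ∈ U) :
    Continuous (remSym p q N x) :=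
  continuousOn_univ.1 ((continuousOn_remSym hU hp N).comp (f := fun ξ => (x, ξ)) (by fun_prop)
    fun ξ _ => ⟨hx, mem_univ _⟩)

theorem integrable_remSym (hU : IsOpen U) (hp : IsSymbol U m p q) {N : ℕ}
    (hN : m - N ≤ -(n + 1)) {x : E n} (hx : x ∈ U) : Integrable (remSym p q N x) := by
  obtain ⟨C, -, hC⟩ := norm_remSym_le hU hp hN (isCompact_singleton (x := x))
    (singleton_subset_iff.2 hx)
  have := (integrable_one_add_norm_pow (0 : E n)).const_mul C
  simp only [sub_zero] at this
  exact this.mono' (continuous_remSym hU hp N hx).aestronglyMeasurable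
    (Eventually.of_forall fun ξ => hC x rfl ξ)

theorem continuous_remKer (hU : IsOpen U) (hp : IsSymbol U m p q) {N : ℕ}
    (hN : m - N ≤ -(n + 1)) {x : E n} (hx : x ∈ U) : Continuous (remKer p q N x) := by
  refine continuous_const.mul (continuous_of_dominated (bound := fun ξ => ‖remSym p q N x ξ‖)
    (fun z => ?_) (fun z => ?_) (integrable_remSym hU hp hN hx).norm
    (Eventually.of_forall fun ξ => ?_))
  · exact ((contDiff_ee_right _).continuous.mul
      (continuous_remSym hU hp N hx)).aestronglyMeasurable
  · exact Eventually.of_forall fun ξ => by rw [norm_mul, norm_ee, one_mul]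
  · exact (continuous_ee.comp (f := fun z : E n => (z, ξ)) (by fun_prop)).mul continuous_const

theorem norm_remKer_le (hU : IsOpen U) (hp : IsSymbol U m p q) {N : ℕ} (hN : m - N ≤ -(n + 1))
    {K : Set (E n)} (hK : IsCompact K) (hKU : K ⊆ U) : ∃ C : ℝ, ∀ x ∈ K, ∀ z : E n,
      ‖remKer p q N x z‖ ≤ C := by
  obtain ⟨C, -, hC⟩ := norm_remSym_le hU hp hN hK hKU
  have := (integrable_one_add_norm_pow (0 : E n)).const_mul C
  simp only [sub_zero] at this
  refine ⟨‖cn n‖ * ∫ ξ : E n, C * ((1 + ‖ξ‖) ^ (n + 1))⁻¹, fun x hx z => ?_⟩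
  rw [remKer, norm_mul]
  refine mul_le_mul_of_nonneg_left (norm_integral_le_of_norm_le this
    (Eventually.of_forall fun ξ => ?_)) (norm_nonneg _)
  rw [norm_mul, norm_ee, one_mul]
  exact hC x hx ξ

/-- The amplitude `q(x,ζ) bump(ζ)`. -/
def cutAmp (q : E n → E n → ℂ) (z : E n × E n) : ℂ := q z.1 z.2 * bump z.2

theorem IsHomogSymbol.isAmp_cutAmp (hU : IsOpen U) {d : ℤ} {q : E n → E n → ℂ}
    (hq : IsHomogSymbol U d q) : IsAmp U (cutAmp q) :=
  IsAmp.mul_testSym hU hq.1 bump_mem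

/-- The kernel of `p(x,D)` off the diagonal. -/
def symKer (p : E n → E n → ℂ) (q : ℕ → E n → E n → ℂ) (m : ℤ) (x y : E n) : ℂ :=
  ∑ j ∈ Finset.range (m + n + 1).toNat, tailInt (cutAmp (q j)) (m + n - j).toNat x (x - y) +
    remKer p q (m + n + 1).toNat x (x - y)

theorem continuousOn_symKer (hU : IsOpen U) (hp : IsSymbol U m p q) {x : E n} (hx : x ∈ U) :
    ContinuousOn (symKer p q m x) {x}ᶜ := by
  refine ContinuousOn.add (continuousOn_finsetSum _ fun j _ => ?_)
    ((continuous_remKer hU hp (by omega) hx).comp (by fun_prop)).continuousOn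
  exact (contDiffOn_tailInt hU ((hp.2.1 j).isAmp_cutAmp hU) _).continuousOn.comp
    (f := fun y => (x, x - y)) (by fun_prop) fun y hy => ⟨hx, fun h =>
      hy (mem_singleton_iff.2 (sub_eq_zero.1 h).symm)⟩

theorem integrable_mul_of_continuousOn_compl {K v : E n → ℂ} {x : E n} (hK : ContinuousOn K {x}ᶜ)
    (hv : Continuous v) (hc : HasCompactSupport v) (hxv : x ∉ tsupport v) :
    Integrable (fun y => K y * v y) := by
  refine (continuous_iff_continuousAt.2 fun y => ?_ : Continuous fun y => K y * v y)
    |>.integrable_of_hasCompactSupport hc.mul_left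
  by_cases hy : y = x
  · subst hy
    refine (continuousAt_const (y := (0 : ℂ))).congr ?_
    filter_upwards [(isClosed_tsupport v).isOpen_compl.mem_nhds hxv] with y hy
    rw [image_eq_zero_of_notMem_tsupport hy, mul_zero]
  · exact (hK.continuousAt (isOpen_compl_singleton.mem_nhds hy)).mul hv.continuousAt

theorem quantize_eq_integral (hU : IsOpen U) (hp : IsSymbol U m p q) {x : E n} (hx : x ∈ U)
    {v : E n → ℂ} (hv : ContDiff ℝ ∞ v) (hc : HasCompactSupport v) (hxv : x ∉ tsupport v) :
    quantize p v x = ∫ y, symKer p q m x y * v y := by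
  set N := (m + n + 1).toNat with hNdef
  have hN : m - N ≤ -(n + 1) := by omega
  have hmeasF := (stronglyMeasurable_fourier hv.continuous).aestronglyMeasurable (μ := volume)
  have hterm : ∀ j, Integrable (fun ξ => ee x ξ * (hi ξ * q j x ξ) * fourier v ξ) := by
    intro j
    have hf := (hp.2.1 j).homog hx
    obtain ⟨C, hC0, hC⟩ := hf.bound
    have hcont : Continuous (fun ξ => hi ξ * q j x ξ) := continuousOn_univ.1
      ((contDiffOn_hi_mul hU (hp.2.1 j).1).continuousOn.comp (f := fun ξ => (x, ξ)) (by fun_prop)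
        fun ξ _ => ⟨hx, mem_univ _⟩)
    refine ((integrable_mul_fourier hv hc (m - j).natAbs).const_mul C).mono'
      (((contDiff_ee_right x).continuous.mul hcont).aestronglyMeasurable.mul hmeasF)
      (Eventually.of_forall fun ξ => ?_)
    rw [norm_mul, norm_mul, norm_ee, one_mul, ← mul_assoc]
    refine mul_le_mul_of_nonneg_right ?_ (norm_nonneg _)
    rcases le_total ‖ξ‖ (1 / 2) with h | h
    · rw [hi_eq_zero h, zero_mul, norm_zero]; positivity
    · rw [norm_mul]
      exact (mul_le_of_le_one_left (norm_nonneg _) (norm_hi_le ξ)).trans (hC ξ h)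
  have hremI : Integrable (fun ξ => ee x ξ * remSym p q N x ξ * fourier v ξ) := by
    obtain ⟨C, hC0, hC⟩ := fourier_decay_of_testOn hv hc 0
    refine ((integrable_remSym hU hp hN hx).norm.const_mul C).mono'
      (((contDiff_ee_right x).continuous.mul (continuous_remSym hU hp N hx)).aestronglyMeasurable.mul
        hmeasF) (Eventually.of_forall fun ξ => ?_)
    rw [norm_mul, norm_mul, norm_ee, one_mul, mul_comm]
    have := hC ξ
    rw [pow_zero, one_mul] at this
    gcongr
  have hsplit : ∀ ξ, ee x ξ * p x ξ * fourier v ξ =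
      (∑ j ∈ Finset.range N, ee x ξ * (hi ξ * q j x ξ) * fourier v ξ) +
        ee x ξ * remSym p q N x ξ * fourier v ξ := fun ξ => by
    rw [remSym, ← Finset.sum_mul, ← Finset.mul_sum]
    ring
  rw [quantize_eq]
  simp_rw [hsplit]
  rw [integral_add (integrable_finsetSum _ fun j _ => hterm j) hremI,
    integral_finsetSum _ fun j _ => hterm j, mul_add, Finset.mul_sum,
    integral_mul_fourier (integrable_remSym hU hp hN hx) hv.continuous hc]
  have h1 : ∀ j ∈ Finset.range N, cn n * ∫ ξ, ee x ξ * (hi ξ * q j x ξ) * fourier v ξ =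
      ∫ y, tailInt (cutAmp (q j)) (m + n - j).toNat x (x - y) * v y := fun j hj => by
    have := Finset.mem_range.1 hj
    exact integral_hi_mul_fourier hU ((hp.2.1 j).isAmp_cutAmp hU) hx ((hp.2.1 j).homog hx)
      (by omega) (fun ζ => rfl) hv hc hxv
  rw [Finset.sum_congr rfl h1]
  have h2 : ∀ j ∈ Finset.range N, Integrable fun y =>
      tailInt (cutAmp (q j)) (m + n - j).toNat x (x - y) * v y := fun j _ =>
    integrable_mul_of_continuousOn_compl ((contDiffOn_tailInt hU ((hp.2.1 j).isAmp_cutAmp hU)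
      _).continuousOn.comp (f := fun y => (x, x - y)) (by fun_prop) fun y hy => ⟨hx, fun h =>
        hy (mem_singleton_iff.2 (sub_eq_zero.1 h).symm)⟩) hv.continuous hc hxv
  rw [← integral_finsetSum _ h2, ← integral_add (integrable_finsetSum _ h2)]
  · congr 1
    ext y
    rw [symKer, add_mul, Finset.sum_mul]
    rfl
  · exact integrable_mul_of_continuousOn_compl
      ((continuous_remKer hU hp hN hx).comp (by fun_prop)).continuousOn hv.continuous hc hxv

/-- The coefficient of the logarithm. -/
def logCoeff (m : ℤ) (q : ℕ → E n → ℂ) : ℂ :=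
  if 0 ≤ m + n then cn n * ∫ ζ, q (m + n).toNat ζ * bump ζ else 0

theorem sum_Icc_neg {S : ℕ} (F : ℤ → ℂ) :
    ∑ t ∈ Finset.Icc (-(S : ℤ)) (-1), F t = ∑ j ∈ Finset.range S, F (j - S) := by
  refine Finset.sum_nbij' (fun t => (t + S).toNat) (fun j => (j : ℤ) - S) ?_ ?_ ?_ ?_ ?_
  all_goals intro t ht; simp only [Finset.mem_Icc, Finset.mem_range] at *
  · omega
  · omega
  · omega
  · omega
  · congr 1; omega

theorem symKer_asymptotics (hU : IsOpen U) (hp : IsSymbol U m p q) : ∃ a : ℤ → E n → E n → ℂ,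
    (∀ j ∈ Finset.Icc (-(m + n)) (-1), IsHomogSymbol U j (a j)) ∧
    ∀ K : Set (E n), IsCompact K → K ⊆ U → ∃ C : ℝ, ∀ x ∈ K, ∀ y ∈ K, x ≠ y →
      ‖symKer p q m x y - ((∑ j ∈ Finset.Icc (-(m + n)) (-1), a j x (x - y))
        - logCoeff m (fun j => q j x) * (Real.log ‖x - y‖ : ℝ))‖ ≤ C := by
  have hb := fun j => (hp.2.1 j).isAmp_cutAmp hU
  refine ⟨fun t => homInt (cutAmp (q (t + m + n).toNat)) (-t).toNat, fun t ht => ?_,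
    fun K hK hKU => ?_⟩
  · rw [Finset.mem_Icc] at ht
    have h1 := isHomogSymbol_homInt hU (hb (t + m + n).toNat) (s := (-t).toNat) (by omega)
    rwa [show -(((-t).toNat : ℕ) : ℤ) = t by omega] at h1
  obtain ⟨C₀, hC₀⟩ := norm_remKer_le hU hp (N := (m + n + 1).toNat) (by omega) hK hKU
  by_cases hm : 0 ≤ m + n
  · obtain ⟨S, hS⟩ := Int.eq_ofNat_of_zero_le hm
    choose C₁ hC₁0 hC₁ using fun j : Fin S => norm_headInt_le hU (hb j) hK hKU
      (s := S - j) (by omega)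
    obtain ⟨C₂, hC₂0, hC₂⟩ := norm_tailInt_add_log_le hU (hb S) hK hKU
    obtain ⟨R, hR⟩ := hK.isBounded.exists_norm_le
    refine ⟨∑ j, C₁ j + C₂ * (1 + (R + R)) + C₀, fun x hx y hy hxy => ?_⟩
    have hz : x - y ≠ 0 := sub_ne_zero.2 hxy
    have e1 : (∑ t ∈ Finset.Icc (-(m + n)) (-1),
        homInt (cutAmp (q (t + m + n).toNat)) (-t).toNat x (x - y)) =
        ∑ j : Fin S, homInt (cutAmp (q j)) (S - j) x (x - y) := by
      rw [hS, sum_Icc_neg, Finset.sum_range]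
      refine Finset.sum_congr rfl fun j _ => ?_
      rw [show ((j : ℤ) - S + m + n).toNat = j by omega, show (-((j : ℤ) - S)).toNat = S - j by omega]
    have e2 : symKer p q m x y = ∑ j : Fin S, tailInt (cutAmp (q j)) (S - j) x (x - y) +
        tailInt (cutAmp (q S)) 0 x (x - y) + remKer p q (m + n + 1).toNat x (x - y) := by
      rw [symKer]
      congr 1
      rw [show (m + n + 1).toNat = S + 1 by omega, Finset.sum_range_succ, Finset.sum_range]
      congr 1
      · refine Finset.sum_congr rfl fun j _ => ?_
        rw [show (m + n - (j : ℕ)).toNat = S - j by omega]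
      · rw [show (m + n - S).toNat = 0 by omega]
    have e3 : logCoeff m (fun j => q j x) = osc (cutAmp (q S)) x 0 := by
      rw [logCoeff, if_pos hm, show (m + n).toNat = S by omega, osc]
      simp [ee_zero_left, cutAmp]
    have e4 : ∑ j : Fin S, homInt (cutAmp (q j)) (S - j) x (x - y) =
        ∑ j : Fin S, headInt (cutAmp (q j)) (S - j) x (x - y) +
          ∑ j : Fin S, tailInt (cutAmp (q j)) (S - j) x (x - y) := by
      rw [← Finset.sum_add_distrib]
      exact Finset.sum_congr rfl fun j _ => homInt_eq hU (hb j) (by omega) (hKU hx) hz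
    rw [e1, e2, e3, e4, show ∀ T t r H L : ℂ, T + t + r - (H + T - L) = -H + (t + L) + r by
      intros; ring]
    refine (norm_add_le _ _).trans (add_le_add ((norm_add_le _ _).trans (add_le_add ?_ ?_))
      (hC₀ x hx _))
    · rw [norm_neg]
      exact (norm_sum_le _ _).trans (Finset.sum_le_sum fun j _ => hC₁ j x hx _)
    · refine (hC₂ x hx _ hz).trans ?_
      have := (norm_sub_le x y).trans (add_le_add (hR x hx) (hR y hy))
      gcongr
  · refine ⟨C₀, fun x hx y hy hxy => ?_⟩
    rw [Finset.Icc_eq_empty (by omega), Finset.sum_empty, logCoeff, if_neg hm, symKer,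
      show (m + n + 1).toNat = 0 by omega, Finset.range_zero, Finset.sum_empty]
    rw [show (m + n + 1).toNat = 0 by omega] at hC₀
    simpa using hC₀ x hx (x - y)

end

end RiemPsiDO

end

noncomputable section
namespace RiemPsiDO
open Set Filter Topology
variable {n : ℕ}

theorem TestOn.integrable_mul {W : Set (E n)} (hW : IsOpen W) {k v : E n → ℂ} (hk : ContinuousOn k W)
    (hv : v ∈ TestOn W) : Integrable (fun y => k y * v y) := by
  refine (continuous_iff_continuousAt.2 fun y => ?_ : Continuous fun y => k y * v y)
    |>.integrable_of_hasCompactSupport hv.2.1.mul_left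
  by_cases hy : y ∈ tsupport v
  · exact (hk.continuousAt (hW.mem_nhds (hv.2.2 hy))).mul hv.1.continuous.continuousAt
  · refine (continuousAt_const (y := (0 : ℂ))).congr ?_
    filter_upwards [(isClosed_tsupport v).isOpen_compl.mem_nhds hy] with y hy
    rw [image_eq_zero_of_notMem_tsupport hy, mul_zero]

theorem eqOn_of_integral_testOn {W : Set (E n)} (hW : IsOpen W) {f g : E n → ℂ}
    (hf : ContinuousOn f W) (hg : ContinuousOn g W)
    (h : ∀ v ∈ TestOn W, ∫ y, f y * v y = ∫ y, g y * v y) : EqOn f g W := by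
  have h1 : ∀ᵐ y, y ∈ W → f y - g y = 0 := by
    refine hW.ae_eq_zero_of_integral_contDiff_smul_eq_zero
      ((hf.sub hg).locallyIntegrableOn hW.measurableSet) fun v hv hc hs => ?_
    have hmem : (fun y => (v y : ℂ)) ∈ TestOn W := by
      have hs' : tsupport (fun y => (v y : ℂ)) ⊆ tsupport v :=
        closure_mono fun y hy h => hy (by simp [h])
      exact ⟨Complex.ofRealCLM.contDiff.comp hv, hc.comp_left Complex.ofReal_zero, hs'.trans hs⟩
    have := h _ hmem
    rw [← sub_eq_zero, ← integral_sub (TestOn.integrable_mul hW hf hmem)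
      (TestOn.integrable_mul hW hg hmem)] at this
    rw [← this]
    congr 1
    ext y
    rw [Complex.real_smul]
    ring
  refine Measure.eqOn_open_of_ae_eq (μ := volume) ?_ hW hf hg
  refine (ae_restrict_iff' hW.measurableSet).2 ?_
  filter_upwards [h1] with y hy hyW using sub_eq_zero.1 (hy hyW)

section
variable {M : Mfd.{u} n} {φ : Coord M} {m : ℤ} {P : Op M} {q : ℕ → E n → E n → ℂ}

theorem contDiffOn_of_offDiagonal (hP : IsSmoothOffDiagonal P) (hφ : IsCoord φ) {k : E n → E n → ℂ}
    (hk : ∀ x ∈ φ.target, ContinuousOn (k x) (φ.target \ {x}))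
    (hkP : ∀ v : Test M, tsupport (v : M → ℂ) ⊆ φ.source →
      ∀ x ∈ φ.source, x ∉ tsupport (v : M → ℂ) →
        (P v : M → ℂ) x = ∫ y in φ.target, k (φ x) y * inCoord φ (v : M → ℂ) y) :
    ContDiffOn ℝ ∞ (fun z : E n × E n => k z.1 z.2)
      {z | z.1 ∈ φ.target ∧ z.2 ∈ φ.target ∧ z.1 ≠ z.2} := by
  rintro ⟨x₀, y₀⟩ ⟨hx₀, hy₀, hne⟩
  obtain ⟨A, B, hA, hB, hxA, hyB, hAB⟩ := t2_separation hne
  set A' : Set M := φ.source ∩ φ ⁻¹' A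
  set B' : Set M := φ.source ∩ φ ⁻¹' B
  have hA' : IsOpen A' := φ.isOpen_inter_preimage hA
  have hB' : IsOpen B' := φ.isOpen_inter_preimage hB
  have hsA : (φ.restr A').source = A' := by
    rw [φ.restr_source' _ hA', inter_eq_right]; exact inter_subset_left
  have hsB : (φ.restr B').source = B' := by
    rw [φ.restr_source' _ hB', inter_eq_right]; exact inter_subset_left
  have htA : (φ.restr A').target = φ.target ∩ A := by
    ext y
    rw [φ.restr_target, hA'.interior_eq]
    refine and_congr_right fun hy => ?_
    simp [A', φ.map_target hy, φ.right_inv hy]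
  have htB : (φ.restr B').target = φ.target ∩ B := by
    ext y
    rw [φ.restr_target, hB'.interior_eq]
    refine and_congr_right fun hy => ?_
    simp [B', φ.map_target hy, φ.right_inv hy]
  obtain ⟨k', hk's, hk'⟩ := hP _ _ (isCoord_restr hφ hA') (isCoord_restr hφ hB') (by
    rw [hsA, hsB]
    exact (hAB.preimage φ).mono inter_subset_right inter_subset_right)
  rw [htA, htB] at hk's
  have hWo : IsOpen (φ.target ∩ B) := φ.open_target.inter hB
  have key : ∀ x ∈ φ.target ∩ A, EqOn (k x) (k' x) (φ.target ∩ B) := by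
    intro x hx
    have hxs : φ.symm x ∈ A' := ⟨φ.map_target hx.1, by
      rw [mem_preimage, φ.right_inv hx.1]; exact hx.2⟩
    refine eqOn_of_integral_testOn hWo ((hk x hx.1).mono fun y hy => ⟨hy.1, fun h => ?_⟩)
      (hk's.continuousOn.comp (f := fun y => (x, y)) (by fun_prop) fun y hy => ⟨hx, hy⟩)
      fun v hv => ?_
    · rw [mem_singleton_iff.1 h] at hy
      exact hAB.le_bot ⟨hx.2, hy.2⟩
    have hv' : v ∈ TestOn φ.target := ⟨hv.1, hv.2.1, hv.2.2.trans inter_subset_left⟩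
    set V : Test M := pushL φ hφ ⟨v, hv'⟩
    have hV : inCoord φ (V : M → ℂ) = v := inCoord_push hv'.2.2
    have hVs : tsupport (V : M → ℂ) ⊆ B' := by
      refine (tsupport_push_subset hv'.2.1 hv'.2.2).trans ?_
      rintro _ ⟨y, hy, rfl⟩
      have hy' := hv.2.2 hy
      exact ⟨φ.map_target hy'.1, by rw [mem_preimage, φ.right_inv hy'.1]; exact hy'.2⟩
    have h1 := hkP V (hVs.trans inter_subset_left) _ hxs.1 fun h => hAB.le_bot
      ⟨hxs.2, (hVs h).2⟩
    have h2 := hk' V (by rwa [hsB]) (φ.symm x) (by rwa [hsA])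
    have h3 : inCoord (φ.restr B') (V : M → ℂ) = v := by
      rw [inCoord, htB]
      ext y
      by_cases hy : y ∈ φ.target ∩ B
      · rw [indicator_of_mem hy]
        exact push_symm hy.1
      · rw [indicator_of_notMem hy, image_eq_zero_of_notMem_tsupport fun h => hy (hv.2.2 h)]
    rw [hV, φ.right_inv hx.1, setIntegral_eq_integral_of_forall_compl_eq_zero fun y hy => by
      rw [image_eq_zero_of_notMem_tsupport fun h => hy (hv'.2.2 h), mul_zero]] at h1
    rw [h3, htB, setIntegral_eq_integral_of_forall_compl_eq_zero fun y hy => by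
      rw [image_eq_zero_of_notMem_tsupport fun h => hy (hv.2.2 h), mul_zero]] at h2
    rw [← h1, h2]
    have h5 : (φ.restr A') (φ.symm x) = x := φ.right_inv hx.1
    rw [h5]
  have hopen : IsOpen ((φ.target ∩ A) ×ˢ (φ.target ∩ B)) := (φ.open_target.inter hA).prod hWo
  have hmem := hopen.mem_nhds (x := (x₀, y₀)) ⟨⟨hx₀, hxA⟩, hy₀, hyB⟩
  refine ((hk's.contDiffAt hmem).congr_of_eventuallyEq ?_).contDiffWithinAt
  filter_upwards [hmem] with z hz using key z.1 hz.1 hz.2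

/-- The behaviour of the Schwartz kernel of a pseudodifferential operator near the diagonal. -/
theorem HasSymbol.kernel_asymptotics (hP : IsSmoothOffDiagonal P) (hφ : IsCoord φ)
    (hS : HasSymbol m P φ q) : ∃ (k : E n → E n → ℂ) (a : ℤ → E n → E n → ℂ),
    IsOffDiagonalKernel P φ k ∧
    (∀ j ∈ Finset.Icc (-(m + n)) (-1), IsHomogSymbol φ.target j (a j)) ∧
    ∀ K : Set (E n), IsCompact K → K ⊆ φ.target → ∃ C : ℝ, ∀ x ∈ K, ∀ y ∈ K, x ≠ y →
      ‖k x y - ((∑ j ∈ Finset.Icc (-(m + n)) (-1), a j x (x - y))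
        - logCoeff m (fun j => q j x) * (Real.log ‖x - y‖ : ℝ))‖ ≤ C := by
  obtain ⟨p, r, hp, hr, hPr⟩ := hS
  obtain ⟨a, ha, hasym⟩ := symKer_asymptotics φ.open_target hp
  have hrc : ∀ x ∈ φ.target, ContinuousOn (r x) φ.target := fun x hx =>
    hr.continuousOn.comp (f := fun y => (x, y)) (by fun_prop) fun y hy => ⟨hx, hy⟩
  have hkP : ∀ v : Test M, tsupport (v : M → ℂ) ⊆ φ.source →
      ∀ x ∈ φ.source, x ∉ tsupport (v : M → ℂ) →
        (P v : M → ℂ) x = ∫ y in φ.target, (symKer p q m (φ x) y + r (φ x) y) *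
          inCoord φ (v : M → ℂ) y := by
    intro v hv x hx hxv
    have hvt := inCoord_mem hφ v.2 hv
    have hx' : φ x ∉ tsupport (inCoord φ (v : M → ℂ)) := fun h => by
      obtain ⟨z, hz, hzx⟩ := tsupport_inCoord_subset v.2.2 hv h
      rw [φ.injOn (hv hz) hx hzx] at hz
      exact hxv hz
    have hz : ∀ (k : E n → ℂ) (y), y ∉ φ.target → k y * inCoord φ (v : M → ℂ) y = 0 :=
      fun k y hy => by rw [image_eq_zero_of_notMem_tsupport fun h => hy (hvt.2.2 h), mul_zero]
    rw [hPr v hv x hx, quantize_eq_integral φ.open_target hp (φ.map_source hx) hvt.1 hvt.2.1 hx',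
      ← setIntegral_eq_integral_of_forall_compl_eq_zero (hz (symKer p q m (φ x))), ← integral_add]
    · congr 1
      ext y
      ring
    · exact (integrable_mul_of_continuousOn_compl (continuousOn_symKer φ.open_target hp
        (φ.map_source hx)) hvt.1.continuous hvt.2.1 hx').integrableOn
    · exact (TestOn.integrable_mul φ.open_target (hrc _ (φ.map_source hx)) hvt).integrableOn
  refine ⟨fun x y => symKer p q m x y + r x y, a, ⟨contDiffOn_of_offDiagonal hP hφ
    (k := fun x y => symKer p q m x y + r x y) (fun x hx => ?_) hkP, hkP⟩, ha, fun K hK hKU => ?_⟩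
  · exact ((continuousOn_symKer φ.open_target hp hx).mono fun y hy => hy.2).add
      ((hrc x hx).mono sdiff_subset)
  · obtain ⟨C₁, hC₁⟩ := hasym K hK hKU
    obtain ⟨C₂, hC₂⟩ := (hK.prod hK).exists_bound_of_continuousOn
      (hr.continuousOn.mono (prod_mono hKU hKU))
    refine ⟨C₁ + C₂, fun x hx y hy hxy => ?_⟩
    rw [add_sub_right_comm]
    exact (norm_add_le _ _).trans (add_le_add (hC₁ x hx y hy hxy) (hC₂ (x, y) ⟨hx, hy⟩))

end

end RiemPsiDO

end

noncomputable section
namespace RiemPsiDO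
open Set Filter Topology
variable {n : ℕ}

section
variable {M : Mfd.{u} n} {φ ψ : Coord M}

theorem mdifferentiable_coord (hφ : IsCoord φ) : φ.MDifferentiable (𝓡 n) (𝓡 n) :=
  ⟨(contMDiffOn_coord hφ).mdifferentiableOn (by simp),
    (contMDiffOn_coord_symm hφ).mdifferentiableOn (by simp)⟩

theorem contMDiffOn_frame (hφ : IsCoord φ) (i : Fin n) :
    ContMDiffOn (𝓡 n) (𝓡 n).tangent ∞
      (fun y => (⟨φ.symm y, frame φ y i⟩ : TangentBundle (𝓡 n) M)) φ.target := by
  have hu : UniqueMDiffOn (𝓡 n) φ.target := φ.open_target.uniqueMDiffOn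
  have h1 := (contMDiffOn_coord_symm hφ).contMDiffOn_tangentMapWithin (m := ∞) (by simp) hu
  have h2 : ContMDiffOn (𝓡 n) (𝓡 n).tangent ∞
      (fun y => (⟨y, e i⟩ : TangentBundle (𝓡 n) (E n))) φ.target := by
    have h3 : ContDiff ℝ ∞ (fun _ : E n => e i) := contDiff_const
    exact (contMDiff_vectorSpace_iff_contDiff (V := fun _ => e i) |>.2 h3).contMDiffOn
  refine (h1.comp h2 fun y hy => hy).congr fun y hy => ?_
  rw [Function.comp_apply, tangentMapWithin_eq_tangentMap (hu y hy)
    ((mdifferentiable_coord hφ).mdifferentiableAt_symm hy)]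
  rfl

theorem contDiffOn_coeff (hφ : IsCoord φ) (g : RMetric M) :
    ContDiffOn ℝ ∞ (coeff g φ) φ.target := by
  refine contDiffOn_pi.2 fun i => contDiffOn_pi.2 fun j => ?_
  rw [← contMDiffOn_iff_contDiffOn]
  intro y hy
  have h := ContMDiffWithinAt.clm_bundle_apply₂ (F₁ := E n) (F₂ := E n) (F₃ := ℝ)
    (E₁ := fun x : M => TangentSpace (𝓡 n) x) (E₂ := fun x : M => TangentSpace (𝓡 n) x)
    (E₃ := Bundle.Trivial M ℝ) (b := φ.symm) (ψ := fun y => g.inner (φ.symm y))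
    (g.contMDiff.contMDiffAt.comp_contMDiffWithinAt y (contMDiffOn_coord_symm hφ y hy))
    (contMDiffOn_frame hφ i y hy) (contMDiffOn_frame hφ j y hy)
  exact (Bundle.contMDiffWithinAt_totalSpace.1 h).2

/-- The differential of a parametrization. -/
def dsymm (φ : Coord M) (y : E n) : E n →L[ℝ] E n := mfderiv (𝓡 n) (𝓡 n) φ.symm y

theorem frame_sum (φ : Coord M) (y : E n) (v : Fin n → ℝ) :
    ∑ i, v i • (frame φ y i : E n) = dsymm φ y (WithLp.toLp 2 v) := by
  have h1 : (WithLp.toLp 2 v : E n) = ∑ i, v i • e i := by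
    ext j
    simp [e, Finset.sum_apply, Pi.single_apply]
  rw [h1, map_sum]
  exact Finset.sum_congr rfl fun i _ => (map_smul (dsymm φ y) (v i) (e i)).symm

theorem inner_sum_sum (g : RMetric M) (x : M) (f : Fin n → TangentSpace (𝓡 n) x) (v w : Fin n → ℝ) :
    g.inner x (∑ i, v i • f i) (∑ j, w j • f j) = ∑ i, ∑ j, v i * g.inner x (f i) (f j) * w j := by
  simp only [map_sum, map_smul, _root_.sum_apply, _root_.smul_apply, smul_eq_mul, Finset.mul_sum]
  rw [Finset.sum_comm]
  refine Finset.sum_congr rfl fun i _ => Finset.sum_congr rfl fun j _ => by ring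

theorem coeff_mem (hφ : IsCoord φ) (g : RMetric M) {y : E n} (hy : y ∈ φ.target) :
    coeff g φ y ∈ Pos n := by
  refine Matrix.PosDef.of_dotProduct_mulVec_pos ?_ fun v hv => ?_
  · ext i j
    exact g.symm _ _ _
  have hinj : ∑ i, v i • frame φ y i ≠ 0 := by
    intro h
    have h1 := (mdifferentiable_coord hφ).comp_symm_deriv hy
    have h2 := (frame_sum φ y v).symm.trans h
    obtain ⟨L, hL⟩ : ∃ L : E n →L[ℝ] E n, L.comp (dsymm φ y) = ContinuousLinearMap.id ℝ (E n) := ⟨_, h1⟩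
    have h3 := congrArg (fun L : E n →L[ℝ] E n => L (WithLp.toLp 2 v)) hL
    simp only [ContinuousLinearMap.comp_apply, h2] at h3
    have h5 : (WithLp.toLp 2 v : E n) = 0 := h3.symm.trans (map_zero L)
    exact hv (by simpa using h5)
  have := g.pos _ _ hinj
  rw [inner_sum_sum] at this
  refine this.trans_eq ?_
  simp [dotProduct, Matrix.mulVec, coeff, Finset.mul_sum, mul_assoc]

theorem contDiffOn_coordChange (hφ : IsCoord φ) (hψ : IsCoord ψ) :
    ContDiffOn ℝ ∞ (φ ∘ ψ.symm) (ψ.target ∩ ψ.symm ⁻¹' φ.source) := by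
  rw [← contMDiffOn_iff_contDiffOn]
  exact (contMDiffOn_coord hφ).comp ((contMDiffOn_coord_symm hψ).mono inter_subset_left)
    fun y hy => hy.2

theorem isOpen_coordChange (φ ψ : Coord M) : IsOpen (ψ.target ∩ ψ.symm ⁻¹' φ.source) :=
  ψ.isOpen_inter_preimage_symm φ.open_source

/-- The matrix of the coordinate change from `ψ` to `φ`. -/
def jac (φ ψ : Coord M) (y : E n) : Matrix (Fin n) (Fin n) ℝ :=
  Matrix.of fun i j => fderiv ℝ (φ ∘ ψ.symm) y (e i) j

theorem dsymm_eq (hφ : IsCoord φ) (hψ : IsCoord ψ) {y : E n} (hy : y ∈ ψ.target)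
    (hy' : ψ.symm y ∈ φ.source) (v : E n) :
    dsymm ψ y v = dsymm φ (φ (ψ.symm y)) (fderiv ℝ (φ ∘ ψ.symm) y v) := by
  have hopen := (isOpen_coordChange φ ψ).mem_nhds ⟨hy, hy'⟩
  have h1 : (ψ.symm : E n → M) =ᶠ[𝓝 y] φ.symm ∘ (φ ∘ ψ.symm) := by
    filter_upwards [hopen] with z hz using (φ.left_inv hz.2).symm
  have h2 : MDifferentiableAt (𝓡 n) (𝓡 n) (φ ∘ ψ.symm) y :=
    (((contDiffOn_coordChange hφ hψ).contDiffAt hopen).contMDiffAt).mdifferentiableAt (by simp)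
  have h3 := mfderiv_comp (I := 𝓡 n) (I' := 𝓡 n) (I'' := 𝓡 n) y
    ((mdifferentiable_coord hφ).mdifferentiableAt_symm (φ.map_source hy')) h2
  rw [dsymm, h1.mfderiv_eq]
  have h4 := congrArg (fun L : E n →L[ℝ] E n => L v) h3
  rw [mfderiv_eq_fderiv] at h4
  exact h4

theorem frame_eq (hφ : IsCoord φ) (hψ : IsCoord ψ) {y : E n} (hy : y ∈ ψ.target)
    (hy' : ψ.symm y ∈ φ.source) (i : Fin n) :
    (frame ψ y i : E n) = ∑ j, jac φ ψ y i j • (frame φ (φ (ψ.symm y)) j : E n) := by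
  rw [frame_sum]
  exact dsymm_eq hφ hψ hy hy' (e i)

/-- The metric at a point, as a function on the model space. -/
theorem inner_congr (g : RMetric M) {x x' : M} (h : x = x') (v w : E n) :
    g.inner x (v : TangentSpace (𝓡 n) x) (w : TangentSpace (𝓡 n) x) =
      g.inner x' (v : TangentSpace (𝓡 n) x') (w : TangentSpace (𝓡 n) x') := by
  subst h; rfl

theorem coeff_coordChange (hφ : IsCoord φ) (hψ : IsCoord ψ) (g : RMetric M) {y : E n}
    (hy : y ∈ ψ.target) (hy' : ψ.symm y ∈ φ.source) :
    Matrix.of (coeff g ψ y) =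
      jac φ ψ y * Matrix.of (coeff g φ (φ (ψ.symm y))) * (jac φ ψ y).transpose := by
  ext i j
  have h1 : coeff g ψ y i j = g.inner (φ.symm (φ (ψ.symm y)))
      (∑ k, jac φ ψ y i k • frame φ (φ (ψ.symm y)) k)
      (∑ l, jac φ ψ y j l • frame φ (φ (ψ.symm y)) l) := by
    have h := inner_congr g (φ.left_inv hy').symm (frame ψ y i : E n) (frame ψ y j : E n)
    have hi : (frame ψ y i : E n) = _ := frame_eq hφ hψ hy hy' i
    have hj : (frame ψ y j : E n) = _ := frame_eq hφ hψ hy hy' j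
    refine Eq.trans h ?_
    rw [hi, hj]
  rw [inner_sum_sum] at h1
  rw [Matrix.of_apply, h1]
  simp only [Matrix.mul_apply, Matrix.transpose_apply, Matrix.of_apply, Finset.sum_mul]
  rw [Finset.sum_comm]
  rfl

theorem det_jac (y : E n) : (jac φ ψ y).det =
    LinearMap.det (fderiv ℝ (φ ∘ ψ.symm) y : E n →ₗ[ℝ] E n) := by
  rw [← LinearMap.det_toMatrix (EuclideanSpace.basisFun (Fin n) ℝ).toBasis, ← Matrix.det_transpose]
  congr 1

theorem isInvertible_coordChange (hφ : IsCoord φ) (hψ : IsCoord ψ) {y : E n} (hy : y ∈ ψ.target)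
    (hy' : ψ.symm y ∈ φ.source) : (fderiv ℝ (φ ∘ ψ.symm) y).IsInvertible := by
  have hop := (isOpen_coordChange φ ψ).mem_nhds ⟨hy, hy'⟩
  have hy2 : φ.symm (φ (ψ.symm y)) ∈ ψ.source := by
    rw [φ.left_inv hy']; exact ψ.map_target hy
  have hop' := (isOpen_coordChange ψ φ).mem_nhds ⟨φ.map_source hy', hy2⟩
  have hd := ((contDiffOn_coordChange hφ hψ).contDiffAt hop).differentiableAt (by simp)
  have hd' := ((contDiffOn_coordChange hψ hφ).contDiffAt hop').differentiableAt (by simp)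
  have e1 : (ψ ∘ φ.symm) ∘ (φ ∘ ψ.symm) =ᶠ[𝓝 y] id := by
    filter_upwards [hop] with z hz
    simp [φ.left_inv hz.2, ψ.right_inv hz.1]
  have e2 : (φ ∘ ψ.symm) ∘ (ψ ∘ φ.symm) =ᶠ[𝓝 (φ (ψ.symm y))] id := by
    filter_upwards [hop'] with z hz
    simp [ψ.left_inv hz.2, φ.right_inv hz.1]
  have hk : (ψ ∘ φ.symm) (φ (ψ.symm y)) = y := by
    simp [φ.left_inv hy', ψ.right_inv hy]
  have c1 := fderiv_comp y hd' hd
  have c2 := fderiv_comp (φ (ψ.symm y)) (g := φ ∘ ψ.symm) (f := ψ ∘ φ.symm) (by rwa [hk]) hd'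
  rw [e1.fderiv_eq, fderiv_id] at c1
  rw [e2.fderiv_eq, fderiv_id, hk] at c2
  exact ⟨ContinuousLinearEquiv.equivOfInverse' _ _ c2.symm c1.symm, rfl⟩

end

end RiemPsiDO

end

noncomputable section
namespace RiemPsiDO
open Set Filter Topology
variable {n : ℕ}

/-! ### Universal symbols -/

/-- The symmetric part of a matrix. -/
def symmetrize (A : Fin n → Fin n → ℝ) : Fin n → Fin n → ℝ := fun i j => (A i j + A j i) / 2

/-- An open neighbourhood of `Pos n` in the space of all matrices. -/
def PosE (n : ℕ) : Set (Fin n → Fin n → ℝ) := {A | symmetrize A ∈ Pos n}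

theorem symmetrize_of_mem {A : Fin n → Fin n → ℝ} (h : A ∈ Pos n) : symmetrize A = A := by
  ext i j
  have := h.1.apply i j
  simp only [Matrix.of_apply, star_trivial] at this
  rw [symmetrize, this]
  ring

theorem pos_subset_posE : Pos n ⊆ PosE n := fun A h => by
  change symmetrize A ∈ Pos n
  rwa [symmetrize_of_mem h]

theorem contDiff_symmetrize : ContDiff ℝ ∞ (symmetrize : (Fin n → Fin n → ℝ) → _) :=
  contDiff_pi.2 fun i => contDiff_pi.2 fun j => by unfold symmetrize; fun_prop

theorem mem_posE_iff {A : Fin n → Fin n → ℝ} :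
    A ∈ PosE n ↔ ∀ v ∈ Metric.sphere (0 : Fin n → ℝ) 1, 0 < ∑ i, ∑ j, v i * A i j * v j := by
  have hsym : ∀ v : Fin n → ℝ, Star.star v ⬝ᵥ (Matrix.of (symmetrize A)).mulVec v =
      ∑ i, ∑ j, v i * A i j * v j := by
    intro v
    have h1 : ∑ i, ∑ j, v i * A j i * v j = ∑ i, ∑ j, v i * A i j * v j := by
      rw [Finset.sum_comm]
      exact Finset.sum_congr rfl fun i _ => Finset.sum_congr rfl fun j _ => by ring
    have h2 : ∑ i, ∑ j, v i * A i j * v j =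
        ∑ i, ∑ j, (v i * A i j * v j + v i * A j i * v j) / 2 := by
      simp_rw [← Finset.sum_div, Finset.sum_add_distrib]
      rw [h1]; ring
    rw [h2]
    simp only [dotProduct, Matrix.mulVec, Matrix.of_apply, symmetrize, star_trivial, Finset.mul_sum]
    exact Finset.sum_congr rfl fun i _ => Finset.sum_congr rfl fun j _ => by ring
  constructor
  · intro h v hv
    rw [← hsym]
    exact Matrix.PosDef.dotProduct_mulVec_pos h fun h0 => by simp [h0] at hv
  · intro h
    refine Matrix.PosDef.of_dotProduct_mulVec_pos ?_ fun v hv => ?_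
    · ext i j
      simp [symmetrize, add_comm]
    · rw [hsym]
      have h0 : 0 < ‖v‖ := norm_pos_iff.2 hv
      have h1 := h (‖v‖⁻¹ • v) (by simp [norm_smul, h0.ne'])
      have h2 : ∑ i, ∑ j, (‖v‖⁻¹ • v) i * A i j * (‖v‖⁻¹ • v) j =
          ‖v‖⁻¹ ^ 2 * ∑ i, ∑ j, v i * A i j * v j := by
        simp only [Finset.mul_sum, Pi.smul_apply, smul_eq_mul]
        exact Finset.sum_congr rfl fun i _ => Finset.sum_congr rfl fun j _ => by ring
      rw [h2] at h1
      exact pos_of_mul_pos_right h1 (by positivity)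

theorem isOpen_posE : IsOpen (PosE n) := by
  refine isOpen_iff_eventually.2 fun A hA => ?_
  simp_rw [mem_posE_iff] at hA ⊢
  refine (isCompact_sphere (0 : Fin n → ℝ) 1).eventually_forall_of_forall_eventually fun v hv => ?_
  have hc : Continuous fun z : (Fin n → Fin n → ℝ) × (Fin n → ℝ) =>
      ∑ i, ∑ j, z.2 i * z.1 i j * z.2 j := by fun_prop
  exact hc.continuousAt.eventually (lt_mem_nhds (hA v hv))

theorem IsHomogSymbol.extend {d : ℤ} {a : (Fin n → Fin n → ℝ) → E n → ℂ}
    (ha : IsHomogSymbol (Pos n) d a) : IsHomogSymbol (PosE n) d (fun A => a (symmetrize A)) :=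
  ⟨ha.1.comp (f := fun z : (Fin n → Fin n → ℝ) × E n => (symmetrize z.1, z.2))
    ((contDiff_symmetrize.comp contDiff_fst).prodMk contDiff_snd).contDiffOn
    fun _ hz => ⟨hz.1, hz.2⟩, fun _ hA => ha.2 _ hA⟩

section
variable {F : Type*} [NormedAddCommGroup F] [NormedSpace ℝ F] {U : Set F} {d : ℤ} {a : F → E n → ℂ}

theorem IsHomogSymbol.diffAt (ha : IsHomogSymbol U d a) (hU : IsOpen U) {x : F} (hx : x ∈ U)
    {ξ : E n} (hξ : ξ ≠ 0) : DifferentiableAt ℝ (fun z : F × E n => a z.1 z.2) (x, ξ) :=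
  differentiableAt_of_contDiffOn (hU.prod isOpen_compl_singleton) ha.1 ⟨hx, hξ⟩

theorem IsHomogSymbol.diffAt_left (ha : IsHomogSymbol U d a) (hU : IsOpen U) {x : F} (hx : x ∈ U)
    {ξ : E n} (hξ : ξ ≠ 0) : DifferentiableAt ℝ (fun x => a x ξ) x :=
  (ha.diffAt hU hx hξ).comp (f := fun x => (x, ξ)) x (by fun_prop)

theorem IsHomogSymbol.dd_right (ha : IsHomogSymbol U d a) (hU : IsOpen U) (v : E n) :
    IsHomogSymbol U (d - 1) (fun x => dd v (a x)) := by
  have hΩ : IsOpen (U ×ˢ ({0}ᶜ : Set (E n))) := hU.prod isOpen_compl_singleton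
  refine ⟨(contDiffOn_dd hΩ ha.1 (0, v)).congr fun z hz => ?_, fun x hx => ((ha.homog hx).dd v).2⟩
  exact dd_slice_right (b := fun z : F × E n => a z.1 z.2) (z := z) (ha.diffAt hU hz.1 hz.2) v

theorem IsHomogSymbol.dd_left (ha : IsHomogSymbol U d a) (hU : IsOpen U) (v : F) :
    IsHomogSymbol U d (fun x ξ => dd v (fun x => a x ξ) x) := by
  have hΩ : IsOpen (U ×ˢ ({0}ᶜ : Set (E n))) := hU.prod isOpen_compl_singleton
  refine ⟨(contDiffOn_dd hΩ ha.1 (v, 0)).congr fun z hz => ?_, fun x hx ξ hξ t ht => ?_⟩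
  · exact dd_slice_left (b := fun z : F × E n => a z.1 z.2) (z := z) (ha.diffAt hU hz.1 hz.2) v
  · have h1 := dd_congr hU (F := fun x => a x (t • ξ)) (G := fun x => (t : ℂ) ^ d * a x ξ)
      (fun y hy => ha.2 y hy ξ hξ t ht) v x hx
    exact h1.trans (dd_const_mul (ha.diffAt_left hU hx hξ) _ _)

theorem IsHomogSymbol.mul {d' : ℤ} {b : F → E n → ℂ} (ha : IsHomogSymbol U d a)
    (hb : IsHomogSymbol U d' b) : IsHomogSymbol U (d + d') (fun x ξ => a x ξ * b x ξ) :=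
  ⟨ha.1.mul hb.1, fun _ hx => ((ha.homog hx).mul (hb.homog hx)).2⟩

theorem IsHomogSymbol.add {b : F → E n → ℂ} (ha : IsHomogSymbol U d a)
    (hb : IsHomogSymbol U d b) : IsHomogSymbol U d (fun x ξ => a x ξ + b x ξ) :=
  ⟨ha.1.add hb.1, fun x hx ξ hξ t ht => by
    beta_reduce; rw [ha.2 x hx ξ hξ t ht, hb.2 x hx ξ hξ t ht]; ring⟩

theorem IsHomogSymbol.zero : IsHomogSymbol U d (fun _ (_ : E n) => (0 : ℂ)) :=
  ⟨contDiffOn_const, fun _ _ _ _ _ _ => by simp⟩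

theorem IsHomogSymbol.const (c : ℂ) : IsHomogSymbol U 0 (fun _ (_ : E n) => c) :=
  ⟨contDiffOn_const, fun _ _ _ _ _ _ => by simp⟩

theorem IsHomogSymbol.contDiffOn_integral_bump [FiniteDimensional ℝ F] (hU : IsOpen U)
    (ha : IsHomogSymbol U d a) : ContDiffOn ℝ ∞ (fun x => ∫ ζ, a x ζ * bump ζ) U := by
  have hc : ContDiffOn ℝ ∞ (fun z : F × E n => a z.1 z.2 * bump z.2) (U ×ˢ {0}ᶜ) :=
    ha.1.mul (bump_mem.1.comp contDiff_snd).contDiffOn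
  exact (contDiffOn_integral_of_support hU (bump_mem (n := n)).2.1
    (hU.prod isOpen_compl_singleton)
    (fun x hx ζ hζ => ⟨hx, TestSym.tsupport_subset bump_mem hζ⟩) hc
    fun x _ ζ hζ => by simp [image_eq_zero_of_notMem_tsupport hζ]).1

end

section PartialDeriv
variable {U : Set (E n)} {f : E n → ℝ}

theorem contDiffOn_partialDeriv (hU : IsOpen U) (hf : ContDiffOn ℝ ∞ f U) (α : List (Fin n)) :
    ContDiffOn ℝ ∞ (partialDeriv α f) U := fun y hy => by
  have h1 : ContDiffAt ℝ ∞ (iteratedFDeriv ℝ α.length f) y :=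
    (hf.contDiffAt (hU.mem_nhds hy)).iteratedFDeriv_right (m := ∞) (by exact_mod_cast le_rfl)
  exact ((ContinuousMultilinearMap.apply ℝ (fun _ : Fin α.length => E n) ℝ
    fun i => e (α.get i)).contDiff.contDiffAt.comp y h1).contDiffWithinAt

theorem fderiv_partialDeriv (hU : IsOpen U) (hf : ContDiffOn ℝ ∞ f U) (α : List (Fin n)) {y : E n}
    (hy : y ∈ U) (i : Fin n) : fderiv ℝ (partialDeriv α f) y (e i) = partialDeriv (i :: α) f y := by
  have h1 : DifferentiableAt ℝ (iteratedFDeriv ℝ α.length f) y :=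
    ((hf.contDiffAt (hU.mem_nhds hy)).iteratedFDeriv_right (m := 1)
      (by exact_mod_cast le_top)).differentiableAt
      one_ne_zero
  have h2 := ((ContinuousMultilinearMap.apply ℝ (fun _ : Fin α.length => E n) ℝ
    fun i => e (α.get i)).hasFDerivAt.comp y h1.hasFDerivAt).fderiv
  have h3 : partialDeriv α f = (ContinuousMultilinearMap.apply ℝ (fun _ : Fin α.length => E n) ℝ
    fun i => e (α.get i)) ∘ iteratedFDeriv ℝ α.length f := rfl
  rw [h3, h2]
  rfl

end PartialDeriv

/-- Functions on the phase space of each coordinate domain of each Riemannian manifold. -/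
abbrev UFun (n : ℕ) : Type (u + 1) := ∀ M : Mfd.{u} n, RMetric M → Coord M → E n → E n → ℂ

/-- The derivative `∂^α g_{ij}`. -/
def pd {M : Mfd.{u} n} (g : RMetric M) (φ : Coord M) (s : Fin n × Fin n × List (Fin n)) (y : E n) : ℝ :=
  partialDeriv s.2.2 (fun z => coeff g φ z s.1 s.2.1) y

/-- The functions of the form `∑ (∂^α g)^β a_β(g, ξ)`, with `a_β` homogeneous of degree `d`. -/
inductive IsUniv : ℤ → UFun.{u} n → Prop
  | base {d : ℤ} {a : (Fin n → Fin n → ℝ) → E n → ℂ} (ha : IsHomogSymbol (PosE n) d a) :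
      IsUniv d (fun _ g φ y ξ => a (coeff g φ y) ξ)
  | mul_pd {d : ℤ} {f : UFun.{u} n} (s : Fin n × Fin n × List (Fin n)) (hf : IsUniv d f) :
      IsUniv d (fun M g φ y ξ => (pd g φ s y : ℂ) * f M g φ y ξ)
  | add {d : ℤ} {f f' : UFun.{u} n} (hf : IsUniv d f) (hf' : IsUniv d f') :
      IsUniv d (fun M g φ y ξ => f M g φ y ξ + f' M g φ y ξ)
  | congr {d : ℤ} {f f' : UFun.{u} n} (hf : IsUniv d f)
      (h : ∀ M g φ, IsCoord φ → ∀ y ∈ φ.target, ∀ ξ ≠ 0, f' M g φ y ξ = f M g φ y ξ) : IsUniv d f'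

section
variable {M : Mfd.{u} n} {φ : Coord M} {d d' : ℤ} {f f' : UFun.{u} n}

theorem contDiffOn_coeff_apply (hφ : IsCoord φ) (g : RMetric M) (i j : Fin n) :
    ContDiffOn ℝ ∞ (fun z => coeff g φ z i j) φ.target :=
  contDiffOn_pi.1 (contDiffOn_pi.1 (contDiffOn_coeff hφ g) i) j

theorem contDiffOn_pd (hφ : IsCoord φ) (g : RMetric M) (s : Fin n × Fin n × List (Fin n)) :
    ContDiffOn ℝ ∞ (pd g φ s) φ.target :=
  contDiffOn_partialDeriv φ.open_target (contDiffOn_coeff_apply hφ g _ _) _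

theorem IsUniv.isHomogSymbol (hf : IsUniv d f) (hφ : IsCoord φ) (g : RMetric M) :
    IsHomogSymbol φ.target d (f M g φ) := by
  induction hf with
  | base ha =>
    refine ⟨ha.1.comp (f := fun z : E n × E n => (coeff g φ z.1, z.2)) (ContDiffOn.prodMk
      ((contDiffOn_coeff hφ g).comp contDiffOn_fst fun z hz => hz.1) contDiffOn_snd)
      fun z hz => ⟨pos_subset_posE (coeff_mem hφ g hz.1), hz.2⟩, fun y hy => ha.2 _ ?_⟩
    exact pos_subset_posE (coeff_mem hφ g hy)
  | mul_pd s _ ih =>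
    refine ⟨ContDiffOn.mul (Complex.ofRealCLM.contDiff.comp_contDiffOn
      ((contDiffOn_pd hφ g s).comp contDiffOn_fst fun z hz => hz.1)) ih.1,
      fun y hy ξ hξ t ht => ?_⟩
    beta_reduce
    rw [ih.2 y hy ξ hξ t ht]
    ring
  | add _ _ ih ih' => exact ih.add ih'
  | congr _ h ih =>
    refine ⟨ih.1.congr fun z hz => h M g φ hφ z.1 hz.1 z.2 hz.2, fun y hy ξ hξ t ht => ?_⟩
    rw [h M g φ hφ y hy ξ hξ, h M g φ hφ y hy _ (smul_ne_zero ht.ne' hξ), ih.2 y hy ξ hξ t ht]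

theorem IsUniv.cast (hf : IsUniv d f) (h : d = d') : IsUniv d' f := h ▸ hf

theorem IsUniv.zero : IsUniv d (fun _ _ _ _ _ => 0 : UFun.{u} n) := .base .zero

theorem IsUniv.sum {ι : Type*} (s : Finset ι) {f : ι → UFun.{u} n} (hf : ∀ i ∈ s, IsUniv d (f i)) :
    IsUniv d (fun M g φ y ξ => ∑ i ∈ s, f i M g φ y ξ) := by
  classical
  induction s using Finset.induction_on with
  | empty => simpa using IsUniv.zero
  | insert i s hi ih =>
    refine ((hf i (Finset.mem_insert_self i s)).add (ih fun j hj =>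
      hf j (Finset.mem_insert_of_mem hj))).congr fun M g φ _ y _ ξ _ => Finset.sum_insert hi

theorem IsUniv.mul (hf : IsUniv d f) (hf' : IsUniv d' f') :
    IsUniv (d + d') (fun M g φ y ξ => f M g φ y ξ * f' M g φ y ξ) := by
  induction hf with
  | base ha =>
    induction hf' with
    | base hb => exact .base (ha.mul hb)
    | mul_pd s _ ih => exact (ih.mul_pd s).congr fun M g φ _ y _ ξ _ => by ring
    | add _ _ ih ih' => exact (ih.add ih').congr fun M g φ _ y _ ξ _ => by ring
    | congr _ h ih => exact ih.congr fun M g φ hφ y hy ξ hξ => by rw [h M g φ hφ y hy ξ hξ]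
  | mul_pd s _ ih => exact (ih.mul_pd s).congr fun M g φ _ y _ ξ _ => by ring
  | add _ _ ih ih' => exact (ih.add ih').congr fun M g φ _ y _ ξ _ => by ring
  | congr _ h ih => exact ih.congr fun M g φ hφ y hy ξ hξ => by rw [h M g φ hφ y hy ξ hξ]

theorem IsUniv.const_mul (hf : IsUniv d f) (c : ℂ) : IsUniv d (fun M g φ y ξ => c * f M g φ y ξ) :=
  ((IsUniv.base (.const c)).mul hf).cast (zero_add d)

theorem IsUniv.dd_right (hf : IsUniv d f) (v : E n) :
    IsUniv (d - 1) (fun M g φ y => dd v (f M g φ y)) := by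
  induction hf with
  | base ha => exact .base (ha.dd_right isOpen_posE v)
  | mul_pd s h ih =>
    refine (ih.mul_pd s).congr fun M g φ hφ y hy ξ hξ => ?_
    exact dd_const_mul (differentiableAt_of_contDiffOn isOpen_compl_singleton
      ((h.isHomogSymbol hφ g).homog hy).1 hξ) _ _
  | add h h' ih ih' =>
    refine (ih.add ih').congr fun M g φ hφ y hy ξ hξ => ?_
    exact dd_add (differentiableAt_of_contDiffOn isOpen_compl_singleton
      ((h.isHomogSymbol hφ g).homog hy).1 hξ) (differentiableAt_of_contDiffOn isOpen_compl_singleton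
      ((h'.isHomogSymbol hφ g).homog hy).1 hξ) _
  | congr _ h ih =>
    refine ih.congr fun M g φ hφ y hy ξ hξ => ?_
    exact dd_congr isOpen_compl_singleton (fun ξ hξ => h M g φ hφ y hy ξ hξ) v ξ hξ

theorem IsUniv.dx (hf : IsUniv d f) (i : Fin n) : IsUniv d (fun M g φ => dx i (f M g φ)) := by
  induction hf with
  | @base a ha =>
    refine (IsUniv.sum Finset.univ (f := fun k => fun M g φ y ξ => ∑ l, (pd g φ (k, l, [i]) y : ℂ) *
      dd (Pi.single k (Pi.single l (1 : ℝ))) (fun A => a A ξ) (coeff g φ y)) fun k _ =>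
      IsUniv.sum Finset.univ fun l _ => (IsUniv.base (ha.dd_left isOpen_posE _)).mul_pd (k, l, [i])).congr
      fun M g φ hφ y hy ξ hξ => ?_
    have h1 := ha.diffAt_left isOpen_posE (pos_subset_posE (coeff_mem hφ g hy)) hξ
    have h2 : DifferentiableAt ℝ (coeff g φ) y :=
      ((contDiffOn_coeff hφ g).contDiffAt (φ.open_target.mem_nhds hy)).differentiableAt (by simp)
    have h3 := congrArg (fun L => L (e i)) (h1.hasFDerivAt.comp y h2.hasFDerivAt).fderiv
    have h4 : fderiv ℝ (coeff g φ) y (e i) = ∑ k, ∑ l, (pd g φ (k, l, [i]) y) •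
        Pi.single k (Pi.single l (1 : ℝ)) := by
      ext k l
      have h5 : fderiv ℝ (coeff g φ) y (e i) k l = fderiv ℝ (fun z => coeff g φ z k l) y (e i) := by
        have := ((ContinuousLinearMap.proj (R := ℝ) (φ := fun _ : Fin n => ℝ) l).comp
          (ContinuousLinearMap.proj (R := ℝ) (φ := fun _ : Fin n => Fin n → ℝ) k)).hasFDerivAt.comp y
          h2.hasFDerivAt
        exact (congrArg (fun L => L (e i)) this.fderiv).symm
      have h6 : partialDeriv [] (fun z => coeff g φ z k l) = fun z => coeff g φ z k l := by
        ext z; simp [partialDeriv]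
      have h7 := fderiv_partialDeriv φ.open_target (contDiffOn_coeff_apply hφ g k l) [] hy i
      rw [h6] at h7
      rw [h5, h7]
      simp [Finset.sum_apply, Pi.single_apply, Finset.sum_ite_eq, ite_apply, pd]
    refine h3.trans ?_
    simp only [ContinuousLinearMap.comp_apply, h4, map_sum, map_smul, Complex.real_smul]
    rfl
  | mul_pd s h ih =>
    refine ((h.mul_pd (s.1, s.2.1, i :: s.2.2)).add (ih.mul_pd s)).congr fun M g φ hφ y hy ξ hξ => ?_
    have h1 : DifferentiableAt ℝ (pd g φ s) y :=
      ((contDiffOn_pd hφ g s).contDiffAt (φ.open_target.mem_nhds hy)).differentiableAt (by simp)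
    have h2 : HasFDerivAt (fun y => (pd g φ s y : ℂ)) _ y :=
      Complex.ofRealCLM.hasFDerivAt.comp y h1.hasFDerivAt
    have h3 := dd_mul h2.differentiableAt ((h.isHomogSymbol hφ g).diffAt_left φ.open_target hy hξ) (e i)
    have h4 : dd (e i) (fun y => (pd g φ s y : ℂ)) y = (pd g φ (s.1, s.2.1, i :: s.2.2) y : ℂ) := by
      rw [dd, h2.fderiv]
      exact congrArg Complex.ofReal (fderiv_partialDeriv φ.open_target
        (contDiffOn_coeff_apply hφ g s.1 s.2.1) s.2.2 hy i)
    rw [← h4, add_comm]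
    exact h3
  | add h h' ih ih' =>
    refine (ih.add ih').congr fun M g φ hφ y hy ξ hξ => ?_
    exact dd_add ((h.isHomogSymbol hφ g).diffAt_left φ.open_target hy hξ)
      ((h'.isHomogSymbol hφ g).diffAt_left φ.open_target hy hξ) _
  | congr _ h ih =>
    refine ih.congr fun M g φ hφ y hy ξ hξ => ?_
    exact dd_congr φ.open_target (fun y hy => h M g φ hφ y hy ξ hξ) (e i) y hy

theorem IsUniv.star (r : ℕ) : ∀ {d d' : ℤ} {f f' : UFun.{u} n}, IsUniv d f → IsUniv d' f' →
    IsUniv (d + d' - r) (fun M g φ y => star r (f M g φ y) (f' M g φ) y) := by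
  induction r with
  | zero => intro d d' f f' hf hf'; simpa [RiemPsiDO.star] using hf.mul hf'
  | succ r ih =>
    intro d d' f f' hf hf'
    exact (IsUniv.sum Finset.univ fun i _ => (ih (hf.dd_right (e i)) (hf'.dx i)).cast
      (by push_cast; ring)).const_mul (-Complex.I)

theorem IsUniv.symInv {m : ℤ} {p : ℕ → UFun.{u} n} (hp : ∀ j : ℕ, IsUniv (m - j) (p j))
    (hinv : IsUniv (-m) (fun M g φ y ξ => (p 0 M g φ y ξ)⁻¹)) (k : ℕ) :
    IsUniv (-m - k) (fun M g φ y => symInv (fun j => p j M g φ) y k) := by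
  induction k using Nat.strong_induction_on with
  | _ k ih =>
    have h1 : IsUniv (-k : ℤ) (fun _ _ _ _ _ => if k = 0 then 1 else 0 : UFun.{u} n) := by
      rcases eq_or_ne k 0 with rfl | hk
      · simpa using (IsUniv.base (n := n) (.const 1) : IsUniv 0 _)
      · simpa [hk] using IsUniv.zero
    have h2 := IsUniv.sum Finset.univ fun (l : Fin k) _ =>
      IsUniv.sum (d := -k) (Finset.HasAntidiagonal.antidiagonal (k - l)) fun s hs =>
        ((IsUniv.star s.2 (ih l l.2) (hp s.1)).const_mul ((s.2.factorial : ℂ)⁻¹)).cast (by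
          rw [Finset.HasAntidiagonal.mem_antidiagonal] at hs
          have := l.2
          omega)
    refine ((hinv.mul (h1.add (h2.const_mul (-1)))).cast (by ring)).congr
      fun M g φ hφ y hy ξ hξ => ?_
    rw [symInv_eq]
    ring

theorem jet_cons (g : RMetric M) (φ : Coord M) (s : Fin n × Fin n × List (Fin n)) (β : Mon n)
    (y : E n) : jet g φ (s ::ₘ β) y = pd g φ s y * jet g φ β y := by
  rw [jet, Multiset.map_cons, Multiset.prod_cons]
  rfl

theorem contDiffOn_jet (hφ : IsCoord φ) (g : RMetric M) (β : Mon n) :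
    ContDiffOn ℝ ∞ (jet g φ β) φ.target := by
  induction β using Multiset.induction_on with
  | empty => exact (contDiffOn_const (c := (1 : ℝ))).congr fun y _ => by simp [jet]
  | cons s β ih => exact ((contDiffOn_pd hφ g s).mul ih).congr fun y _ => jet_cons g φ s β y

theorem IsUniv.mul_jet (hf : IsUniv d f) (β : Mon n) :
    IsUniv d (fun M g φ y ξ => (jet g φ β y : ℝ) * f M g φ y ξ) := by
  induction β using Multiset.induction_on with
  | empty => exact hf.congr fun M g φ _ y _ ξ _ => by simp [jet]
  | cons s β ih =>
    refine (ih.mul_pd s).congr fun M g φ _ y _ ξ _ => ?_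
    rw [jet_cons]
    push_cast
    ring

theorem IsUniv.of_hasUniversalSymbol {m : ℤ} {P : ∀ M : Mfd.{u} n, RMetric M → Op M}
    {S : ℕ → Finset (Mon n)} {a : ℕ → Mon n → (Fin n → Fin n → ℝ) → E n → ℂ}
    (h : HasUniversalSymbol m P S a) (j : ℕ) :
    IsUniv (m - j) (fun _ g φ y ξ => ∑ β ∈ S j, (jet g φ β y : ℝ) * a j β (coeff g φ y) ξ) := by
  refine IsUniv.sum _ fun β _ => ((IsUniv.base (h.1 j β).extend).mul_jet β).congr
    fun M g φ hφ y hy ξ hξ => ?_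
  rw [symmetrize_of_mem (coeff_mem hφ g hy)]

theorem IsUniv.exists_finset (hf : IsUniv d f) : ∃ (S : Finset (Mon n))
    (a : Mon n → (Fin n → Fin n → ℝ) → E n → ℂ), (∀ β, IsHomogSymbol (PosE n) d (a β)) ∧
    ∀ M g φ, IsCoord φ → ∀ y ∈ φ.target, ∀ ξ ≠ 0,
      f M g φ y ξ = ∑ β ∈ S, a β (coeff g φ y) ξ * (jet g φ β y : ℝ) := by
  classical
  induction hf with
  | @base a ha => exact ⟨{0}, fun _ => a, fun _ => ha, fun M g φ _ y _ ξ _ => by simp [jet]⟩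
  | mul_pd s _ ih =>
    obtain ⟨S, a, ha, h⟩ := ih
    refine ⟨S.image (s ::ₘ ·), fun β => a (β.erase s), fun β => ha _, fun M g φ hφ y hy ξ hξ => ?_⟩
    beta_reduce
    rw [Finset.sum_image fun β _ β' _ h => (Multiset.cons_inj_right s).1 h, h M g φ hφ y hy ξ hξ,
      Finset.mul_sum]
    refine Finset.sum_congr rfl fun β _ => ?_
    rw [Multiset.erase_cons_head, jet_cons]
    push_cast
    ring
  | add _ _ ih ih' =>
    obtain ⟨S, a, ha, h⟩ := ih
    obtain ⟨S', a', ha', h'⟩ := ih'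
    refine ⟨S ∪ S', fun β A ξ => (if β ∈ S then a β A ξ else 0) + if β ∈ S' then a' β A ξ else 0,
      fun β => IsHomogSymbol.add ?_ ?_, fun M g φ hφ y hy ξ hξ => ?_⟩
    · split_ifs
      exacts [ha β, .zero]
    · split_ifs
      exacts [ha' β, .zero]
    · beta_reduce
      rw [h M g φ hφ y hy ξ hξ, h' M g φ hφ y hy ξ hξ]
      simp only [add_mul, ite_mul, zero_mul, Finset.sum_add_distrib]
      rw [← Finset.sum_filter, ← Finset.sum_filter, Finset.filter_mem_eq_inter,
        Finset.filter_mem_eq_inter, Finset.union_inter_cancel_left, Finset.union_inter_cancel_right]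
  | congr _ hc ih =>
    obtain ⟨S, a, ha, h⟩ := ih
    exact ⟨S, a, ha, fun M g φ hφ y hy ξ hξ =>
      (hc M g φ hφ y hy ξ hξ).trans (h M g φ hφ y hy ξ hξ)⟩

end

end RiemPsiDO

end

noncomputable section
namespace RiemPsiDO
open Set Filter Topology
variable {n : ℕ}

section Series
variable {μ : ℤ} {A B : PowerSeries (Module.End ℂ (TestSym n))} {a b : ℕ → E n → ℂ}

theorem Rep.logCoeff_smul (hA : Rep μ A a) (hB : Rep μ B b) {c : ℂ} (h : B = c • A) :
    logCoeff μ b = c * logCoeff μ a := by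
  rw [logCoeff, logCoeff]
  split_ifs with hμ
  · have h1 := hB.ev_coeff (μ + n).toNat ⟨bump, bump_mem⟩
    rw [h, PowerSeries.coeff_smul, LinearMap.smul_apply, map_smul, hA.ev_coeff, smul_eq_mul] at h1
    rw [← h1]
    ring
  · rw [mul_zero]

theorem Rep.logCoeff_eq (hA : Rep μ A a) (hB : Rep μ A b) : logCoeff μ b = logCoeff μ a := by
  rw [hA.logCoeff_smul hB (one_smul ℂ A).symm, one_mul]

theorem Rep.logCoeff_coordChange (hA : Rep μ A a) (hB : Rep μ B b) {κ : E n → E n} {x₀ : E n}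
    {U : Set (E n)} (hU : IsOpen U) (hx₀ : x₀ ∈ U) {N : E n → E n ≃L[ℝ] E n} {d : E n → ℝ}
    (hN : IsCoordChange κ x₀ U N d)
    (h : coordSeries hU hx₀ hN * A = B * coordSeries hU hx₀ hN)
    (hκ : LinearMap.det (fderiv ℝ κ x₀ : E n →ₗ[ℝ] E n) ≠ 0) :
    logCoeff μ b = (|LinearMap.det (fderiv ℝ κ x₀ : E n →ₗ[ℝ] E n)| : ℝ) * logCoeff μ a := by
  rw [logCoeff, logCoeff]
  split_ifs with hμ
  · have h0 : ((|LinearMap.det (fderiv ℝ κ x₀ : E n →ₗ[ℝ] E n)| : ℝ) : ℂ) ≠ 0 := by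
      exact_mod_cast abs_ne_zero.2 hκ
    rw [hA.integral_bump hB hU hx₀ hN h (k := (μ + n).toNat) (by omega), hN.d_base,
      Complex.ofReal_inv]
    field_simp
  · rw [mul_zero]

end Series

section
variable {M : Mfd.{u} n} {φ ψ : Coord M} {m : ℤ} {P : Op M} {q q' : ℕ → E n → E n → ℂ}

theorem det_jac_ne_zero (hφ : IsCoord φ) (hψ : IsCoord ψ) {y : E n} (hy : y ∈ ψ.target)
    (hy' : ψ.symm y ∈ φ.source) : (jac φ ψ y).det ≠ 0 := by
  obtain ⟨L, hL⟩ := isInvertible_coordChange hφ hψ hy hy'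
  rw [det_jac, ← hL]
  exact (LinearEquiv.isUnit_det' L.toLinearEquiv).ne_zero

theorem exists_coordSeries (hc : IsContinuousOp P) (hφ : IsCoord φ) (hψ : IsCoord ψ)
    (hP : HasSymbol m P φ q) (hP' : HasSymbol m P ψ q') {y : E n} (hy : y ∈ ψ.target)
    (hy' : ψ.symm y ∈ φ.source) : ∃ (U : Set (E n)) (hU : IsOpen U) (hyU : y ∈ U)
      (N : E n → E n ≃L[ℝ] E n) (d : E n → ℝ) (hN : IsCoordChange (φ ∘ ψ.symm) y U N d),
      coordSeries hU hyU hN *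
          symSeries φ.open_target (φ.map_source hy') q (fun j => (hP.homog j).1) =
        symSeries ψ.open_target hy q' (fun j => (hP'.homog j).1) * coordSeries hU hyU hN := by
  obtain ⟨δ, hδ, hball, N, d, hN⟩ := exists_isCoordChange (isOpen_coordChange φ ψ)
    (contDiffOn_coordChange hφ hψ) ⟨hy, hy'⟩ (isInvertible_coordChange hφ hψ hy hy')
  exact ⟨_, Metric.isOpen_ball, Metric.mem_ball_self hδ, N, d, hN, coordSeries_mul_symSeries hc hφ hψ
    hP hP' Metric.isOpen_ball (convex_ball y δ) (Metric.mem_ball_self hδ) (fun z hz => (hball hz).1)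
    (fun z hz => (hball hz).2) hN (φ.map_source hy')⟩

theorem HasSymbol.logCoeff_coordChange (hc : IsContinuousOp P) (hφ : IsCoord φ) (hψ : IsCoord ψ)
    (hP : HasSymbol m P φ q) (hP' : HasSymbol m P ψ q') {y : E n} (hy : y ∈ ψ.target)
    (hy' : ψ.symm y ∈ φ.source) : logCoeff m (fun j => q' j y) =
      (|(jac φ ψ y).det| : ℝ) * logCoeff m (fun j => q j (φ (ψ.symm y))) := by
  obtain ⟨U, hU, hyU, N, d, hN, h⟩ := exists_coordSeries hc hφ hψ hP hP' hy hy'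
  have h0 := det_jac_ne_zero hφ hψ hy hy'
  rw [det_jac] at h0 ⊢
  exact (rep_symSeries φ.open_target (φ.map_source hy') hP.homog).logCoeff_coordChange
    (rep_symSeries ψ.open_target hy hP'.homog) hU hyU hN h h0

theorem HasSymbol.logCoeff_symInv_coordChange (hc : IsContinuousOp P) (hφ : IsCoord φ)
    (hψ : IsCoord ψ) (hP : HasSymbol m P φ q) (hP' : HasSymbol m P ψ q') {y : E n}
    (hy : y ∈ ψ.target) (hy' : ψ.symm y ∈ φ.source)
    (h0 : ∀ ζ ≠ 0, q 0 (φ (ψ.symm y)) ζ ≠ 0) (h0' : ∀ ζ ≠ 0, q' 0 y ζ ≠ 0) :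
    logCoeff (-m) (symInv q' y) =
      (|(jac φ ψ y).det| : ℝ) * logCoeff (-m) (symInv q (φ (ψ.symm y))) := by
  obtain ⟨U, hU, hyU, N, d, hN, h⟩ := exists_coordSeries hc hφ hψ hP hP' hy hy'
  have hd := det_jac_ne_zero hφ hψ hy hy'
  rw [det_jac] at hd ⊢
  obtain ⟨R, hR, hR'⟩ := exists_symSeries_inv φ.open_target (φ.map_source hy')
    (fun j => (hP.homog j).1) h0
  obtain ⟨T, hT, hT'⟩ := exists_symSeries_inv ψ.open_target hy (fun j => (hP'.homog j).1) h0'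
  refine (rep_symInv φ.open_target (φ.map_source hy') hP.homog h0 hR).logCoeff_coordChange
    (rep_symInv ψ.open_target hy hP'.homog h0' hT) hU hyU hN ?_ hd
  set K := coordSeries hU hyU hN
  calc K * R = T * (symSeries ψ.open_target hy q' (fun j => (hP'.homog j).1) * K) * R := by
        rw [← mul_assoc T, hT, one_mul]
    _ = T * K := by rw [← h, mul_assoc, mul_assoc, hR', mul_one]

theorem symSeries_eq_smul {P' : Op M} (hφ : IsCoord φ) (hP : HasSymbol m P φ q)
    (hP' : HasSymbol m P' φ q') {c : ℂ} (hs : IsSmoothing (P' - c • P)) {y : E n}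
    (hy : y ∈ φ.target) :
    symSeries φ.open_target hy q' (fun j => (hP'.homog j).1) =
      c • symSeries φ.open_target hy q (fun j => (hP.homog j).1) := by
  rw [symSeries_eq_of_smoothing hφ hP hP' hs hy]
  ext1 k
  rw [PowerSeries.coeff_mk, PowerSeries.coeff_smul]

theorem HasSymbol.logCoeff_smul {P' : Op M} (hφ : IsCoord φ) (hP : HasSymbol m P φ q)
    (hP' : HasSymbol m P' φ q') {c : ℂ} (hs : IsSmoothing (P' - c • P)) {y : E n}
    (hy : y ∈ φ.target) : logCoeff m (fun j => q' j y) = c * logCoeff m (fun j => q j y) :=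
  (rep_symSeries φ.open_target hy hP.homog).logCoeff_smul
    (rep_symSeries φ.open_target hy hP'.homog) (symSeries_eq_smul hφ hP hP' hs hy)

theorem HasSymbol.logCoeff_symInv_smul {P' : Op M} (hφ : IsCoord φ) (hP : HasSymbol m P φ q)
    (hP' : HasSymbol m P' φ q') {c : ℂ} (hc : c ≠ 0) (hs : IsSmoothing (P' - c • P)) {y : E n}
    (hy : y ∈ φ.target) (h0 : ∀ ζ ≠ 0, q 0 y ζ ≠ 0) (h0' : ∀ ζ ≠ 0, q' 0 y ζ ≠ 0) :
    logCoeff (-m) (symInv q' y) = c⁻¹ * logCoeff (-m) (symInv q y) := by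
  obtain ⟨R, hR, hR'⟩ := exists_symSeries_inv φ.open_target hy (fun j => (hP.homog j).1) h0
  obtain ⟨T, hT, hT'⟩ := exists_symSeries_inv φ.open_target hy (fun j => (hP'.homog j).1) h0'
  refine (rep_symInv φ.open_target hy hP.homog h0 hR).logCoeff_smul
    (rep_symInv φ.open_target hy hP'.homog h0' hT) ?_
  have h1 := hT
  rw [symSeries_eq_smul hφ hP hP' hs hy, mul_smul_comm] at h1
  calc T = T * (symSeries φ.open_target hy q (fun j => (hP.homog j).1) * R) := by rw [hR', mul_one]
    _ = c⁻¹ • ((c • (T * symSeries φ.open_target hy q (fun j => (hP.homog j).1))) * R) := by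
        rw [smul_mul_assoc, inv_smul_smul₀ hc, mul_assoc]
    _ = c⁻¹ • R := by rw [h1, one_mul]

theorem isSmoothing_zero : IsSmoothing (0 : Op M) := fun φ ψ _ _ =>
  ⟨fun _ _ => 0, contDiffOn_const, fun v _ x _ => by simp⟩

theorem HasSymbol.principal_unique (hφ : IsCoord φ) (hP : HasSymbol m P φ q)
    (hP' : HasSymbol m P φ q') {y : E n} (hy : y ∈ φ.target) {ξ : E n} (hξ : ξ ≠ 0) :
    q' 0 y ξ = q 0 y ξ := by
  have h1 := symSeries_eq_smul hφ hP hP' (c := 1) (by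
    have h : P - (1 : ℂ) • P = 0 := by rw [one_smul]; exact sub_self P
    rw [h]
    exact isSmoothing_zero) hy
  rw [one_smul] at h1
  have h2 := congrArg (PowerSeries.coeff 0) h1
  have e := coeff_zero_symSeries φ.open_target hy (q := q) (fun j => (hP.homog j).1)
  have e' := coeff_zero_symSeries φ.open_target hy (q := q') (fun j => (hP'.homog j).1)
  replace h2 := e'.symm.trans (h2.trans e)
  obtain ⟨χ, hχ, hχ1⟩ := exists_testOn isOpen_compl_singleton hξ
  have h3 := congrArg (fun L : Module.End ℂ (TestSym n) =>
    (L ⟨χ, TestSym.mem_of_tsupport_subset hχ.1 hχ.2.1 hχ.2.2⟩ : E n → ℂ) ξ) h2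
  simpa [TestSym.mulL_apply, hχ1.eq_of_nhds] using h3

theorem HasSymbol.logCoeff_parametrix {Q : Op M} (hc : IsContinuousOp P) (hPQ : IsParametrix m P Q)
    (hφ : IsCoord φ) (hP : HasSymbol m P φ q) (hQ : HasSymbol (-m) Q φ q') {y : E n}
    (hy : y ∈ φ.target) (h0 : ∀ ζ ≠ 0, q 0 y ζ ≠ 0) :
    logCoeff (-m) (fun j => q' j y) = logCoeff (-m) (symInv q y) := by
  have h1 := symSeries_mul_of_isParametrix hc hPQ hφ hP hQ hy
  obtain ⟨R, hR, hR'⟩ := exists_symSeries_inv φ.open_target hy (fun j => (hP.homog j).1) h0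
  have h2 : R = symSeries φ.open_target hy q' (fun j => (hQ.homog j).1) := by
    rw [← mul_one R, ← h1, ← mul_assoc, hR, one_mul]
  subst h2
  exact (rep_symInv φ.open_target hy hP.homog h0 hR).logCoeff_eq
    (rep_symSeries φ.open_target hy hQ.homog)

end

/-! ### Local invariants -/

theorem contDiffOn_inv_sqrt_det :
    ContDiffOn ℝ ∞ (fun A : Fin n → Fin n → ℝ => ((Real.sqrt (Matrix.of A).det : ℝ) : ℂ)⁻¹) (Pos n) := by
  have h1 : ContDiff ℝ ∞ (fun A : Fin n → Fin n → ℝ => (Matrix.of A).det) := by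
    simp only [Matrix.det_apply, Matrix.of_apply]
    refine ContDiff.sum fun σ _ => ContDiff.const_smul _ (contDiff_prod fun i _ => ?_)
    fun_prop
  have h2 := h1.contDiffOn.sqrt (s := Pos n) fun A hA => (Matrix.PosDef.det_pos hA).ne'
  refine ContDiffOn.inv (Complex.ofRealCLM.contDiff.comp_contDiffOn h2) fun A hA => ?_
  exact_mod_cast (Real.sqrt_pos.2 (Matrix.PosDef.det_pos hA)).ne'

section
variable {M : Mfd.{u} n} {φ ψ : Coord M}

/-- The coefficient of the Riemannian density in local coordinates. -/
def vol (g : RMetric M) (φ : Coord M) (y : E n) : ℝ := Real.sqrt (Matrix.of (coeff g φ y)).det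

theorem vol_pos (hφ : IsCoord φ) (g : RMetric M) {y : E n} (hy : y ∈ φ.target) : 0 < vol g φ y :=
  Real.sqrt_pos.2 (Matrix.PosDef.det_pos (coeff_mem hφ g hy))

theorem vol_coordChange (hφ : IsCoord φ) (hψ : IsCoord ψ) (g : RMetric M) {y : E n}
    (hy : y ∈ ψ.target) (hy' : ψ.symm y ∈ φ.source) :
    vol g ψ y = |(jac φ ψ y).det| * vol g φ (φ (ψ.symm y)) := by
  rw [vol, coeff_coordChange hφ hψ g hy hy', Matrix.det_mul, Matrix.det_mul, Matrix.det_transpose,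
    mul_right_comm, ← sq, Real.sqrt_mul (sq_nonneg _), Real.sqrt_sq_eq_abs, vol]

theorem vol_scale (g : RMetric M) {t : ℝ} (ht : 0 < t) (φ : Coord M) (y : E n) :
    vol (g.scale t ht) φ y = t ^ ((n : ℝ) / 2) * vol g φ y := by
  have h1 : Matrix.of (coeff (g.scale t ht) φ y) = t • Matrix.of (coeff g φ y) := by
    ext i j
    rfl
  rw [vol, h1, Matrix.det_smul, Fintype.card_fin, Real.sqrt_mul (by positivity), vol]
  congr 1
  rw [Real.sqrt_eq_rpow, ← Real.rpow_natCast, ← Real.rpow_mul ht.le]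
  congr 1
  ring

end

theorem integral_sum_mul_bump {d : ℤ} {F : E n → ℂ} {S : Finset (Mon n)} {a : Mon n → E n → ℂ}
    (c : Mon n → ℂ) (ha : ∀ β, Homog d (a β)) (h : ∀ ξ ≠ 0, F ξ = ∑ β ∈ S, a β ξ * c β) :
    ∫ ζ, F ζ * bump ζ = ∑ β ∈ S, (∫ ζ, a β ζ * bump ζ) * c β := by
  simp_rw [← integral_mul_const]
  rw [← integral_finsetSum]
  · refine integral_congr_ae (Eventually.of_forall fun ζ => ?_)
    beta_reduce
    rcases eq_or_ne ζ 0 with rfl | hζ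
    · simp [bump]
    · rw [h ζ hζ, Finset.sum_mul]
      exact Finset.sum_congr rfl fun β _ => by ring
  · exact fun β _ => (TestSym.integrable_mul (ha β).1 bump_mem).mul_const _

theorem isCoord_chartAt {M : Mfd.{u} n} (x : M) : IsCoord (chartAt (E n) x) :=
  IsManifold.chart_mem_maximalAtlas x

/-- A residue which is universal, transforms as a density and is homogeneous in the metric defines
a local invariant. -/
theorem exists_isLocalInvariant {μ : ℤ} {w : ℝ} {f : ℕ → UFun.{u} n}
    (hf : ∀ j : ℕ, IsUniv (μ - j) (f j))
    (hD : ∀ (M : Mfd.{u} n) (g : RMetric M) (φ ψ : Coord M), IsCoord φ → IsCoord ψ →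
      ∀ y ∈ ψ.target, ψ.symm y ∈ φ.source → logCoeff μ (fun j => f j M g ψ y) =
        (|(jac φ ψ y).det| : ℝ) * logCoeff μ (fun j => f j M g φ (φ (ψ.symm y))))
    (hS : ∀ (M : Mfd.{u} n) (g : RMetric M) (t : ℝ) (ht : 0 < t) (φ : Coord M), IsCoord φ →
      ∀ y ∈ φ.target, logCoeff μ (fun j => f j M (g.scale t ht) φ y) =
        ((t ^ (-w) : ℝ) : ℂ) * logCoeff μ (fun j => f j M g φ y)) :
    ∃ I : ∀ M : Mfd.{u} n, RMetric M → M → ℂ, IsLocalInvariant ((n : ℝ) / 2 + w) I ∧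
      ∀ (M : Mfd.{u} n) (g : RMetric M) (φ : Coord M), IsCoord φ → ∀ y ∈ φ.target,
        (mulVol (I M g) g).coord φ y = logCoeff μ (fun j => f j M g φ y) := by
  set I : ∀ M : Mfd.{u} n, RMetric M → M → ℂ := fun M g x =>
    logCoeff μ (fun j => f j M g (chartAt (E n) x) (chartAt (E n) x x)) *
      ((vol g (chartAt (E n) x) (chartAt (E n) x x) : ℝ) : ℂ)⁻¹ with hI
  have key : ∀ (M : Mfd.{u} n) (g : RMetric M) (φ : Coord M), IsCoord φ → ∀ x ∈ φ.source,
      I M g x = logCoeff μ (fun j => f j M g φ (φ x)) * ((vol g φ (φ x) : ℝ) : ℂ)⁻¹ := by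
    intro M g φ hφ x hx
    have hψ := isCoord_chartAt x
    have hxs : x ∈ (chartAt (E n) x).source := mem_chart_source _ x
    have hy := (chartAt (E n) x).map_source hxs
    have hsx := (chartAt (E n) x).left_inv hxs
    have hy' : (chartAt (E n) x).symm (chartAt (E n) x x) ∈ φ.source := by rwa [hsx]
    have h1 := hD M g φ _ hφ hψ _ hy hy'
    have h2 := vol_coordChange hφ hψ g hy hy'
    have h3 : ((|(jac φ (chartAt (E n) x) (chartAt (E n) x x)).det| : ℝ) : ℂ) ≠ 0 := by
      exact_mod_cast abs_ne_zero.2 (det_jac_ne_zero hφ hψ hy hy')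
    rw [hsx] at h1 h2
    simp only [hI]
    rw [h1, h2, Complex.ofReal_mul, mul_inv]
    field_simp
  have huniv : ∃ (S : Finset (Mon n)) (a : Mon n → (Fin n → Fin n → ℝ) → ℂ),
      (∀ β, ContDiffOn ℝ ∞ (a β) (Pos n)) ∧
      ∀ (M : Mfd.{u} n) (g : RMetric M) (φ : Coord M), IsCoord φ → ∀ x ∈ φ.source,
        I M g x = ∑ β ∈ S, a β (coeff g φ (φ x)) * (jet g φ β (φ x) : ℝ) := by
    by_cases hμ : 0 ≤ μ + n
    · obtain ⟨S, a, ha, h⟩ := (hf (μ + n).toNat).exists_finset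
      refine ⟨S, fun β A => cn n * (∫ ζ, a β A ζ * bump ζ) *
        ((Real.sqrt (Matrix.of A).det : ℝ) : ℂ)⁻¹, fun β => ?_, fun M g φ hφ x hx => ?_⟩
      · exact (contDiffOn_const.mul (((ha β).contDiffOn_integral_bump isOpen_posE).mono
          pos_subset_posE)).mul contDiffOn_inv_sqrt_det
      · have hy := φ.map_source hx
        rw [key M g φ hφ x hx, logCoeff, if_pos hμ, integral_sum_mul_bump
          (fun β => (jet g φ β (φ x) : ℂ)) (fun β => (ha β).homog (pos_subset_posE (coeff_mem hφ g hy)))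
          (h M g φ hφ _ hy), Finset.mul_sum, Finset.sum_mul]
        refine Finset.sum_congr rfl fun β _ => ?_
        rw [vol]
        ring
    · refine ⟨∅, fun _ _ => 0, fun _ => contDiffOn_const, fun M g φ hφ x hx => ?_⟩
      rw [key M g φ hφ x hx, logCoeff, if_neg hμ]
      simp
  refine ⟨I, ⟨fun M g x => ?_, huniv, fun M g t ht x => ?_⟩, fun M g φ hφ y hy => ?_⟩
  · obtain ⟨S, a, ha, h⟩ := huniv
    set φ : Coord M := chartAt (E n) x
    have hφ : IsCoord φ := isCoord_chartAt x
    have hxs : x ∈ φ.source := mem_chart_source _ x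
    have hF : ContDiffOn ℝ ∞ (fun y => ∑ β ∈ S, a β (coeff g φ y) * ((jet g φ β y : ℝ) : ℂ))
        φ.target := ContDiffOn.sum fun β _ => ((ha β).comp (contDiffOn_coeff hφ g)
          fun y hy => coeff_mem hφ g hy).mul
            (Complex.ofRealCLM.contDiff.comp_contDiffOn (contDiffOn_jet hφ g β))
    have h1 := ((hF.contDiffAt (φ.open_target.mem_nhds (φ.map_source hxs))).contMDiffAt).comp x
      ((contMDiffOn_coord hφ).contMDiffAt (φ.open_source.mem_nhds hxs))
    refine h1.congr_of_eventuallyEq ?_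
    filter_upwards [φ.open_source.mem_nhds hxs] with z hz using h M g φ hφ z hz
  · have hy := (chartAt (E n) x).map_source (mem_chart_source (E n) x)
    simp only [hI]
    rw [hS M g t ht _ (isCoord_chartAt x) _ hy, vol_scale g ht, neg_add, Real.rpow_add ht,
      Real.rpow_neg ht.le (n / 2)]
    push_cast
    rw [mul_inv]
    ring
  · have hx := φ.map_target hy
    have h0 : ((vol g φ y : ℝ) : ℂ) ≠ 0 := by exact_mod_cast (vol_pos hφ g hy).ne'
    change I M g (φ.symm y) * ((vol g φ y : ℝ) : ℂ) = _
    rw [key M g φ hφ _ hx, φ.right_inv hy, mul_assoc, inv_mul_cancel₀ h0, mul_one]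

end RiemPsiDO

end

noncomputable section
namespace RiemPsiDO
open Set Filter Topology
variable {n : ℕ}

/-! ### Ellipticity and universal symbols -/

open scoped MatrixOrder in
theorem exists_eq_transpose_mul {A : Matrix (Fin n) (Fin n) ℝ} (hA : A.PosDef) :
    ∃ B : Matrix (Fin n) (Fin n) ℝ, A = B.transpose * B ∧ IsUnit B.det := by
  obtain ⟨B, hB⟩ := CStarAlgebra.nonneg_iff_eq_star_mul_self.1
    (Matrix.nonneg_iff_posSemidef.2 hA.posSemidef)
  have hB' : A = B.transpose * B := by
    rw [hB, Matrix.star_eq_conjTranspose, Matrix.conjTranspose_eq_transpose_of_trivial]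
  refine ⟨B, hB', ?_⟩
  have h := hA.det_pos.ne'
  rw [hB', Matrix.det_mul] at h
  exact (right_ne_zero_of_mul h).isUnit

theorem exists_mul_mul_transpose_eq {G A : Matrix (Fin n) (Fin n) ℝ} (hG : G.PosDef)
    (hA : A.PosDef) :
    ∃ J : Matrix (Fin n) (Fin n) ℝ, IsUnit J.det ∧ J * G * J.transpose = A := by
  obtain ⟨B, rfl, hB⟩ := exists_eq_transpose_mul hG
  obtain ⟨D, rfl, hD⟩ := exists_eq_transpose_mul hA
  refine ⟨D.transpose * B⁻¹.transpose, ?_, ?_⟩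
  · rw [Matrix.det_mul, Matrix.det_transpose, Matrix.det_transpose]
    exact hD.mul (Matrix.isUnit_nonsing_inv_det B hB)
  · rw [Matrix.transpose_mul, Matrix.transpose_transpose, Matrix.transpose_transpose,
      mul_assoc D.transpose, ← mul_assoc B⁻¹.transpose, ← Matrix.transpose_mul,
      Matrix.mul_nonsing_inv B hB, Matrix.transpose_one, one_mul, mul_assoc D.transpose,
      Matrix.mul_nonsing_inv_cancel_left _ _ hB]

theorem exists_clm_apply_e {J : Matrix (Fin n) (Fin n) ℝ} (hJ : IsUnit J.det) :
    ∃ C : E n ≃L[ℝ] E n, ∀ i j, C (e i) j = J i j := by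
  have h1 : J.transpose * J⁻¹.transpose = 1 := by
    rw [← Matrix.transpose_mul, Matrix.nonsing_inv_mul _ hJ, Matrix.transpose_one]
  have h2 : J⁻¹.transpose * J.transpose = 1 := by
    rw [← Matrix.transpose_mul, Matrix.mul_nonsing_inv _ hJ, Matrix.transpose_one]
  refine ⟨(LinearEquiv.ofLinearMap (Matrix.toLpLin 2 2 J.transpose) (Matrix.toLpLin 2 2 J⁻¹.transpose)
    ?_ ?_).toContinuousLinearEquiv, fun i j => ?_⟩
  · rw [← Matrix.toLpLin_mul_same, h1, Matrix.toLpLin_one]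
  · rw [← Matrix.toLpLin_mul_same, h2, Matrix.toLpLin_one]
  · simp [e, Matrix.toLpLin_apply]

section
variable {M : Mfd.{u} n} {φ : Coord M}

/-- Every positive definite matrix is the matrix of the metric in suitable coordinates. -/
theorem exists_coord_coeff_eq (hφ : IsCoord φ) (g : RMetric M) {y : E n} (hy : y ∈ φ.target)
    {A : Fin n → Fin n → ℝ} (hA : A ∈ Pos n) :
    ∃ ψ : Coord M, IsCoord ψ ∧ ∃ z ∈ ψ.target, coeff g ψ z = A := by
  obtain ⟨J, hJ, hJA⟩ := exists_mul_mul_transpose_eq (coeff_mem hφ g hy) hA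
  obtain ⟨C, hC⟩ := exists_clm_apply_e hJ
  set ψ : Coord M := φ.trans C.symm.toHomeomorph.toOpenPartialHomeomorph with hψdef
  have hψ : IsCoord ψ := by
    refine OpenPartialHomeomorph.mem_maximalAtlas_of_contMDiffOn _ ?_ ?_
    · exact (C.symm.contDiff.contMDiff (n := ∞)).comp_contMDiffOn
        ((contMDiffOn_coord hφ).mono fun x hx => hx.1)
    · exact (contMDiffOn_coord_symm hφ).comp (C.contDiff.contMDiff (n := ∞)).contMDiffOn
        fun z hz => hz.2
  have hz : C.symm y ∈ ψ.target := by
    simpa [hψdef] using hy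
  have hψs : ∀ z, ψ.symm z = φ.symm (C z) := fun z => rfl
  have hyz : ψ.symm (C.symm y) = φ.symm y := by rw [hψs, C.apply_symm_apply]
  have hz' : ψ.symm (C.symm y) ∈ φ.source := hyz ▸ φ.map_target hy
  have hjac : jac φ ψ (C.symm y) = J := by
    have h1 : φ ∘ ψ.symm =ᶠ[𝓝 (C.symm y)] C := by
      have h2 : C ⁻¹' φ.target ∈ 𝓝 (C.symm y) :=
        C.continuous.continuousAt.preimage_mem_nhds
          (φ.open_target.mem_nhds (by rwa [C.apply_symm_apply]))
      filter_upwards [h2] with z hz using φ.right_inv hz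
    ext i j
    rw [jac, Matrix.of_apply, h1.fderiv_eq, C.fderiv]
    exact hC i j
  refine ⟨ψ, hψ, _, hz, ?_⟩
  have h3 := coeff_coordChange hφ hψ g hz hz'
  rw [hjac, hyz, φ.right_inv hy, hJA] at h3
  exact Matrix.of.injective h3

end

section
variable {m : ℤ} {P : ∀ M : Mfd.{u} n, RMetric M → Op M} {S : ℕ → Finset (Mon n)}
  {a : ℕ → Mon n → (Fin n → Fin n → ℝ) → E n → ℂ}

/-- The symbol with coefficients `a`, in all local coordinates. -/
def univSymbol (S : ℕ → Finset (Mon n)) (a : ℕ → Mon n → (Fin n → Fin n → ℝ) → E n → ℂ) (j : ℕ) :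
    UFun.{u} n :=
  fun _ g φ y ξ => ∑ β ∈ S j, (jet g φ β y : ℝ) * a j β (coeff g φ y) ξ

theorem univSymbol_zero_ne_zero (h : HasUniversalSymbol m P S a)
    (hell : ∀ (M : Mfd.{u} n) (g : RMetric M), IsElliptic m (P M g)) {M : Mfd.{u} n} (g : RMetric M)
    {φ : Coord M} (hφ : IsCoord φ) {y : E n} (hy : y ∈ φ.target) {ξ : E n} (hξ : ξ ≠ 0) :
    univSymbol S a 0 M g φ y ξ ≠ 0 := by
  obtain ⟨q, hq, hq0⟩ := hell M g φ hφ
  have h1 := (h.2 M g φ hφ).principal_unique hφ hq hy hξ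
  change _ = univSymbol S a 0 M g φ y ξ at h1
  exact h1 ▸ hq0 y hy ξ hξ

theorem IsUniv.inv_univSymbol (h : HasUniversalSymbol m P S a) (ha : ∀ β, β ≠ 0 → a 0 β = 0)
    (hell : ∀ (M : Mfd.{u} n) (g : RMetric M), IsElliptic m (P M g)) :
    IsUniv (-m) (fun M g φ y ξ => (univSymbol S a 0 M g φ y ξ)⁻¹ : UFun.{u} n) := by
  classical
  set b : (Fin n → Fin n → ℝ) → E n → ℂ := fun A ξ => if 0 ∈ S 0 then a 0 0 A ξ else 0 with hb
  have hbs : ∀ (M : Mfd.{u} n) (g : RMetric M) (φ : Coord M) (y ξ : E n),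
      univSymbol S a 0 M g φ y ξ = b (coeff g φ y) ξ := by
    intro M g φ y ξ
    simp only [univSymbol, hb]
    split_ifs with h0
    · rw [Finset.sum_eq_single_of_mem 0 h0 fun β _ hβ => by simp [ha β hβ]]
      simp [jet]
    · refine Finset.sum_eq_zero fun β hβ => ?_
      rw [ha β (fun h => h0 (h ▸ hβ))]
      simp
  by_cases hne : ∃ (M : Mfd.{u} n) (_ : RMetric M) (φ : Coord M), IsCoord φ ∧ φ.target.Nonempty
  · obtain ⟨M, g, φ, hφ, y, hy⟩ := hne
    have hb0 : ∀ A ∈ Pos n, ∀ ξ ≠ 0, b A ξ ≠ 0 := by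
      intro A hA ξ hξ
      obtain ⟨ψ, hψ, z, hz, rfl⟩ := exists_coord_coeff_eq hφ g hy hA
      rw [← hbs]
      exact univSymbol_zero_ne_zero h hell g hψ hz hξ
    have hbh : IsHomogSymbol (Pos n) m b := by
      have h1 := h.1 0 0
      rw [Nat.cast_zero, sub_zero] at h1
      by_cases h0 : (0 : Mon n) ∈ S 0
      · simpa [hb, h0] using h1
      · simpa [hb, h0] using IsHomogSymbol.zero
    have hbi : IsHomogSymbol (Pos n) (-m) (fun A ξ => (b A ξ)⁻¹) := by
      refine ⟨hbh.1.inv fun z hz => hb0 _ hz.1 _ hz.2, fun A hA ξ hξ t ht => ?_⟩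
      beta_reduce
      rw [hbh.2 A hA ξ hξ t ht, mul_inv, zpow_neg]
    refine (IsUniv.base hbi.extend).congr fun M g φ hφ y hy ξ hξ => ?_
    rw [hbs, symmetrize_of_mem (coeff_mem hφ g hy)]
  · exact IsUniv.zero.congr fun M g φ hφ y hy ξ hξ => (hne ⟨M, g, φ, hφ, y, hy⟩).elim

end

theorem isLogSing_of_hasSymbol {M : Mfd.{u} n} {m : ℤ} {P : Op M} {c : Density M}
    (hP : IsSmoothOffDiagonal P)
    (h : ∀ φ, IsCoord φ → ∃ q, HasSymbol m P φ q ∧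
      ∀ y ∈ φ.target, c.coord φ y = logCoeff m (fun j => q j y)) : IsLogSing m P c := by
  intro φ hφ
  obtain ⟨q, hq, hc⟩ := h φ hφ
  obtain ⟨k, b, hk, hb, hK⟩ := hq.kernel_asymptotics hP hφ
  refine ⟨k, b, hk, hb, fun K hKc hKs => ?_⟩
  obtain ⟨C, hC⟩ := hK K hKc hKs
  exact ⟨C, fun x hx => by rw [hc x (hKs hx)]; exact hC x hx⟩

section
variable {m : ℤ} {w : ℝ} {P : ∀ M : Mfd.{u} n, RMetric M → Op M}

theorem IsInvariantPsiDO.exists_logSing (hP : IsInvariantPsiDO m w P) :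
    ∃ I : ∀ M : Mfd.{u} n, RMetric M → M → ℂ, IsLocalInvariant ((n : ℝ) / 2 + w) I ∧
      ∀ (M : Mfd.{u} n) (g : RMetric M), IsLogSing m (P M g) (mulVol (I M g) g) := by
  obtain ⟨S, a, h⟩ := hP.universal
  obtain ⟨I, hI, hI'⟩ := exists_isLocalInvariant (μ := m) (w := w) (f := univSymbol S a)
    (fun j => .of_hasUniversalSymbol h j)
    (fun M g φ ψ hφ hψ y hy hy' => (h.2 M g φ hφ).logCoeff_coordChange (hP.psiDO M g).continuous
      hφ hψ (h.2 M g ψ hψ) hy hy')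
    (fun M g t ht φ hφ y hy => (h.2 M g φ hφ).logCoeff_smul hφ (h.2 M (g.scale t ht) φ hφ)
      (hP.scaling M g t ht) hy)
  exact ⟨I, hI, fun M g => isLogSing_of_hasSymbol (hP.psiDO M g).offDiagonal fun φ hφ =>
    ⟨_, h.2 M g φ hφ, hI' M g φ hφ⟩⟩

theorem IsInvariantPsiDO.exists_greenLogSing (hP : IsInvariantPsiDO m w P)
    (hell : ∀ (M : Mfd.{u} n) (g : RMetric M), IsElliptic m (P M g)) (hadm : IsAdmissible m P) :
    ∃ J : ∀ M : Mfd.{u} n, RMetric M → M → ℂ, IsLocalInvariant ((n : ℝ) / 2 - w) J ∧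
      ∀ (M : Mfd.{u} n) (g : RMetric M), IsGreenLogSing m (P M g) (mulVol (J M g) g) := by
  obtain ⟨S, a, h, ha⟩ := hadm
  have h0 := @univSymbol_zero_ne_zero n m P S a h hell
  obtain ⟨J, hJ, hJ'⟩ := exists_isLocalInvariant (μ := -m) (w := -w)
    (f := fun k M g φ y => symInv (fun j => univSymbol S a j M g φ) y k)
    (IsUniv.symInv (fun j => .of_hasUniversalSymbol h j) (.inv_univSymbol h ha hell))
    (fun M g φ ψ hφ hψ y hy hy' => (h.2 M g φ hφ).logCoeff_symInv_coordChange
      (hP.psiDO M g).continuous hφ hψ (h.2 M g ψ hψ) hy hy'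
      (fun ζ hζ => h0 g hφ (φ.map_source hy') hζ) (fun ζ hζ => h0 g hψ hy hζ))
    (fun M g t ht φ hφ y hy => by
      have h1 := (h.2 M g φ hφ).logCoeff_symInv_smul hφ (h.2 M (g.scale t ht) φ hφ)
        (Complex.ofReal_ne_zero.2 (Real.rpow_pos_of_pos ht _).ne') (hP.scaling M g t ht) hy
        (fun ζ hζ => h0 g hφ hy hζ) (fun ζ hζ => h0 _ hφ hy hζ)
      rw [Real.rpow_neg ht.le, Complex.ofReal_inv]
      exact h1)
  rw [← sub_eq_add_neg] at hJ
  exact ⟨J, hJ, fun M g Q hQ => isLogSing_of_hasSymbol hQ.1.offDiagonal fun φ hφ => by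
    obtain ⟨q, hq⟩ := hQ.1.symbol φ hφ
    exact ⟨q, hq, fun y hy => (hJ' M g φ hφ y hy).trans ((h.2 M g φ hφ).logCoeff_parametrix
      (hP.psiDO M g).continuous hQ hφ hq hy fun ζ hζ => h0 g hφ hy hζ).symm⟩⟩

end

end RiemPsiDO

end

theorem mainTheorem7 (n : ℕ) (hn : 0 < n) (m : ℤ) (w : ℝ)
    (P : ∀ M : Mfd.{u} n, RMetric M → Op M) (hP : IsInvariantPsiDO m w P) :
    (∃ I : ∀ M : Mfd.{u} n, RMetric M → M → ℂ,
      IsLocalInvariant ((n : ℝ) / 2 + w) I ∧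
      ∀ (M : Mfd.{u} n) (g : RMetric M), IsLogSing m (P M g) (mulVol (I M g) g)) ∧
    ((∀ (M : Mfd.{u} n) (g : RMetric M), IsElliptic m (P M g)) → IsAdmissible m P →
      ∃ J : ∀ M : Mfd.{u} n, RMetric M → M → ℂ,
        IsLocalInvariant ((n : ℝ) / 2 - w) J ∧
        ∀ (M : Mfd.{u} n) (g : RMetric M),
          IsGreenLogSing m (P M g) (mulVol (J M g) g)) :=
  ⟨hP.exists_logSing, hP.exists_greenLogSing⟩
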